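/- Let $(M,\omega)$ be a connected symplectic manifold of dimension $2n$ (smooth, Hausdorff, second countable). For a smooth function $f$ let $X_f$ be its Hamiltonian vector field, $df(v)=\omega(v,X_f)$ for all tangent vectors $v$, and let $\{f,g\}=df(X_g)$. Let $G$ be a connected Lie group with a free, proper, smooth Hamiltonian action on $M$ with momentum map $\Phi:M\to\mathfrak g^*$: the action is by symplectomorphisms, the one-parameter group $\exp(t\xi)$ is generated by $X_{\phi_\xi}$, where $\phi_\xi=(\Phi,\xi)$, and $\phi_{[\xi,\eta]}=\{\phi_\xi,\phi_\eta\}$ for $\xi,\eta\in\mathfrak g$. Assume that $0$ is a regular value of $\Phi$. Let $\xi_1,\dots,\xi_p$ be a basis of $\mathfrak g$, let $\phi_\alpha=(\Phi,\xi_\alpha)$, let $$M_0=\{x\in M:\ \phi_1(x)=\dots=\phi_p(x)=0\},$$ and let $m=2n-p$. Let $h:M\to\mathbb R$ be a smooth function such that $M_0$ is invariant under the flow of $\dot x=X_h(x)$. Let $\Omega=\omega^n$ be the Liouville volume form. Its restriction to $M_0$ is the volume form $\Omega_0$ on $M_0$ which is $\mu\,\Theta|_{\phi=0}$ in local coordinates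 $(z,\phi)$ of $M$ in which $\Omega=\mu(z,\phi)\,d\phi_1\wedge\dots\wedge d\phi_p\wedge\Theta(z)$; equivalently, for $x\in M_0$ and $v_1,\dots,v_m\in T_xM_0$, $\Omega_0(v_1,\dots,v_m)=\Omega(w_1,\dots,w_p,v_1,\dots,v_m)$ for any $w_1,\dots,w_p\in T_xM$ with $d\phi_\alpha(w_\beta)=\delta_{\alpha\beta}$. The (possibly only locally defined) flow $F^t$ of $X_h$ restricted to $M_0$ preserves $\Omega_0$ if $(F^t)^*\Omega_0=\Omega_0$ wherever $F^t$ is defined. **(i)** There are smooth functions $\psi_{\alpha\beta}$ on an open neighbourhood of $M_0$ such that, on that neighbourhood, $$\frac{d\phi_\alpha}{dt}=\{\phi_\alpha,h\}=\sum_{\beta}\psi_{\alpha\beta}\,\phi_\beta,\qquad \alpha=1,\dots,p,$$ and for every such choice of $\psi=(\psi_{\alpha\beta})$ the flow of $X_h$ restricted to $M_0$ preserves $\Omega_0$ if and only if $\operatorname{tr}\psi(x)=0$ for all $x\in M_0$. In particular, if $h$ is $G$-invariant, then the flow of $X_h$ restricted to $M_0$ preserves $\Omega_0$. **(ii)** Let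 in addition $K$ be a compact connected Lie group with a free smooth Hamiltonian action on $M$ with momentum map $\Psi:M\to\mathfrak k^*$, such that $\{(\Phi,\xi),(\Psi,\zeta)\}=0$ for all $\xi\in\mathfrak g$, $\zeta\in\mathfrak k$. Let $\sigma:M\to M/K$ be the projection and let $h=H\circ\sigma$ be $K$-invariant. Suppose that the flow of $X_h$ restricted to $M_0$ preserves $\Omega_0$. Then the reduced flow $\dot F=\{F,H\}^K$, $F\in C^\infty(M/K)$, where $\{F_1,F_2\}^K\circ\sigma=\{F_1\circ\sigma,F_2\circ\sigma\}$, restricted to $M_0/K$, also has an invariant measure: there is a Borel measure on the manifold $M_0/K$ which has smooth positive densities in local coordinates and is invariant under the reduced flow. -/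

import Mathlib

open scoped Manifold ContDiff
open MeasureTheory

noncomputable section

namespace InvariantRelations

/-! ### Differential forms and symplectic forms on a manifold -/

section Forms

variable {E : Type*} [NormedAddCommGroup E] [NormedSpace ℝ E]
  {M : Type*} [TopologicalSpace M] [ChartedSpace E M]

/-- The coordinate expression, in the preferred chart at `x₀`, of a (not necessarily smooth)
differential `k`-form on `M`: its pullback by the inverse of the chart. It is meaningful on the
target of that chart. -/
def chartForm {k : ℕ} (α : ∀ x : M, TangentSpace 𝓘(ℝ, E) x [⋀^Fin k]→L[ℝ] ℝ) (x₀ : M) :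
    E → E [⋀^Fin k]→L[ℝ] ℝ :=
  fun y => (α ((extChartAt 𝓘(ℝ, E) x₀).symm y)).compContinuousLinearMap
    (mfderiv 𝓘(ℝ, E) 𝓘(ℝ, E) (extChartAt 𝓘(ℝ, E) x₀).symm y)

variable (E M) in
/-- A symplectic form: a smooth closed nondegenerate differential 2-form. -/
structure SymplecticForm where
  /-- the value of the form at a point -/
  toForm : ∀ x : M, TangentSpace 𝓘(ℝ, E) x [⋀^Fin 2]→L[ℝ] ℝ
  smooth : ∀ x₀ : M, ContDiffOn ℝ ∞ (chartForm toForm x₀) (extChartAt 𝓘(ℝ, E) x₀).target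
  closed : ∀ x₀ : M, ∀ y ∈ (extChartAt 𝓘(ℝ, E) x₀).target,
    extDeriv (chartForm toForm x₀) y = 0
  nondegenerate : ∀ (x : M) (u : TangentSpace 𝓘(ℝ, E) x),
    (∀ v : TangentSpace 𝓘(ℝ, E) x, toForm x ![u, v] = 0) → u = 0

/-- The differential of a real function on `M`. -/
def differential (f : M → ℝ) (x : M) (v : TangentSpace 𝓘(ℝ, E) x) : ℝ :=
  mfderiv 𝓘(ℝ, E) 𝓘(ℝ, ℝ) f x v

/-- The Hamiltonian vector field `X_h` of `h`, determined by `dh(v) = ω(v, X_h)` for all `v`. -/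
def hamiltonianField (ωM : SymplecticForm E M) (h : M → ℝ) (x : M) : TangentSpace 𝓘(ℝ, E) x :=
  Classical.epsilon fun X => ∀ v : TangentSpace 𝓘(ℝ, E) x,
    differential h x v = ωM.toForm x ![v, X]

/-- A nondegenerate alternating bilinear form on a finite-dimensional space represents every linear
functional. -/
theorem exists_eq_of_nondegenerate {V : Type*} [NormedAddCommGroup V] [NormedSpace ℝ V]
    [FiniteDimensional ℝ V] (A : V [⋀^Fin 2]→L[ℝ] ℝ)
    (hA : ∀ u : V, (∀ v : V, A ![u, v] = 0) → u = 0) (L : V →ₗ[ℝ] ℝ) :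
    ∃ X : V, ∀ v : V, L v = A ![v, X] := by
  have hu0 : ∀ a b z : V, Function.update ![a, b] 0 z = ![z, b] := by
    intro a b z
    funext i
    fin_cases i <;> rfl
  have hu1 : ∀ a b z : V, Function.update ![a, b] 1 z = ![a, z] := by
    intro a b z
    funext i
    fin_cases i <;> rfl
  let B : V →ₗ[ℝ] V →ₗ[ℝ] ℝ := LinearMap.mk₂ ℝ (fun a b : V => A ![a, b])
    (fun a a' b => by
      have := A.map_update_add ![a, b] 0 a a'
      rwa [hu0, hu0, hu0] at this)
    (fun c a b => by
      have := A.map_update_smul ![a, b] 0 c a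
      rwa [hu0, hu0] at this)
    (fun a b b' => by
      have := A.map_update_add ![a, b] 1 b b'
      rwa [hu1, hu1, hu1] at this)
    (fun c a b => by
      have := A.map_update_smul ![a, b] 1 c b
      rwa [hu1, hu1] at this)
  have hinj : Function.Injective B := by
    rw [← LinearMap.ker_eq_bot, LinearMap.ker_eq_bot']
    intro a ha
    exact hA a fun b => congrArg (fun L : V →ₗ[ℝ] ℝ => L b) ha
  have hsurj : Function.Surjective B :=
    (LinearMap.injective_iff_surjective_of_finrank_eq_finrank
      (Subspace.dual_finrank_eq (K := ℝ) (V := V)).symm).1 hinj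
  obtain ⟨X, hX⟩ := hsurj (-L)
  refine ⟨X, fun v => ?_⟩
  have h1 : A ![X, v] = -L v := congrArg (fun L : V →ₗ[ℝ] ℝ => L v) hX
  have h2 : A (![X, v] ∘ Equiv.swap (0 : Fin 2) 1) = -A ![X, v] :=
    A.toAlternatingMap.map_swap ![X, v] (by decide)
  have h3 : (![X, v] : Fin 2 → V) ∘ Equiv.swap (0 : Fin 2) 1 = ![v, X] := by
    funext i
    fin_cases i <;> rfl
  rw [h3, h1, neg_neg] at h2
  exact h2.symm

/-- In finite dimension the Hamiltonian vector field does satisfy its defining equation. -/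
theorem hamiltonianField_spec [FiniteDimensional ℝ E] (ωM : SymplecticForm E M) (h : M → ℝ)
    (x : M) (v : TangentSpace 𝓘(ℝ, E) x) :
    differential h x v = ωM.toForm x ![v, hamiltonianField ωM h x] := by
  have hex : ∃ X : TangentSpace 𝓘(ℝ, E) x, ∀ v : TangentSpace 𝓘(ℝ, E) x,
      differential h x v = ωM.toForm x ![v, X] :=
    exists_eq_of_nondegenerate (V := E) (ωM.toForm x) (ωM.nondegenerate x)
      (mfderiv 𝓘(ℝ, E) 𝓘(ℝ, ℝ) h x : E →L[ℝ] ℝ).toLinearMap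
  exact Classical.epsilon_spec hex v

/-- The Poisson bracket `{f, g} = df(X_g)`. -/
def poissonBracket (ωM : SymplecticForm E M) (f g : M → ℝ) (x : M) : ℝ :=
  differential f x (hamiltonianField ωM g x)

/-- The Liouville volume form `ω ∧ ⋯ ∧ ω` (`n` factors), evaluated on `2 n` tangent vectors. -/
def liouvilleForm (ωM : SymplecticForm E M) (n : ℕ) (x : M)
    (v : Fin (2 * n) → TangentSpace 𝓘(ℝ, E) x) : ℝ :=
  (2 ^ n : ℝ)⁻¹ * ∑ τ : Equiv.Perm (Fin (2 * n)), ((Equiv.Perm.sign τ : ℤ) : ℝ) *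
    ∏ i : Fin n, ωM.toForm x ![v (τ ⟨2 * i, by omega⟩), v (τ ⟨2 * i + 1, by omega⟩)]

/-! ### Restriction of the Liouville volume to a common zero level set -/

/-- A system of vectors at `x` dual to `dφ₁, …, dφ_p` (it exists where these differentials are
independent), for instance the coordinate vectors `∂/∂φ_α` of a chart `(z, φ)`. -/
def dualFrame {p : ℕ} (φ : Fin p → M → ℝ) (x : M) : Fin p → TangentSpace 𝓘(ℝ, E) x :=
  Classical.epsilon fun w => ∀ α β, differential (φ α) x (w β) = if α = β then (1 : ℝ) else 0

/-- The restriction of the Liouville volume `Ω` to the level set `φ = 0`, of dimension `m`, as a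
form on the tangent spaces of the level set. If `Ω = dφ₁ ∧ ⋯ ∧ dφ_p ∧ μ Θ` in coordinates
`(z, φ)`, then on vectors `v` tangent to the level set its value is
`μ Θ(v) = Ω(∂/∂φ₁, …, ∂/∂φ_p, v)`; this value is the same for all systems of vectors dual to
`dφ₁, …, dφ_p`. -/
def restrictedVolume (ωM : SymplecticForm E M) {n p m : ℕ} (hdim : 2 * n = p + m)
    (φ : Fin p → M → ℝ) (x : M) (v : Fin m → TangentSpace 𝓘(ℝ, E) x) : ℝ :=
  liouvilleForm ωM n x (Fin.append (dualFrame φ x) v ∘ Fin.cast hdim)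

/-! ### Flows -/

/-- The solution of `dx/dt = X(x)` that starts at `x` exists on the time interval between `0` and
`t` and is at `y` at time `t`. -/
def FlowsTo (X : ∀ x : M, TangentSpace 𝓘(ℝ, E) x) (t : ℝ) (x y : M) : Prop :=
  ∃ γ : ℝ → M, IsMIntegralCurveOn γ X (Set.uIcc 0 t) ∧ γ 0 = x ∧ γ t = y

/-- The set `S` is invariant under the flow of `X`. -/
def IsFlowInvariant (X : ∀ x : M, TangentSpace 𝓘(ℝ, E) x) (S : Set M) : Prop :=
  ∀ (t : ℝ) (x y : M), x ∈ S → FlowsTo X t x y → y ∈ S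

/-- The (local) flow of `X_h`, restricted to the level set `φ = 0`, preserves the restriction `Ω₀`
of the Liouville volume to that level set: if `F` is the time-`t` flow map on an open set `U`,
then `F^* Ω₀ = Ω₀` at all points of the level set in `U`. -/
def FlowPreservesRestrictedVolume (ωM : SymplecticForm E M) {n p m : ℕ} (hdim : 2 * n = p + m)
    (φ : Fin p → M → ℝ) (h : M → ℝ) : Prop :=
  ∀ (t : ℝ) (U : Set M) (F : M → M), IsOpen U →
    (∀ x ∈ U, FlowsTo (hamiltonianField ωM h) t x (F x)) →
    ∀ x ∈ U, (∀ α, φ α x = 0) →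
      ∀ v : Fin m → TangentSpace 𝓘(ℝ, E) x, (∀ i α, differential (φ α) x (v i) = 0) →
        restrictedVolume ωM hdim φ (F x)
          (fun i => mfderiv 𝓘(ℝ, E) 𝓘(ℝ, E) F x (v i)) = restrictedVolume ωM hdim φ x v

/-- The functions `ψ α β` are smooth on the open neighbourhood `U` of the level set `φ = 0`, and
`dφ_α/dt = {φ_α, h} = ∑ β, ψ α β φ_β` there. -/
structure IsRelationMatrix (ωM : SymplecticForm E M) {p : ℕ} (φ : Fin p → M → ℝ) (h : M → ℝ)
    (U : Set M) (ψ : Fin p → Fin p → M → ℝ) : Prop where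
  isOpen : IsOpen U
  subset : {x | ∀ α, φ α x = 0} ⊆ U
  smooth : ∀ α β, ContMDiffOn 𝓘(ℝ, E) 𝓘(ℝ, ℝ) ∞ (ψ α β) U
  eq : ∀ x ∈ U, ∀ α, poissonBracket ωM (φ α) h x = ∑ β, ψ α β x * φ β x

end Forms

/-! ### Hamiltonian actions -/

section Actions

variable {E : Type*} [NormedAddCommGroup E] [NormedSpace ℝ E]
  {M : Type*} [TopologicalSpace M] [ChartedSpace E M]
  {EG : Type*} [NormedAddCommGroup EG] [NormedSpace ℝ EG]
  {G : Type*} [TopologicalSpace G] [ChartedSpace EG G] [Group G] [MulAction G M]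

/-- The vector field on `M` generated by the one-parameter subgroup `exp(t ξ)`. -/
def generator (E : Type*) [NormedAddCommGroup E] [NormedSpace ℝ E] [ChartedSpace E M]
    (ξ : GroupLieAlgebra 𝓘(ℝ, EG) G) (x : M) : TangentSpace 𝓘(ℝ, E) x :=
  (mfderiv 𝓘(ℝ, EG) 𝓘(ℝ, E) (fun g : G => g • x) 1 ξ : TangentSpace 𝓘(ℝ, E) ((1 : G) • x))

/-- The action of `G` on `M` is Hamiltonian with momentum map `Φ : M → 𝔤^*`. Here
`Φ x ξ = φ_ξ(x)` are the components of the momentum map. -/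
structure IsHamiltonianAction (ωM : SymplecticForm E M)
    (Φ : M → Module.Dual ℝ (GroupLieAlgebra 𝓘(ℝ, EG) G)) : Prop where
  symplectic : ∀ (g : G) (x : M) (u v : TangentSpace 𝓘(ℝ, E) x),
    ωM.toForm (g • x) ![mfderiv 𝓘(ℝ, E) 𝓘(ℝ, E) (fun y : M => g • y) x u,
      mfderiv 𝓘(ℝ, E) 𝓘(ℝ, E) (fun y : M => g • y) x v] = ωM.toForm x ![u, v]
  smooth : ∀ ξ, ContMDiff 𝓘(ℝ, E) 𝓘(ℝ, ℝ) ∞ fun x => Φ x ξ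
  generated : ∀ ξ x, hamiltonianField ωM (fun y => Φ y ξ) x = generator E ξ x
  bracket : ∀ (ξ η : GroupLieAlgebra 𝓘(ℝ, EG) G) (x : M),
    Φ x ⁅ξ, η⁆ = poissonBracket ωM (fun y => Φ y ξ) (fun y => Φ y η) x

/-- `0` is a regular value of the momentum map. -/
def ZeroIsRegularValue (E : Type*) [NormedAddCommGroup E] [NormedSpace ℝ E] [ChartedSpace E M]
    (Φ : M → Module.Dual ℝ (GroupLieAlgebra 𝓘(ℝ, EG) G)) : Prop :=
  ∀ x, Φ x = 0 → ∀ η : Module.Dual ℝ (GroupLieAlgebra 𝓘(ℝ, EG) G),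
    ∃ v : TangentSpace 𝓘(ℝ, E) x, ∀ ξ, differential (fun y => Φ y ξ) x v = η ξ

end Actions

/-! ### Reduction by a group `K` -/

section Reduction

/-- The orbit space `M / K`, with the quotient topology and the Borel σ-algebra. -/
def OrbitSpace (K M : Type*) [Group K] [MulAction K M] : Type _ := MulAction.orbitRel.Quotient K M

variable {K M : Type*} [Group K] [MulAction K M] [TopologicalSpace M]

instance : TopologicalSpace (OrbitSpace K M) :=
  inferInstanceAs (TopologicalSpace (Quotient (MulAction.orbitRel K M)))

instance : MeasurableSpace (OrbitSpace K M) := borel _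

instance : BorelSpace (OrbitSpace K M) := ⟨rfl⟩

/-- The projection `σ : M → M / K`. -/
def orbitProj (K : Type*) {M : Type*} [Group K] [MulAction K M] (x : M) : OrbitSpace K M :=
  Quotient.mk (MulAction.orbitRel K M) x

variable {E : Type*} [NormedAddCommGroup E] [NormedSpace ℝ E] [ChartedSpace E M]

/-- The reduced Poisson bracket on `M / K`, determined by `{F₁, F₂}^K ∘ σ = {F₁ ∘ σ, F₂ ∘ σ}`. -/
def reducedBracket (ωM : SymplecticForm E M) (F₁ F₂ : OrbitSpace K M → ℝ) (y : OrbitSpace K M) :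
    ℝ :=
  poissonBracket ωM (F₁ ∘ orbitProj K) (F₂ ∘ orbitProj K) (Quotient.out y)

/-- The curve `c` in `M / K` solves the reduced equations `dF/dt = {F, H}^K`, for all smooth
functions `F` on `M / K`, on the set of times `J`. A function `F` on `M / K` is smooth if `F ∘ σ`
is smooth on `M`. -/
def IsReducedTrajectoryOn (ωM : SymplecticForm E M) (H : OrbitSpace K M → ℝ)
    (c : ℝ → OrbitSpace K M) (J : Set ℝ) : Prop :=
  ContinuousOn c J ∧ ∀ F : OrbitSpace K M → ℝ,
    ContMDiff 𝓘(ℝ, E) 𝓘(ℝ, ℝ) ∞ (F ∘ orbitProj K : M → ℝ) →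
      ∀ t ∈ J, HasDerivWithinAt (F ∘ c) (reducedBracket ωM F H (c t)) J t

/-- The reduced flow carries `y` to `y'` in time `t`. -/
def ReducedFlowsTo (ωM : SymplecticForm E M) (H : OrbitSpace K M → ℝ) (t : ℝ)
    (y y' : OrbitSpace K M) : Prop :=
  ∃ c : ℝ → OrbitSpace K M,
    IsReducedTrajectoryOn ωM H c (Set.uIcc 0 t) ∧ c 0 = y ∧ c t = y'

/-- The measure `ν`, carried by the subset `S` of `M / K`, is invariant under the reduced flow
restricted to `S`: if the time-`t` flow map `F` is defined on the Borel set `A ⊆ S`, then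
`ν (F(A)) = ν A`. -/
def IsReducedInvariantMeasure (ωM : SymplecticForm E M) (H : OrbitSpace K M → ℝ)
    (S : Set (OrbitSpace K M)) (ν : Measure (OrbitSpace K M)) : Prop :=
  ∀ (t : ℝ) (A : Set (OrbitSpace K M)) (F : OrbitSpace K M → OrbitSpace K M),
    MeasurableSet A → A ⊆ S → (∀ y ∈ A, ReducedFlowsTo ωM H t y (F y)) → ν (F '' A) = ν A

variable {EK : Type*} [NormedAddCommGroup EK] [NormedSpace ℝ EK]
  [TopologicalSpace K] [ChartedSpace EK K]

/-- Smooth local coordinates on the manifold `S / K`, for a `K`-invariant submanifold `S` of `M`: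
`σ ∘ s` is a diffeomorphism of the open set `V` of `ℝ^d` onto an open subset of `S / K`. Here `s` is
a smooth map into `S`; `σ ∘ s` is injective with image open in `S / K`; and its differential is
injective, that is, `ds` is injective modulo the tangent spaces of the orbits. -/
structure IsQuotientParametrization (E EK K : Type*) {M : Type*} [Group K] [MulAction K M]
    [TopologicalSpace M] [NormedAddCommGroup E] [NormedSpace ℝ E] [ChartedSpace E M]
    [NormedAddCommGroup EK] [NormedSpace ℝ EK] [TopologicalSpace K] [ChartedSpace EK K]
    (S : Set M) {d : ℕ} (V : Set (EuclideanSpace ℝ (Fin d)))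
    (s : EuclideanSpace ℝ (Fin d) → M) : Prop where
  isOpen : IsOpen V
  smooth : ContMDiffOn 𝓘(ℝ, EuclideanSpace ℝ (Fin d)) 𝓘(ℝ, E) ∞ s V
  mapsTo : Set.MapsTo s V S
  injOn : Set.InjOn (fun z => orbitProj K (s z)) V
  isOpen_image : ∃ O : Set (OrbitSpace K M), IsOpen O ∧
    (fun z => orbitProj K (s z)) '' V = O ∩ orbitProj K '' S
  immersive : ∀ z ∈ V, ∀ (u : EuclideanSpace ℝ (Fin d)) (ζ : GroupLieAlgebra 𝓘(ℝ, EK) K),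
    mfderiv 𝓘(ℝ, EuclideanSpace ℝ (Fin d)) 𝓘(ℝ, E) s z u = generator E ζ (s z) → u = 0

/-- The measure `ν` is carried by `S / K` and has, around each point of `S / K`, a smooth positive
density with respect to Lebesgue measure in some smooth local coordinates. -/
def IsSmoothQuotientMeasure (E EK K : Type*) {M : Type*} [Group K] [MulAction K M]
    [TopologicalSpace M] [NormedAddCommGroup E] [NormedSpace ℝ E] [ChartedSpace E M]
    [NormedAddCommGroup EK] [NormedSpace ℝ EK] [TopologicalSpace K] [ChartedSpace EK K]
    (S : Set M) (d : ℕ) (ν : Measure (OrbitSpace K M)) : Prop :=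
  ν (orbitProj K '' S)ᶜ = 0 ∧
  ∀ x ∈ S, ∃ (V : Set (EuclideanSpace ℝ (Fin d))) (s : EuclideanSpace ℝ (Fin d) → M)
    (ρ : EuclideanSpace ℝ (Fin d) → ℝ),
    IsQuotientParametrization E EK K S V s ∧
    orbitProj K x ∈ (fun z => orbitProj K (s z)) '' V ∧
    ContDiffOn ℝ ∞ ρ V ∧ (∀ z ∈ V, 0 < ρ z) ∧
    ∀ A : Set (OrbitSpace K M), MeasurableSet A → A ⊆ (fun z => orbitProj K (s z)) '' V →
      ν A = ∫⁻ z in V ∩ (fun z => orbitProj K (s z)) ⁻¹' A, ENNReal.ofReal (ρ z)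

end Reduction

end InvariantRelations

end

set_option linter.unusedSectionVars false

noncomputable section

namespace InvariantRelations

open Set Filter Topology

/-! ### Ordinary differential equations: uniqueness, the variational equation, local flows. -/

section ODE

variable {V : Type*} [NormedAddCommGroup V] [NormedSpace ℝ V]

/-! Existence of ψ is a division property. Invariance of the level set forces `{φ_α, h} = 0` on it,
because `φ_α` vanishes along the trajectories that start there. As `0` is a regular value, the `φ_β`
can be taken as coordinates near a point of the level set, and Hadamard's lemma divides `{φ_α, h}`
by them. Away from the level set one divides by the sum of the squares of the `φ_γ`. The admissible
values of ψ at a point form an affine space, so a partition of unity glues the local solutions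
(`exists_isRelationMatrix`).

The trace criterion compares two volumes. Since ω is closed, the Hamiltonian flow preserves ω
(`lie_derivative_form_eq_zero`), hence also the Liouville form Ω. For vectors `v` tangent to the
level set and arbitrary `w`, `Ω(w, v) = det(dφ_α(w_β)) Ω₀(v)` (`volAt_append`). Let `L` be the
derivative of the flow from `x` to `y` and let `w` be dual to the `dφ_α` at `x`. Then `det(dφ_α(L
w_β)) Ω₀(L v) = Ω₀(v)`, so Ω₀ is preserved exactly as long as this determinant stays equal to `1`.
Along the linearized flow the matrix `dφ_α(L w_β)` solves `m' = ψ m`, because the derivative of `∑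
ψ_αβ φ_β` is `∑ ψ_αβ dφ_β` where φ vanishes. By Jacobi's formula the logarithmic derivative of the
determinant is therefore `tr ψ` (`IsLinearizedTrajectory.hasDerivAt_diffMatrix_det`). Both
implications follow. If `h` is `G`-invariant, then `{φ_α, h} = 0` everywhere, and `ψ = 0` is an
admissible choice with trace zero.

For the reduction, the `φ_α` Poisson commute with the momentum map of the connected group `K`, so
they are `K`-invariant. Inserting the generators of the `K`-action into Ω₀ and taking absolute
values gives a density on every transversal to the orbits in the level set (`sliceDensity`). Passing
from one transversal to another translates by some `k` and slides along the orbits. The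
corresponding linear map is block triangular, with diagonal blocks `Ad_k` and the Jacobian of the
change of coordinates. As `K` is compact, `|det Ad_k| = 1`, so the densities transform as they
should (`exists_transition`) and define one measure on the quotient (`IsReducible.exists_measure`).
Slices exist by the inverse function theorem, freeness and compactness (`exists_isSliceChart`).

The flow of a `K`-invariant `h` commutes with `K` and so carries generators to generators. If it
also preserves Ω₀, it carries a transversal to another one with the same density
(`IsReducible.sliceDensity_flow`). The reduced flow is defined only through its action on smooth
functions, so it must still be shown to be the projection of the flow of `h`. Uniqueness is proved
in slice coordinates, which extend to smooth functions on the orbit space, and a reduced trajectory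
is lifted in short steps of uniform length (`IsReducible.exists_flowsTo_of_reducedFlowsTo`). The
measure is then invariant by countable decomposition (`measure_image_eq_of_densities`). -/

theorem hasDerivWithinAt_Ici_of_Icc {f : ℝ → V} {f' : V} {J : Set ℝ} {t b : ℝ}
    (hf : HasDerivWithinAt f f' J t) (htb : t < b) (hJ : Icc t b ⊆ J) :
    HasDerivWithinAt f f' (Ici t) t :=
  (hf.mono hJ).mono_of_mem_nhdsWithin (Icc_mem_nhdsGE htb)

theorem hasDerivWithinAt_Iic_of_Icc {f : ℝ → V} {f' : V} {J : Set ℝ} {t a : ℝ}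
    (hf : HasDerivWithinAt f f' J t) (hat : a < t) (hJ : Icc a t ⊆ J) :
    HasDerivWithinAt f f' (Iic t) t :=
  (hf.mono hJ).mono_of_mem_nhdsWithin (Icc_mem_nhdsLE hat)

/-- Two solutions on an interval of an autonomous ODE which agree at one time agree nearby. -/
theorem eventually_eq_of_hasDerivWithinAt {f g : ℝ → V} {v : V → V} {J : Set ℝ}
    (hJ : J.OrdConnected) {s : ℝ} (hs : s ∈ J) (hv : ContDiffAt ℝ 1 v (f s))
    (hf : ∀ᶠ r in 𝓝[J] s, HasDerivWithinAt f (v (f r)) J r)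
    (hg : ∀ᶠ r in 𝓝[J] s, HasDerivWithinAt g (v (g r)) J r)
    (heq : f s = g s) : ∀ᶠ r in 𝓝[J] s, f r = g r := by
  obtain ⟨K, U, hU, hL⟩ := hv.exists_lipschitzOnWith
  have hfc : ContinuousWithinAt f J s := (hf.self_of_nhdsWithin hs).continuousWithinAt
  have hgc : ContinuousWithinAt g J s := (hg.self_of_nhdsWithin hs).continuousWithinAt
  have h1 : ∀ᶠ r in 𝓝[J] s, f r ∈ U := hfc.eventually hU
  have h2 : ∀ᶠ r in 𝓝[J] s, g r ∈ U := hgc.eventually (heq ▸ hU)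
  have h3 := (hf.and hg).and (h1.and h2)
  rw [eventually_nhdsWithin_iff, Metric.eventually_nhds_iff_ball] at h3
  obtain ⟨δ, hδ, H⟩ := h3
  rw [eventually_nhdsWithin_iff, Metric.eventually_nhds_iff_ball]
  refine ⟨δ, hδ, fun r hr hrJ => ?_⟩
  have hsb : s ∈ Metric.ball s δ := Metric.mem_ball_self hδ
  have hbo : (Metric.ball s δ).OrdConnected := by
    rw [Real.ball_eq_Ioo]; exact ordConnected_Ioo
  rcases le_total s r with h | h
  · have hsub : Icc s r ⊆ J := hJ.out hs hrJ
    have hsub' : Icc s r ⊆ Metric.ball s δ := hbo.out hsb hr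
    refine ODE_solution_unique_of_mem_Icc_right (v := fun _ => v) (s := fun _ => U) (K := K)
      (fun _ _ => hL) (fun t ht => ((H t (hsub' ht) (hsub ht)).1.1.mono hsub).continuousWithinAt)
      (fun t ht => ?_) (fun t ht => (H t (hsub' (Ico_subset_Icc_self ht))
        (hsub (Ico_subset_Icc_self ht))).2.1)
      (fun t ht => ((H t (hsub' ht) (hsub ht)).1.2.mono hsub).continuousWithinAt)
      (fun t ht => ?_) (fun t ht => (H t (hsub' (Ico_subset_Icc_self ht))
        (hsub (Ico_subset_Icc_self ht))).2.2) heq (right_mem_Icc.2 h)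
    · exact hasDerivWithinAt_Ici_of_Icc ((H t (hsub' (Ico_subset_Icc_self ht))
        (hsub (Ico_subset_Icc_self ht))).1.1) ht.2 ((Icc_subset_Icc_left ht.1).trans hsub)
    · exact hasDerivWithinAt_Ici_of_Icc ((H t (hsub' (Ico_subset_Icc_self ht))
        (hsub (Ico_subset_Icc_self ht))).1.2) ht.2 ((Icc_subset_Icc_left ht.1).trans hsub)
  · have hsub : Icc r s ⊆ J := hJ.out hrJ hs
    have hsub' : Icc r s ⊆ Metric.ball s δ := hbo.out hr hsb
    refine ODE_solution_unique_of_mem_Icc_left (v := fun _ => v) (s := fun _ => U) (K := K)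
      (fun _ _ => hL) (fun t ht => ((H t (hsub' ht) (hsub ht)).1.1.mono hsub).continuousWithinAt)
      (fun t ht => ?_) (fun t ht => (H t (hsub' (Ioc_subset_Icc_self ht))
        (hsub (Ioc_subset_Icc_self ht))).2.1)
      (fun t ht => ((H t (hsub' ht) (hsub ht)).1.2.mono hsub).continuousWithinAt)
      (fun t ht => ?_) (fun t ht => (H t (hsub' (Ioc_subset_Icc_self ht))
        (hsub (Ioc_subset_Icc_self ht))).2.2) heq (left_mem_Icc.2 h)
    · exact hasDerivWithinAt_Iic_of_Icc ((H t (hsub' (Ioc_subset_Icc_self ht))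
        (hsub (Ioc_subset_Icc_self ht))).1.1) ht.1 ((Icc_subset_Icc_right ht.2).trans hsub)
    · exact hasDerivWithinAt_Iic_of_Icc ((H t (hsub' (Ioc_subset_Icc_self ht))
        (hsub (Ioc_subset_Icc_self ht))).1.2) ht.1 ((Icc_subset_Icc_right ht.2).trans hsub)

/-- Two curves in a Hausdorff space on an interval which agree at one point agree everywhere, if
agreement at a time implies agreement at nearby times. -/
theorem eqOn_of_locally_eq {Y : Type*} [TopologicalSpace Y] [T2Space Y] {J : Set ℝ}
    (hJ : IsPreconnected J) {f g : ℝ → Y} (hf : ContinuousOn f J) (hg : ContinuousOn g J)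
    {t₀ : ℝ} (ht₀ : t₀ ∈ J) (h₀ : f t₀ = g t₀)
    (hloc : ∀ s ∈ J, f s = g s → ∀ᶠ r in 𝓝[J] s, f r = g r) : EqOn f g J := by
  have : PreconnectedSpace J := isPreconnected_iff_preconnectedSpace.1 hJ
  have hclopen : IsClopen {x : J | f x = g x} := by
    refine ⟨isClosed_eq hf.domRestrict hg.domRestrict, ?_⟩
    rw [isOpen_iff_mem_nhds]
    intro x hx
    have := hloc x x.2 hx
    rw [nhdsWithin_eq_map_subtype_coe x.2] at this
    exact this
  have huniv := hclopen.eq_univ ⟨⟨t₀, ht₀⟩, h₀⟩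
  intro x hx
  have : (⟨x, hx⟩ : J) ∈ {x : J | f x = g x} := huniv ▸ mem_univ _
  exact this

/-- Deviation of a solution from the linearization of the equation along another solution. -/
theorem norm_sub_sub_le_of_variational {v : V → V} {s : Set V} (hs : Convex ℝ s)
    {K C : NNReal} (hv : ∀ x ∈ s, DifferentiableAt ℝ v x) (hK : ∀ x ∈ s, ‖fderiv ℝ v x‖ ≤ K)
    (hC : LipschitzOnWith C (fderiv ℝ v) s) {f g w : ℝ → V} {T : ℝ}
    (hf : ∀ t ∈ Icc 0 T, HasDerivAt f (v (f t)) t) (hfs : ∀ t ∈ Icc 0 T, f t ∈ s)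
    (hg : ∀ t ∈ Icc 0 T, HasDerivAt g (v (g t)) t) (hgs : ∀ t ∈ Icc 0 T, g t ∈ s)
    (hw : ∀ t ∈ Icc 0 T, HasDerivAt w (fderiv ℝ v (f t) (w t)) t)
    (hw0 : w 0 = g 0 - f 0) (hT : 0 ≤ T) :
    ‖g T - f T - w T‖ ≤ gronwallBound 0 K (C * (‖g 0 - f 0‖ * Real.exp (K * T)) ^ 2) T := by
  have hLip : LipschitzOnWith K v s := hs.lipschitzOnWith_of_nnnorm_fderiv_le hv hK
  have hdist : ∀ t ∈ Icc 0 T, ‖g t - f t‖ ≤ ‖g 0 - f 0‖ * Real.exp (K * T) := by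
    intro t ht
    have h1 := dist_le_of_trajectories_ODE_of_mem (v := fun _ => v) (s := fun _ => s) (K := K)
      (f := g) (g := f) (a := 0) (b := T) (δ := ‖g 0 - f 0‖) (fun _ _ => hLip)
      (fun t ht => (hg t ht).continuousAt.continuousWithinAt)
      (fun t ht => (hg t (Ico_subset_Icc_self ht)).hasDerivWithinAt)
      (fun t ht => hgs t (Ico_subset_Icc_self ht))
      (fun t ht => (hf t ht).continuousAt.continuousWithinAt)
      (fun t ht => (hf t (Ico_subset_Icc_self ht)).hasDerivWithinAt)
      (fun t ht => hfs t (Ico_subset_Icc_self ht)) (by rw [dist_eq_norm]) t ht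
    rw [dist_eq_norm] at h1
    refine h1.trans ?_
    have := ht.2
    gcongr
    linarith
  have hder : ∀ t ∈ Icc 0 T, HasDerivAt (fun t => g t - f t - w t)
      (v (g t) - v (f t) - fderiv ℝ v (f t) (w t)) t := fun t ht =>
    ((hg t ht).sub (hf t ht)).sub (hw t ht)
  have := norm_le_gronwallBound_of_norm_deriv_right_le (f := fun t => g t - f t - w t)
    (δ := 0) (K := K) (ε := C * (‖g 0 - f 0‖ * Real.exp (K * T)) ^ 2) (a := 0) (b := T)
    (fun t ht => (hder t ht).continuousAt.continuousWithinAt)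
    (fun t ht => (hder t (Ico_subset_Icc_self ht)).hasDerivWithinAt) (by simp [hw0]) ?_ T
    (right_mem_Icc.2 hT)
  · simpa using this
  intro t ht
  have ht' := Ico_subset_Icc_self ht
  have hseg : segment ℝ (f t) (g t) ⊆ s := hs.segment_subset (hfs t ht') (hgs t ht')
  -- The derivative of `v` is `C`-Lipschitz, so on the segment it deviates from its value at `f t`
  -- by at most `C ‖g t - f t‖`; the mean value inequality then gives a quadratic remainder.
  have hR : ‖v (g t) - v (f t) - fderiv ℝ v (f t) (g t - f t)‖
      ≤ (C * ‖g t - f t‖) * ‖g t - f t‖ := by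
    refine Convex.norm_image_sub_le_of_norm_fderiv_le' (𝕜 := ℝ) (s := segment ℝ (f t) (g t))
      (fun x hx => hv x (hseg hx)) (fun x hx => ?_) (convex_segment _ _)
      (left_mem_segment _ _ _) (right_mem_segment _ _ _)
    have := hC.norm_sub_le (hseg hx) (hfs t ht')
    refine this.trans ?_
    gcongr
    obtain ⟨a, b, ha, hb, hab, rfl⟩ := hx
    have : a • f t + b • g t - f t = b • (g t - f t) := by
      have : a = 1 - b := by linarith
      rw [this]; module
    rw [this, norm_smul, Real.norm_of_nonneg hb]
    exact mul_le_of_le_one_left (norm_nonneg _) (by linarith)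
  -- The derivative of the deviation is linear in the deviation plus the quadratic remainder, which
  -- is the form required by Grönwall's inequality.
  have hsplit : v (g t) - v (f t) - fderiv ℝ v (f t) (w t)
      = fderiv ℝ v (f t) (g t - f t - w t)
        + (v (g t) - v (f t) - fderiv ℝ v (f t) (g t - f t)) := by
    rw [map_sub (fderiv ℝ v (f t)) (g t - f t)]; abel
  rw [hsplit]
  refine (norm_add_le _ _).trans (add_le_add ?_ (hR.trans ?_))
  · exact ((fderiv ℝ v (f t)).le_opNorm _).trans
      (mul_le_mul_of_nonneg_right (hK _ (hfs t ht')) (norm_nonneg _))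
  · have := hdist t ht'
    rw [mul_assoc, ← sq]
    gcongr

/-- A `C²` vector field has a local flow, which is differentiable in the initial value; the
derivative solves the variational equation. -/
theorem exists_local_flow [CompleteSpace V] {v : V → V} {Ω : Set V} (hΩ : IsOpen Ω)
    (hv : ContDiffOn ℝ 2 v Ω) {y₀ : V} (hy₀ : y₀ ∈ Ω) :
    ∃ ε > 0, ∃ B : Set V, IsOpen B ∧ y₀ ∈ B ∧ B ⊆ Ω ∧ ∃ (Θ : ℝ → V → V) (W : ℝ → V → V →L[ℝ] V),
      ∀ y ∈ B, Θ 0 y = y ∧ W 0 y = ContinuousLinearMap.id ℝ V ∧ ∀ t ∈ Ioo (-ε) ε,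
        Θ t y ∈ Ω ∧ HasDerivAt (fun s => Θ s y) (v (Θ t y)) t ∧
        HasDerivAt (fun s => W s y) ((fderiv ℝ v (Θ t y)).comp (W t y)) t ∧
        HasFDerivAt (Θ t) (W t y) y := by
  have hvat : ContDiffAt ℝ 2 v y₀ := hv.contDiffAt (hΩ.mem_nhds hy₀)
  have hv' : ContDiffAt ℝ 1 (fderiv ℝ v) y₀ := hvat.fderiv_right (by norm_num)
  have hv1 : ContDiffAt ℝ 1 v y₀ := hvat.of_le (by norm_num)
  let id' := ContinuousLinearMap.id ℝ V
  -- The equation and its linearization are solved together as one system. It is `C¹` because `v` is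
  -- `C²`, so Picard–Lindelöf yields the flow and the candidate for its derivative on a common time
  -- interval.
  let G : V × (V →L[ℝ] V) → V × (V →L[ℝ] V) := fun p => (v p.1, (fderiv ℝ v p.1).comp p.2)
  have hG : ContDiffAt ℝ 1 G (y₀, id') := by
    refine ContDiffAt.prodMk (hv1.comp (y₀, id') contDiffAt_fst) ?_
    exact (ContDiffAt.comp (y₀, id') hv' contDiffAt_fst).clm_comp contDiffAt_snd
  obtain ⟨ε₀, hε₀, a, r, L, K₀, hr, hPL⟩ := IsPicardLindelof.of_contDiffAt_one hG
  obtain ⟨α, hα, hαc⟩ :=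
    (hPL 0).exists_forall_mem_closedBall_eq_hasDerivWithinAt_continuousOn
  simp only [zero_sub, zero_add] at hα hαc
  -- a convex neighbourhood with uniform bounds
  obtain ⟨C, U, hU, hC⟩ := hv'.exists_lipschitzOnWith
  have hbdd : ∀ᶠ x in 𝓝 y₀, ‖fderiv ℝ v x‖ < ‖fderiv ℝ v y₀‖ + 1 :=
    hv'.continuousAt.norm.eventually_lt continuousAt_const (by simp)
  obtain ⟨ρ, hρ, hρs⟩ := Metric.mem_nhds_iff.1
    (inter_mem (inter_mem hU (hΩ.mem_nhds hy₀)) hbdd)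
  have hpt : ((y₀, id'), (0 : ℝ)) ∈ Metric.closedBall (y₀, id') (r : ℝ) ×ˢ Icc (-ε₀) ε₀ :=
    ⟨Metric.mem_closedBall_self r.2, by simp [hε₀.le]⟩
  have hα0 : α ((y₀, id'), 0) = (y₀, id') := (hα _ hpt.1).1
  have hnear : ∀ᶠ q in 𝓝 ((y₀, id'), (0 : ℝ)), (α q).1 ∈ Metric.ball y₀ ρ := by
    have h1 : Metric.closedBall (y₀, id') (r : ℝ) ×ˢ Icc (-ε₀) ε₀ ∈ 𝓝 ((y₀, id'), (0 : ℝ)) :=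
      prod_mem_nhds (Metric.closedBall_mem_nhds _ hr) (Icc_mem_nhds (by linarith) hε₀)
    have h3 : ContinuousAt (fun q => (α q).1) ((y₀, id'), (0 : ℝ)) := (hαc.continuousAt h1).fst
    refine h3.eventually (Metric.isOpen_ball.mem_nhds ?_)
    simp only [hα0]
    exact Metric.mem_ball_self hρ
  obtain ⟨η, hη, hηs⟩ := Metric.eventually_nhds_iff_ball.1 hnear
  have hr' : (0 : ℝ) < r := hr
  have hball : ∀ y ∈ Metric.ball y₀ (min η r), ∀ t ∈ Ioo (-(min η ε₀)) (min η ε₀),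
      ((y, id'), t) ∈ Metric.ball ((y₀, id'), (0 : ℝ)) η := by
    intro y hy t ht
    rw [Metric.mem_ball, Prod.dist_eq, Prod.dist_eq]
    simp only [dist_self]
    refine max_lt (max_lt (lt_of_lt_of_le hy (min_le_left _ _)) hη) ?_
    rw [Real.dist_0_eq_abs]
    exact (abs_lt.2 ht).trans_le (min_le_left _ _)
  have hcl : ∀ y ∈ Metric.ball y₀ (min η r), (y, id') ∈ Metric.closedBall (y₀, id') (r : ℝ) := by
    intro y hy
    rw [Metric.mem_closedBall, Prod.dist_eq]
    simp only [dist_self]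
    exact max_le ((lt_of_lt_of_le hy (min_le_right _ _)).le) hr'.le
  have hsol : ∀ y ∈ Metric.ball y₀ (min η r), ∀ t ∈ Ioo (-(min η ε₀)) (min η ε₀),
      HasDerivAt (fun t => α ((y, id'), t)) (G (α ((y, id'), t))) t := by
    intro y hy t ht
    have h1 : -ε₀ < t := lt_of_le_of_lt (neg_le_neg (min_le_right _ _)) ht.1
    have h2 : t < ε₀ := ht.2.trans_le (min_le_right _ _)
    exact ((hα _ (hcl y hy)).2 t ⟨h1.le, h2.le⟩).hasDerivAt (Icc_mem_nhds h1 h2)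
  have hΘ : ∀ y ∈ Metric.ball y₀ (min η r), ∀ t ∈ Ioo (-(min η ε₀)) (min η ε₀),
      HasDerivAt (fun t => (α ((y, id'), t)).1) (v (α ((y, id'), t)).1) t := fun y hy t ht =>
    (hsol y hy t ht).fst
  have hW : ∀ y ∈ Metric.ball y₀ (min η r), ∀ t ∈ Ioo (-(min η ε₀)) (min η ε₀),
      HasDerivAt (fun t => (α ((y, id'), t)).2)
        ((fderiv ℝ v (α ((y, id'), t)).1).comp (α ((y, id'), t)).2) t := fun y hy t ht =>
    (hsol y hy t ht).snd
  have hin : ∀ y ∈ Metric.ball y₀ (min η r), ∀ t ∈ Ioo (-(min η ε₀)) (min η ε₀),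
      (α ((y, id'), t)).1 ∈ Metric.ball y₀ ρ := fun y hy t ht => hηs _ (hball y hy t ht)
  have hinit : ∀ y ∈ Metric.ball y₀ (min η r), α ((y, id'), 0) = (y, id') := fun y hy =>
    (hα _ (hcl y hy)).1
  have hε : 0 < min η ε₀ := lt_min hη hε₀
  -- Adding `1` makes `K` a bound near `y₀` and also nonzero, so that `gronwallBound` has its
  -- explicit exponential form.
  let K : NNReal := ‖fderiv ℝ v y₀‖₊ + 1
  have hKpos : (K : ℝ) ≠ 0 := by positivity
  refine ⟨min η ε₀, hε, Metric.ball y₀ (min η r) ∩ Ω, Metric.isOpen_ball.inter hΩ,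
    ⟨Metric.mem_ball_self (lt_min hη hr'), hy₀⟩, inter_subset_right,
    fun t y => (α ((y, id'), t)).1, fun t y => (α ((y, id'), t)).2, ?_⟩
  rintro y ⟨hy, -⟩
  refine ⟨by simp only [hinit y hy], by simp only [hinit y hy]; rfl, fun t ht =>
    ⟨(hρs (hin y hy t ht)).1.2, hΘ y hy t ht, hW y hy t ht, ?_⟩⟩
  have hdiff : ∀ x ∈ Metric.ball y₀ ρ, DifferentiableAt ℝ v x := fun x hx =>
    (hv.contDiffAt (hΩ.mem_nhds (hρs hx).1.2)).differentiableAt (by norm_num)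
  have hKb : ∀ x ∈ Metric.ball y₀ ρ, ‖fderiv ℝ v x‖ ≤ K := fun x hx => (hρs hx).2.le
  have hCl : LipschitzOnWith C (fderiv ℝ v) (Metric.ball y₀ ρ) := hC.mono fun x hx => (hρs hx).1.1
  -- quadratic estimate
  have hquad : ∀ y' ∈ Metric.ball y₀ (min η r), ‖(α ((y', id'), t)).1 - (α ((y, id'), t)).1
      - (α ((y, id'), t)).2 (y' - y)‖
      ≤ C * Real.exp (K * |t|) ^ 2 / K * (Real.exp (K * |t|) - 1) * ‖y' - y‖ ^ 2 := by
    intro y' hy'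
    have hgr : gronwallBound 0 K (C * (‖y' - y‖ * Real.exp (K * |t|)) ^ 2) |t|
        = C * Real.exp (K * |t|) ^ 2 / K * (Real.exp (K * |t|) - 1) * ‖y' - y‖ ^ 2 := by
      rw [gronwallBound_of_K_ne_0 hKpos]; ring
    rw [← hgr]
    rcases le_total 0 t with h0 | h0
    · have hT : ∀ s ∈ Icc 0 t, s ∈ Ioo (-(min η ε₀)) (min η ε₀) := fun s hs =>
        ⟨by linarith [hs.1], by linarith [hs.2, ht.2]⟩
      have := norm_sub_sub_le_of_variational (convex_ball y₀ ρ) hdiff hKb hCl (T := t)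
        (f := fun t => (α ((y, id'), t)).1) (g := fun t => (α ((y', id'), t)).1)
        (w := fun t => (α ((y, id'), t)).2 (y' - y))
        (fun s hs => hΘ y hy s (hT s hs)) (fun s hs => hin y hy s (hT s hs))
        (fun s hs => hΘ y' hy' s (hT s hs)) (fun s hs => hin y' hy' s (hT s hs))
        (fun s hs => by
          simpa using (hW y hy s (hT s hs)).clm_apply (hasDerivAt_const s (y' - y)))
        (by simp [hinit y hy, hinit y' hy', id']) h0
      simpa [hinit y hy, hinit y' hy', abs_of_nonneg h0] using this
    -- Negative times are reduced to positive ones by reversing time, that is, by replacing `v` with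
    -- `-v`.
    · have hT : ∀ s ∈ Icc 0 (-t), -s ∈ Ioo (-(min η ε₀)) (min η ε₀) := fun s hs =>
        ⟨by linarith [hs.2, ht.1], by linarith [hs.1]⟩
      have hneg : fderiv ℝ (fun x => -v x) = fun x => -fderiv ℝ v x := by
        ext1 x; exact fderiv_fun_neg
      have := norm_sub_sub_le_of_variational (v := fun x => -v x) (K := K) (C := C)
        (convex_ball y₀ ρ)
        (fun x hx => (hdiff x hx).neg) (by simpa [hneg] using hKb)
        (by rw [hneg]; exact hCl.neg) (T := -t)
        (f := fun t => (α ((y, id'), -t)).1) (g := fun t => (α ((y', id'), -t)).1)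
        (w := fun t => (α ((y, id'), -t)).2 (y' - y))
        (fun s hs => by
          simpa [Function.comp_def] using (hΘ y hy (-s) (hT s hs)).scomp s (hasDerivAt_neg s))
        (fun s hs => hin y hy _ (hT s hs))
        (fun s hs => by
          simpa [Function.comp_def] using (hΘ y' hy' (-s) (hT s hs)).scomp s (hasDerivAt_neg s))
        (fun s hs => hin y' hy' _ (hT s hs))
        (fun s hs => by
          simpa [hneg] using ((hW y hy (-s) (hT s hs)).scomp s (hasDerivAt_neg s)).clm_apply
            (hasDerivAt_const s (y' - y)))
        (by simp [hinit y hy, hinit y' hy', id']) (by linarith)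
      simpa [hinit y hy, hinit y' hy', abs_of_nonpos h0] using this
  set c : ℝ := C * Real.exp (K * |t|) ^ 2 / K * (Real.exp (K * |t|) - 1)
  refine HasFDerivAt.of_isLittleO ?_
  have hbig : (fun y' => (α ((y', id'), t)).1 - (α ((y, id'), t)).1
      - (α ((y, id'), t)).2 (y' - y)) =O[𝓝 y] fun y' => ‖y' - y‖ ^ 2 := by
    refine Asymptotics.IsBigO.of_bound c ?_
    filter_upwards [Metric.isOpen_ball.mem_nhds hy] with y' hy'
    simpa using hquad y' hy'
  refine hbig.trans_isLittleO ?_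
  have h1 : Tendsto (fun y' => y' - y) (𝓝 y) (𝓝 0) := by
    have : ContinuousAt (fun y' => y' - y) y := by fun_prop
    simpa [ContinuousAt] using this
  exact (Asymptotics.isLittleO_norm_pow_id one_lt_two).comp_tendsto h1

end ODE

end InvariantRelations

end

noncomputable section

namespace InvariantRelations

open Set Filter Topology

/-! ### Linear algebra of 2-forms, their top exterior powers, and forms with some arguments fixed.
-/

section LinearAlgebra

variable {V : Type*} [NormedAddCommGroup V] [NormedSpace ℝ V]

theorem alt_add_left (A : V [⋀^Fin 2]→L[ℝ] ℝ) (a a' b : V) :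
    A ![a + a', b] = A ![a, b] + A ![a', b] := by
  have := A.map_update_add ![a, b] 0 a a'
  have hu : ∀ z : V, Function.update ![a, b] 0 z = ![z, b] := by
    intro z; funext i; fin_cases i <;> rfl
  rwa [hu, hu, hu] at this

theorem alt_smul_left (A : V [⋀^Fin 2]→L[ℝ] ℝ) (c : ℝ) (a b : V) :
    A ![c • a, b] = c * A ![a, b] := by
  have := A.map_update_smul ![a, b] 0 c a
  have hu : ∀ z : V, Function.update ![a, b] 0 z = ![z, b] := by
    intro z; funext i; fin_cases i <;> rfl
  rwa [hu, hu] at this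

theorem alt_swap (A : V [⋀^Fin 2]→L[ℝ] ℝ) (a b : V) : A ![b, a] = -A ![a, b] := by
  have h2 : A (![a, b] ∘ Equiv.swap (0 : Fin 2) 1) = -A ![a, b] :=
    A.toAlternatingMap.map_swap ![a, b] (by decide)
  have h3 : (![a, b] : Fin 2 → V) ∘ Equiv.swap (0 : Fin 2) 1 = ![b, a] := by
    funext i; fin_cases i <;> rfl
  rwa [h3] at h2

theorem alt_self (A : V [⋀^Fin 2]→L[ℝ] ℝ) (a : V) : A ![a, a] = 0 := by
  have := alt_swap A a a; linarith

theorem alt_add_right (A : V [⋀^Fin 2]→L[ℝ] ℝ) (a b b' : V) :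
    A ![a, b + b'] = A ![a, b] + A ![a, b'] := by
  rw [alt_swap, alt_add_left, alt_swap A a b, alt_swap A a b']; ring

theorem alt_smul_right (A : V [⋀^Fin 2]→L[ℝ] ℝ) (c : ℝ) (a b : V) :
    A ![a, c • b] = c * A ![a, b] := by
  rw [alt_swap, alt_smul_left, alt_swap A a b]; ring

/-- An alternating bilinear form as a bilinear map. -/
def altBilin (A : V [⋀^Fin 2]→L[ℝ] ℝ) : V →ₗ[ℝ] V →ₗ[ℝ] ℝ :=
  LinearMap.mk₂ ℝ (fun a b : V => A ![a, b]) (alt_add_left A) (alt_smul_left A) (alt_add_right A)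
    (alt_smul_right A)

@[simp] theorem altBilin_apply (A : V [⋀^Fin 2]→L[ℝ] ℝ) (a b : V) : altBilin A a b = A ![a, b] :=
  rfl

/-- The slot `j` belongs to the pair `j / 2`, and its parity tells which entry of the pair it is;
all other factors stay as they were. This reduces multilinearity of the product to bilinearity of
`A`. -/
theorem prod_pairs_update (A : V [⋀^Fin 2]→L[ℝ] ℝ) {n : ℕ} (v : Fin (2 * n) → V)
    (j : Fin (2 * n)) (z : V) :
    ∏ i : Fin n, A ![Function.update v j z ⟨2 * i, by omega⟩,
        Function.update v j z ⟨2 * i + 1, by omega⟩] =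
      (if (j : ℕ) % 2 = 0 then A ![z, v ⟨2 * (j / 2) + 1, by omega⟩] else
        A ![v ⟨2 * (j / 2), by omega⟩, z]) *
      ∏ i ∈ Finset.univ.erase (⟨j / 2, by omega⟩ : Fin n),
        A ![v ⟨2 * i, by omega⟩, v ⟨2 * i + 1, by omega⟩] := by
  rw [← Finset.mul_prod_erase Finset.univ _ (Finset.mem_univ (⟨j / 2, by omega⟩ : Fin n))]
  congr 1
  · split_ifs with hj
    · rw [show (⟨2 * (j / 2 : ℕ), by omega⟩ : Fin (2 * n)) = j from Fin.ext (by simp; omega),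
        Function.update_self, Function.update_of_ne (by simp [Fin.ext_iff]; omega)]
    · rw [show (⟨2 * (j / 2 : ℕ) + 1, by omega⟩ : Fin (2 * n)) = j from
        Fin.ext (by simp; omega), Function.update_self,
        Function.update_of_ne (by simp [Fin.ext_iff]; omega)]
  · refine Finset.prod_congr rfl fun i hi => ?_
    have hi' : (i : ℕ) ≠ j / 2 := fun h => (Finset.mem_erase.1 hi).1 (Fin.ext h)
    rw [Function.update_of_ne (by simp [Fin.ext_iff]; omega),
      Function.update_of_ne (by simp [Fin.ext_iff]; omega)]

/-- The product of the values of a bilinear form on `n` consecutive pairs of vectors. -/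
def pairProduct (A : V [⋀^Fin 2]→L[ℝ] ℝ) (n : ℕ) :
    MultilinearMap ℝ (fun _ : Fin (2 * n) => V) ℝ where
  toFun v := ∏ i : Fin n, A ![v ⟨2 * i, by omega⟩, v ⟨2 * i + 1, by omega⟩]
  map_update_add' := by
    intro inst v j x y
    obtain rfl := Subsingleton.elim inst (instDecidableEqFin _)
    rw [prod_pairs_update, prod_pairs_update, prod_pairs_update]
    split_ifs
    · rw [alt_add_left, add_mul]
    · rw [alt_add_right, add_mul]
  map_update_smul' := by
    intro inst v j c x
    obtain rfl := Subsingleton.elim inst (instDecidableEqFin _)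
    rw [prod_pairs_update, prod_pairs_update]
    split_ifs
    · rw [alt_smul_left, smul_eq_mul, mul_assoc]
    · rw [alt_smul_right, smul_eq_mul, mul_assoc]

/-- The `n`-th exterior power of a 2-form, as an alternating map. -/
def liouvilleAlt (A : V [⋀^Fin 2]→L[ℝ] ℝ) (n : ℕ) : V [⋀^Fin (2 * n)]→ₗ[ℝ] ℝ :=
  (2 ^ n : ℝ)⁻¹ • MultilinearMap.alternatization (pairProduct A n)

theorem liouvilleAlt_apply (A : V [⋀^Fin 2]→L[ℝ] ℝ) (n : ℕ) (v : Fin (2 * n) → V) :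
    liouvilleAlt A n v = (2 ^ n : ℝ)⁻¹ * ∑ τ : Equiv.Perm (Fin (2 * n)),
      ((Equiv.Perm.sign τ : ℤ) : ℝ) *
      ∏ i : Fin n, A ![v (τ ⟨2 * i, by omega⟩), v (τ ⟨2 * i + 1, by omega⟩)] := by
  simp only [liouvilleAlt, AlternatingMap.smul_apply, MultilinearMap.alternatization_apply,
    smul_eq_mul]
  congr 1
  refine Finset.sum_congr rfl fun τ _ => ?_
  rw [Units.smul_def, zsmul_eq_mul]
  rfl

/-- A system of vectors forming the beginning of a Darboux basis. -/
structure IsDarboux (A : V [⋀^Fin 2]→L[ℝ] ℝ) {k : ℕ} (e f : Fin k → V) : Prop where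
  ee : ∀ i j, A ![e i, e j] = 0
  ff : ∀ i j, A ![f i, f j] = 0
  ef : ∀ i j, A ![e i, f j] = if i = j then 1 else 0

/-- Symplectic Gram–Schmidt: choose `u` orthogonal to the pairs found so far, take a vector not
orthogonal to `u`, correct it by those pairs and normalize. -/
theorem exists_isDarboux [FiniteDimensional ℝ V] (A : V [⋀^Fin 2]→L[ℝ] ℝ)
    (hA : ∀ u : V, (∀ v : V, A ![u, v] = 0) → u = 0) (k : ℕ) (hk : 2 * k ≤ Module.finrank ℝ V) :
    ∃ e f : Fin k → V, IsDarboux A e f := by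
  induction k with
  | zero => exact ⟨Fin.elim0, Fin.elim0, ⟨fun i => i.elim0, fun i => i.elim0, fun i => i.elim0⟩⟩
  | succ k ih =>
    obtain ⟨e, f, h⟩ := ih (by omega)
    let L : V →ₗ[ℝ] (Fin k → ℝ) × (Fin k → ℝ) :=
      (LinearMap.pi fun i => altBilin A (e i)).prod (LinearMap.pi fun i => altBilin A (f i))
    -- Orthogonality to the previous pairs is `2 k` linear conditions on a space of dimension at
    -- least `2 k + 2`.
    have hker : L.ker ≠ ⊥ := by
      apply LinearMap.ker_ne_bot_of_finrank_lt
      simp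
      omega
    obtain ⟨u, hu, hu0⟩ := Submodule.exists_mem_ne_zero_of_ne_bot hker
    have hLu : L u = 0 := hu
    have hue : ∀ i, A ![e i, u] = 0 := fun i => congrFun (congrArg Prod.fst hLu) i
    have huf : ∀ i, A ![f i, u] = 0 := fun i => congrFun (congrArg Prod.snd hLu) i
    obtain ⟨w, hw⟩ : ∃ w, A ![u, w] ≠ 0 := by
      by_contra! hcon
      exact hu0 (hA u hcon)
    -- make the partner orthogonal to the previous vectors
    let w' : V := w - ∑ i, A ![e i, w] • f i + ∑ i, A ![f i, w] • e i
    have hAw : ∀ a, A ![a, w'] = A ![a, w] - ∑ i, A ![e i, w] * A ![a, f i]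
        + ∑ i, A ![f i, w] * A ![a, e i] := by
      intro a
      change altBilin A a w' = _
      simp [w', map_add, map_sub, map_sum]
    have hfe : ∀ i j, A ![f i, e j] = if i = j then -1 else 0 := by
      intro i j
      rw [alt_swap, h.ef]
      split_ifs <;> simp_all
    have hw'e : ∀ i, A ![e i, w'] = 0 := by
      intro i
      rw [hAw]
      simp [h.ee, h.ef]
    have hw'f : ∀ i, A ![f i, w'] = 0 := by
      intro i
      rw [hAw]
      simp [h.ff, hfe]
    have hw'u : A ![u, w'] = A ![u, w] := by
      rw [hAw]
      simp [alt_swap A (f _) u, alt_swap A (e _) u, hue, huf]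
    let g : V := (A ![u, w])⁻¹ • w'
    have hug : A ![u, g] = 1 := by
      rw [alt_smul_right, hw'u, inv_mul_cancel₀ hw]
    refine ⟨Fin.snoc e u, Fin.snoc f g, ⟨?_, ?_, ?_⟩⟩
    · intro i j
      refine Fin.lastCases ?_ (fun i => ?_) i <;> refine Fin.lastCases ?_ (fun j => ?_) j
      · simp [alt_self]
      · simp [alt_swap A (e _) u, hue]
      · simp [hue]
      · simp [h.ee]
    · intro i j
      refine Fin.lastCases ?_ (fun i => ?_) i <;> refine Fin.lastCases ?_ (fun j => ?_) j
      · simp [alt_self]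
      · simp [g, alt_smul_left, alt_swap A (f _) w', hw'f]
      · simp [g, alt_smul_right, hw'f]
      · simp [h.ff]
    · intro i j
      refine Fin.lastCases ?_ (fun i => ?_) i <;> refine Fin.lastCases ?_ (fun j => ?_) j
      · simp [hug]
      · simp [alt_swap A (f _) u, huf, Fin.ext_iff]; omega
      · simp [g, alt_smul_right, hw'e, Fin.ext_iff]; omega
      · simp [h.ef]

/-- The signed product over pairs, for a permutation of `Fin n × Fin 2`: it is `0` or `1` in a
Darboux basis. -/
theorem sign_mul_prod_darboux {n : ℕ} (u : Fin n × Fin 2 → Fin n × Fin 2 → ℝ)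
    (hu : ∀ x y, u x y = if x.1 = y.1 then (if x.2 = y.2 then 0 else if x.2 = 0 then 1 else -1)
      else 0)
    (σ : Equiv.Perm (Fin n × Fin 2)) :
    ((Equiv.Perm.sign σ : ℤ) : ℝ) * ∏ i, u (σ (i, 0)) (σ (i, 1)) = 0 ∨
    ((Equiv.Perm.sign σ : ℤ) : ℝ) * ∏ i, u (σ (i, 0)) (σ (i, 1)) = 1 := by
  by_cases h0 : ∏ i, u (σ (i, 0)) (σ (i, 1)) = 0
  · exact Or.inl (by rw [h0, mul_zero])
  right
  rw [Finset.prod_eq_zero_iff] at h0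
  push Not at h0
  have hpair : ∀ i, (σ (i, 0)).1 = (σ (i, 1)).1 := by
    intro i
    by_contra hne
    exact h0 i (Finset.mem_univ i) (by rw [hu, if_neg hne])
  have hdiff : ∀ i, (σ (i, 0)).2 ≠ (σ (i, 1)).2 := by
    intro i he
    have := σ.injective (Prod.ext (hpair i) he)
    simp at this
  have hfst : ∀ i b, (σ (i, b)).1 = (σ (i, 0)).1 := by
    intro i b
    fin_cases b
    · rfl
    · exact (hpair i).symm
  have hsurj : ∀ i c, ∃ b, σ (i, b) = ((σ (i, 0)).1, c) := by
    intro i c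
    by_cases hc : (σ (i, 0)).2 = c
    · exact ⟨0, by rw [← hc]⟩
    · refine ⟨1, Prod.ext (hpair i).symm ?_⟩
      change (σ (i, 1)).2 = c
      have := hdiff i
      revert this hc
      generalize (σ (i, 0)).2 = x
      generalize (σ (i, 1)).2 = y
      revert x y c
      decide
  have hinj : Function.Injective fun i => (σ (i, 0)).1 := by
    intro i j hij
    obtain ⟨b, hb⟩ := hsurj i (σ (j, 0)).2
    have hij' : (σ (i, 0)).1 = (σ (j, 0)).1 := hij
    rw [hij'] at hb
    exact congrArg Prod.fst (σ.injective hb)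
  -- A nonzero product forces `σ` to send pairs to pairs: `π` records where each pair goes, and `s
  -- i` records whether its two members are exchanged.
  let π : Equiv.Perm (Fin n) := Equiv.ofBijective _ (Finite.injective_iff_bijective.1 hinj)
  let s : Fin n → Equiv.Perm (Fin 2) := fun i =>
    if (σ (i, 0)).2 = 0 then 1 else Equiv.swap 0 1
  have hs : ∀ i b, s i b = (σ (i, b)).2 := by
    intro i b
    have := hdiff i
    simp only [s]
    fin_cases b <;> revert this <;> dsimp only [Fin.zero_eta, Fin.mk_one] <;>
      generalize (σ (i, 0)).2 = x <;> generalize (σ (i, 1)).2 = y <;> revert x y <;> decide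
  have hσ : σ = Equiv.prodCongrLeft (fun _ : Fin 2 => π) * Equiv.prodCongrRight s := by
    ext1 ⟨i, b⟩
    rw [Equiv.Perm.mul_apply, Equiv.prodCongrRight_apply, Equiv.prodCongrLeft_apply]
    exact Prod.ext (hfst i b) (hs i b).symm
  -- The permutation `π` of the pairs acts once on each of the two members, so its sign enters
  -- squared and only the exchanges within pairs contribute.
  have hsign : Equiv.Perm.sign σ = ∏ i, Equiv.Perm.sign (s i) := by
    conv_lhs => rw [hσ]
    rw [Equiv.Perm.sign_mul, Equiv.Perm.sign_prodCongrLeft, Equiv.Perm.sign_prodCongrRight]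
    simp
  have hval : ∀ i, u (σ (i, 0)) (σ (i, 1)) = ((Equiv.Perm.sign (s i) : ℤ) : ℝ) := by
    intro i
    rw [hu, if_pos (hpair i), if_neg (hdiff i)]
    simp only [s]
    split_ifs <;> simp
  rw [hsign, Finset.prod_congr rfl fun i _ => hval i, Units.coe_prod, Int.cast_prod,
    ← Finset.prod_mul_distrib]
  refine Finset.prod_eq_one fun i _ => ?_
  rcases Int.units_eq_one_or (Equiv.Perm.sign (s i)) with h | h <;> simp [h]

/-- In the sum over permutations every term is `0` or `1`, since a sign lost by exchanging the
members of a pair is regained from antisymmetry of `A`. There is no cancellation, and the identity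
contributes `1`. -/
theorem liouvilleAlt_darboux_ne_zero (A : V [⋀^Fin 2]→L[ℝ] ℝ) {n : ℕ} {e f : Fin n → V}
    (h : IsDarboux A e f) : ∃ v : Fin (2 * n) → V, liouvilleAlt A n v ≠ 0 := by
  let E : Fin n × Fin 2 ≃ Fin (2 * n) := finProdFinEquiv.trans (finCongr (mul_comm n 2))
  have hE0 : ∀ i : Fin n, E (i, 0) = ⟨2 * i, by omega⟩ := fun i => Fin.ext (by simp [E])
  have hE1 : ∀ i : Fin n, E (i, 1) = ⟨2 * i + 1, by omega⟩ := fun i =>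
    Fin.ext (by simp [E]; omega)
  let w : Fin n × Fin 2 → V := fun x => if x.2 = 0 then e x.1 else f x.1
  let u : Fin n × Fin 2 → Fin n × Fin 2 → ℝ := fun x y => A ![w x, w y]
  have hfe : ∀ i j, A ![f i, e j] = if i = j then -1 else 0 := by
    intro i j
    rw [alt_swap, h.ef]
    split_ifs <;> simp_all
  have hu : ∀ x y, u x y = if x.1 = y.1 then
      (if x.2 = y.2 then 0 else if x.2 = 0 then 1 else -1) else 0 := by
    rintro ⟨i, a⟩ ⟨j, b⟩
    fin_cases a <;> fin_cases b <;> simp [u, w, h.ee, h.ff, h.ef, hfe]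
  refine ⟨w ∘ E.symm, ?_⟩
  rw [liouvilleAlt_apply]
  refine mul_ne_zero (by positivity) (ne_of_gt ?_)
  have hterm : ∀ τ : Equiv.Perm (Fin (2 * n)), ((Equiv.Perm.sign τ : ℤ) : ℝ) *
      ∏ i : Fin n, A ![(w ∘ E.symm) (τ ⟨2 * i, by omega⟩), (w ∘ E.symm) (τ ⟨2 * i + 1, by omega⟩)]
      = ((Equiv.Perm.sign (E.symm.permCongr τ) : ℤ) : ℝ) *
        ∏ i, u (E.symm.permCongr τ (i, 0)) (E.symm.permCongr τ (i, 1)) := by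
    intro τ
    rw [Equiv.Perm.sign_permCongr]
    simp [u, Equiv.permCongr_apply, hE0, hE1]
  refine Finset.sum_pos' (fun τ _ => ?_) ⟨1, Finset.mem_univ _, ?_⟩
  · rw [hterm]
    rcases sign_mul_prod_darboux u hu (E.symm.permCongr τ) with h | h <;> rw [h]
    exact zero_le_one
  · rw [hterm]
    simp [Equiv.permCongr_apply, hu]

/-- A form of top degree that is nonzero on one family of vectors is nonzero on every basis, and a
Darboux basis provides such a family. -/
theorem liouvilleAlt_ne_zero [FiniteDimensional ℝ V] (A : V [⋀^Fin 2]→L[ℝ] ℝ)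
    (hA : ∀ u : V, (∀ v : V, A ![u, v] = 0) → u = 0) {n : ℕ} (hn : Module.finrank ℝ V = 2 * n)
    {v : Fin (2 * n) → V} (hv : LinearIndependent ℝ v) : liouvilleAlt A n v ≠ 0 := by
  obtain ⟨e, f, h⟩ := exists_isDarboux A hA n hn.ge
  obtain ⟨w, hw⟩ := liouvilleAlt_darboux_ne_zero A h
  rcases Nat.eq_zero_or_pos n with rfl | hpos
  · rwa [show v = w from funext fun i => absurd i.2 (by simp)]
  have : Nonempty (Fin (2 * n)) := ⟨⟨0, by omega⟩⟩
  have hb := (liouvilleAlt A n).map_basis_ne_zero_iff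
    (basisOfLinearIndependentOfCardEqFinrank hv (by simp [hn]))
  rw [coe_basisOfLinearIndependentOfCardEqFinrank] at hb
  rw [hb]
  intro h0
  exact hw (by rw [h0]; rfl)

theorem append_update_castAdd {p m : ℕ} {α : Type*} (w : Fin p → α) (v : Fin m → α) (i : Fin p)
    (x : α) : Fin.append (Function.update w i x) v =
      Function.update (Fin.append w v) (Fin.castAdd m i) x := by
  funext j
  refine Fin.addCases (fun j => ?_) (fun j => ?_) j
  · rw [Fin.append_left]
    rcases eq_or_ne j i with rfl | hj
    · rw [Function.update_self, Function.update_self]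
    · rw [Function.update_of_ne hj, Function.update_of_ne
        (fun h => hj (Fin.castAdd_injective _ _ h)), Fin.append_left]
  · rw [Fin.append_right, Function.update_of_ne
      (by simp [Fin.ext_iff]; omega), Fin.append_right]

/-- Fixing the last `m` arguments of an alternating map of `p + m` arguments. -/
def fixRight {V : Type*} [AddCommGroup V] [Module ℝ V] {p m : ℕ}
    (g : V [⋀^Fin (p + m)]→ₗ[ℝ] ℝ) (v : Fin m → V) : V [⋀^Fin p]→ₗ[ℝ] ℝ where
  toFun w := g (Fin.append w v)
  map_update_add' := by
    intro inst w i x y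
    obtain rfl := Subsingleton.elim inst (instDecidableEqFin _)
    rw [append_update_castAdd, append_update_castAdd, append_update_castAdd, g.map_update_add]
  map_update_smul' := by
    intro inst w i c x
    obtain rfl := Subsingleton.elim inst (instDecidableEqFin _)
    rw [append_update_castAdd, append_update_castAdd, g.map_update_smul]
  map_eq_zero_of_eq' := by
    intro w i j hij hne
    refine g.map_eq_zero_of_eq _ (i := Fin.castAdd m i) (j := Fin.castAdd m j) ?_
      fun h => hne (Fin.castAdd_injective _ _ h)
    rw [Fin.append_left, Fin.append_left, hij]

@[simp] theorem fixRight_apply {V : Type*} [AddCommGroup V] [Module ℝ V] {p m : ℕ}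
    (g : V [⋀^Fin (p + m)]→ₗ[ℝ] ℝ) (v : Fin m → V) (w : Fin p → V) :
    fixRight g v w = g (Fin.append w v) := rfl

/-! ### Top-degree forms relative to the common kernel of independent functionals. -/

section Restrict

variable {V : Type*} [AddCommGroup V] [Module ℝ V] [FiniteDimensional ℝ V] {p m : ℕ}

theorem finrank_iInf_ker {ℓ : Fin p → V →ₗ[ℝ] ℝ} {e : Fin p → V}
    (he : ∀ α β, ℓ α (e β) = if α = β then 1 else 0) (hV : Module.finrank ℝ V = p + m) :
    Module.finrank ℝ (LinearMap.pi ℓ).ker = m := by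
  have hsurj : Function.Surjective (LinearMap.pi ℓ) := by
    intro c
    refine ⟨∑ β, c β • e β, ?_⟩
    funext α
    simp [he]
  have h1 := LinearMap.finrank_range_add_finrank_ker (LinearMap.pi ℓ)
  rw [LinearMap.range_eq_top.2 hsurj, finrank_top, Module.finrank_fin_fun, hV] at h1
  omega

/-- A form of top degree, with `m` arguments in the common kernel of `p` independent functionals,
depends on the other arguments only through these functionals. -/
theorem alternating_append_eq_det {ℓ : Fin p → V →ₗ[ℝ] ℝ} {e : Fin p → V}
    (he : ∀ α β, ℓ α (e β) = if α = β then 1 else 0) (hV : Module.finrank ℝ V = p + m)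
    (g : V [⋀^Fin (p + m)]→ₗ[ℝ] ℝ) {v : Fin m → V} (hv : ∀ i α, ℓ α (v i) = 0)
    (w : Fin p → V) :
    g (Fin.append w v) = (Matrix.of fun α β => ℓ α (w β)).det * g (Fin.append e v) := by
  -- If some `w i` lies in the common kernel, it gives together with `v` a family of `m + 1` vectors
  -- in a space of dimension `m`, so the arguments are dependent.
  have hzero : ∀ w : Fin p → V, ∀ i, (∀ α, ℓ α (w i) = 0) → fixRight g v w = 0 := by
    intro w i hi
    refine g.map_linearDependent _ fun hli => ?_
    let ι : Option (Fin m) → Fin (p + m) := fun o => o.elim (Fin.castAdd m i) (Fin.natAdd p)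
    have hι : Function.Injective ι := by
      intro a b hab
      rcases a with _ | a <;> rcases b with _ | b <;> simp [ι, Fin.ext_iff] at hab ⊢ <;> omega
    have h1 := hli.comp ι hι
    have hmem : ∀ o, (Fin.append w v ∘ ι) o ∈ (LinearMap.pi ℓ).ker := by
      intro o
      rw [LinearMap.mem_ker]
      funext α
      rcases o with _ | a
      · simpa [ι] using hi α
      · simpa [ι] using hv a α
    have h2 : LinearIndependent ℝ (fun o => (⟨_, hmem o⟩ : (LinearMap.pi ℓ).ker)) :=
      LinearIndependent.of_comp (LinearMap.pi ℓ).ker.subtype h1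
    have h3 := h2.fintype_card_le_finrank
    rw [finrank_iInf_ker he hV] at h3
    simp at h3
  let P : (Fin p → ℝ) →ₗ[ℝ] V := Fintype.linearCombination ℝ e
  have hP : ∀ c, P c = ∑ β, c β • e β := fun c => rfl
  -- Each `w β` differs from its projection to the span of `e` by a kernel vector. In the
  -- multilinear expansion all terms but one contain such a vector and vanish.
  have hproj : fixRight g v w = fixRight g v fun β => P fun α => ℓ α (w β) := by
    have hsum : w = (fun β => P fun α => ℓ α (w β)) + fun β => w β - P fun α => ℓ α (w β) := by
      funext β; simp
    conv_lhs => rw [hsum]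
    refine ((fixRight g v).toMultilinearMap.map_add_univ _ _).trans ?_
    rw [Finset.sum_eq_single Finset.univ]
    · rw [Finset.piecewise_univ]; rfl
    · intro s _ hs
      obtain ⟨i, hi⟩ : ∃ i, i ∉ s := by
        by_contra! h
        exact hs (Finset.eq_univ_of_forall h)
      refine hzero _ i fun α => ?_
      rw [Finset.piecewise_eq_of_notMem _ _ _ hi]
      simp [hP, he]
    · simp
  rw [← fixRight_apply, hproj]
  have hdet := AlternatingMap.eq_smul_basis_det (Pi.basisFun ℝ (Fin p))
    ((fixRight g v).compLinearMap P)
  have := congrArg (fun F => F fun β α => ℓ α (w β)) hdet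
  simp only [AlternatingMap.compLinearMap_apply, AlternatingMap.smul_apply,
    Pi.basisFun_det_apply, smul_eq_mul] at this
  have hPe : (fun i => P (Pi.basisFun ℝ (Fin p) i)) = e := by
    funext i; simp [P]
  rw [this, hPe, fixRight_apply, ← Matrix.det_transpose, mul_comm]
  rfl

end Restrict

end LinearAlgebra

end InvariantRelations

end

noncomputable section

namespace InvariantRelations

open Set Filter Topology

/-! ### Derivatives of maps between manifolds as linear maps of the model spaces. -/

section TangentMaps

variable {E : Type*} [NormedAddCommGroup E] [NormedSpace ℝ E]
  {M : Type*} [TopologicalSpace M] [ChartedSpace E M]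
  {E' : Type*} [NormedAddCommGroup E'] [NormedSpace ℝ E']
  {N : Type*} [TopologicalSpace N] [ChartedSpace E' N]
  {E'' : Type*} [NormedAddCommGroup E''] [NormedSpace ℝ E'']
  {P : Type*} [TopologicalSpace P] [ChartedSpace E'' P]

variable (E E') in
/-- The derivative of a map between manifolds, as a linear map between the model spaces. -/
def tmap (f : M → N) (x : M) : E →L[ℝ] E' := mfderiv 𝓘(ℝ, E) 𝓘(ℝ, E') f x

theorem tmap_comp {g : N → P} {f : M → N} {x : M}
    (hg : MDifferentiableAt 𝓘(ℝ, E') 𝓘(ℝ, E'') g (f x))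
    (hf : MDifferentiableAt 𝓘(ℝ, E) 𝓘(ℝ, E') f x) :
    tmap E E'' (g ∘ f) x = (tmap E' E'' g (f x)).comp (tmap E E' f x) :=
  mfderiv_comp x hg hf

theorem tmap_comp_apply {g : N → P} {f : M → N} {x : M}
    (hg : MDifferentiableAt 𝓘(ℝ, E') 𝓘(ℝ, E'') g (f x))
    (hf : MDifferentiableAt 𝓘(ℝ, E) 𝓘(ℝ, E') f x) (v : E) :
    tmap E E'' (fun y => g (f y)) x v = tmap E' E'' g (f x) (tmap E E' f x v) :=
  congrArg (fun L : E →L[ℝ] E'' => L v) (tmap_comp hg hf)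

theorem tmap_congr {f g : M → N} {x : M} (h : f =ᶠ[𝓝 x] g) :
    tmap E E' f x = tmap E E' g x := by
  have h0 := h.self_of_nhds
  have := h.mfderiv_eq (I := 𝓘(ℝ, E)) (I' := 𝓘(ℝ, E'))
  exact this

theorem tmap_id (x : M) : tmap E E (fun y : M => y) x = ContinuousLinearMap.id ℝ E :=
  mfderiv_id

theorem tmap_const (c : N) (x : M) : tmap E E' (fun _ : M => c) x = 0 :=
  mfderiv_const

theorem tmap_eq_fderiv (f : E → E') (x : E) : tmap E E' f x = fderiv ℝ f x :=
  mfderiv_eq_fderiv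

theorem _root_.HasMFDerivAt.tmap_eq {f : M → N} {x : M} {L : E →L[ℝ] E'}
    (h : HasMFDerivAt 𝓘(ℝ, E) 𝓘(ℝ, E') f x L) : tmap E E' f x = L :=
  h.mfderiv

variable [IsManifold 𝓘(ℝ, E) ∞ M]

/-! ### Preferred charts and coordinate expressions of vector fields. -/

section Charts

variable {x₀ : M}

theorem mdifferentiableAt_chart {x : M} (hx : x ∈ (extChartAt 𝓘(ℝ, E) x₀).source) :
    MDifferentiableAt 𝓘(ℝ, E) 𝓘(ℝ, E) (extChartAt 𝓘(ℝ, E) x₀) x := by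
  have : IsManifold 𝓘(ℝ, E) 1 M := IsManifold.of_le (n := ∞) (by simp)
  exact mdifferentiableAt_extChartAt (by rwa [extChartAt_source] at hx)

theorem contMDiffAt_chart_symm {y : E} (hy : y ∈ (extChartAt 𝓘(ℝ, E) x₀).target) :
    ContMDiffAt 𝓘(ℝ, E) 𝓘(ℝ, E) ∞ (extChartAt 𝓘(ℝ, E) x₀).symm y :=
  (contMDiffOn_extChartAt_symm x₀).contMDiffAt ((isOpen_extChartAt_target x₀).mem_nhds hy)

theorem contMDiffAt_chart {x : M} (hx : x ∈ (extChartAt 𝓘(ℝ, E) x₀).source) :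
    ContMDiffAt 𝓘(ℝ, E) 𝓘(ℝ, E) ∞ (extChartAt 𝓘(ℝ, E) x₀) x :=
  contMDiffAt_extChartAt' (by rwa [extChartAt_source] at hx)

theorem mdifferentiableAt_chart_symm {y : E} (hy : y ∈ (extChartAt 𝓘(ℝ, E) x₀).target) :
    MDifferentiableAt 𝓘(ℝ, E) 𝓘(ℝ, E) (extChartAt 𝓘(ℝ, E) x₀).symm y :=
  (contMDiffAt_chart_symm hy).mdifferentiableAt (by simp)

theorem tmap_chart_tmap_symm {y : E} (hy : y ∈ (extChartAt 𝓘(ℝ, E) x₀).target) (v : E) :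
    tmap E E (extChartAt 𝓘(ℝ, E) x₀) ((extChartAt 𝓘(ℝ, E) x₀).symm y)
      (tmap E E (extChartAt 𝓘(ℝ, E) x₀).symm y v) = v := by
  rw [← tmap_comp_apply (mdifferentiableAt_chart ((extChartAt 𝓘(ℝ, E) x₀).map_target hy))
    (mdifferentiableAt_chart_symm hy)]
  have : (fun z => extChartAt 𝓘(ℝ, E) x₀ ((extChartAt 𝓘(ℝ, E) x₀).symm z)) =ᶠ[𝓝 y] fun z => z := by
    filter_upwards [(isOpen_extChartAt_target x₀).mem_nhds hy] with z hz
    exact (extChartAt 𝓘(ℝ, E) x₀).right_inv hz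
  rw [tmap_congr this, tmap_id]
  rfl

theorem tmap_symm_tmap_chart {x : M} (hx : x ∈ (extChartAt 𝓘(ℝ, E) x₀).source) (v : E) :
    tmap E E (extChartAt 𝓘(ℝ, E) x₀).symm (extChartAt 𝓘(ℝ, E) x₀ x)
      (tmap E E (extChartAt 𝓘(ℝ, E) x₀) x v) = v := by
  rw [← tmap_comp_apply (mdifferentiableAt_chart_symm ((extChartAt 𝓘(ℝ, E) x₀).map_source hx))
    (mdifferentiableAt_chart hx)]
  have : (fun z => (extChartAt 𝓘(ℝ, E) x₀).symm (extChartAt 𝓘(ℝ, E) x₀ z)) =ᶠ[𝓝 x] fun z => z := by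
    filter_upwards [(isOpen_extChartAt_source x₀).mem_nhds hx] with z hz
    exact (extChartAt 𝓘(ℝ, E) x₀).left_inv hz
  rw [tmap_congr this, tmap_id]
  rfl

/-- The coordinate expression of a vector field in the preferred chart at `x₀`. -/
def chartField (X : M → E) (x₀ : M) (y : E) : E :=
  tmap E E (extChartAt 𝓘(ℝ, E) x₀) ((extChartAt 𝓘(ℝ, E) x₀).symm y)
    (X ((extChartAt 𝓘(ℝ, E) x₀).symm y))

theorem tmap_symm_chartField (X : M → E) {y : E} (hy : y ∈ (extChartAt 𝓘(ℝ, E) x₀).target) :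
    tmap E E (extChartAt 𝓘(ℝ, E) x₀).symm y (chartField X x₀ y) =
      X ((extChartAt 𝓘(ℝ, E) x₀).symm y) := by
  have := tmap_symm_tmap_chart (x₀ := x₀) ((extChartAt 𝓘(ℝ, E) x₀).map_target hy)
    (X ((extChartAt 𝓘(ℝ, E) x₀).symm y))
  rwa [(extChartAt 𝓘(ℝ, E) x₀).right_inv hy] at this

theorem contDiffOn_comp_chart_symm {f : M → E'} (hf : ContMDiff 𝓘(ℝ, E) 𝓘(ℝ, E') ∞ f) (x₀ : M) :
    ContDiffOn ℝ ∞ (f ∘ (extChartAt 𝓘(ℝ, E) x₀).symm) (extChartAt 𝓘(ℝ, E) x₀).target :=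
  contMDiffOn_iff_contDiffOn.1 (hf.comp_contMDiffOn (contMDiffOn_extChartAt_symm x₀))

theorem fderiv_comp_chart_symm {f : M → E'} {y : E}
    (hy : y ∈ (extChartAt 𝓘(ℝ, E) x₀).target)
    (hf : MDifferentiableAt 𝓘(ℝ, E) 𝓘(ℝ, E') f ((extChartAt 𝓘(ℝ, E) x₀).symm y)) (v : E) :
    fderiv ℝ (f ∘ (extChartAt 𝓘(ℝ, E) x₀).symm) y v =
      tmap E E' f ((extChartAt 𝓘(ℝ, E) x₀).symm y)
        (tmap E E (extChartAt 𝓘(ℝ, E) x₀).symm y v) := by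
  rw [← tmap_eq_fderiv, tmap_comp hf (mdifferentiableAt_chart_symm hy)]
  rfl

/-- A curve in the domain of a chart is an integral curve of a vector field if and only if its
coordinate expression is. -/
theorem hasDerivWithinAt_chart_comp {X : M → E} {γ : ℝ → M} {J : Set ℝ} {t : ℝ}
    (h : HasMFDerivWithinAt 𝓘(ℝ, ℝ) 𝓘(ℝ, E) γ J t ((1 : ℝ →L[ℝ] ℝ).smulRight (X (γ t)) : ℝ →L[ℝ] E))
    (hx : γ t ∈ (extChartAt 𝓘(ℝ, E) x₀).source) :
    HasDerivWithinAt (extChartAt 𝓘(ℝ, E) x₀ ∘ γ)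
      (chartField X x₀ (extChartAt 𝓘(ℝ, E) x₀ (γ t))) J t := by
  have h1 := (mdifferentiableAt_chart (x₀ := x₀) hx).hasMFDerivAt.comp_hasMFDerivWithinAt t h
  have h2 : HasFDerivWithinAt (extChartAt 𝓘(ℝ, E) x₀ ∘ γ)
      ((tmap E E (extChartAt 𝓘(ℝ, E) x₀) (γ t)).comp
        ((1 : ℝ →L[ℝ] ℝ).smulRight (X (γ t)))) J t :=
    hasMFDerivWithinAt_iff_hasFDerivWithinAt.1 h1
  have h3 := h2.hasDerivWithinAt
  rw [chartField, (extChartAt 𝓘(ℝ, E) x₀).left_inv hx]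
  simpa using h3

theorem hasMFDerivAt_chart_symm_comp {X : M → E} {c : ℝ → E} {t : ℝ}
    (hc : HasDerivAt c (chartField X x₀ (c t)) t)
    (hy : c t ∈ (extChartAt 𝓘(ℝ, E) x₀).target) :
    HasMFDerivAt 𝓘(ℝ, ℝ) 𝓘(ℝ, E) ((extChartAt 𝓘(ℝ, E) x₀).symm ∘ c) t
      ((1 : ℝ →L[ℝ] ℝ).smulRight (X ((extChartAt 𝓘(ℝ, E) x₀).symm (c t))) : ℝ →L[ℝ] E) := by
  have h1 : HasMFDerivAt 𝓘(ℝ, ℝ) 𝓘(ℝ, E) ((extChartAt 𝓘(ℝ, E) x₀).symm ∘ c) t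
      ((tmap E E (extChartAt 𝓘(ℝ, E) x₀).symm (c t)).comp
        (ContinuousLinearMap.toSpanSingleton ℝ (chartField X x₀ (c t)))) :=
    (mdifferentiableAt_chart_symm hy).hasMFDerivAt.comp t hc.hasFDerivAt.hasMFDerivAt
  have h2 : (tmap E E (extChartAt 𝓘(ℝ, E) x₀).symm (c t)).comp
      (ContinuousLinearMap.toSpanSingleton ℝ (chartField X x₀ (c t))) =
      (1 : ℝ →L[ℝ] ℝ).smulRight (X ((extChartAt 𝓘(ℝ, E) x₀).symm (c t))) := by
    ext
    simpa using tmap_symm_chartField X hy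
  exact h1.congr_mfderiv h2

end Charts

/-! ### Integral curves and local flows on a manifold. -/

section Flow

variable {X : M → E}

/-- A vector field with `C²` coordinate expressions. -/
def IsC2Field (X : M → E) : Prop :=
  ∀ x₀ : M, ContDiffOn ℝ 2 (chartField X x₀) (extChartAt 𝓘(ℝ, E) x₀).target

/-- Uniqueness for the coordinate equation makes the set of times of agreement open; it is closed
because `M` is Hausdorff, and the interval is connected. -/
theorem eqOn_of_isMIntegralCurveOn [T2Space M] (hX : IsC2Field X) {J : Set ℝ} (hJ : J.OrdConnected)
    {γ γ' : ℝ → M} (h : IsMIntegralCurveOn (I := 𝓘(ℝ, E)) γ X J)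
    (h' : IsMIntegralCurveOn (I := 𝓘(ℝ, E)) γ' X J)
    {t₀ : ℝ} (ht₀ : t₀ ∈ J) (h₀ : γ t₀ = γ' t₀) : EqOn γ γ' J := by
  have hc : ContinuousOn γ J := fun t ht => (h t ht).1
  have hc' : ContinuousOn γ' J := fun t ht => (h' t ht).1
  refine eqOn_of_locally_eq hJ.isPreconnected hc hc' ht₀ h₀ fun s hs hss => ?_
  have hsrc : (extChartAt 𝓘(ℝ, E) (γ s)).source ∈ 𝓝 (γ s) := extChartAt_source_mem_nhds (γ s)
  have h1 : ∀ᶠ r in 𝓝[J] s, γ r ∈ (extChartAt 𝓘(ℝ, E) (γ s)).source := (hc s hs).eventually hsrc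
  have h2 : ∀ᶠ r in 𝓝[J] s, γ' r ∈ (extChartAt 𝓘(ℝ, E) (γ s)).source :=
    (hc' s hs).eventually (hss ▸ hsrc)
  have hv : ContDiffAt ℝ 1 (chartField X (γ s)) ((extChartAt 𝓘(ℝ, E) (γ s) ∘ γ) s) :=
    ((hX (γ s)).contDiffAt (extChartAt_target_mem_nhds (γ s))).of_le (by norm_num)
  have key := eventually_eq_of_hasDerivWithinAt (f := extChartAt 𝓘(ℝ, E) (γ s) ∘ γ)
    (g := extChartAt 𝓘(ℝ, E) (γ s) ∘ γ') hJ hs hv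
    (by filter_upwards [h1, self_mem_nhdsWithin] with r hr hrJ
        exact hasDerivWithinAt_chart_comp (h r hrJ) hr)
    (by filter_upwards [h2, self_mem_nhdsWithin] with r hr hrJ
        exact hasDerivWithinAt_chart_comp (h' r hrJ) hr)
    (by simp only [Function.comp_apply, hss])
  filter_upwards [key, h1, h2] with r hr hr1 hr2
  exact (extChartAt 𝓘(ℝ, E) (γ s)).injOn hr1 hr2 hr

theorem FlowsTo.unique [T2Space M] (hX : IsC2Field X) {t : ℝ} {x y y' : M}
    (h : FlowsTo (E := E) X t x y) (h' : FlowsTo (E := E) X t x y') : y = y' := by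
  obtain ⟨γ, h1, h2, h3⟩ := h
  obtain ⟨γ', h1', h2', h3'⟩ := h'
  rw [← h3, ← h3']
  exact eqOn_of_isMIntegralCurveOn hX ordConnected_uIcc h1 h1' left_mem_uIcc (h2.trans h2'.symm)
    right_mem_uIcc

theorem FlowsTo.refl (x : M) : FlowsTo (E := E) X 0 x x := by
  refine ⟨fun _ => x, ?_, rfl, rfl⟩
  intro t ht
  rw [uIcc_self, mem_singleton_iff] at ht
  subst ht
  rw [uIcc_self]
  refine ⟨continuousWithinAt_const, ?_⟩
  -- Within a one-point set every linear map is a derivative, so the constant curve solves the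
  -- equation on the degenerate interval.
  have h0 : ∀ (f : ℝ → E) (L : ℝ →L[ℝ] E), HasFDerivWithinAt f L {0} 0 := fun f L =>
    HasFDerivWithinAt.of_subsingleton subsingleton_singleton
  exact (h0 _ _).mono fun z hz => hz.1

theorem FlowsTo.symm {t : ℝ} {x y : M} (h : FlowsTo (E := E) X t x y) :
    FlowsTo (E := E) X (-t) y x := by
  obtain ⟨γ, h1, h2, h3⟩ := h
  refine ⟨γ ∘ (· + t), ?_, by simp [h3], by simp [h2]⟩
  refine (h1.comp_add t).mono ?_
  intro s hs
  rw [mem_uIcc] at hs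
  simp only [mem_ofPred_eq, mem_uIcc]
  rcases hs with hs | hs
  · right; constructor <;> linarith [hs.1, hs.2]
  · left; constructor <;> linarith [hs.1, hs.2]

theorem isMIntegralCurveOn_union {γ : ℝ → M} {A B : Set ℝ} (hA : IsClosed A) (hB : IsClosed B)
    (h : IsMIntegralCurveOn (I := 𝓘(ℝ, E)) γ X A) (h' : IsMIntegralCurveOn (I := 𝓘(ℝ, E)) γ X B) :
    IsMIntegralCurveOn (I := 𝓘(ℝ, E)) γ X (A ∪ B) := by
  intro t ht
  by_cases hta : t ∈ A <;> by_cases htb : t ∈ B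
  · exact (h t hta).union (h' t htb)
  · refine (h t hta).mono_of_mem_nhdsWithin ?_
    filter_upwards [self_mem_nhdsWithin, mem_nhdsWithin_of_mem_nhds (hB.isOpen_compl.mem_nhds htb)]
      with z hz hz'
    exact hz.resolve_right hz'
  · refine (h' t htb).mono_of_mem_nhdsWithin ?_
    filter_upwards [self_mem_nhdsWithin, mem_nhdsWithin_of_mem_nhds (hA.isOpen_compl.mem_nhds hta)]
      with z hz hz'
    exact hz.resolve_left hz'
  · exact absurd ht (by simp [hta, htb])

/-- The sign condition says that the two motions do not run in opposite time directions. The two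
time intervals then meet only at `s`, and the concatenated curve is defined without conflict. -/
theorem FlowsTo.trans {s r : ℝ} (hsr : 0 ≤ s * r) {x y z : M} (h : FlowsTo (E := E) X s x y)
    (h' : FlowsTo (E := E) X r y z) : FlowsTo (E := E) X (s + r) x z := by
  classical
  obtain ⟨γ, h1, h2, h3⟩ := h
  obtain ⟨γ', h1', h2', h3'⟩ := h'
  let c : ℝ → M := fun u => if u ∈ uIcc 0 s then γ u else γ' (u - s)
  have hcA : ∀ u ∈ uIcc 0 s, c u = γ u := fun u hu => if_pos hu
  have hcB : ∀ u ∈ uIcc s (s + r), c u = γ' (u - s) := by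
    intro u hu
    by_cases hA : u ∈ uIcc 0 s
    · rw [hcA u hA]
      have hus : u = s := by
        rw [mem_uIcc] at hu hA
        rcases hu with hu | hu <;> rcases hA with hA | hA
        · linarith [hu.1, hA.2]
        · rcases eq_or_lt_of_le hu.1 with e | e
          · exact e.symm
          · nlinarith [hu.1, hu.2, hA.1, hA.2]
        · rcases eq_or_lt_of_le hu.2 with e | e
          · exact e
          · nlinarith [hu.1, hu.2, hA.1, hA.2]
        · linarith [hu.2, hA.1]
      rw [hus, h3, sub_self, h2']
    · exact if_neg hA
  have hsB : s ∈ uIcc s (s + r) := left_mem_uIcc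
  have hA : IsMIntegralCurveOn (I := 𝓘(ℝ, E)) c X (uIcc 0 s) := by
    intro t ht
    have := (h1 t ht).congr_of_eventuallyEq (f₁ := c)
      (by filter_upwards [self_mem_nhdsWithin] with u hu using hcA u hu) (hcA t ht)
    rw [← hcA t ht] at this
    exact this
  have hB : IsMIntegralCurveOn (I := 𝓘(ℝ, E)) c X (uIcc s (s + r)) := by
    intro t ht
    have hsub : uIcc s (s + r) ⊆ {t | t + -s ∈ uIcc 0 r} := by
      intro u hu
      rw [mem_uIcc] at hu
      simp only [mem_ofPred_eq, mem_uIcc]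
      rcases hu with hu | hu
      · left; constructor <;> linarith [hu.1, hu.2]
      · right; constructor <;> linarith [hu.1, hu.2]
    have h4 := ((h1'.comp_add (-s)).mono hsub) t ht
    have := h4.congr_of_eventuallyEq (f₁ := c)
      (by filter_upwards [self_mem_nhdsWithin] with u hu
          exact hcB u hu) (hcB t ht)
    have h5 : (γ' ∘ fun x => x + -s) t = c t := (hcB t ht).symm
    rw [h5] at this
    exact this
  refine ⟨c, (isMIntegralCurveOn_union isClosed_Icc isClosed_Icc hA hB).mono ?_, ?_, ?_⟩
  · intro u hu
    by_contra hcon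
    rw [mem_union, not_or] at hcon
    obtain ⟨hc1, hc2⟩ : u ∉ uIcc 0 s ∧ u ∉ uIcc s (s + r) := hcon
    rw [mem_uIcc] at hu hc1 hc2
    push Not at hc1 hc2
    rcases hu with hu | hu
    · rcases le_total u s with e | e
      · exact absurd e (not_le.2 (hc1.1 hu.1))
      · exact absurd hu.2 (not_le.2 (hc2.1 e))
    · rcases le_total s u with e | e
      · exact absurd hu.2 (not_le.2 (hc1.2 e))
      · exact absurd e (not_le.2 (hc2.2 hu.1))
  · rw [hcA 0 left_mem_uIcc, h2]
  · rw [hcB (s + r) right_mem_uIcc, add_sub_cancel_left, h3']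

/-- Data of a local flow near a point, for times in `(-ε, ε)`, with a property of its
derivatives. -/
def HasLocalFlow (X : M → E) (R : M → M → (E →L[ℝ] E) → Prop) (x₀ : M) (ε : ℝ) : Prop :=
  ∃ O : Set M, IsOpen O ∧ x₀ ∈ O ∧ ∃ θ : ℝ → M → M, ∀ x ∈ O, ∀ t ∈ Ioo (-ε) ε,
    FlowsTo (E := E) X t x (θ t x) ∧ MDifferentiableAt 𝓘(ℝ, E) 𝓘(ℝ, E) (θ t) x ∧
      R x (θ t x) (tmap E E (θ t) x)

/-- A Lebesgue number argument: the piece of the trajectory is compact, so a single `ε` serves at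
all of its points, and `N` is taken so large that one step is shorter than `ε`. -/
theorem FlowsTo.exists_steps {X : M → E} {t : ℝ} {x y : M} (h : FlowsTo (E := E) X t x y)
    {Q : M → ℝ → Prop} (hmono : ∀ z ε δ, Q z ε → δ ≤ ε → Q z δ)
    (hQ : ∀ z, ∃ ε > 0, ∀ᶠ w in 𝓝 z, Q w ε) :
    ∃ (N : ℕ) (c : ℕ → M), 0 < N ∧ c 0 = x ∧ c N = y ∧ ∃ ε > 0, |t / N| < ε ∧ ∀ i < N,
      Q (c i) ε ∧ FlowsTo (E := E) X (i * (t / N)) x (c i) := by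
  obtain ⟨γ, h1, h2, h3⟩ := h
  have hunif : ∃ δ > 0, ∀ s ∈ uIcc 0 t, Q (γ s) δ := by
    refine isCompact_uIcc.induction_on (p := fun S => ∃ δ > 0, ∀ s ∈ S, Q (γ s) δ)
      ⟨1, one_pos, by simp⟩ ?_ ?_ ?_
    · rintro S T hST ⟨δ, hδ, H⟩
      exact ⟨δ, hδ, fun s hs => H s (hST hs)⟩
    · rintro S T ⟨δ, hδ, H⟩ ⟨δ', hδ', H'⟩
      refine ⟨min δ δ', lt_min hδ hδ', ?_⟩
      rintro s (hs | hs)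
      · exact hmono _ _ _ (H s hs) (min_le_left _ _)
      · exact hmono _ _ _ (H' s hs) (min_le_right _ _)
    · intro s hs
      obtain ⟨ε, hε, hw⟩ := hQ (γ s)
      exact ⟨_, (h1 s hs).1.eventually hw, ε, hε, fun r hr => hr⟩
  obtain ⟨δ, hδ, H⟩ := hunif
  obtain ⟨N, hN⟩ := exists_nat_gt (|t| / δ)
  have hN0 : 0 < (N : ℝ) := lt_of_le_of_lt (by positivity) hN
  have hmem : ∀ i ≤ N, (i : ℝ) * (t / N) ∈ uIcc 0 t := by
    intro i hi
    have hi1 : (i : ℝ) / N ≤ 1 := by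
      rw [div_le_one hN0]; exact_mod_cast hi
    have hi0 : 0 ≤ (i : ℝ) / N := by positivity
    have he : (i : ℝ) * (t / N) = (i / N) * t := by ring
    rw [he, mem_uIcc]
    rcases le_total 0 t with h | h
    · left; constructor <;> nlinarith
    · right; constructor <;> nlinarith
  refine ⟨N, fun i => γ (i * (t / N)), by exact_mod_cast hN0, by simp [h2], ?_, δ, hδ, ?_,
    fun i hi => ⟨H _ (hmem i hi.le), γ, ?_, h2, rfl⟩⟩
  · simp only
    rw [mul_div_cancel₀ _ hN0.ne', h3]
  · rw [abs_div, abs_of_pos hN0, div_lt_comm₀ hN0 hδ]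
    exact hN
  · exact h1.mono (uIcc_subset_uIcc_left (hmem i hi.le))

/-- Near a point whose trajectory exists up to time `t`, the flow map of time `t` exists and is
differentiable. -/
theorem exists_flow_map [T2Space M] (hX : IsC2Field X)
    {R : M → M → (E →L[ℝ] E) → Prop} (hrefl : ∀ x, R x x (ContinuousLinearMap.id ℝ E))
    (htrans : ∀ x y z L L', R x y L → R y z L' → R x z (L'.comp L))
    (hloc : ∀ x₀, ∃ ε > 0, HasLocalFlow X R x₀ ε) {t : ℝ} {x y : M}
    (h : FlowsTo (E := E) X t x y) :
    ∃ U : Set M, IsOpen U ∧ x ∈ U ∧ ∃ θ : M → M, θ x = y ∧ ∀ x' ∈ U,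
      FlowsTo (E := E) X t x' (θ x') ∧ MDifferentiableAt 𝓘(ℝ, E) 𝓘(ℝ, E) θ x' ∧
        R x' (θ x') (tmap E E θ x') := by
  obtain ⟨N, c, hN, hc0, hcN, ε, hε, htN, H⟩ := h.exists_steps (Q := HasLocalFlow X R)
    (fun z ε δ ⟨O, hO, hz, θ, hθ⟩ hδ => ⟨O, hO, hz, θ, fun x hx t ht => hθ x hx t
      ⟨by linarith [ht.1], by linarith [ht.2]⟩⟩)
    (fun z => by
      obtain ⟨ε, hε, O, hO, hz, θ, hθ⟩ := hloc z
      refine ⟨ε, hε, ?_⟩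
      filter_upwards [hO.mem_nhds hz] with w hw
      exact ⟨O, hO, hw, θ, hθ⟩)
  -- The flow map for time `i t / N` is a composition of `i` short flow maps. Since `R` is
  -- transitive, a property of derivatives that holds for short times passes to the composition.
  have hstep : ∀ i ≤ N, ∃ U : Set M, IsOpen U ∧ x ∈ U ∧ ∃ θ : M → M, ∀ x' ∈ U,
      FlowsTo (E := E) X (i * (t / N)) x' (θ x') ∧ MDifferentiableAt 𝓘(ℝ, E) 𝓘(ℝ, E) θ x' ∧
        R x' (θ x') (tmap E E θ x') := by
    intro i
    induction i with
    | zero =>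
      intro _
      refine ⟨univ, isOpen_univ, mem_univ _, fun z => z, fun x' _ => ⟨?_, mdifferentiableAt_id, ?_⟩⟩
      · simpa using FlowsTo.refl x'
      · rw [tmap_id]; exact hrefl x'
    | succ i ih =>
      intro hi
      obtain ⟨U, hU, hxU, θ, hθ⟩ := ih (by omega)
      obtain ⟨⟨O, hO, hcO, θ', hθ'⟩, hflow⟩ := H i (by omega)
      have hxc : θ x = c i := (hθ x hxU).1.unique hX hflow
      have hcont : ContinuousOn θ U := fun z hz => (hθ z hz).2.1.continuousAt.continuousWithinAt
      have hr : t / N ∈ Ioo (-ε) ε := abs_lt.1 htN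
      refine ⟨U ∩ θ ⁻¹' O, hcont.isOpen_inter_preimage hU hO, ⟨hxU, by rwa [mem_preimage, hxc]⟩,
        fun z => θ' (t / N) (θ z), fun x' hx' => ⟨?_, ?_, ?_⟩⟩
      · have := (hθ x' hx'.1).1.trans (by
          rw [mul_assoc]; exact mul_nonneg (by positivity) (mul_self_nonneg _))
          (hθ' (θ x') hx'.2 _ hr).1
        convert this using 1
        push_cast; ring
      · exact (hθ' (θ x') hx'.2 _ hr).2.1.comp x' (hθ x' hx'.1).2.1
      · have h4 := tmap_comp (hθ' (θ x') hx'.2 _ hr).2.1 (hθ x' hx'.1).2.1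
        have h5 := htrans _ _ _ _ _ (hθ x' hx'.1).2.2 (hθ' (θ x') hx'.2 _ hr).2.2
        rw [← h4] at h5
        exact h5
  obtain ⟨U, hU, hxU, θ, hθ⟩ := hstep N le_rfl
  have hNt : (N : ℝ) * (t / N) = t := mul_div_cancel₀ _ (by positivity)
  rw [hNt] at hθ
  exact ⟨U, hU, hxU, θ, (hθ x hxU).1.unique hX h, hθ⟩

/-- The local flow in a chart. -/
theorem exists_local_flow_chart [CompleteSpace E] (hX : IsC2Field X) (x₀ : M) :
    ∃ ε > 0, ∃ B : Set E, IsOpen B ∧ extChartAt 𝓘(ℝ, E) x₀ x₀ ∈ B ∧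
      B ⊆ (extChartAt 𝓘(ℝ, E) x₀).target ∧
      ∃ (Θ : ℝ → E → E) (W : ℝ → E → E →L[ℝ] E), ∀ y ∈ B,
        Θ 0 y = y ∧ W 0 y = ContinuousLinearMap.id ℝ E ∧ ∀ t ∈ Ioo (-ε) ε,
          Θ t y ∈ (extChartAt 𝓘(ℝ, E) x₀).target ∧
          HasDerivAt (fun s => Θ s y) (chartField X x₀ (Θ t y)) t ∧
          HasDerivAt (fun s => W s y) ((fderiv ℝ (chartField X x₀) (Θ t y)).comp (W t y)) t ∧
          HasFDerivAt (Θ t) (W t y) y :=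
  exists_local_flow (isOpen_extChartAt_target x₀) (hX x₀) (mem_extChartAt_target x₀)

theorem flowsTo_of_chart {x₀ : M} {c : ℝ → E} {t : ℝ}
    (hc : ∀ s ∈ uIcc 0 t, c s ∈ (extChartAt 𝓘(ℝ, E) x₀).target ∧
      HasDerivAt c (chartField X x₀ (c s)) s) :
    FlowsTo (E := E) X t ((extChartAt 𝓘(ℝ, E) x₀).symm (c 0))
      ((extChartAt 𝓘(ℝ, E) x₀).symm (c t)) :=
  ⟨(extChartAt 𝓘(ℝ, E) x₀).symm ∘ c, fun s hs =>
    (hasMFDerivAt_chart_symm_comp (hc s hs).2 (hc s hs).1).hasMFDerivWithinAt, rfl, rfl⟩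

theorem uIcc_subset_Ioo_of_mem {ε t : ℝ} (ht : t ∈ Ioo (-ε) ε) : uIcc 0 t ⊆ Ioo (-ε) ε := by
  intro s hs
  rw [mem_uIcc] at hs
  rcases hs with h | h <;> constructor <;> linarith [h.1, h.2, ht.1, ht.2]

/-- A flow in a chart, as a flow on the manifold. -/
def chartFlow (x₀ : M) (Θ : ℝ → E → E) (t : ℝ) (x : M) : M :=
  (extChartAt 𝓘(ℝ, E) x₀).symm (Θ t (extChartAt 𝓘(ℝ, E) x₀ x))

/-- The derivative is tested on images of coordinate vectors only. These exhaust the tangent space,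
and in this form the derivative of the flow is conjugate to `W t` without inverting the chart
differential. -/
theorem chartFlow_spec {x₀ : M} {ε : ℝ} {B : Set E} (hBt : B ⊆ (extChartAt 𝓘(ℝ, E) x₀).target)
    {Θ : ℝ → E → E} {W : ℝ → E → E →L[ℝ] E}
    (hΘ : ∀ y ∈ B, Θ 0 y = y ∧ ∀ t ∈ Ioo (-ε) ε, Θ t y ∈ (extChartAt 𝓘(ℝ, E) x₀).target ∧
      HasDerivAt (fun s => Θ s y) (chartField X x₀ (Θ t y)) t ∧ HasFDerivAt (Θ t) (W t y) y)
    {x : M} (hx : x ∈ (extChartAt 𝓘(ℝ, E) x₀).source) (hxB : extChartAt 𝓘(ℝ, E) x₀ x ∈ B) {t : ℝ}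
    (ht : t ∈ Ioo (-ε) ε) :
    FlowsTo (E := E) X t x (chartFlow x₀ Θ t x) ∧
      MDifferentiableAt 𝓘(ℝ, E) 𝓘(ℝ, E) (chartFlow x₀ Θ t) x ∧
      ∀ a, tmap E E (chartFlow x₀ Θ t) x
          (tmap E E (extChartAt 𝓘(ℝ, E) x₀).symm (extChartAt 𝓘(ℝ, E) x₀ x) a) =
        tmap E E (extChartAt 𝓘(ℝ, E) x₀).symm (Θ t (extChartAt 𝓘(ℝ, E) x₀ x))
          (W t (extChartAt 𝓘(ℝ, E) x₀ x) a) := by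
  obtain ⟨hy0, hy⟩ := hΘ _ hxB
  obtain ⟨h1, h2, h3⟩ := hy t ht
  have hleft := (extChartAt 𝓘(ℝ, E) x₀).left_inv hx
  have hd1 : MDifferentiableAt 𝓘(ℝ, E) 𝓘(ℝ, E)
      (fun x => Θ t (extChartAt 𝓘(ℝ, E) x₀ x)) x :=
    h3.differentiableAt.mdifferentiableAt.comp x (mdifferentiableAt_chart hx)
  refine ⟨?_, (mdifferentiableAt_chart_symm h1).comp x hd1, fun a => ?_⟩
  · have := flowsTo_of_chart (X := X) (c := fun s => Θ s (extChartAt 𝓘(ℝ, E) x₀ x)) (t := t)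
      (x₀ := x₀) fun s hs =>
        ⟨(hy s (uIcc_subset_Ioo_of_mem ht hs)).1, (hy s (uIcc_subset_Ioo_of_mem ht hs)).2.1⟩
    simpa only [hy0, hleft, chartFlow] using this
  · change tmap E E (fun x => (extChartAt 𝓘(ℝ, E) x₀).symm (Θ t (extChartAt 𝓘(ℝ, E) x₀ x))) x _ = _
    rw [tmap_comp_apply (g := (extChartAt 𝓘(ℝ, E) x₀).symm)
      (f := fun x => Θ t (extChartAt 𝓘(ℝ, E) x₀ x)) (mdifferentiableAt_chart_symm h1) hd1,
      tmap_comp_apply (g := Θ t) (f := extChartAt 𝓘(ℝ, E) x₀)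
        h3.differentiableAt.mdifferentiableAt (mdifferentiableAt_chart hx), tmap_eq_fderiv,
      h3.fderiv]
    congr 2
    have := tmap_chart_tmap_symm (hBt hxB) a
    rwa [hleft] at this

/-- Passing from a property of the flow in charts to a local flow on the manifold. -/
theorem hasLocalFlow_of_chart {R : M → M → (E →L[ℝ] E) → Prop} {x₀ : M} {ε : ℝ} {B : Set E}
    (hB : IsOpen B) (hx₀ : extChartAt 𝓘(ℝ, E) x₀ x₀ ∈ B) (hBt : B ⊆ (extChartAt 𝓘(ℝ, E) x₀).target)
    {Θ : ℝ → E → E} {W : ℝ → E → E →L[ℝ] E}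
    (hΘ : ∀ y ∈ B, Θ 0 y = y ∧ ∀ t ∈ Ioo (-ε) ε, Θ t y ∈ (extChartAt 𝓘(ℝ, E) x₀).target ∧
      HasDerivAt (fun s => Θ s y) (chartField X x₀ (Θ t y)) t ∧ HasFDerivAt (Θ t) (W t y) y)
    (hR : ∀ y ∈ B, ∀ t ∈ Ioo (-ε) ε, ∀ L : E →L[ℝ] E,
      (∀ a, L (tmap E E (extChartAt 𝓘(ℝ, E) x₀).symm y a) =
        tmap E E (extChartAt 𝓘(ℝ, E) x₀).symm (Θ t y) (W t y a)) →
      R ((extChartAt 𝓘(ℝ, E) x₀).symm y) ((extChartAt 𝓘(ℝ, E) x₀).symm (Θ t y)) L) :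
    HasLocalFlow X R x₀ ε := by
  refine ⟨(extChartAt 𝓘(ℝ, E) x₀).source ∩ extChartAt 𝓘(ℝ, E) x₀ ⁻¹' B,
    (continuousOn_extChartAt x₀).isOpen_inter_preimage (isOpen_extChartAt_source x₀) hB,
    ⟨mem_extChartAt_source x₀, hx₀⟩, chartFlow x₀ Θ, ?_⟩
  rintro x ⟨hx, hxB⟩ t ht
  obtain ⟨h1, h2, h3⟩ := chartFlow_spec hBt hΘ hx hxB ht
  have := hR _ hxB t ht _ h3
  rw [(extChartAt 𝓘(ℝ, E) x₀).left_inv hx] at this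
  exact ⟨h1, h2, this⟩

/-- A `C²` vector field has local flows by differentiable maps. -/
theorem exists_hasLocalFlow [CompleteSpace E] (hX : IsC2Field X) (x₀ : M) :
    ∃ ε > 0, HasLocalFlow X (fun _ _ _ => True) x₀ ε := by
  obtain ⟨ε, hε, B, hB, hx, hBt, Θ, W, H⟩ := exists_local_flow_chart hX x₀
  exact ⟨ε, hε, hasLocalFlow_of_chart hB hx hBt (W := W) (fun y hy => ⟨(H y hy).1, fun t ht =>
    ⟨((H y hy).2.2 t ht).1, ((H y hy).2.2 t ht).2.1, ((H y hy).2.2 t ht).2.2.2⟩⟩)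
    fun _ _ _ _ _ _ => trivial⟩

end Flow

end TangentMaps

end InvariantRelations

end

noncomputable section

namespace InvariantRelations

open Set Filter Topology

/-! ### The inverse function theorem with a smooth inverse on the whole image. -/

section InverseFunction

variable {V W : Type*} [NormedAddCommGroup V] [NormedSpace ℝ V] [CompleteSpace V]
  [NormedAddCommGroup W] [NormedSpace ℝ W]

/-- The inverse function theorem, for a smooth function on an open set. -/
theorem exists_smooth_openPartialHomeomorph {f : V → W} {Ω : Set V} (hΩ : IsOpen Ω)
    (hf : ContDiffOn ℝ ∞ f Ω) {y₀ : V} (hy₀ : y₀ ∈ Ω) (A : V ≃L[ℝ] W)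
    (hA : fderiv ℝ f y₀ = (A : V →L[ℝ] W)) :
    ∃ T : OpenPartialHomeomorph V W, y₀ ∈ T.source ∧ T.source ⊆ Ω ∧ (⇑T = f) ∧
      ContDiffOn ℝ ∞ T.symm T.target ∧
      ∀ y ∈ T.source, ∃ B : V ≃L[ℝ] W, fderiv ℝ f y = (B : V →L[ℝ] W) := by
  have hat : ∀ y ∈ Ω, ContDiffAt ℝ ∞ f y := fun y hy => hf.contDiffAt (hΩ.mem_nhds hy)
  have hder : HasFDerivAt f (A : V →L[ℝ] W) y₀ := by
    rw [← hA]; exact ((hat y₀ hy₀).differentiableAt (by simp)).hasFDerivAt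
  let T₀ := (hat y₀ hy₀).toOpenPartialHomeomorph f hder (by simp)
  -- The source is shrunk to the points where the derivative is invertible, so that the inverse is
  -- smooth on the entire target and not only at the image of `y₀`.
  have hinv : IsOpen {y | y ∈ Ω ∧ ∃ B : V ≃L[ℝ] W, (B : V →L[ℝ] W) = fderiv ℝ f y} := by
    have hc : ContinuousOn (fderiv ℝ f) Ω := hf.continuousOn_fderiv_of_isOpen hΩ (by simp)
    exact hc.isOpen_inter_preimage hΩ (ContinuousLinearEquiv.isOpen (𝕜 := ℝ) (E := V) (F := W))
  let T := T₀.restrOpen _ hinv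
  have hT : ⇑T = f := rfl
  refine ⟨T, ⟨(hat y₀ hy₀).mem_toOpenPartialHomeomorph_source hder (by simp), hy₀, A, hA.symm⟩,
    fun y hy => hy.2.1, hT, ?_, fun y hy => ?_⟩
  · intro w hw
    have hsrc := T.map_target hw
    obtain ⟨hΩ', B, hB⟩ := hsrc.2
    refine (T.contDiffAt_symm hw (f₀' := B) ?_ ?_).contDiffWithinAt
    · rw [hB]
      exact ((hat _ hΩ').differentiableAt (by simp)).hasFDerivAt
    · exact hat _ hΩ'
  · obtain ⟨hΩ', B, hB⟩ := hy.2
    exact ⟨B, hB.symm⟩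

end InverseFunction

/-! ### Hadamard's lemma and smooth cutoffs. -/

section Hadamard

variable {V : Type*} [NormedAddCommGroup V] [NormedSpace ℝ V] [FiniteDimensional ℝ V]

theorem hasFDerivAt_integral_of_contDiff {F : V × ℝ → ℝ} (hF : ContDiff ℝ ∞ F) (x : V) :
    HasFDerivAt (fun x => ∫ t in (0 : ℝ)..1, F (x, t))
      (∫ t in (0 : ℝ)..1, (fderiv ℝ F (x, t)).comp (ContinuousLinearMap.inl ℝ V ℝ)) x := by
  have hcF' : Continuous fun q : V × ℝ => (fderiv ℝ F q).comp (ContinuousLinearMap.inl ℝ V ℝ) :=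
    (hF.continuous_fderiv (by simp)).clm_comp continuous_const
  have : ProperSpace V := FiniteDimensional.proper_real V
  obtain ⟨C, hC⟩ := ((isCompact_closedBall x 1).prod (isCompact_Icc (a := (0 : ℝ)) (b := 1))).exists_bound_of_continuousOn
    hcF'.continuousOn
  refine intervalIntegral.hasFDerivAt_integral_of_dominated_of_fderiv_le (bound := fun _ => C)
    (F' := fun x t => (fderiv ℝ F (x, t)).comp (ContinuousLinearMap.inl ℝ V ℝ))
    (s := Metric.closedBall x 1) (Metric.closedBall_mem_nhds x one_pos) ?_ ?_ ?_ ?_ ?_ ?_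
  · exact Eventually.of_forall fun y =>
      (hF.continuous.comp (by fun_prop : Continuous fun t : ℝ => (y, t))).aestronglyMeasurable
  · exact (hF.continuous.comp (by fun_prop : Continuous fun t : ℝ => (x, t))).intervalIntegrable _ _
  · exact (hcF'.comp (by fun_prop : Continuous fun t : ℝ => (x, t))).aestronglyMeasurable
  · refine Eventually.of_forall fun t ht y hy => hC (y, t) ⟨hy, ?_⟩
    rw [uIoc_of_le zero_le_one] at ht
    exact Ioc_subset_Icc_self ht
  · exact intervalIntegrable_const
  · refine Eventually.of_forall fun t _ y _ => ?_
    have h1 : HasFDerivAt F (fderiv ℝ F (y, t)) (y, t) :=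
      (hF.differentiable (by simp) _).hasFDerivAt
    exact h1.comp y (hasFDerivAt_prodMk_left y t)

/-- Each directional derivative of the integral is the integral of a smooth function of the same
kind, so induction on the order applies with `F` varying. -/
theorem contDiff_integral {F : V × ℝ → ℝ} (hF : ContDiff ℝ ∞ F) :
    ContDiff ℝ ∞ fun x => ∫ t in (0 : ℝ)..1, F (x, t) := by
  rw [contDiff_infty]
  intro n
  induction n generalizing F with
  | zero =>
    exact contDiff_zero.2 (continuous_iff_continuousAt.2 fun x =>
      (hasFDerivAt_integral_of_contDiff hF x).continuousAt)
  | succ n ih =>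
    push_cast
    rw [contDiff_succ_iff_fderiv_apply]
    refine ⟨fun x => (hasFDerivAt_integral_of_contDiff hF x).differentiableAt, by simp, fun y => ?_⟩
    have hG : ContDiff ℝ ∞ fun q : V × ℝ => fderiv ℝ F q (y, 0) :=
      (hF.fderiv_right (m := ∞) (by simp)).clm_apply contDiff_const
    convert ih hG using 1
    funext x
    rw [(hasFDerivAt_integral_of_contDiff hF x).fderiv, ContinuousLinearMap.intervalIntegral_apply]
    · rfl
    · have hcF' : Continuous fun q : V × ℝ =>
          (fderiv ℝ F q).comp (ContinuousLinearMap.inl ℝ V ℝ) :=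
        (hF.continuous_fderiv (by simp)).clm_comp continuous_const
      exact (hcF'.comp (by fun_prop : Continuous fun t : ℝ => (x, t))).intervalIntegrable _ _

/-- Hadamard's lemma. -/
theorem exists_eq_sum_mul_of_vanishing {p : ℕ} {G : V × (Fin p → ℝ) → ℝ} (hG : ContDiff ℝ ∞ G)
    (h0 : ∀ z, G (z, 0) = 0) :
    ∃ g : Fin p → V × (Fin p → ℝ) → ℝ, (∀ β, ContDiff ℝ ∞ (g β)) ∧
      ∀ q, G q = ∑ β, g β q * q.2 β := by
  -- This is the `β`-th partial derivative at `(z, t c)`. Since `G(z, 0) = 0`, integrating the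
  -- derivative of `t ↦ G(z, t c)` over `[0, 1]` recovers `G(z, c)`.
  let F : Fin p → (V × (Fin p → ℝ)) × ℝ → ℝ := fun β q =>
    fderiv ℝ G (q.1.1, q.2 • q.1.2) (0, Pi.single β 1)
  have hline : ContDiff ℝ ∞ fun q : (V × (Fin p → ℝ)) × ℝ => (q.1.1, q.2 • q.1.2) :=
    (contDiff_fst.fst).prodMk (contDiff_snd.smul contDiff_fst.snd)
  have hF : ∀ β, ContDiff ℝ ∞ (F β) := fun β =>
    (((hG.fderiv_right (m := ∞) (by simp)).comp hline)).clm_apply contDiff_const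
  refine ⟨fun β q => ∫ t in (0 : ℝ)..1, F β (q, t), fun β => contDiff_integral (hF β), ?_⟩
  rintro ⟨z, c⟩
  have hder : ∀ t : ℝ, HasDerivAt (fun t : ℝ => G (z, t • c)) (∑ β, F β ((z, c), t) * c β) t := by
    intro t
    have h1 : HasDerivAt (fun t : ℝ => (z, t • c)) ((0 : V), c) t := by
      refine (hasDerivAt_const t z).prodMk ?_
      simpa using (hasDerivAt_id t).smul_const c
    have h2 := ((hG.differentiable (by simp) (z, t • c)).hasFDerivAt).comp_hasDerivAt t h1
    have hc : ((0 : V), c) = ∑ β, c β • ((0 : V), (Pi.single β 1 : Fin p → ℝ)) := by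
      ext1
      · simp [Prod.fst_sum]
      · rw [Prod.snd_sum]
        simp only [Prod.smul_snd]
        exact (pi_eq_sum_univ' c).trans (by
          refine Finset.sum_congr rfl fun β _ => ?_
          congr 1)
    have he : fderiv ℝ G (z, t • c) (0, c) = ∑ β, F β ((z, c), t) * c β := by
      rw [hc, map_sum]
      refine Finset.sum_congr rfl fun β _ => ?_
      rw [map_smul, smul_eq_mul, mul_comm]
    rw [← he]
    exact h2
  have hcont : ∀ β, Continuous fun t : ℝ => F β ((z, c), t) := fun β =>
    (hF β).continuous.comp (by fun_prop)
  have hint := intervalIntegral.integral_eq_sub_of_hasDerivAt (a := 0) (b := 1)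
    (fun t _ => hder t) ((continuous_finsetSum _ fun β _ =>
      (hcont β).mul continuous_const).intervalIntegrable _ _)
  simp only [one_smul, zero_smul, h0, sub_zero] at hint
  have hi : ∀ β ∈ Finset.univ, IntervalIntegrable (fun t => F β ((z, c), t) * c β) volume 0 1 :=
    fun β _ => ((hcont β).mul continuous_const).intervalIntegrable _ _
  rw [← hint, intervalIntegral.integral_finsetSum hi]
  simp only [intervalIntegral.integral_mul_const]

/-- A smooth function near a point agrees near this point with a globally smooth one, which
vanishes wherever the given function vanishes. -/
theorem exists_contDiff_eq_near {f : V → ℝ} {Ω : Set V} (hΩ : IsOpen Ω) (hf : ContDiffOn ℝ ∞ f Ω)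
    {y₀ : V} (hy₀ : y₀ ∈ Ω) : ∃ G : V → ℝ, ContDiff ℝ ∞ G ∧ (∀ᶠ y in 𝓝 y₀, G y = f y) ∧
      (∀ y, (y ∈ Ω → f y = 0) → G y = 0) ∧ ∃ C ⊆ Ω, IsCompact C ∧ ∀ y ∉ C, G y = 0 := by
  obtain ⟨r, hr, hrΩ⟩ := Metric.isOpen_iff.1 hΩ y₀ hy₀
  let χ : ContDiffBump y₀ := ⟨r / 4, r / 2, by positivity, by linarith⟩
  have hsupp : tsupport χ ⊆ Ω := by
    rw [χ.tsupport_eq]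
    exact (Metric.closedBall_subset_ball (by change r / 2 < r; linarith)).trans hrΩ
  refine ⟨fun y => χ y * f y, ?_, ?_, ?_, tsupport χ, hsupp, ?_, ?_⟩
  · refine contMDiff_iff_contDiff.1 (contMDiff_of_tsupport fun y hy => ?_)
    have hyΩ : y ∈ Ω := hsupp (tsupport_mul_subset_left hy)
    exact (χ.contDiff.contDiffAt.mul (hf.contDiffAt (hΩ.mem_nhds hyΩ))).contMDiffAt
  · filter_upwards [χ.eventuallyEq_one] with y hy
    rw [hy, Pi.one_apply, one_mul]
  · intro y hy
    by_cases hyΩ : y ∈ Ω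
    · simp only [hy hyΩ, mul_zero]
    · have : χ y = 0 := by
        by_contra h
        exact hyΩ (hsupp (subset_tsupport _ h))
      simp only [this, zero_mul]
  · exact χ.hasCompactSupport
  · intro y hy
    have : χ y = 0 := by
      by_contra h
      exact hy (subset_tsupport _ h)
    simp only [this, zero_mul]

end Hadamard

/-! ### Coordinates adapted to independent functions. -/

section Straightening

variable {E : Type*} [NormedAddCommGroup E] [NormedSpace ℝ E]
  {M : Type*} [TopologicalSpace M] [ChartedSpace E M]
  {E' : Type*} [NormedAddCommGroup E'] [NormedSpace ℝ E']
  {N : Type*} [TopologicalSpace N] [ChartedSpace E' N]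

variable (E E') in
/-- A diffeomorphism between open subsets of two manifolds. -/
structure IsSmoothChart (Φ : OpenPartialHomeomorph M N) : Prop where
  smooth : ContMDiffOn 𝓘(ℝ, E) 𝓘(ℝ, E') ∞ Φ Φ.source
  smooth_symm : ContMDiffOn 𝓘(ℝ, E') 𝓘(ℝ, E) ∞ Φ.symm Φ.target

namespace IsSmoothChart

variable {Φ : OpenPartialHomeomorph M N}

theorem contMDiffAt (h : IsSmoothChart E E' Φ) {x : M} (hx : x ∈ Φ.source) :
    ContMDiffAt 𝓘(ℝ, E) 𝓘(ℝ, E') ∞ Φ x := h.smooth.contMDiffAt (Φ.open_source.mem_nhds hx)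

theorem contMDiffAt_symm (h : IsSmoothChart E E' Φ) {y : N} (hy : y ∈ Φ.target) :
    ContMDiffAt 𝓘(ℝ, E') 𝓘(ℝ, E) ∞ Φ.symm y :=
  h.smooth_symm.contMDiffAt (Φ.open_target.mem_nhds hy)

theorem mdifferentiableAt (h : IsSmoothChart E E' Φ) {x : M} (hx : x ∈ Φ.source) :
    MDifferentiableAt 𝓘(ℝ, E) 𝓘(ℝ, E') Φ x := (h.contMDiffAt hx).mdifferentiableAt (by simp)

theorem mdifferentiableAt_symm (h : IsSmoothChart E E' Φ) {y : N} (hy : y ∈ Φ.target) :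
    MDifferentiableAt 𝓘(ℝ, E') 𝓘(ℝ, E) Φ.symm y :=
  (h.contMDiffAt_symm hy).mdifferentiableAt (by simp)

theorem tmap_symm_tmap (h : IsSmoothChart E E' Φ) {x : M} (hx : x ∈ Φ.source) (v : E) :
    tmap E' E Φ.symm (Φ x) (tmap E E' Φ x v) = v := by
  rw [← tmap_comp_apply (h.mdifferentiableAt_symm (Φ.map_source hx)) (h.mdifferentiableAt hx)]
  have : (fun z => Φ.symm (Φ z)) =ᶠ[𝓝 x] fun z => z := by
    filter_upwards [Φ.open_source.mem_nhds hx] with z hz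
    exact Φ.left_inv hz
  rw [tmap_congr this, tmap_id]
  rfl

theorem tmap_tmap_symm (h : IsSmoothChart E E' Φ) {y : N} (hy : y ∈ Φ.target) (v : E') :
    tmap E E' Φ (Φ.symm y) (tmap E' E Φ.symm y v) = v := by
  rw [← tmap_comp_apply (h.mdifferentiableAt (Φ.map_target hy)) (h.mdifferentiableAt_symm hy)]
  have : (fun z => Φ (Φ.symm z)) =ᶠ[𝓝 y] fun z => z := by
    filter_upwards [Φ.open_target.mem_nhds hy] with z hz
    exact Φ.right_inv hz
  rw [tmap_congr this, tmap_id]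
  rfl

end IsSmoothChart

variable [IsManifold 𝓘(ℝ, E) ∞ M] {Z : Type*} [NormedAddCommGroup Z] [NormedSpace ℝ Z]

/-- Coordinates in which given independent functions are some of the coordinate functions. -/
theorem exists_straightening [CompleteSpace E] {p : ℕ} {φ : Fin p → M → ℝ}
    (hφ : ∀ α, ContMDiff 𝓘(ℝ, E) 𝓘(ℝ, ℝ) ∞ (φ α)) {x : M} (hx : ∀ α, φ α x = 0)
    (A : E ≃L[ℝ] Z × (Fin p → ℝ))
    (hA : ∀ v α, (A (tmap E E (extChartAt 𝓘(ℝ, E) x) x v)).2 α = tmap E ℝ (φ α) x v) :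
    ∃ Φ : OpenPartialHomeomorph M (Z × (Fin p → ℝ)), x ∈ Φ.source ∧ Φ x = 0 ∧
      Φ.source ⊆ (extChartAt 𝓘(ℝ, E) x).source ∧
      IsSmoothChart E (Z × (Fin p → ℝ)) Φ ∧ (∀ y ∈ Φ.source, ∀ α, (Φ y).2 α = φ α y) ∧
      ∀ v, tmap E (Z × (Fin p → ℝ)) Φ x v = A (tmap E E (extChartAt 𝓘(ℝ, E) x) x v) := by
  let y₀ := extChartAt 𝓘(ℝ, E) x x
  have hy₀ : y₀ ∈ (extChartAt 𝓘(ℝ, E) x).target := mem_extChartAt_target x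
  have hsymm : (extChartAt 𝓘(ℝ, E) x).symm y₀ = x := extChartAt_to_inv x
  -- The first component is linear and the second consists of the functions `φ` themselves; the
  -- assumption on `A` makes the derivative at `y₀` exactly `A`.
  let f : E → Z × (Fin p → ℝ) := fun y =>
    ((A (y - y₀)).1, fun α => φ α ((extChartAt 𝓘(ℝ, E) x).symm y))
  have hf2 : ∀ α, ContDiffOn ℝ ∞ (fun y => φ α ((extChartAt 𝓘(ℝ, E) x).symm y))
      (extChartAt 𝓘(ℝ, E) x).target := fun α => contDiffOn_comp_chart_symm (hφ α) x
  have hf1 : ContDiff ℝ ∞ fun y => (A (y - y₀)).1 :=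
    contDiff_fst.comp (A.contDiff.comp (contDiff_id.sub contDiff_const))
  have hf : ContDiffOn ℝ ∞ f (extChartAt 𝓘(ℝ, E) x).target :=
    hf1.contDiffOn.prodMk (contDiffOn_pi.2 hf2)
  have hder : fderiv ℝ f y₀ = (A : E →L[ℝ] Z × (Fin p → ℝ)) := by
    have hd2 : ∀ α, HasFDerivAt (fun y => φ α ((extChartAt 𝓘(ℝ, E) x).symm y))
        (fderiv ℝ (φ α ∘ (extChartAt 𝓘(ℝ, E) x).symm) y₀) y₀ := fun α =>
      (((hf2 α).contDiffAt ((isOpen_extChartAt_target x).mem_nhds hy₀)).differentiableAt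
        (by simp)).hasFDerivAt
    have hd1 : HasFDerivAt (fun y => (A (y - y₀)).1)
        ((ContinuousLinearMap.fst ℝ Z (Fin p → ℝ)).comp (A : E →L[ℝ] Z × (Fin p → ℝ))) y₀ := by
      have := ((ContinuousLinearMap.fst ℝ Z (Fin p → ℝ)).comp
        (A : E →L[ℝ] Z × (Fin p → ℝ))).hasFDerivAt.comp y₀ ((hasFDerivAt_id y₀).sub_const y₀)
      exact this
    have := hd1.prodMk (hasFDerivAt_pi.2 hd2)
    rw [this.fderiv]
    ext v
    · rfl
    · rename_i α
      have h1 := hA (tmap E E (extChartAt 𝓘(ℝ, E) x).symm y₀ v) α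
      have h2 := tmap_chart_tmap_symm hy₀ v
      rw [hsymm] at h2
      rw [h2] at h1
      change fderiv ℝ (φ α ∘ (extChartAt 𝓘(ℝ, E) x).symm) y₀ v = (A v).2 α
      rw [fderiv_comp_chart_symm hy₀ ((hφ α).mdifferentiableAt (by simp)), hsymm, h1]
  obtain ⟨T, hT0, hTΩ, hTf, hTs, -⟩ := exists_smooth_openPartialHomeomorph
    (isOpen_extChartAt_target x) hf hy₀ A hder
  have hce : ∀ z, extChartAt 𝓘(ℝ, E) x z = chartAt E x z := fun z => by simp [mfld_simps]
  have hcs : ∀ z, (extChartAt 𝓘(ℝ, E) x).symm z = (chartAt E x).symm z := fun z => by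
    simp [mfld_simps]
  have hsrc : ∀ z, z ∈ ((chartAt E x).trans T).source ↔
      z ∈ (extChartAt 𝓘(ℝ, E) x).source ∧ extChartAt 𝓘(ℝ, E) x z ∈ T.source := by
    intro z
    rw [OpenPartialHomeomorph.trans_source, extChartAt_source, hce]
    rfl
  have hval : ∀ z, ((chartAt E x).trans T) z = f (extChartAt 𝓘(ℝ, E) x z) := by
    intro z
    rw [OpenPartialHomeomorph.trans_apply, hTf, hce]
  have hxs : x ∈ ((chartAt E x).trans T).source := (hsrc x).2 ⟨mem_extChartAt_source x, hT0⟩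
  refine ⟨(chartAt E x).trans T, hxs, ?_, fun z hz => ((hsrc z).1 hz).1, ⟨?_, ?_⟩, ?_, ?_⟩
  · rw [hval]
    change f y₀ = 0
    simp only [f, sub_self, map_zero, hsymm, hx]
    rfl
  · intro z hz
    obtain ⟨h1, h2⟩ := (hsrc z).1 hz
    have h3 : ContMDiffAt 𝓘(ℝ, E) 𝓘(ℝ, Z × (Fin p → ℝ)) ∞
        (fun z => f (extChartAt 𝓘(ℝ, E) x z)) z :=
      ((hf.contDiffAt ((isOpen_extChartAt_target x).mem_nhds (hTΩ h2))).contMDiffAt).comp z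
        (contMDiffAt_chart h1)
    have h4 : ⇑((chartAt E x).trans T) = fun z => f (extChartAt 𝓘(ℝ, E) x z) := funext hval
    rw [h4]
    exact h3.contMDiffWithinAt
  · intro w hw
    rw [OpenPartialHomeomorph.trans_target] at hw
    have hT3 : T.symm w ∈ T.source := T.map_target hw.1
    have h3 : ContMDiffAt 𝓘(ℝ, Z × (Fin p → ℝ)) 𝓘(ℝ, E) ∞
        (fun z => (extChartAt 𝓘(ℝ, E) x).symm (T.symm z)) w :=
      (contMDiffAt_chart_symm (hTΩ hT3)).comp w
        ((hTs.contDiffAt (T.open_target.mem_nhds hw.1)).contMDiffAt)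
    have h4 : ⇑((chartAt E x).trans T).symm =
        fun z => (extChartAt 𝓘(ℝ, E) x).symm (T.symm z) := by
      funext z
      rw [hcs]
      rfl
    rw [h4]
    exact h3.contMDiffWithinAt
  · intro z hz α
    rw [hval]
    simp only [f]
    rw [(extChartAt 𝓘(ℝ, E) x).left_inv ((hsrc z).1 hz).1]
  · intro v
    have h4 : ⇑((chartAt E x).trans T) = fun z => f (extChartAt 𝓘(ℝ, E) x z) := funext hval
    rw [h4, tmap_comp_apply (g := f) (f := extChartAt 𝓘(ℝ, E) x) (((hf.contDiffAt ((isOpen_extChartAt_target x).mem_nhds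
      hy₀)).differentiableAt (by simp)).mdifferentiableAt)
      (mdifferentiableAt_chart (mem_extChartAt_source x)), tmap_eq_fderiv]
    change fderiv ℝ f y₀ _ = _
    rw [hder]
    rfl

/-- The differentials of the functions `φ` at `x` are independent. -/
def IsRegularAt (E : Type*) [NormedAddCommGroup E] [NormedSpace ℝ E] {M : Type*}
    [TopologicalSpace M] [ChartedSpace E M] {p : ℕ} (φ : Fin p → M → ℝ) (x : M) : Prop :=
  ∃ w : Fin p → E, ∀ α β, tmap E ℝ (φ α) x (w β) = if α = β then 1 else 0

/-- Independent differentials have a surjective joint map `F`. A projection onto `F.ker` along a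
complement, paired with `F`, is the linear isomorphism needed to straighten. -/
theorem exists_straightening_of_isRegularAt [FiniteDimensional ℝ E] {p : ℕ} {φ : Fin p → M → ℝ}
    (hφ : ∀ α, ContMDiff 𝓘(ℝ, E) 𝓘(ℝ, ℝ) ∞ (φ α)) {x : M} (hx : ∀ α, φ α x = 0)
    (hreg : IsRegularAt E φ x) :
    ∃ (Z : Submodule ℝ E) (Φ : OpenPartialHomeomorph M (Z × (Fin p → ℝ))), x ∈ Φ.source ∧
      Φ x = 0 ∧ IsSmoothChart E (Z × (Fin p → ℝ)) Φ ∧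
      (∀ y ∈ Φ.source, ∀ α, (Φ y).2 α = φ α y) := by
  let y₀ := extChartAt 𝓘(ℝ, E) x x
  let D := tmap E E (extChartAt 𝓘(ℝ, E) x).symm y₀
  have hsymm : (extChartAt 𝓘(ℝ, E) x).symm y₀ = x := extChartAt_to_inv x
  let F : E →L[ℝ] (Fin p → ℝ) := ContinuousLinearMap.pi fun α => (tmap E ℝ (φ α) x).comp D
  have hsurj : F.range = ⊤ := by
    rw [LinearMap.range_eq_top]
    intro c
    obtain ⟨w, hw⟩ := hreg
    have hD : ∀ v, D (tmap E E (extChartAt 𝓘(ℝ, E) x) x v) = v :=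
      tmap_symm_tmap_chart (mem_extChartAt_source x)
    have hF : ∀ β, F (tmap E E (extChartAt 𝓘(ℝ, E) x) x (w β)) = Pi.single β 1 := by
      intro β
      funext α
      change tmap E ℝ (φ α) x (D _) = _
      rw [hD, hw, Pi.single_apply]
    refine ⟨∑ β, c β • tmap E E (extChartAt 𝓘(ℝ, E) x) x (w β), ?_⟩
    change F _ = c
    rw [map_sum]
    funext α
    simp_rw [map_smul, hF]
    simp [Pi.single_apply]
  obtain ⟨Q, hQ⟩ := Submodule.exists_isCompl F.ker
  let g : E →L[ℝ] F.ker := (F.ker.projectionOnto Q hQ).toContinuousLinearMap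
  have hg : g.range = ⊤ := Submodule.range_projectionOnto hQ
  have hgk : g.ker = Q := Submodule.ker_projectionOnto hQ
  let A := ContinuousLinearMap.equivProdOfSurjectiveOfIsCompl g F hg hsurj (by
    rw [hgk]; exact hQ.symm)
  obtain ⟨Φ, h1, h2, -, h3, h4, -⟩ := exists_straightening hφ hx A (by
    intro v α
    change tmap E ℝ (φ α) x (D _) = _
    rw [tmap_symm_tmap_chart (mem_extChartAt_source x)])
  exact ⟨F.ker, Φ, h1, h2, h3, h4⟩

/-- A smooth function which vanishes on a regular level set is, locally, a combination of the
functions defining the level set. -/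
theorem exists_local_eq_sum_mul [FiniteDimensional ℝ E] {p : ℕ} {φ : Fin p → M → ℝ}
    (hφ : ∀ α, ContMDiff 𝓘(ℝ, E) 𝓘(ℝ, ℝ) ∞ (φ α)) {x : M} (hx : ∀ α, φ α x = 0)
    (hreg : IsRegularAt E φ x) {f : M → ℝ} (hf : ContMDiff 𝓘(ℝ, E) 𝓘(ℝ, ℝ) ∞ f)
    (hf0 : ∀ y, (∀ α, φ α y = 0) → f y = 0) :
    ∃ U ∈ 𝓝 x, ∃ ψ : Fin p → M → ℝ, (∀ β, ContMDiffOn 𝓘(ℝ, E) 𝓘(ℝ, ℝ) ∞ (ψ β) U) ∧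
      ∀ y ∈ U, f y = ∑ β, ψ β y * φ β y := by
  obtain ⟨Z, Φ, hxs, hΦx, hΦ, hΦφ⟩ := exists_straightening_of_isRegularAt hφ hx hreg
  have h0 : (0 : Z × (Fin p → ℝ)) ∈ Φ.target := hΦx ▸ Φ.map_source hxs
  have hcd : ContDiffOn ℝ ∞ (f ∘ Φ.symm) Φ.target :=
    contMDiffOn_iff_contDiffOn.1 (hf.comp_contMDiffOn hΦ.smooth_symm)
  -- Hadamard's lemma is applied to a globally defined function. The cutoff keeps the zeros on `φ =
  -- 0` and changes nothing near the base point.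
  obtain ⟨G, hG, hGf, hGz, -⟩ := exists_contDiff_eq_near Φ.open_target hcd h0
  obtain ⟨g, hg, hGg⟩ := exists_eq_sum_mul_of_vanishing hG fun z => hGz _ fun hz => by
    refine hf0 _ fun α => ?_
    rw [← hΦφ _ (Φ.map_target hz), Φ.right_inv hz]
    rfl
  refine ⟨Φ.source ∩ {y | G (Φ y) = f (Φ.symm (Φ y))}, inter_mem (Φ.open_source.mem_nhds hxs) ?_,
    fun β => g β ∘ Φ, fun β => ?_, ?_⟩
  · have : Tendsto Φ (𝓝 x) (𝓝 0) := by
      have := Φ.continuousAt hxs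
      rwa [ContinuousAt, hΦx] at this
    exact this.eventually hGf
  · exact ((hg β).contMDiff.comp_contMDiffOn hΦ.smooth).mono inter_subset_left
  · rintro y ⟨hy, hyG⟩
    have hyG' : G (Φ y) = f (Φ.symm (Φ y)) := hyG
    rw [Φ.left_inv hy] at hyG'
    rw [← hyG', hGg]
    refine Finset.sum_congr rfl fun β _ => ?_
    rw [hΦφ y hy]
    rfl

/-- A differentiable map that preserves a regular level set preserves its tangent spaces. -/
theorem tmap_mem_ker_of_mapsTo [FiniteDimensional ℝ E] {p : ℕ} {φ : Fin p → M → ℝ}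
    (hφ : ∀ α, ContMDiff 𝓘(ℝ, E) 𝓘(ℝ, ℝ) ∞ (φ α)) {x : M} (hx : ∀ α, φ α x = 0)
    (hreg : IsRegularAt E φ x) {f : M → ℝ} (hf : MDifferentiableAt 𝓘(ℝ, E) 𝓘(ℝ, ℝ) f x)
    (hf0 : ∀ᶠ y in 𝓝 x, (∀ α, φ α y = 0) → f y = 0) {v : E}
    (hv : ∀ α, tmap E ℝ (φ α) x v = 0) : tmap E ℝ f x v = 0 := by
  obtain ⟨Z, Φ, hxs, hΦx, hΦ, hΦφ⟩ := exists_straightening_of_isRegularAt hφ hx hreg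
  have h0 : (0 : Z × (Fin p → ℝ)) ∈ Φ.target := hΦx ▸ Φ.map_source hxs
  have hΦ0 : Φ.symm 0 = x := by rw [← hΦx, Φ.left_inv hxs]
  let u := tmap E (Z × (Fin p → ℝ)) Φ x v
  have hu2 : u.2 = 0 := by
    funext α
    have h1 : tmap E ℝ (fun y => (Φ y).2 α) x v = u.2 α := by
      have := tmap_comp_apply (g := fun q : Z × (Fin p → ℝ) => q.2 α) (f := Φ) (x := x)
        (by fun_prop : DifferentiableAt ℝ (fun q : Z × (Fin p → ℝ) => q.2 α) (Φ x)).mdifferentiableAt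
        (hΦ.mdifferentiableAt hxs) v
      rw [this, tmap_eq_fderiv]
      have h2 : (fun q : Z × (Fin p → ℝ) => q.2 α) =
        ((ContinuousLinearMap.proj α).comp (ContinuousLinearMap.snd ℝ Z (Fin p → ℝ))) := rfl
      rw [h2, ContinuousLinearMap.fderiv]
      rfl
    have h2 : (fun y => (Φ y).2 α) =ᶠ[𝓝 x] φ α := by
      filter_upwards [Φ.open_source.mem_nhds hxs] with y hy using hΦφ y hy α
    rw [← h1, tmap_congr h2, hv]
    rfl
  -- In straightened coordinates the level set is the linear subspace with second component zero,
  -- and `u` lies in it. The straight line in direction `u` therefore stays in the level set.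
  let c : ℝ → Z × (Fin p → ℝ) := fun s => s • u
  have hc0 : c 0 = 0 := zero_smul _ _
  have hc : HasDerivAt c u 0 := by simpa using (hasDerivAt_id (0 : ℝ)).smul_const u
  have hd1 : MDifferentiableAt 𝓘(ℝ, Z × (Fin p → ℝ)) 𝓘(ℝ, ℝ) (fun q => f (Φ.symm q)) 0 := by
    have h1 : MDifferentiableAt 𝓘(ℝ, E) 𝓘(ℝ, ℝ) f (Φ.symm 0) := by rwa [hΦ0]
    exact h1.comp 0 (hΦ.mdifferentiableAt_symm h0)
  have hd : fderiv ℝ (fun q => f (Φ.symm q)) 0 u = tmap E ℝ f x v := by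
    have := tmap_comp_apply (g := f) (f := Φ.symm) (x := 0) (by rwa [hΦ0])
      (hΦ.mdifferentiableAt_symm h0) u
    rw [tmap_eq_fderiv, hΦ0] at this
    rw [this]
    have h1 := hΦ.tmap_symm_tmap hxs v
    rw [hΦx] at h1
    rw [h1]
  have hcomp : HasDerivAt (fun s => f (Φ.symm (c s))) (fderiv ℝ (fun q => f (Φ.symm q)) 0 u) 0 := by
    have h1 : HasFDerivAt (fun q => f (Φ.symm q)) (fderiv ℝ (fun q => f (Φ.symm q)) 0) (c 0) := by
      rw [hc0]; exact hd1.differentiableAt.hasFDerivAt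
    exact h1.comp_hasDerivAt (0 : ℝ) hc
  have hzero : (fun s => f (Φ.symm (c s))) =ᶠ[𝓝 0] fun _ => 0 := by
    have ht : Tendsto c (𝓝 0) (𝓝 0) := by
      have := hc.continuousAt
      rwa [ContinuousAt, hc0] at this
    have ht2 : Tendsto (fun s => Φ.symm (c s)) (𝓝 0) (𝓝 x) := by
      have := (Φ.continuousAt_symm h0).tendsto.comp ht
      rwa [hΦ0] at this
    filter_upwards [ht.eventually (Φ.open_target.mem_nhds h0), ht2.eventually hf0] with s hs hfs
    refine hfs fun α => ?_
    rw [← hΦφ _ (Φ.map_target hs), Φ.right_inv hs]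
    simp [c, hu2]
  rw [← hd]
  exact (hcomp.congr_of_eventuallyEq hzero.symm).unique (hasDerivAt_const 0 0)

end Straightening

end InvariantRelations

end

noncomputable section

namespace InvariantRelations

open Set Filter Topology

/-! ### Derivatives along the linearized flow. -/

section Calculus

variable {V : Type*} [NormedAddCommGroup V] [NormedSpace ℝ V]

theorem two_le_infty : (2 : WithTop ℕ∞) ≤ ∞ := by
  exact WithTop.coe_le_coe.2 (le_top : (2 : ℕ∞) ≤ ⊤)

/-- Closedness is used below only in this cyclic form, with the vectors held constant. -/
theorem extDeriv_two_form {η : V → V [⋀^Fin 2]→L[ℝ] ℝ} {y : V} (hη : DifferentiableAt ℝ η y)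
    (h0 : extDeriv η y = 0) (a b c : V) :
    fderiv ℝ (fun z => η z ![b, c]) y a - fderiv ℝ (fun z => η z ![a, c]) y b +
      fderiv ℝ (fun z => η z ![a, b]) y c = 0 := by
  have h1 := extDeriv_apply hη ![a, b, c]
  rw [h0, Fin.sum_univ_three] at h1
  have e0 : (0 : Fin 3).removeNth ![a, b, c] = ![b, c] := by
    funext i; fin_cases i <;> rfl
  have e1 : (1 : Fin 3).removeNth ![a, b, c] = ![a, c] := by
    funext i; fin_cases i <;> rfl
  have e2 : (2 : Fin 3).removeNth ![a, b, c] = ![a, b] := by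
    funext i; fin_cases i <;> rfl
  rw [e0, e1, e2] at h1
  simp at h1
  linarith

/-- The Lie derivative of a closed 2-form along its Hamiltonian field vanishes. -/
theorem lie_derivative_form_eq_zero {B : V → V →L[ℝ] V →L[ℝ] ℝ} {h : V → ℝ} {X : V → V} {y : V}
    (hB : DifferentiableAt ℝ B y) (hX : DifferentiableAt ℝ X y)
    (hsymm : IsSymmSndFDerivAt ℝ h y)
    (hh : ∀ᶠ z in 𝓝 y, ∀ a, fderiv ℝ h z a = B z a (X z))
    (hanti : ∀ᶠ z in 𝓝 y, ∀ a b, B z a b = -B z b a)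
    (hcl : ∀ a b c, fderiv ℝ B y a b c - fderiv ℝ B y b a c + fderiv ℝ B y c a b = 0) (u w : V) :
    fderiv ℝ B y (X y) u w + B y (fderiv ℝ X y u) w + B y u (fderiv ℝ X y w) = 0 := by
  have hBa : ∀ a, HasFDerivAt (fun z => B z a) ((fderiv ℝ B y).flip a) y := fun a =>
    (hB.hasFDerivAt.clm_apply (hasFDerivAt_const a y)).congr_fderiv (by ext; simp)
  have hBab : ∀ a b, HasFDerivAt (fun z => B z a b) (((fderiv ℝ B y).flip a).flip b) y :=
    fun a b => ((hBa a).clm_apply (hasFDerivAt_const b y)).congr_fderiv (by ext; simp)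
  have hdanti : ∀ v a b, fderiv ℝ B y v a b = -fderiv ℝ B y v b a := by
    intro v a b
    have h1 : (fun z => B z a b) =ᶠ[𝓝 y] fun z => -B z b a := by
      filter_upwards [hanti] with z hz using hz a b
    have h2 := ((hBab a b).congr_of_eventuallyEq h1.symm).unique (hBab b a).neg
    have h3 := congrArg (fun L : V →L[ℝ] ℝ => L v) h2
    simpa using h3
  -- This is the derivative of `dh = B(·, X)`. Subtracting it from itself with `u` and `w` exchanged
  -- and using the symmetry of the second derivative of `h`, one is left with the claim up to the
  -- cyclic sum that vanishes for a closed form.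
  have hsnd : ∀ a v, fderiv ℝ (fderiv ℝ h) y v a = fderiv ℝ B y v a (X y) +
      B y a (fderiv ℝ X y v) := by
    have hfd : (fderiv ℝ h) =ᶠ[𝓝 y] fun z => (-(B z)) (X z) := by
      filter_upwards [hh, hanti] with z hz hz'
      ext a
      rw [hz, hz']
      rfl
    have h2 : HasFDerivAt (fun z => (-(B z)) (X z)) _ y :=
      hB.hasFDerivAt.neg.clm_apply hX.hasFDerivAt
    intro a v
    rw [hfd.fderiv_eq, h2.fderiv]
    have := hanti.self_of_nhds a (fderiv ℝ X y v)
    simp [hdanti v a (X y), this]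
    ring
  have h1 := hsymm u w
  rw [hsnd, hsnd] at h1
  have h2 := hcl (X y) u w
  have h3 := hanti.self_of_nhds (fderiv ℝ X y u) w
  have h4 := hdanti u w (X y)
  have h5 := hdanti w u (X y)
  linarith

theorem fderiv_clm_apply_apply {B : V → V →L[ℝ] V →L[ℝ] ℝ} {y : V} (hB : DifferentiableAt ℝ B y)
    (v a b : V) : fderiv ℝ (fun z => B z a b) y v = fderiv ℝ B y v a b := by
  have h1 := (hB.hasFDerivAt.clm_apply (hasFDerivAt_const a y)).clm_apply (hasFDerivAt_const b y)
  have h2 : HasFDerivAt (fun z => B z a b) _ y := h1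
  rw [h2.fderiv]
  simp

theorem _root_.HasDerivAt.clm_apply_apply {B : V → V →L[ℝ] V →L[ℝ] ℝ} {c u w : ℝ → V} {t : ℝ}
    {c' u' w' : V} (hB : DifferentiableAt ℝ B (c t)) (hc : HasDerivAt c c' t)
    (hu : HasDerivAt u u' t) (hw : HasDerivAt w w' t) :
    HasDerivAt (fun s => B (c s) (u s) (w s))
      (fderiv ℝ B (c t) c' (u t) (w t) + B (c t) u' (w t) + B (c t) (u t) w') t := by
  have h1 : HasDerivAt (fun s => B (c s)) (fderiv ℝ B (c t) c') t :=
    HasFDerivAt.comp_hasDerivAt (l := B) (l' := fderiv ℝ B (c t)) (f := c) t hB.hasFDerivAt hc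
  have h2 : HasDerivAt (fun s => B (c s) (u s)) (fderiv ℝ B (c t) c' (u t) + B (c t) u') t :=
    h1.clm_apply hu
  have h3 := h2.clm_apply hw
  rwa [add_apply] at h3

/-- If `g = df(X)`, then `df` transported along the linearized flow changes at the rate `dg`. -/
theorem hasDerivAt_fderiv_linearized {f g : V → ℝ} {X : V → V} {Ω : Set V} (hΩ : IsOpen Ω)
    (hf : ContDiffOn ℝ 2 f Ω) (hX : DifferentiableOn ℝ X Ω)
    (hg : ∀ z ∈ Ω, fderiv ℝ f z (X z) = g z) {c u : ℝ → V} {t : ℝ} (hcΩ : c t ∈ Ω)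
    (hc : HasDerivAt c (X (c t)) t) (hu : HasDerivAt u (fderiv ℝ X (c t) (u t)) t) :
    HasDerivAt (fun s => fderiv ℝ f (c s) (u s)) (fderiv ℝ g (c t) (u t)) t := by
  have hn := hΩ.mem_nhds hcΩ
  have hfa := hf.contDiffAt hn
  have hd : DifferentiableAt ℝ (fderiv ℝ f) (c t) :=
    (hfa.fderiv_right (m := 1) (by norm_num)).differentiableAt (by simp)
  have hXd := (hX.differentiableAt hn)
  have h1 : HasDerivAt (fun s => fderiv ℝ f (c s)) (fderiv ℝ (fderiv ℝ f) (c t) (X (c t))) t :=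
    hd.hasFDerivAt.comp_hasDerivAt t hc
  have h2 := h1.clm_apply hu
  have h3 : g =ᶠ[𝓝 (c t)] fun z => fderiv ℝ f z (X z) := by
    filter_upwards [hn] with z hz using (hg z hz).symm
  have h4 := hd.hasFDerivAt.clm_apply hXd.hasFDerivAt
  have h5 := hfa.isSymmSndFDerivAt (by simp) (X (c t)) (u t)
  refine h2.congr_deriv ?_
  rw [h3.fderiv_eq, h4.fderiv]
  simp [h5, add_comm]

/-- Jacobi's formula. The determinant is multilinear in the rows, and replacing row `α` of `m` by
row `α` of `Ψ m` multiplies it by `Ψ α α`, since the other rows added in do not count. -/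
theorem hasDerivAt_det {p : ℕ} {m : ℝ → Matrix (Fin p) (Fin p) ℝ} {Ψ : Matrix (Fin p) (Fin p) ℝ}
    {t : ℝ} (hm : ∀ α β, HasDerivAt (fun s => m s α β) ((Ψ * m t) α β) t) :
    HasDerivAt (fun s => (m s).det) (Ψ.trace * (m t).det) t := by
  let D : ContinuousMultilinearMap ℝ (fun _ : Fin p => Fin p → ℝ) ℝ :=
    { Matrix.detRowAlternating.toMultilinearMap with
      cont := Continuous.matrix_det continuous_id }
  have hD : ∀ A : Fin p → Fin p → ℝ, D A = (Matrix.of A).det := fun A => rfl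
  have hrow : ∀ α, HasDerivAt (fun s => m s α) ((Ψ * m t) α) t := fun α =>
    hasDerivAt_pi.2 fun β => hm α β
  have h1 := (HasFDerivAt.multilinear_comp (f := D) fun α => (hrow α).hasFDerivAt).hasDerivAt
  have h2 : HasDerivAt (fun s => (m s).det) _ t := h1
  convert h2 using 1
  have h3 : ∀ α, Matrix.det (Matrix.updateRow (m t) α ((Ψ * m t) α)) = Ψ α α * (m t).det := by
    intro α
    have hsum : (Ψ * m t) α = ∑ β, Ψ α β • (m t) β := by
      funext γ
      simp [Matrix.mul_apply]
    rw [hsum, Matrix.det_updateRow_sum, smul_eq_mul]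
  simp only [FunLike.coe_sum, Finset.sum_apply, Matrix.trace, Matrix.diag,
    Finset.sum_mul]
  refine Finset.sum_congr rfl fun α _ => ?_
  rw [← h3]
  simp [ContinuousMultilinearMap.toContinuousLinearMap]
  rfl

end Calculus

/-! ### Hamiltonian vector fields in coordinates. -/

section HamiltonianField

variable {E : Type*} [NormedAddCommGroup E] [NormedSpace ℝ E]
  {M : Type*} [TopologicalSpace M] [ChartedSpace E M]

/-- The value of a symplectic form at a point, as a form on the model space. -/
def formAt (ωM : SymplecticForm E M) (x : M) : E [⋀^Fin 2]→L[ℝ] ℝ := ωM.toForm x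

/-- The Hamiltonian vector field, with values in the model space. -/
def hamField (ωM : SymplecticForm E M) (h : M → ℝ) : M → E := hamiltonianField ωM h

theorem formAt_nondegenerate (ωM : SymplecticForm E M) (x : M) (u : E)
    (hu : ∀ v : E, formAt ωM x ![u, v] = 0) : u = 0 := ωM.nondegenerate x u hu

theorem chartForm_apply (ωM : SymplecticForm E M) (x₀ : M) (y a b : E) :
    chartForm ωM.toForm x₀ y ![a, b] = formAt ωM ((extChartAt 𝓘(ℝ, E) x₀).symm y)
      ![tmap E E (extChartAt 𝓘(ℝ, E) x₀).symm y a, tmap E E (extChartAt 𝓘(ℝ, E) x₀).symm y b] := by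
  have : (![tmap E E (extChartAt 𝓘(ℝ, E) x₀).symm y a,
      tmap E E (extChartAt 𝓘(ℝ, E) x₀).symm y b] : Fin 2 → E) =
      tmap E E (extChartAt 𝓘(ℝ, E) x₀).symm y ∘ ![a, b] := by
    funext i; fin_cases i <;> rfl
  rw [this]
  rfl

theorem poissonBracket_eq (ωM : SymplecticForm E M) (f g : M → ℝ) (x : M) :
    poissonBracket ωM f g x = tmap E ℝ f x (hamField ωM g x) := rfl

variable [FiniteDimensional ℝ E]

theorem tmap_eq_formAt (ωM : SymplecticForm E M) (h : M → ℝ) (x : M) (v : E) :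
    tmap E ℝ h x v = formAt ωM x ![v, hamField ωM h x] := hamiltonianField_spec ωM h x v

theorem poissonBracket_eq_formAt (ωM : SymplecticForm E M) (f g : M → ℝ) (x : M) :
    poissonBracket ωM f g x = formAt ωM x ![hamField ωM g x, hamField ωM f x] :=
  tmap_eq_formAt ωM f x _

theorem poissonBracket_swap (ωM : SymplecticForm E M) (f g : M → ℝ) (x : M) :
    poissonBracket ωM f g x = -poissonBracket ωM g f x := by
  rw [poissonBracket_eq_formAt, poissonBracket_eq_formAt, alt_swap]

theorem hamField_unique (ωM : SymplecticForm E M) {h : M → ℝ} {x : M} {u : E}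
    (hu : ∀ v, tmap E ℝ h x v = formAt ωM x ![v, u]) : hamField ωM h x = u := by
  rw [← sub_eq_zero]
  refine formAt_nondegenerate ωM x _ fun v => ?_
  have h1 := hu v
  rw [tmap_eq_formAt ωM] at h1
  rw [alt_swap, sub_eq_add_neg, alt_add_right, h1, ← alt_add_right, add_neg_cancel]
  have := alt_smul_right (formAt ωM x) 0 v 0
  simpa using this

/-- The continuous bilinear map of an alternating 2-form. -/
def altCLM (A : E [⋀^Fin 2]→L[ℝ] ℝ) : E →L[ℝ] E →L[ℝ] ℝ :=
  LinearMap.toContinuousLinearMap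
    ((LinearMap.toContinuousLinearMap : (E →ₗ[ℝ] ℝ) ≃ₗ[ℝ] E →L[ℝ] ℝ).toLinearMap ∘ₗ altBilin A)

@[simp] theorem altCLM_apply (A : E [⋀^Fin 2]→L[ℝ] ℝ) (a b : E) : altCLM A a b = A ![a, b] := rfl

variable [IsManifold 𝓘(ℝ, E) ∞ M] (ωM : SymplecticForm E M) (x₀ : M)

theorem contDiffOn_altCLM_chartForm :
    ContDiffOn ℝ ∞ (fun y => altCLM (chartForm ωM.toForm x₀ y))
      (extChartAt 𝓘(ℝ, E) x₀).target := by
  refine contDiffOn_clm_apply.2 fun a => contDiffOn_clm_apply.2 fun b => ?_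
  have h1 := ωM.smooth x₀
  exact (ContinuousAlternatingMap.apply ℝ E ℝ ![a, b]).contDiff.comp_contDiffOn h1

variable {x₀} {y : E}

theorem fderiv_comp_chart_symm_eq (hy : y ∈ (extChartAt 𝓘(ℝ, E) x₀).target) {h : M → ℝ}
    (hh : ContMDiff 𝓘(ℝ, E) 𝓘(ℝ, ℝ) ∞ h) (a : E) :
    fderiv ℝ (h ∘ (extChartAt 𝓘(ℝ, E) x₀).symm) y a =
      altCLM (chartForm ωM.toForm x₀ y) a (chartField (hamField ωM h) x₀ y) := by
  rw [altCLM_apply, chartForm_apply, tmap_symm_chartField _ hy,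
    fderiv_comp_chart_symm hy (hh.mdifferentiableAt (by simp)), tmap_eq_formAt ωM]

theorem altCLM_chartForm_injective (hy : y ∈ (extChartAt 𝓘(ℝ, E) x₀).target) :
    Function.Injective (altCLM (chartForm ωM.toForm x₀ y)) := by
  rw [injective_iff_map_eq_zero]
  intro a ha
  have h1 : tmap E E (extChartAt 𝓘(ℝ, E) x₀).symm y a = 0 := by
    refine formAt_nondegenerate ωM ((extChartAt 𝓘(ℝ, E) x₀).symm y) _ fun v => ?_
    have h2 := tmap_symm_tmap_chart (x₀ := x₀) ((extChartAt 𝓘(ℝ, E) x₀).map_target hy) v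
    rw [(extChartAt 𝓘(ℝ, E) x₀).right_inv hy] at h2
    rw [← h2, ← chartForm_apply, ← altCLM_apply, ha]
    rfl
  rw [← tmap_chart_tmap_symm hy a, h1, map_zero]

/-- The defining equation is solved for the field: by nondegeneracy the field is the inverse of the
form applied to `-dh`, and inversion of linear maps is smooth at invertible ones. The sign comes
from the field being the second argument of the form. -/
theorem contDiffOn_chartField_hamField (x₀ : M) {h : M → ℝ}
    (hh : ContMDiff 𝓘(ℝ, E) 𝓘(ℝ, ℝ) ∞ h) :
    ContDiffOn ℝ ∞ (chartField (hamField ωM h) x₀) (extChartAt 𝓘(ℝ, E) x₀).target := by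
  have ho := isOpen_extChartAt_target (I := 𝓘(ℝ, E)) x₀
  have heq : ∀ y ∈ (extChartAt 𝓘(ℝ, E) x₀).target, ∃ e : E ≃L[ℝ] (E →L[ℝ] ℝ),
      (e : E →L[ℝ] (E →L[ℝ] ℝ)) = altCLM (chartForm ωM.toForm x₀ y) := by
    intro y hy
    have hfr : Module.finrank ℝ E = Module.finrank ℝ (E →L[ℝ] ℝ) := by
      rw [← (LinearMap.toContinuousLinearMap : (E →ₗ[ℝ] ℝ) ≃ₗ[ℝ] E →L[ℝ] ℝ).finrank_eq]
      exact (Subspace.dual_finrank_eq (K := ℝ) (V := E)).symm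
    refine ⟨(LinearEquiv.ofInjectiveOfFinrankEq (altCLM (chartForm ωM.toForm x₀ y)).toLinearMap
      (altCLM_chartForm_injective ωM hy) hfr).toContinuousLinearEquiv, ?_⟩
    ext a
    rfl
  have hformula : ∀ y ∈ (extChartAt 𝓘(ℝ, E) x₀).target, chartField (hamField ωM h) x₀ y =
      (altCLM (chartForm ωM.toForm x₀ y)).inverse
        (-(fderiv ℝ (h ∘ (extChartAt 𝓘(ℝ, E) x₀).symm) y)) := by
    intro y hy
    obtain ⟨e, he⟩ := heq y hy
    have h1 : -(fderiv ℝ (h ∘ (extChartAt 𝓘(ℝ, E) x₀).symm) y) =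
        e (chartField (hamField ωM h) x₀ y) := by
      ext a
      have : (e (chartField (hamField ωM h) x₀ y)) a =
        altCLM (chartForm ωM.toForm x₀ y) (chartField (hamField ωM h) x₀ y) a := by
        rw [← he]; rfl
      rw [this, neg_apply, fderiv_comp_chart_symm_eq ωM hy hh, altCLM_apply,
        altCLM_apply, ← alt_swap]
    rw [h1, ← he, ContinuousLinearMap.inverse_equiv]
    simp
  refine ContDiffOn.congr (f := fun y => (altCLM (chartForm ωM.toForm x₀ y)).inverse
        (-(fderiv ℝ (h ∘ (extChartAt 𝓘(ℝ, E) x₀).symm) y))) ?_ hformula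
  intro y hy
  obtain ⟨e, he⟩ := heq y hy
  have h1 : ContDiffAt ℝ ∞ (fun y => (altCLM (chartForm ωM.toForm x₀ y)).inverse) y := by
    have h2 := contDiffAt_map_inverse (n := ∞) e
    rw [he] at h2
    exact h2.comp y ((contDiffOn_altCLM_chartForm ωM x₀).contDiffAt (ho.mem_nhds hy))
  have h2 : ContDiffAt ℝ ∞ (fderiv ℝ (h ∘ (extChartAt 𝓘(ℝ, E) x₀).symm)) y :=
    ((contDiffOn_comp_chart_symm hh x₀).contDiffAt (ho.mem_nhds hy)).fderiv_right (by simp)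
  exact (h1.clm_apply h2.neg).contDiffWithinAt

theorem isC2Field_hamField {h : M → ℝ} (hh : ContMDiff 𝓘(ℝ, E) 𝓘(ℝ, ℝ) ∞ h) :
    IsC2Field (hamField ωM h) := fun x₀ =>
  (contDiffOn_chartField_hamField ωM x₀ hh).of_le two_le_infty

/-- The form is constant along the linearized Hamiltonian flow. -/
theorem hasDerivAt_form_linearized {h : M → ℝ} (hh : ContMDiff 𝓘(ℝ, E) 𝓘(ℝ, ℝ) ∞ h) {c u w : ℝ → E}
    {t : ℝ} (hct : c t ∈ (extChartAt 𝓘(ℝ, E) x₀).target)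
    (hc : HasDerivAt c (chartField (hamField ωM h) x₀ (c t)) t)
    (hu : HasDerivAt u (fderiv ℝ (chartField (hamField ωM h) x₀) (c t) (u t)) t)
    (hw : HasDerivAt w (fderiv ℝ (chartField (hamField ωM h) x₀) (c t) (w t)) t) :
    HasDerivAt (fun s => altCLM (chartForm ωM.toForm x₀ (c s)) (u s) (w s)) 0 t := by
  have ho := isOpen_extChartAt_target (I := 𝓘(ℝ, E)) x₀
  have hn := ho.mem_nhds hct
  have hB : DifferentiableAt ℝ (fun y => altCLM (chartForm ωM.toForm x₀ y)) (c t) :=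
    ((contDiffOn_altCLM_chartForm ωM x₀).contDiffAt hn).differentiableAt (by simp)
  have hX := ((contDiffOn_chartField_hamField ωM x₀ hh).contDiffAt hn).differentiableAt (by simp)
  have hω : DifferentiableAt ℝ (chartForm ωM.toForm x₀) (c t) :=
    ((ωM.smooth x₀).contDiffAt hn).differentiableAt (by simp)
  have key := lie_derivative_form_eq_zero hB hX
    (((contDiffOn_comp_chart_symm hh x₀).contDiffAt hn).isSymmSndFDerivAt
      (by simpa using two_le_infty))
    (by filter_upwards [hn] with z hz using fderiv_comp_chart_symm_eq ωM hz hh)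
    (Eventually.of_forall fun z a b => by rw [altCLM_apply, altCLM_apply, alt_swap])
    (fun a b d => by
      rw [← fderiv_clm_apply_apply hB, ← fderiv_clm_apply_apply hB, ← fderiv_clm_apply_apply hB]
      simp only [altCLM_apply]
      exact extDeriv_two_form hω (ωM.closed x₀ _ hct) a b d) (u t) (w t)
  exact (HasDerivAt.clm_apply_apply hB hc hu hw).congr_deriv key

end HamiltonianField

end InvariantRelations

end

noncomputable section

namespace InvariantRelations

open Set Filter Topology

/-! ### The Liouville volume restricted to a level set. -/

section RestrictedVolume

variable {E : Type*} [NormedAddCommGroup E] [NormedSpace ℝ E]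
  {M : Type*} [TopologicalSpace M] [ChartedSpace E M]
  (ωM : SymplecticForm E M) {n p m : ℕ} (hdim : 2 * n = p + m) {φ : Fin p → M → ℝ}

/-- The Liouville volume at a point, as an alternating map on the model space. -/
def volAt (x : M) : E [⋀^Fin (p + m)]→ₗ[ℝ] ℝ :=
  (liouvilleAlt (formAt ωM x) n).domDomCongr (finCongr hdim)

variable (E φ) in
/-- The dual frame, in the model space. -/
def dualFrameAt (x : M) : Fin p → E := dualFrame φ x

variable (φ) in
/-- The restricted volume, with arguments in the model space. -/
def restrictedVolumeAt (x : M) (v : Fin m → E) : ℝ := restrictedVolume ωM hdim φ x v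

theorem restrictedVolumeAt_eq (x : M) (v : Fin m → E) :
    restrictedVolumeAt ωM hdim φ x v =
      volAt ωM hdim x (Fin.append (dualFrameAt E φ x) v) :=
  (liouvilleAlt_apply (formAt ωM x) n _).symm

theorem IsRegularAt.tmap_dualFrame {x : M} (hx : IsRegularAt E φ x) (α β : Fin p) :
    tmap E ℝ (φ α) x (dualFrameAt E φ x β) = if α = β then 1 else 0 :=
  Classical.epsilon_spec (p := fun w : Fin p → TangentSpace 𝓘(ℝ, E) x =>
    ∀ α β, differential (φ α) x (w β) = if α = β then (1 : ℝ) else 0) hx α β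

variable (E φ) in
/-- The matrix of the derivatives of the functions `φ` along given vectors. -/
def diffMatrix (x : M) (w : Fin p → E) : Matrix (Fin p) (Fin p) ℝ :=
  Matrix.of fun α β => tmap E ℝ (φ α) x (w β)

theorem IsRegularAt.diffMatrix_dualFrame {x : M} (hx : IsRegularAt E φ x) :
    diffMatrix E φ x (dualFrameAt E φ x) = 1 := by
  ext α β
  rw [Matrix.one_apply]
  exact hx.tmap_dualFrame α β

/-- This factorization is what makes Ω₀ independent of the dual frame, and it measures how Ω₀
responds to a frame that is no longer dual. -/
theorem volAt_append [FiniteDimensional ℝ E] (hE : Module.finrank ℝ E = 2 * n) {x : M} (hx : IsRegularAt E φ x)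
    {v : Fin m → E} (hv : ∀ i α, tmap E ℝ (φ α) x (v i) = 0) (w : Fin p → E) :
    volAt ωM hdim x (Fin.append w v) =
      (diffMatrix E φ x w).det * restrictedVolumeAt ωM hdim φ x v := by
  rw [restrictedVolumeAt_eq]
  exact alternating_append_eq_det (ℓ := fun α => (tmap E ℝ (φ α) x).toLinearMap)
    hx.tmap_dualFrame (hE.trans hdim) _ hv w

theorem linearIndependent_append {V : Type*} [AddCommGroup V] [Module ℝ V] {ℓ : Fin p → V →ₗ[ℝ] ℝ}
    {w : Fin p → V} (hw : ∀ α β, ℓ α (w β) = if α = β then 1 else 0) {v : Fin m → V}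
    (hv : ∀ i α, ℓ α (v i) = 0) (hli : LinearIndependent ℝ v) :
    LinearIndependent ℝ (Fin.append w v) := by
  rw [Fintype.linearIndependent_iff] at hli ⊢
  intro g hg
  rw [Fin.sum_univ_add] at hg
  simp only [Fin.append_left, Fin.append_right] at hg
  have h1 : ∀ α, g (Fin.castAdd m α) = 0 := by
    intro α
    have := congrArg (ℓ α) hg
    simpa [hw, hv] using this
  simp only [h1, zero_smul, Finset.sum_const_zero, zero_add] at hg
  have h2 := hli _ hg
  intro i
  exact Fin.addCases h1 h2 i

/-- A dual frame together with independent tangent vectors of the level set is a basis, and the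
Liouville form does not vanish on a basis. -/
theorem restrictedVolumeAt_ne_zero [FiniteDimensional ℝ E] (hE : Module.finrank ℝ E = 2 * n)
    {x : M} (hx : IsRegularAt E φ x)
    {v : Fin m → E} (hv : ∀ i α, tmap E ℝ (φ α) x (v i) = 0) (hli : LinearIndependent ℝ v) :
    restrictedVolumeAt ωM hdim φ x v ≠ 0 := by
  rw [restrictedVolumeAt_eq]
  refine liouvilleAlt_ne_zero (formAt ωM x) (formAt_nondegenerate ωM x) hE
    (v := Fin.append (dualFrameAt E φ x) v ∘ finCongr hdim) ?_
  exact (linearIndependent_append (ℓ := fun α => (tmap E ℝ (φ α) x).toLinearMap)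
    hx.tmap_dualFrame hv hli).comp _ (finCongr hdim).injective

theorem exists_restrictedVolumeAt_ne_zero [FiniteDimensional ℝ E]
    (hE : Module.finrank ℝ E = 2 * n) {x : M} (hx : IsRegularAt E φ x) :
    ∃ v : Fin m → E, (∀ i α, tmap E ℝ (φ α) x (v i) = 0) ∧
      restrictedVolumeAt ωM hdim φ x v ≠ 0 := by
  have h1 := finrank_iInf_ker (ℓ := fun α => (tmap E ℝ (φ α) x).toLinearMap)
    hx.tmap_dualFrame (hE.trans hdim)
  let b := Module.finBasisOfFinrankEq ℝ _ h1
  have hv : ∀ i α, tmap E ℝ (φ α) x (b i : E) = 0 := fun i α => congrFun (b i).2 α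
  have hli : LinearIndependent ℝ fun i => (b i : E) :=
    b.linearIndependent.map' (Submodule.subtype _) (Submodule.ker_subtype _)
  exact ⟨fun i => b i, hv, restrictedVolumeAt_ne_zero ωM hdim hE hx hv hli⟩

theorem volAt_map {x y : M} {L : E →L[ℝ] E}
    (hL : ∀ u w, formAt ωM y ![L u, L w] = formAt ωM x ![u, w]) (v : Fin (p + m) → E) :
    volAt ωM hdim y (L ∘ v) = volAt ωM hdim x v := by
  simp only [volAt, AlternatingMap.domDomCongr_apply, liouvilleAlt_apply, Function.comp_apply, hL]

/-- A map that preserves ω preserves Ω; both sides are the value of Ω on `w` followed by `v`,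
computed at `y` and at `x`. Hence Ω₀ changes by the reciprocal of the change of the transversal
determinant. -/
theorem det_mul_restrictedVolumeAt_map [FiniteDimensional ℝ E]
    (hE : Module.finrank ℝ E = 2 * n) {x y : M}
    (hx : IsRegularAt E φ x) (hy : IsRegularAt E φ y) {L : E →L[ℝ] E}
    (hL : ∀ u w, formAt ωM y ![L u, L w] = formAt ωM x ![u, w])
    {v : Fin m → E} (hv : ∀ i α, tmap E ℝ (φ α) x (v i) = 0)
    (hLv : ∀ i α, tmap E ℝ (φ α) y (L (v i)) = 0) (w : Fin p → E) :
    (diffMatrix E φ y (L ∘ w)).det * restrictedVolumeAt ωM hdim φ y (L ∘ v) =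
      (diffMatrix E φ x w).det * restrictedVolumeAt ωM hdim φ x v := by
  rw [← volAt_append ωM hdim hE hx hv, ← volAt_append ωM hdim hE hy (v := L ∘ v) hLv,
    ← volAt_map ωM hdim hL]
  congr 1
  funext i
  refine Fin.addCases (fun j => ?_) (fun j => ?_) i
  · simp
  · simp

end RestrictedVolume

/-! ### The trace criterion. -/

section LevelSetFlow

variable {E : Type*} [NormedAddCommGroup E] [NormedSpace ℝ E] [FiniteDimensional ℝ E]
  {M : Type*} [TopologicalSpace M] [ChartedSpace E M] [IsManifold 𝓘(ℝ, E) ∞ M]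
  {ωM : SymplecticForm E M} {p : ℕ} {φ : Fin p → M → ℝ}
  {h : M → ℝ} {x₀ : M} {ε : ℝ} {c : ℝ → E} {W : ℝ → E →L[ℝ] E}

/-- A trajectory of a Hamiltonian field in a chart, with a solution of the linearized equation. -/
structure IsLinearizedTrajectory (ωM : SymplecticForm E M) (h : M → ℝ) (x₀ : M) (ε : ℝ)
    (c : ℝ → E) (W : ℝ → E →L[ℝ] E) : Prop where
  mem : ∀ t ∈ Ioo (-ε) ε, c t ∈ (extChartAt 𝓘(ℝ, E) x₀).target
  deriv : ∀ t ∈ Ioo (-ε) ε, HasDerivAt c (chartField (hamField ωM h) x₀ (c t)) t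
  deriv_lin : ∀ t ∈ Ioo (-ε) ε,
    HasDerivAt W ((fderiv ℝ (chartField (hamField ωM h) x₀) (c t)).comp (W t)) t
  lin_zero : W 0 = ContinuousLinearMap.id ℝ E

namespace IsLinearizedTrajectory

theorem deriv_apply (H : IsLinearizedTrajectory ωM h x₀ ε c W) {t : ℝ} (ht : t ∈ Ioo (-ε) ε)
    (a : E) : HasDerivAt (fun s => W s a)
      (fderiv ℝ (chartField (hamField ωM h) x₀) (c t) (W t a)) t := by
  have := (H.deriv_lin t ht).clm_apply (hasDerivAt_const t a)
  simpa using this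

theorem flowsTo (H : IsLinearizedTrajectory ωM h x₀ ε c W) {t : ℝ} (ht : t ∈ Ioo (-ε) ε) :
    FlowsTo (hamiltonianField ωM h) t ((extChartAt 𝓘(ℝ, E) x₀).symm (c 0))
      ((extChartAt 𝓘(ℝ, E) x₀).symm (c t)) :=
  flowsTo_of_chart (X := hamField ωM h) fun s hs =>
    ⟨H.mem s (uIcc_subset_Ioo_of_mem ht hs), H.deriv s (uIcc_subset_Ioo_of_mem ht hs)⟩

theorem form_eq (H : IsLinearizedTrajectory ωM h x₀ ε c W)
    (hh : ContMDiff 𝓘(ℝ, E) 𝓘(ℝ, ℝ) ∞ h) {t : ℝ} (ht : t ∈ Ioo (-ε) ε) (a b : E) :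
    altCLM (chartForm ωM.toForm x₀ (c t)) (W t a) (W t b) =
      altCLM (chartForm ωM.toForm x₀ (c 0)) a b := by
  have h0 : (0 : ℝ) ∈ Ioo (-ε) ε := uIcc_subset_Ioo_of_mem ht left_mem_uIcc
  have hd : ∀ s ∈ Ioo (-ε) ε, HasDerivAt
      (fun s => altCLM (chartForm ωM.toForm x₀ (c s)) (W s a) (W s b)) 0 s := fun s hs =>
    hasDerivAt_form_linearized ωM hh (H.mem s hs) (H.deriv s hs) (H.deriv_apply hs a)
      (H.deriv_apply hs b)
  have := isOpen_Ioo.is_const_of_deriv_eq_zero isPreconnected_Ioo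
    (fun s hs => (hd s hs).differentiableAt.differentiableWithinAt)
    (fun s hs => (hd s hs).deriv) ht h0
  simpa [H.lin_zero] using this

variable (hφ : ∀ α, ContMDiff 𝓘(ℝ, E) 𝓘(ℝ, ℝ) ∞ (φ α))
include hφ

/-- On the level set the differential of `{φ_α, h}` is `∑ ψ_αγ dφ_γ`, so the matrix solves `m' = ψ
m` and Jacobi's formula gives the trace. -/
theorem hasDerivAt_diffMatrix_det (H : IsLinearizedTrajectory ωM h x₀ ε c W)
    (hh : ContMDiff 𝓘(ℝ, E) 𝓘(ℝ, ℝ) ∞ h) {U : Set M} {ψ : Fin p → Fin p → M → ℝ}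
    (hψ : IsRelationMatrix ωM φ h U ψ) {t : ℝ} (ht : t ∈ Ioo (-ε) ε)
    (hct : ∀ α, φ α ((extChartAt 𝓘(ℝ, E) x₀).symm (c t)) = 0) (a : Fin p → E) :
    HasDerivAt (fun s => (Matrix.of fun α β =>
        fderiv ℝ (φ α ∘ (extChartAt 𝓘(ℝ, E) x₀).symm) (c s) (W s (a β))).det)
      ((∑ α, ψ α α ((extChartAt 𝓘(ℝ, E) x₀).symm (c t))) * (Matrix.of fun α β =>
        fderiv ℝ (φ α ∘ (extChartAt 𝓘(ℝ, E) x₀).symm) (c t) (W t (a β))).det) t := by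
  have ho := isOpen_extChartAt_target (I := 𝓘(ℝ, E)) x₀
  have hn := ho.mem_nhds (H.mem t ht)
  refine hasDerivAt_det (Ψ := Matrix.of fun α β => ψ α β ((extChartAt 𝓘(ℝ, E) x₀).symm (c t)))
    fun α β => ?_
  have hbr : ∀ z ∈ (extChartAt 𝓘(ℝ, E) x₀).target,
      fderiv ℝ (φ α ∘ (extChartAt 𝓘(ℝ, E) x₀).symm) z (chartField (hamField ωM h) x₀ z) =
        poissonBracket ωM (φ α) h ((extChartAt 𝓘(ℝ, E) x₀).symm z) := by
    intro z hz
    rw [fderiv_comp_chart_symm hz ((hφ α).mdifferentiableAt (by simp)),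
      tmap_symm_chartField _ hz, poissonBracket_eq]
  have key := hasDerivAt_fderiv_linearized ho
    ((contDiffOn_comp_chart_symm (hφ α) x₀).of_le two_le_infty)
    ((contDiffOn_chartField_hamField ωM x₀ hh).differentiableOn (by simp)) hbr (H.mem t ht)
    (H.deriv t ht) (H.deriv_apply ht (a β))
  refine key.congr_deriv ?_
  have hU : (extChartAt 𝓘(ℝ, E) x₀).symm (c t) ∈ U := hψ.subset hct
  have hev : (fun z => poissonBracket ωM (φ α) h ((extChartAt 𝓘(ℝ, E) x₀).symm z)) =ᶠ[𝓝 (c t)]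
      fun z => ∑ γ, ψ α γ ((extChartAt 𝓘(ℝ, E) x₀).symm z) *
        φ γ ((extChartAt 𝓘(ℝ, E) x₀).symm z) := by
    have h1 : ∀ᶠ z in 𝓝 (c t), (extChartAt 𝓘(ℝ, E) x₀).symm z ∈ U :=
      (contMDiffAt_chart_symm (H.mem t ht)).continuousAt.eventually (hψ.isOpen.mem_nhds hU)
    filter_upwards [h1] with z hz using hψ.eq _ hz α
  have hd : HasFDerivAt (fun z => ∑ γ, ψ α γ ((extChartAt 𝓘(ℝ, E) x₀).symm z) *
        φ γ ((extChartAt 𝓘(ℝ, E) x₀).symm z))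
      (∑ γ, ψ α γ ((extChartAt 𝓘(ℝ, E) x₀).symm (c t)) •
        fderiv ℝ (φ γ ∘ (extChartAt 𝓘(ℝ, E) x₀).symm) (c t)) (c t) := by
    refine HasFDerivAt.fun_sum fun γ _ => ?_
    have h1 : DifferentiableAt ℝ (ψ α γ ∘ (extChartAt 𝓘(ℝ, E) x₀).symm) (c t) := by
      have := ((hψ.smooth α γ).contMDiffAt (hψ.isOpen.mem_nhds hU)).comp (c t)
        (contMDiffAt_chart_symm (H.mem t ht))
      exact this.contDiffAt.differentiableAt (by simp)
    have h2 : DifferentiableAt ℝ (φ γ ∘ (extChartAt 𝓘(ℝ, E) x₀).symm) (c t) :=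
      ((contDiffOn_comp_chart_symm (hφ γ) x₀).contDiffAt hn).differentiableAt (by simp)
    -- The term with the differential of `ψ` carries the factor `φ γ`, which is zero on the level
    -- set.
    have h3 := h1.hasFDerivAt.mul h2.hasFDerivAt
    refine h3.congr_fderiv ?_
    rw [Function.comp_apply, Function.comp_apply, hct γ, zero_smul, add_zero]
  rw [hev.fderiv_eq, hd.fderiv, Matrix.mul_apply]
  simp

end IsLinearizedTrajectory

theorem exists_isLinearizedTrajectory (hh : ContMDiff 𝓘(ℝ, E) 𝓘(ℝ, ℝ) ∞ h) (x₀ : M) :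
    ∃ ε > 0, ∃ B : Set E, IsOpen B ∧ extChartAt 𝓘(ℝ, E) x₀ x₀ ∈ B ∧
      B ⊆ (extChartAt 𝓘(ℝ, E) x₀).target ∧
      ∃ (Θ : ℝ → E → E) (W : ℝ → E → E →L[ℝ] E), ∀ y ∈ B, Θ 0 y = y ∧
        IsLinearizedTrajectory ωM h x₀ ε (fun t => Θ t y) (fun t => W t y) ∧
        ∀ t ∈ Ioo (-ε) ε, HasFDerivAt (Θ t) (W t y) y := by
  obtain ⟨ε, hε, B, hB, hxB, hBt, Θ, W, H⟩ :=
    exists_local_flow_chart (isC2Field_hamField ωM hh) x₀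
  exact ⟨ε, hε, B, hB, hxB, hBt, Θ, W, fun y hy => ⟨(H y hy).1,
    ⟨fun t ht => ((H y hy).2.2 t ht).1, fun t ht => ((H y hy).2.2 t ht).2.1,
      fun t ht => ((H y hy).2.2 t ht).2.2.1, (H y hy).2.1⟩, fun t ht =>
      ((H y hy).2.2 t ht).2.2.2⟩⟩

/-- The derivative of the flow preserves the form. -/
def PreservesForm (ωM : SymplecticForm E M) (x y : M) (L : E →L[ℝ] E) : Prop :=
  ∀ u w, formAt ωM y ![L u, L w] = formAt ωM x ![u, w]

theorem preservesForm_of_chart {y z : E} (hy : y ∈ (extChartAt 𝓘(ℝ, E) x₀).target) {L T : E →L[ℝ] E}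
    (hT : ∀ a b, altCLM (chartForm ωM.toForm x₀ z) (T a) (T b) =
      altCLM (chartForm ωM.toForm x₀ y) a b)
    (hL : ∀ a, L (tmap E E (extChartAt 𝓘(ℝ, E) x₀).symm y a) =
        tmap E E (extChartAt 𝓘(ℝ, E) x₀).symm z (T a)) :
    PreservesForm ωM ((extChartAt 𝓘(ℝ, E) x₀).symm y) ((extChartAt 𝓘(ℝ, E) x₀).symm z) L := by
  have hsurj : ∀ u, ∃ a, u = tmap E E (extChartAt 𝓘(ℝ, E) x₀).symm y a := fun u => by
    have h2 := tmap_symm_tmap_chart (x₀ := x₀) ((extChartAt 𝓘(ℝ, E) x₀).map_target hy) u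
    rw [(extChartAt 𝓘(ℝ, E) x₀).right_inv hy] at h2
    exact ⟨_, h2.symm⟩
  intro u w
  obtain ⟨a, rfl⟩ := hsurj u
  obtain ⟨b, rfl⟩ := hsurj w
  rw [hL, hL, ← chartForm_apply, ← chartForm_apply]
  exact hT a b

variable [T2Space M] {n m : ℕ} {hdim : 2 * n = p + m}

theorem diffMatrix_det_chart (hφ : ∀ α, ContMDiff 𝓘(ℝ, E) 𝓘(ℝ, ℝ) ∞ (φ α)) {y : E}
    (hy : y ∈ (extChartAt 𝓘(ℝ, E) x₀).target) (a : Fin p → E) :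
    diffMatrix E φ ((extChartAt 𝓘(ℝ, E) x₀).symm y)
      (fun β => tmap E E (extChartAt 𝓘(ℝ, E) x₀).symm y (a β)) =
    Matrix.of fun α β => fderiv ℝ (φ α ∘ (extChartAt 𝓘(ℝ, E) x₀).symm) y (a β) := by
  ext α β
  exact (fderiv_comp_chart_symm hy ((hφ α).mdifferentiableAt (by simp)) (a β)).symm

variable (hE : Module.finrank ℝ E = 2 * n) (hφ : ∀ α, ContMDiff 𝓘(ℝ, E) 𝓘(ℝ, ℝ) ∞ (φ α))
  (hreg : ∀ x, (∀ α, φ α x = 0) → IsRegularAt E φ x) (hh : ContMDiff 𝓘(ℝ, E) 𝓘(ℝ, ℝ) ∞ h)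
  (hinv : IsFlowInvariant (hamiltonianField ωM h) {x | ∀ α, φ α x = 0})
include hφ hreg hh hinv

/-- A differentiable time-`t` flow map maps the tangent spaces of an invariant level set to each
other. -/
theorem tmap_flow_mem_ker {t : ℝ} {x : M} (hx : ∀ α, φ α x = 0) {θ : M → M}
    (hθ : MDifferentiableAt 𝓘(ℝ, E) 𝓘(ℝ, E) θ x)
    (hflow : ∀ᶠ y in 𝓝 x, FlowsTo (hamiltonianField ωM h) t y (θ y))
    {v : E} (hv : ∀ α, tmap E ℝ (φ α) x v = 0) (α : Fin p) :
    tmap E ℝ (φ α) (θ x) (tmap E E θ x v) = 0 := by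
  have hd : MDifferentiableAt 𝓘(ℝ, E) 𝓘(ℝ, ℝ) (φ α) (θ x) := (hφ α).mdifferentiableAt (by simp)
  rw [← tmap_comp_apply hd hθ]
  refine tmap_mem_ker_of_mapsTo hφ hx (hreg x hx) (hd.comp x hθ) ?_ hv
  filter_upwards [hflow] with y hy h0
  exact hinv t y _ h0 hy α

include hE in
/-- If the trace of the relation matrix vanishes on the level set, the flow preserves the
restricted volume. -/
theorem flowPreserves_of_trace {U : Set M} {ψ : Fin p → Fin p → M → ℝ}
    (hψ : IsRelationMatrix ωM φ h U ψ) (htr : ∀ x, (∀ α, φ α x = 0) → ∑ α, ψ α α x = 0) :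
    FlowPreservesRestrictedVolume ωM hdim φ h := by
  -- The property is chosen to be transitive, so that it can be proved for short times in a chart
  -- and then propagated to the whole trajectory by `exists_flow_map`.
  let R : M → M → (E →L[ℝ] E) → Prop := fun x y L => PreservesForm ωM x y L ∧
    ((∀ α, φ α x = 0) → (∀ α, φ α y = 0) ∧
      ∀ w : Fin p → E, (diffMatrix E φ y (L ∘ w)).det = (diffMatrix E φ x w).det)
  have hloc : ∀ x₀, ∃ ε > 0, HasLocalFlow (hamField ωM h) R x₀ ε := by
    intro x₀
    obtain ⟨ε, hε, B, hB, hxB, hBt, Θ, W, H⟩ := exists_isLinearizedTrajectory (ωM := ωM) hh x₀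
    refine ⟨ε, hε, hasLocalFlow_of_chart hB hxB hBt (W := W) (Θ := Θ) (fun y hy =>
      ⟨(H y hy).1, fun t ht => ⟨(H y hy).2.1.mem t ht, (H y hy).2.1.deriv t ht,
        (H y hy).2.2 t ht⟩⟩) ?_⟩
    intro y hy t ht L hL
    obtain ⟨hy0, Hy, -⟩ := H y hy
    refine ⟨preservesForm_of_chart (hBt hy) (T := W t y) (fun a b => ?_) hL, fun hy0' => ?_⟩
    · have := Hy.form_eq hh ht a b
      simpa only [hy0] using this
    have hM : ∀ s ∈ Ioo (-ε) ε, ∀ α, φ α ((extChartAt 𝓘(ℝ, E) x₀).symm (Θ s y)) = 0 := by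
      intro s hs
      have := Hy.flowsTo hs
      simp only [hy0] at this
      exact hinv s _ _ hy0' this
    refine ⟨hM t ht, fun w => ?_⟩
    let a : Fin p → E := fun β => tmap E E (extChartAt 𝓘(ℝ, E) x₀)
      ((extChartAt 𝓘(ℝ, E) x₀).symm y) (w β)
    have haw : ∀ β, tmap E E (extChartAt 𝓘(ℝ, E) x₀).symm y (a β) = w β := fun β => by
      have h2 := tmap_symm_tmap_chart (x₀ := x₀) ((extChartAt 𝓘(ℝ, E) x₀).map_target (hBt hy))
        (w β)
      rwa [(extChartAt 𝓘(ℝ, E) x₀).right_inv (hBt hy)] at h2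
    have hd : ∀ s ∈ Ioo (-ε) ε, HasDerivAt (fun s => (Matrix.of fun α β =>
        fderiv ℝ (φ α ∘ (extChartAt 𝓘(ℝ, E) x₀).symm) (Θ s y) (W s y (a β))).det) 0 s := by
      intro s hs
      have := Hy.hasDerivAt_diffMatrix_det hφ hh hψ hs (hM s hs) a
      rwa [htr _ (hM s hs), zero_mul] at this
    have h0 : (0 : ℝ) ∈ Ioo (-ε) ε := ⟨by linarith, hε⟩
    have hconst := isOpen_Ioo.is_const_of_deriv_eq_zero isPreconnected_Ioo
      (fun s hs => (hd s hs).differentiableAt.differentiableWithinAt)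
      (fun s hs => (hd s hs).deriv) ht h0
    have hw : w = fun β => tmap E E (extChartAt 𝓘(ℝ, E) x₀).symm y (a β) :=
      funext fun β => (haw β).symm
    have hLw : L ∘ w = fun β => tmap E E (extChartAt 𝓘(ℝ, E) x₀).symm (Θ t y) (W t y (a β)) := by
      funext β
      rw [← hL, haw]
      rfl
    rw [hLw, diffMatrix_det_chart hφ (Hy.mem t ht), hw, diffMatrix_det_chart hφ (hBt hy)]
    have hW0 : W 0 y = ContinuousLinearMap.id ℝ E := Hy.lin_zero
    refine hconst.trans ?_
    rw [hy0, hW0]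
    rfl
  intro t O F hO hF x hxO hx v hv
  obtain ⟨U', hU', hxU', θ, hθx, hθ⟩ := exists_flow_map (isC2Field_hamField ωM hh) (R := R)
    (fun x => ⟨fun u w => rfl, fun hx => ⟨hx, fun w => rfl⟩⟩)
    (fun x y z L L' h1 h2 => ⟨fun u w => (h2.1 _ _).trans (h1.1 u w), fun hx =>
      ⟨(h2.2 (h1.2 hx).1).1, fun w => ((h2.2 (h1.2 hx).1).2 (L ∘ w)).trans ((h1.2 hx).2 w)⟩⟩)
    hloc (hF x hxO)
  -- Nothing is assumed about the regularity of `F`; uniqueness of trajectories identifies it near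
  -- `x` with the differentiable flow map.
  have hFθ : F =ᶠ[𝓝 x] θ := by
    filter_upwards [hO.mem_nhds hxO, hU'.mem_nhds hxU'] with y hy hy'
    exact FlowsTo.unique (isC2Field_hamField ωM hh) (hF y hy) (hθ y hy').1
  obtain ⟨-, hd, hform, hdet⟩ := hθ x hxU'
  obtain ⟨hy0, hdet⟩ := hdet hx
  have hLv : ∀ i α, tmap E ℝ (φ α) (θ x) (tmap E E θ x (v i)) = 0 := fun i α =>
    tmap_flow_mem_ker hφ hreg hh hinv hx hd (by
      filter_upwards [hU'.mem_nhds hxU'] with y hy using (hθ y hy).1) (hv i) α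
  have h1 := det_mul_restrictedVolumeAt_map ωM hdim hE (hreg x hx) (hreg _ hy0) hform
    (v := v) hv hLv (dualFrameAt E φ x)
  rw [hdet, (hreg x hx).diffMatrix_dualFrame, Matrix.det_one, one_mul, one_mul] at h1
  change restrictedVolumeAt ωM hdim φ (F x) (fun i => tmap E E F x (v i)) = _
  rw [hθx.symm, tmap_congr hFθ]
  exact h1

include hE in
-- If Ω₀ is preserved, then since it is nonzero on some tangent frame at `x`, the transversal
-- determinant is identically `1` for short times. Its derivative at time zero is the trace.
theorem trace_eq_zero_of_flowPreserves {U : Set M} {ψ : Fin p → Fin p → M → ℝ}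
    (hψ : IsRelationMatrix ωM φ h U ψ) (hpres : FlowPreservesRestrictedVolume ωM hdim φ h)
    {x : M} (hx : ∀ α, φ α x = 0) : ∑ α, ψ α α x = 0 := by
  obtain ⟨ε, hε, B, hB, hxB, hBt, Θ, W, H⟩ := exists_isLinearizedTrajectory (ωM := ωM) hh x
  let y := extChartAt 𝓘(ℝ, E) x x
  have hyx : (extChartAt 𝓘(ℝ, E) x).symm y = x := extChartAt_to_inv x
  obtain ⟨hy0, Hy, -⟩ := H y hxB
  have hy0' : Θ 0 y = y := hy0
  have hW0 : W 0 y = ContinuousLinearMap.id ℝ E := Hy.lin_zero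
  have hM : ∀ s ∈ Ioo (-ε) ε, ∀ α, φ α ((extChartAt 𝓘(ℝ, E) x).symm (Θ s y)) = 0 := by
    intro s hs
    have := Hy.flowsTo hs
    simp only [hy0', hyx] at this
    exact hinv s _ _ hx this
  let a : Fin p → E := fun β => tmap E E (extChartAt 𝓘(ℝ, E) x) x (dualFrameAt E φ x β)
  have haw : (fun β => tmap E E (extChartAt 𝓘(ℝ, E) x).symm y (a β)) = dualFrameAt E φ x :=
    funext fun β => tmap_symm_tmap_chart (x₀ := x) (mem_extChartAt_source x) _
  obtain ⟨v, hv, hvol⟩ := exists_restrictedVolumeAt_ne_zero ωM hdim hE (hreg x hx)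
  have h0 : (0 : ℝ) ∈ Ioo (-ε) ε := ⟨by linarith, hε⟩
  -- The vectors `a` represent the dual frame at `x`, so the determinant has value `1` at time zero
  -- and any later deviation would show up as a change of Ω₀.
  have hdet : ∀ t ∈ Ioo (-ε) ε, (Matrix.of fun α β =>
        fderiv ℝ (φ α ∘ (extChartAt 𝓘(ℝ, E) x).symm) (Θ t y) (W t y (a β))).det = 1 := by
    intro t ht
    let F := chartFlow x Θ t
    have hspec : ∀ z ∈ (extChartAt 𝓘(ℝ, E) x).source ∩ extChartAt 𝓘(ℝ, E) x ⁻¹' B, _ := fun z hz =>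
      chartFlow_spec (X := hamField ωM h) hBt (W := W) (Θ := Θ) (ε := ε) (fun y hy =>
      ⟨(H y hy).1, fun t ht => ⟨(H y hy).2.1.mem t ht, (H y hy).2.1.deriv t ht,
        (H y hy).2.2 t ht⟩⟩) hz.1 hz.2 ht
    have hO : IsOpen ((extChartAt 𝓘(ℝ, E) x).source ∩ extChartAt 𝓘(ℝ, E) x ⁻¹' B) :=
      (continuousOn_extChartAt x).isOpen_inter_preimage (isOpen_extChartAt_source x) hB
    have hxO : x ∈ (extChartAt 𝓘(ℝ, E) x).source ∩ extChartAt 𝓘(ℝ, E) x ⁻¹' B :=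
      ⟨mem_extChartAt_source x, hxB⟩
    obtain ⟨-, hFd, hFW⟩ := hspec x hxO
    have hform : PreservesForm ωM x (F x) (tmap E E F x) := by
      have h1 : PreservesForm ωM ((extChartAt 𝓘(ℝ, E) x).symm y)
          ((extChartAt 𝓘(ℝ, E) x).symm (Θ t y)) (tmap E E F x) :=
        preservesForm_of_chart (hBt hxB) (T := W t y) (fun a b => by
          have := Hy.form_eq hh ht a b
          simpa only [hy0'] using this) hFW
      rwa [hyx] at h1
    have hFx : ∀ α, φ α (F x) = 0 := hM t ht
    have hLv : ∀ i α, tmap E ℝ (φ α) (F x) (tmap E E F x (v i)) = 0 := fun i α =>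
      tmap_flow_mem_ker hφ hreg hh hinv hx hFd (by
        filter_upwards [hO.mem_nhds hxO] with y hy using (hspec y hy).1) (hv i) α
    have h1 := det_mul_restrictedVolumeAt_map ωM hdim hE (hreg x hx) (hreg _ hFx) hform hv hLv
      (dualFrameAt E φ x)
    have h2 : restrictedVolumeAt ωM hdim φ (F x) (tmap E E F x ∘ v) =
        restrictedVolumeAt ωM hdim φ x v :=
      hpres t _ F hO (fun z hz => (hspec z hz).1) x hxO hx v hv
    rw [h2, (hreg x hx).diffMatrix_dualFrame, Matrix.det_one] at h1
    have h3 := mul_right_cancel₀ hvol h1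
    have h4 : tmap E E F x ∘ dualFrameAt E φ x = fun β =>
        tmap E E (extChartAt 𝓘(ℝ, E) x).symm (Θ t y) (W t y (a β)) := by
      funext β
      rw [← hFW, ← haw]
      rfl
    rw [h4] at h3
    rw [← diffMatrix_det_chart hφ (Hy.mem t ht)]
    exact h3
  have hd := Hy.hasDerivAt_diffMatrix_det hφ hh hψ h0 (hM 0 h0) a
  have hd1 : HasDerivAt (fun s => (Matrix.of fun α β =>
        fderiv ℝ (φ α ∘ (extChartAt 𝓘(ℝ, E) x).symm) (Θ s y) (W s y (a β))).det) 0 0 :=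
    (hasDerivAt_const (0 : ℝ) (1 : ℝ)).congr_of_eventuallyEq (by
      filter_upwards [isOpen_Ioo.mem_nhds h0] with s hs using hdet s hs)
  have h5 := hd.unique hd1
  have h6 := hdet 0 h0
  rw [h6, mul_one, hy0', hyx] at h5
  exact h5

end LevelSetFlow

end InvariantRelations

end

noncomputable section

namespace InvariantRelations

open Set Filter Topology

/-! ### Existence of the relation matrix. -/

section Relations

variable {E : Type*} [NormedAddCommGroup E] [NormedSpace ℝ E] [FiniteDimensional ℝ E]
  {M : Type*} [TopologicalSpace M] [ChartedSpace E M] [IsManifold 𝓘(ℝ, E) ∞ M]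
  {ωM : SymplecticForm E M} {p : ℕ} {φ : Fin p → M → ℝ} {h : M → ℝ}

theorem contMDiff_poissonBracket {f : M → ℝ} (hf : ContMDiff 𝓘(ℝ, E) 𝓘(ℝ, ℝ) ∞ f)
    (hh : ContMDiff 𝓘(ℝ, E) 𝓘(ℝ, ℝ) ∞ h) :
    ContMDiff 𝓘(ℝ, E) 𝓘(ℝ, ℝ) ∞ (poissonBracket ωM f h) := by
  intro x₀
  have hn := (isOpen_extChartAt_target (I := 𝓘(ℝ, E)) x₀).mem_nhds (mem_extChartAt_target x₀)
  have h1 : ContDiffAt ℝ ∞ (fun z => fderiv ℝ (f ∘ (extChartAt 𝓘(ℝ, E) x₀).symm) z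
      (chartField (hamField ωM h) x₀ z)) (extChartAt 𝓘(ℝ, E) x₀ x₀) :=
    (((contDiffOn_comp_chart_symm hf x₀).contDiffAt hn).fderiv_right (by simp)).clm_apply
      ((contDiffOn_chartField_hamField ωM x₀ hh).contDiffAt hn)
  have h2 := h1.contMDiffAt.comp x₀ (contMDiffAt_chart (x₀ := x₀) (mem_extChartAt_source x₀))
  refine h2.congr_of_eventuallyEq ?_
  filter_upwards [extChartAt_source_mem_nhds (I := 𝓘(ℝ, E)) x₀] with y hy
  have hyt := (extChartAt 𝓘(ℝ, E) x₀).map_source hy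
  rw [Function.comp_apply, fderiv_comp_chart_symm hyt (hf.mdifferentiableAt (by simp)),
    tmap_symm_chartField _ hyt, (extChartAt 𝓘(ℝ, E) x₀).left_inv hy, poissonBracket_eq]

variable (hφ : ∀ α, ContMDiff 𝓘(ℝ, E) 𝓘(ℝ, ℝ) ∞ (φ α))
  (hh : ContMDiff 𝓘(ℝ, E) 𝓘(ℝ, ℝ) ∞ h)
  (hinv : IsFlowInvariant (hamiltonianField ωM h) {x | ∀ α, φ α x = 0})
include hφ hh hinv

/-- The bracket is the derivative at time zero of `φ α` along the trajectory through `x`, and by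
invariance this function is zero for all short times. -/
theorem poissonBracket_eq_zero_of_invariant {x : M} (hx : ∀ α, φ α x = 0) (α : Fin p) :
    poissonBracket ωM (φ α) h x = 0 := by
  obtain ⟨ε, hε, B, hB, hxB, hBt, Θ, W, H⟩ := exists_isLinearizedTrajectory (ωM := ωM) hh x
  let y := extChartAt 𝓘(ℝ, E) x x
  have hyx : (extChartAt 𝓘(ℝ, E) x).symm y = x := extChartAt_to_inv x
  obtain ⟨hy0, Hy, -⟩ := H y hxB
  have hy0' : Θ 0 y = y := hy0
  have h0 : (0 : ℝ) ∈ Ioo (-ε) ε := ⟨by linarith, hε⟩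
  have hM : ∀ s ∈ Ioo (-ε) ε, φ α ((extChartAt 𝓘(ℝ, E) x).symm (Θ s y)) = 0 := by
    intro s hs
    have := Hy.flowsTo hs
    simp only [hy0', hyx] at this
    exact hinv s _ _ hx this α
  have hd := Hy.deriv 0 h0
  simp only [hy0'] at hd
  have hyt := hBt hxB
  have hf : HasFDerivAt (φ α ∘ (extChartAt 𝓘(ℝ, E) x).symm)
      (fderiv ℝ (φ α ∘ (extChartAt 𝓘(ℝ, E) x).symm) y) (Θ 0 y) := by
    rw [hy0']
    exact (((contDiffOn_comp_chart_symm (hφ α) x).contDiffAt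
      ((isOpen_extChartAt_target x).mem_nhds hyt)).differentiableAt (by simp)).hasFDerivAt
  have h1 := hf.comp_hasDerivAt (0 : ℝ) hd
  rw [fderiv_comp_chart_symm hyt ((hφ α).mdifferentiableAt (by simp)),
    tmap_symm_chartField _ hyt, hyx] at h1
  have h2 : HasDerivAt (φ α ∘ (extChartAt 𝓘(ℝ, E) x).symm ∘ fun t => Θ t y) 0 0 :=
    (hasDerivAt_const (0 : ℝ) (0 : ℝ)).congr_of_eventuallyEq (by
      filter_upwards [isOpen_Ioo.mem_nhds h0] with s hs using hM s hs)
  exact h1.unique h2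

/-- The condition on the value of `ψ` at a point is affine, hence convex, so a partition of unity
combines local solutions into one that is defined on all of `M`. -/
theorem exists_isRelationMatrix [T2Space M] [SecondCountableTopology M]
    (hreg : ∀ x, (∀ α, φ α x = 0) → IsRegularAt E φ x) :
    ∃ U ψ, IsRelationMatrix ωM φ h U ψ := by
  have : LocallyCompactSpace M := Manifold.locallyCompact_of_finiteDimensional 𝓘(ℝ, E)
  have hf : ∀ α, ContMDiff 𝓘(ℝ, E) 𝓘(ℝ, ℝ) ∞ (poissonBracket ωM (φ α) h) := fun α =>
    contMDiff_poissonBracket (hφ α) hh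
  obtain ⟨g, hg⟩ := exists_contMDiffMap_forall_mem_convex_of_local (n := (⊤ : ℕ∞)) 𝓘(ℝ, E)
    (F := Fin p → Fin p → ℝ)
    (t := fun x : M => {ψ | ∀ α, poissonBracket ωM (φ α) h x = ∑ β, ψ α β * φ β x}) (by
      intro x ψ hψ ψ' hψ' a b _ _ hab α
      simp only [Pi.add_apply, Pi.smul_apply, smul_eq_mul, add_mul, mul_assoc,
        Finset.sum_add_distrib, ← Finset.mul_sum, ← hψ α, ← hψ' α]
      rw [← add_mul, hab, one_mul]) (by
      intro x
      by_cases hx : ∀ α, φ α x = 0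
      · have := fun α => exists_local_eq_sum_mul hφ hx (hreg x hx) (hf α) fun y hy =>
          poissonBracket_eq_zero_of_invariant hφ hh hinv hy α
        choose U hU ψ hψ hψeq using this
        refine ⟨⋂ α, U α, Filter.iInter_mem.2 hU, fun y α β => ψ α β y, ?_, fun y hy α =>
          hψeq α y (mem_iInter.1 hy α)⟩
        exact contMDiffOn_pi_space.2 fun α => contMDiffOn_pi_space.2 fun β =>
          (hψ α β).mono (iInter_subset _ α)
      · push Not at hx
        obtain ⟨γ, hγ⟩ := hx
        have hS : ContMDiff 𝓘(ℝ, E) 𝓘(ℝ, ℝ) ∞ fun y => ∑ γ, φ γ y * φ γ y :=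
          contMDiff_finsetSum fun γ _ => (hφ γ).mul (hφ γ)
        -- Off the level set the sum of the squares is invertible, and `{φ_α, h} φ_β` divided by it
        -- solves the relation.
        refine ⟨{y | ∑ γ, φ γ y * φ γ y ≠ 0}, (isOpen_ne_fun hS.continuous
          continuous_const).mem_nhds ?_, fun y α β => poissonBracket ωM (φ α) h y * φ β y *
            (∑ γ, φ γ y * φ γ y)⁻¹, ?_, ?_⟩
        · change ∑ γ, φ γ x * φ γ x ≠ 0
          exact (Finset.sum_pos' (fun i _ => mul_self_nonneg (φ i x))
            ⟨γ, Finset.mem_univ _, mul_self_pos.2 hγ⟩).ne'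
        · refine contMDiffOn_pi_space.2 fun α => contMDiffOn_pi_space.2 fun β => ?_
          exact (((hf α).mul (hφ β)).contMDiffOn).mul (hS.contMDiffOn.inv₀ fun y hy => hy)
        · intro y hy α
          have hy' : ∑ γ, φ γ y * φ γ y ≠ 0 := hy
          have : ∀ β, poissonBracket ωM (φ α) h y * φ β y * (∑ γ, φ γ y * φ γ y)⁻¹ * φ β y =
            poissonBracket ωM (φ α) h y * (∑ γ, φ γ y * φ γ y)⁻¹ * (φ β y * φ β y) := fun β => by
              ring
          simp only [this, ← Finset.mul_sum]
          rw [mul_assoc, inv_mul_cancel₀ hy', mul_one])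
  refine ⟨univ, fun α β x => g x α β, isOpen_univ, subset_univ _, fun α β => ?_,
    fun x _ α => hg x α⟩
  have h1 : ContMDiff 𝓘(ℝ, E) 𝓘(ℝ, Fin p → Fin p → ℝ) ∞ g := g.contMDiff
  exact (contMDiff_pi_space.1 (contMDiff_pi_space.1 h1 α) β).contMDiffOn

end Relations

/-! ### Generators of an action, and invariant Hamiltonians. -/

section Generators

variable {E : Type*} [NormedAddCommGroup E] [NormedSpace ℝ E]
  {M : Type*} [TopologicalSpace M] [ChartedSpace E M]
  {EG : Type*} [NormedAddCommGroup EG] [NormedSpace ℝ EG]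
  {G : Type*} [TopologicalSpace G] [ChartedSpace EG G] [Group G] [MulAction G M]

variable (E) in
/-- The generators of an action, with values in the model space. -/
def genField (ξ : EG) (x : M) : E :=
  tmap EG E (fun g : G => g • x) 1 ξ

theorem mdifferentiableAt_smul_left [ContMDiffSMul 𝓘(ℝ, EG) 𝓘(ℝ, E) ∞ G M] (g : G) (x : M) :
    MDifferentiableAt 𝓘(ℝ, EG) 𝓘(ℝ, E) (fun g : G => g • x) g := by
  have h1 : ContMDiff 𝓘(ℝ, EG) 𝓘(ℝ, E) ∞ fun g : G => g • x :=
    contMDiff_id.smul contMDiff_const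
  exact h1.mdifferentiableAt (by simp)

theorem mdifferentiableAt_smul_right [ContMDiffSMul 𝓘(ℝ, EG) 𝓘(ℝ, E) ∞ G M] (g : G) (x : M) :
    MDifferentiableAt 𝓘(ℝ, E) 𝓘(ℝ, E) (fun x : M => g • x) x := by
  have h1 : ContMDiff 𝓘(ℝ, E) 𝓘(ℝ, E) ∞ fun x : M => g • x :=
    (contMDiff_const (I' := 𝓘(ℝ, EG)) (c := g)).smul contMDiff_id
  exact h1.mdifferentiableAt (by simp)

theorem tmap_genField_eq_zero [ContMDiffSMul 𝓘(ℝ, EG) 𝓘(ℝ, E) ∞ G M] {f : M → ℝ} {x : M}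
    (hf : MDifferentiableAt 𝓘(ℝ, E) 𝓘(ℝ, ℝ) f x) (hinv : ∀ g : G, f (g • x) = f x) (ξ : EG) :
    tmap E ℝ f x (genField E (G := G) ξ x) = 0 := by
  have h1 : MDifferentiableAt 𝓘(ℝ, E) 𝓘(ℝ, ℝ) f ((1 : G) • x) := by rwa [one_smul]
  have h2 := tmap_comp_apply (f := fun g : G => g • x) h1 (mdifferentiableAt_smul_left 1 x) ξ
  have h3 : (fun g : G => f (g • x)) = fun _ => f x := funext hinv
  rw [h3, tmap_const, one_smul] at h2
  exact h2.symm

variable {ωM : SymplecticForm E M} {Φ : M → Module.Dual ℝ (GroupLieAlgebra 𝓘(ℝ, EG) G)}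

theorem IsHamiltonianAction.hamField_eq (hΦ : IsHamiltonianAction ωM Φ) (ξ : EG) (x : M) :
    hamField ωM (fun y => Φ y ξ) x = genField E (G := G) ξ x := hΦ.generated ξ x

/-- This is Noether's theorem: `{φ_α, h}` is, up to sign, the derivative of `h` along a generator
and vanishes. The zero matrix is then a relation matrix. -/
theorem flowPreserves_of_invariant [FiniteDimensional ℝ E] [IsManifold 𝓘(ℝ, E) ∞ M] [T2Space M]
    [ContMDiffSMul 𝓘(ℝ, EG) 𝓘(ℝ, E) ∞ G M]
    {n p m : ℕ} (hE : Module.finrank ℝ E = 2 * n) {hdim : 2 * n = p + m}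
    (hΦ : IsHamiltonianAction ωM Φ) (b : Fin p → EG) {φ : Fin p → M → ℝ}
    (hφ : ∀ α, φ α = fun x => Φ x (b α))
    (hreg : ∀ x, (∀ α, φ α x = 0) → IsRegularAt E φ x)
    {h : M → ℝ} (hh : ContMDiff 𝓘(ℝ, E) 𝓘(ℝ, ℝ) ∞ h)
    (hinv : IsFlowInvariant (hamiltonianField ωM h) {x | ∀ α, φ α x = 0})
    (hG : ∀ (g : G) (x : M), h (g • x) = h x) : FlowPreservesRestrictedVolume ωM hdim φ h := by
  refine flowPreserves_of_trace hE (fun α => hφ α ▸ hΦ.smooth (b α)) hreg hh hinv (U := univ)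
    (ψ := fun _ _ _ => 0) ⟨isOpen_univ, subset_univ _, fun _ _ => contMDiffOn_const, ?_⟩ ?_
  · intro x _ α
    simp only [zero_mul, Finset.sum_const_zero]
    rw [poissonBracket_swap, poissonBracket_eq, hφ α, hΦ.hamField_eq, tmap_genField_eq_zero
      (hh.mdifferentiableAt (by simp)) fun g => hG g x, neg_zero]
  · simp

theorem isRegularAt_of_zeroIsRegularValue (hreg : ZeroIsRegularValue E Φ) {p : ℕ}
    (b : Module.Basis (Fin p) ℝ (GroupLieAlgebra 𝓘(ℝ, EG) G)) {φ : Fin p → M → ℝ}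
    (hφ : ∀ α, φ α = fun x => Φ x (b α)) {x : M} (hx : ∀ α, φ α x = 0) : IsRegularAt E φ x := by
  have hΦx : Φ x = 0 := b.ext fun α => by
    have := hx α
    rw [hφ] at this
    exact this
  choose w hw using fun β => hreg x hΦx (b.coord β)
  refine ⟨w, fun α β => ?_⟩
  have h1 : tmap E ℝ (fun y => Φ y (b α)) x (w β) = b.coord β (b α) := hw β (b α)
  rw [hφ α, h1, Module.Basis.coord_apply, Module.Basis.repr_self, Finsupp.single_apply]

end Generators

end InvariantRelations

end

noncomputable section

namespace InvariantRelations

open Set Filter Topology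

/-! ### Functions with vanishing derivative. -/

section LocallyConstant

variable {E : Type*} [NormedAddCommGroup E] [NormedSpace ℝ E]
  {M : Type*} [TopologicalSpace M] [ChartedSpace E M] [IsManifold 𝓘(ℝ, E) ∞ M]

/-- A function with vanishing derivative on a connected manifold is constant. -/
theorem eq_of_tmap_eq_zero [PreconnectedSpace M] {f : M → ℝ}
    (hf : ContMDiff 𝓘(ℝ, E) 𝓘(ℝ, ℝ) ∞ f) (h0 : ∀ x, tmap E ℝ f x = 0) (x y : M) : f x = f y := by
  refine IsLocallyConstant.apply_eq_of_preconnectedSpace ?_ x y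
  rw [IsLocallyConstant.iff_eventually_eq]
  intro x₀
  obtain ⟨r, hr, hball⟩ := Metric.isOpen_iff.1 (isOpen_extChartAt_target (I := 𝓘(ℝ, E)) x₀) _
    (mem_extChartAt_target x₀)
  have hd : ∀ z ∈ Metric.ball (extChartAt 𝓘(ℝ, E) x₀ x₀) r,
      DifferentiableAt ℝ (f ∘ (extChartAt 𝓘(ℝ, E) x₀).symm) z := fun z hz =>
    ((contDiffOn_comp_chart_symm hf x₀).contDiffAt
      ((isOpen_extChartAt_target x₀).mem_nhds (hball hz))).differentiableAt (by simp)
  have hconst : ∀ z ∈ Metric.ball (extChartAt 𝓘(ℝ, E) x₀ x₀) r,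
      (f ∘ (extChartAt 𝓘(ℝ, E) x₀).symm) z =
        (f ∘ (extChartAt 𝓘(ℝ, E) x₀).symm) (extChartAt 𝓘(ℝ, E) x₀ x₀) := by
    intro z hz
    refine Metric.isOpen_ball.is_const_of_fderiv_eq_zero (𝕜 := ℝ)
      (convex_ball _ _).isPreconnected (fun w hw => (hd w hw).differentiableWithinAt) ?_ hz
      (Metric.mem_ball_self hr)
    intro w hw
    ext v
    rw [fderiv_comp_chart_symm (hball hw) (hf.mdifferentiableAt (by simp)), h0]
    rfl
  filter_upwards [extChartAt_source_mem_nhds (I := 𝓘(ℝ, E)) x₀,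
    (continuousAt_extChartAt (I := 𝓘(ℝ, E)) x₀).eventually (Metric.ball_mem_nhds _ hr)] with y hy hyb
  have := hconst _ hyb
  simpa only [Function.comp_apply, (extChartAt 𝓘(ℝ, E) x₀).left_inv hy,
    extChartAt_to_inv x₀] using this

end LocallyConstant

/-! ### The adjoint representation and free actions. -/

section GroupAction

variable {E : Type*} [NormedAddCommGroup E] [NormedSpace ℝ E]
  {M : Type*} [TopologicalSpace M] [ChartedSpace E M]
  {EK : Type*} [NormedAddCommGroup EK] [NormedSpace ℝ EK]
  {K : Type*} [TopologicalSpace K] [ChartedSpace EK K] [Group K] [LieGroup 𝓘(ℝ, EK) ∞ K]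

theorem mdifferentiableAt_mul_left (k g : K) :
    MDifferentiableAt 𝓘(ℝ, EK) 𝓘(ℝ, EK) (fun g : K => k * g) g :=
  (contMDiff_mul_left (I := 𝓘(ℝ, EK)) (n := ∞)).mdifferentiableAt (by simp)

theorem mdifferentiableAt_mul_right (k g : K) :
    MDifferentiableAt 𝓘(ℝ, EK) 𝓘(ℝ, EK) (fun g : K => g * k) g :=
  (contMDiff_mul_right (I := 𝓘(ℝ, EK)) (n := ∞)).mdifferentiableAt (by simp)

/-- The adjoint representation. -/
def adMap (k : K) : EK →L[ℝ] EK := tmap EK EK (fun g : K => k * g * k⁻¹) 1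

theorem contMDiff_conj : ContMDiff (𝓘(ℝ, EK).prod 𝓘(ℝ, EK)) 𝓘(ℝ, EK) ∞
    fun q : K × K => q.1 * q.2 * q.1⁻¹ :=
  (contMDiff_fst.mul contMDiff_snd).mul (contMDiff_fst.inv)

theorem mdifferentiableAt_conj (k g : K) :
    MDifferentiableAt 𝓘(ℝ, EK) 𝓘(ℝ, EK) (fun g : K => k * g * k⁻¹) g := by
  have : ContMDiff 𝓘(ℝ, EK) 𝓘(ℝ, EK) ∞ fun g : K => k * g * k⁻¹ :=
    (contMDiff_const.mul contMDiff_id).mul contMDiff_const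
  exact this.mdifferentiableAt (by simp)

theorem adMap_mul (k l : K) : adMap (EK := EK) (k * l) = (adMap k).comp (adMap l) := by
  have h1 : (fun g : K => k * l * g * (k * l)⁻¹) =
      (fun g : K => k * g * k⁻¹) ∘ fun g : K => l * g * l⁻¹ := by
    funext g; simp [mul_assoc]
  rw [adMap, h1, tmap_comp (mdifferentiableAt_conj _ _) (mdifferentiableAt_conj _ _)]
  simp only [mul_one, mul_inv_cancel]
  rfl

theorem adMap_one : adMap (EK := EK) (1 : K) = ContinuousLinearMap.id ℝ EK := by
  have h1 : (fun g : K => 1 * g * 1⁻¹) = fun g => g := by funext g; simp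
  rw [adMap, h1, tmap_id]

/-- Joint smoothness of conjugation gives continuity of the derivative in tangent coordinates.
Conjugation fixes `1`, so source and target are always expressed in the chart at `1` and the
coordinate changes are the identity. -/
theorem continuous_adMap : Continuous (adMap (EK := EK) : K → EK →L[ℝ] EK) := by
  have : IsManifold 𝓘(ℝ, EK) ∞ K := inferInstance
  refine continuous_iff_continuousAt.2 fun k => ?_
  have h1 := ContMDiffAt.mfderiv (I := 𝓘(ℝ, EK)) (I' := 𝓘(ℝ, EK)) (J := 𝓘(ℝ, EK)) (m := 0)
    (n := ∞) (x₀ := k) (fun k g : K => k * g * k⁻¹) (fun _ : K => (1 : K))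
    contMDiff_conj.contMDiffAt contMDiffAt_const (by simp)
  have h2 := h1.continuousAt
  have he : (fun l : K => l * 1 * l⁻¹) = fun _ => 1 := by funext l; simp
  rw [he] at h2
  refine h2.congr (Eventually.of_forall fun l => ?_)
  refine (inTangentCoordinates_eq (I := 𝓘(ℝ, EK)) (I' := 𝓘(ℝ, EK)) (fun _ : K => (1 : K))
    (fun _ : K => (1 : K)) (fun l => adMap l) (x₀ := k) (x := l)
    (mem_chart_source EK (1 : K)) (mem_chart_source EK (1 : K))).trans ?_
  ext v
  have h3 : ∀ w : EK, (tangentBundleCore 𝓘(ℝ, EK) K).coordChange (achart EK (1 : K))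
      (achart EK (1 : K)) 1 w = w := fun w =>
    (tangentBundleCore 𝓘(ℝ, EK) K).coordChange_self (achart EK (1 : K)) 1
      (mem_chart_source EK (1 : K)) w
  change (tangentBundleCore 𝓘(ℝ, EK) K).coordChange (achart EK (1 : K))
      (achart EK (1 : K)) 1 (adMap l ((tangentBundleCore 𝓘(ℝ, EK) K).coordChange
        (achart EK (1 : K)) (achart EK (1 : K)) 1 v)) = adMap l v
  rw [h3, h3]

/-- A multiplicative function on a group that is bounded, as it is here by compactness, cannot
exceed `1` because of the powers; applied to the inverse element, it cannot be below `1`. This makes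
the density on a transversal independent of translations by `K`. -/
theorem abs_det_adMap [FiniteDimensional ℝ EK] [CompactSpace K] (k : K) :
    |LinearMap.det (adMap (EK := EK) k).toLinearMap| = 1 := by
  have hmul : ∀ k l : K, |LinearMap.det (adMap (EK := EK) (k * l)).toLinearMap| =
      |LinearMap.det (adMap (EK := EK) k).toLinearMap| *
        |LinearMap.det (adMap (EK := EK) l).toLinearMap| := by
    intro k l
    rw [adMap_mul, ← abs_mul, ← LinearMap.det_comp]
    rfl
  have hone : |LinearMap.det (adMap (EK := EK) (1 : K)).toLinearMap| = 1 := by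
    rw [adMap_one]
    change |LinearMap.det (LinearMap.id : EK →ₗ[ℝ] EK)| = 1
    simp
  have hcont : Continuous fun k : K => |LinearMap.det (adMap (EK := EK) k).toLinearMap| :=
    (ContinuousLinearMap.continuous_det.comp continuous_adMap).abs
  obtain ⟨C, hC⟩ := (isCompact_range hcont).bddAbove
  have hpow : ∀ (k : K) (j : ℕ), |LinearMap.det (adMap (EK := EK) (k ^ j)).toLinearMap| =
      |LinearMap.det (adMap (EK := EK) k).toLinearMap| ^ j := by
    intro k j
    induction j with
    | zero => rw [pow_zero, pow_zero, hone]
    | succ j ih => rw [pow_succ, pow_succ, hmul, ih]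
  have hle : ∀ k : K, |LinearMap.det (adMap (EK := EK) k).toLinearMap| ≤ 1 := by
    intro k
    by_contra hcon
    push Not at hcon
    obtain ⟨j, hj⟩ := pow_unbounded_of_one_lt C hcon
    rw [← hpow] at hj
    exact absurd (hC ⟨k ^ j, rfl⟩) (not_le.2 hj)
  refine le_antisymm (hle k) ?_
  have h1 := hmul k k⁻¹
  rw [mul_inv_cancel, hone] at h1
  have h2 := hle k⁻¹
  have h3 := hle k
  nlinarith [abs_nonneg (LinearMap.det (adMap (EK := EK) k).toLinearMap)]

theorem tmap_smul_tmap_inv_smul [MulAction K M] [ContMDiffSMul 𝓘(ℝ, EK) 𝓘(ℝ, E) ∞ K M]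
    (k : K) (x : M) (v : E) :
    tmap E E (fun x : M => k • x) x (tmap E E (fun x : M => k⁻¹ • x) (k • x) v) = v := by
  have h2 := tmap_comp_apply (E' := E) (g := fun x : M => k • x) (f := fun x : M => k⁻¹ • x) (x := k • x)
    (mdifferentiableAt_smul_right (EG := EK) k _) (mdifferentiableAt_smul_right (EG := EK) k⁻¹ _) v
  simp only [smul_inv_smul, inv_smul_smul] at h2
  rw [← h2, tmap_id]
  rfl

variable [MulAction K M] [ContMDiffSMul 𝓘(ℝ, EK) 𝓘(ℝ, E) ∞ K M]

theorem tmap_smul_genField (k : K) (ζ : EK) (x : M) :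
    tmap E E (fun x : M => k • x) x (genField E (G := K) ζ x) =
      genField E (G := K) (adMap k ζ) (k • x) := by
  have h1 : (fun g : K => k • g • x) = fun g : K => (k * g * k⁻¹) • k • x := by
    funext g; simp [mul_smul]
  have h2 := tmap_comp_apply (E' := E) (g := fun x : M => k • x) (f := fun g : K => g • x) (x := 1)
    (mdifferentiableAt_smul_right (EG := EK) k _) (mdifferentiableAt_smul_left (E := E) 1 x) ζ
  have h3 := tmap_comp_apply (E' := EK) (g := fun g : K => g • k • x) (f := fun g : K => k * g * k⁻¹) (x := 1)
    (mdifferentiableAt_smul_left (E := E) _ (k • x)) (mdifferentiableAt_conj k 1) ζ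
  rw [h1] at h2
  rw [h2] at h3
  simp only [one_smul, mul_one, mul_inv_cancel] at h3
  exact h3

/-- The derivative of an orbit map at an arbitrary group element. -/
theorem tmap_orbit_mul_right (k : K) (x : M) (ζ : EK) :
    tmap EK E (fun g : K => g • x) k (tmap EK EK (fun g : K => g * k) 1 ζ) =
      genField E (G := K) ζ (k • x) := by
  have h2 := tmap_comp_apply (E' := EK) (g := fun g : K => g • x) (f := fun g : K => g * k) (x := 1)
    (mdifferentiableAt_smul_left (E := E) _ x) (mdifferentiableAt_mul_right k 1) ζ
  simp only [one_mul, mul_smul] at h2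
  exact h2.symm

theorem tmap_orbit_mul_left (k : K) (x : M) (ζ : EK) :
    tmap EK E (fun g : K => g • x) k (tmap EK EK (fun g : K => k * g) 1 ζ) =
      tmap E E (fun x : M => k • x) x (genField E (G := K) ζ x) := by
  have h2 := tmap_comp_apply (E' := EK) (g := fun g : K => g • x) (f := fun g : K => k * g) (x := 1)
    (mdifferentiableAt_smul_left (E := E) _ x) (mdifferentiableAt_mul_left k 1) ζ
  have h3 := tmap_comp_apply (E' := E) (g := fun x : M => k • x) (f := fun g : K => g • x) (x := 1)
    (mdifferentiableAt_smul_right (EG := EK) k _) (mdifferentiableAt_smul_left (E := E) 1 x) ζ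
  simp only [mul_smul, mul_one, one_smul] at h2 h3
  rw [h3] at h2
  exact h2.symm

/-- The generators of a free action do not vanish. -/
theorem eq_zero_of_genField_eq_zero [CompleteSpace EK] [IsManifold 𝓘(ℝ, E) ∞ M] [T2Space M]
    (hfree : ∀ (k : K) (x : M), k • x = x → k = 1) {x : M} {ζ : EK}
    (h0 : genField E (G := K) ζ x = 0) : ζ = 0 := by
  have : LieGroup 𝓘(ℝ, EK) (minSmoothness ℝ 3) K :=
    LieGroup.of_le (n := ∞) (by simp; exact WithTop.coe_le_coe.2 (le_top : (3 : ℕ∞) ≤ ⊤))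
  have : IsManifold 𝓘(ℝ, EK) 1 K := IsManifold.of_le (n := ∞) (by simp)
  -- The curve `γ` follows the left-invariant field of `ζ` from `1`. Then `γ t • x` has zero
  -- velocity, so it stays at `x`; freeness gives `γ = 1` near zero, and the velocity of `γ` at zero
  -- is `ζ`.
  obtain ⟨γ, hγ0, hγ⟩ := exists_isMIntegralCurveAt_of_contMDiffAt_boundaryless (t₀ := 0)
    (v := mulInvariantVectorField (I := 𝓘(ℝ, EK)) (G := K) ζ) (x₀ := 1)
    ((contMDiffAt_mulInvariantVectorField (I := 𝓘(ℝ, EK)) (G := K) ζ).of_le (by simp))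
  have hu : ∀ᶠ t in 𝓝 (0 : ℝ), HasMFDerivAt 𝓘(ℝ, ℝ) 𝓘(ℝ, E) (fun t => γ t • x) t
      ((1 : ℝ →L[ℝ] ℝ).smulRight (0 : E) : ℝ →L[ℝ] E) := by
    filter_upwards [hγ] with t ht
    have h1 := (mdifferentiableAt_smul_left (E := E) (γ t) x).hasMFDerivAt.comp t ht
    refine h1.congr_mfderiv ?_
    have h2 : tmap EK E (fun g : K => g • x) (γ t) (tmap EK EK (fun g : K => γ t * g) 1 ζ) = 0 := by
      rw [tmap_orbit_mul_left, h0, map_zero]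
    have h3 : (tmap EK E (fun g : K => g • x) (γ t)).comp ((1 : ℝ →L[ℝ] ℝ).smulRight
        (tmap EK EK (fun g : K => γ t * g) 1 ζ)) = (1 : ℝ →L[ℝ] ℝ).smulRight (0 : E) := by
      ext
      simp [h2]
    exact h3
  obtain ⟨δ, hδ, hball⟩ := Metric.eventually_nhds_iff_ball.1 hu
  have hC2 : IsC2Field (fun _ : M => (0 : E)) := fun x₀ => by
    have : chartField (fun _ : M => (0 : E)) x₀ = fun _ => 0 := by
      funext y
      exact map_zero _
    rw [this]
    exact contDiffOn_const
  have hcurve : IsMIntegralCurveOn (I := 𝓘(ℝ, E)) (fun t => γ t • x) (fun _ : M => (0 : E))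
      (Metric.ball 0 δ) := fun t ht => (hball t ht).hasMFDerivWithinAt
  have hconst : IsMIntegralCurveOn (I := 𝓘(ℝ, E)) (fun _ => x) (fun _ : M => (0 : E))
      (Metric.ball 0 δ) := fun t _ => by
    refine (hasMFDerivAt_const x t).hasMFDerivWithinAt.congr_mfderiv ?_
    have : (0 : ℝ →L[ℝ] E) = (1 : ℝ →L[ℝ] ℝ).smulRight (0 : E) := by ext; simp
    exact this
  have heq := eqOn_of_isMIntegralCurveOn hC2 (convex_ball (0 : ℝ) δ).ordConnected hcurve hconst
    (Metric.mem_ball_self hδ) (by simp [hγ0])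
  have hγ1 : γ =ᶠ[𝓝 0] fun _ => 1 := by
    filter_upwards [Metric.ball_mem_nhds (0 : ℝ) hδ] with t ht using hfree _ x (heq ht)
  have hd0 : HasMFDerivAt 𝓘(ℝ, ℝ) 𝓘(ℝ, EK) γ 0
      ((1 : ℝ →L[ℝ] ℝ).smulRight (tmap EK EK (fun g : K => γ 0 * g) 1 ζ) : ℝ →L[ℝ] EK) :=
    hγ.self_of_nhds
  have h4 := hd0.tmap_eq
  rw [tmap_congr hγ1, tmap_const] at h4
  have h5 := congrArg (fun L : ℝ →L[ℝ] EK => L 1) h4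
  have h6 : (fun g : K => γ 0 * g) = fun g => g := by funext g; simp [hγ0]
  rw [h6, tmap_id] at h5
  simpa using h5.symm

end GroupAction

/-! ### Invariance under a Hamiltonian action. -/

section HamiltonianInvariance

variable {E : Type*} [NormedAddCommGroup E] [NormedSpace ℝ E] [FiniteDimensional ℝ E]
  {M : Type*} [TopologicalSpace M] [ChartedSpace E M]
  {EK : Type*} [NormedAddCommGroup EK] [NormedSpace ℝ EK]
  {K : Type*} [TopologicalSpace K] [ChartedSpace EK K] [Group K] [LieGroup 𝓘(ℝ, EK) ∞ K]
  [MulAction K M] [ContMDiffSMul 𝓘(ℝ, EK) 𝓘(ℝ, E) ∞ K M]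
  {ωM : SymplecticForm E M}

/-- A function which Poisson commutes with the momentum map of a connected group is invariant. -/
theorem smul_eq_of_poissonBracket_eq_zero [PreconnectedSpace K]
    {Ψ : M → Module.Dual ℝ (GroupLieAlgebra 𝓘(ℝ, EK) K)} (hΨ : IsHamiltonianAction ωM Ψ)
    {f : M → ℝ} (hf : ContMDiff 𝓘(ℝ, E) 𝓘(ℝ, ℝ) ∞ f)
    (h0 : ∀ (ζ : EK) (x : M), poissonBracket ωM f (fun y => Ψ y ζ) x = 0) (k : K) (x : M) :
    f (k • x) = f x := by
  have hsm : ContMDiff 𝓘(ℝ, EK) 𝓘(ℝ, ℝ) ∞ fun g : K => f (g • x) :=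
    hf.comp (contMDiff_id.smul contMDiff_const)
  have h1 := eq_of_tmap_eq_zero hsm (fun g => ?_) k 1
  · simpa using h1
  ext v
  -- Every tangent vector of `K` at `g` is the right translate of one at `1`. The derivative of `g ↦
  -- f (g • x)` is therefore a derivative of `f` along a generator at `g • x`, that is, a Poisson
  -- bracket.
  have hv : v = tmap EK EK (fun l : K => l * g) 1 (tmap EK EK (fun l : K => l * g⁻¹) g v) := by
    have h2 := tmap_comp_apply (E' := EK) (g := fun l : K => l * g) (f := fun l : K => l * g⁻¹)
      (x := g) (mdifferentiableAt_mul_right _ _) (mdifferentiableAt_mul_right _ _) v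
    simp only [inv_mul_cancel_right, mul_inv_cancel] at h2
    rw [← h2, tmap_id]
    rfl
  rw [tmap_comp_apply (E' := E) (g := f) (f := fun g : K => g • x)
    (hf.mdifferentiableAt (by simp)) (mdifferentiableAt_smul_left (E := E) g x), hv,
    tmap_orbit_mul_right, ← hΨ.hamField_eq, ← poissonBracket_eq, h0]
  rfl

variable {Ψ : M → Module.Dual ℝ (GroupLieAlgebra 𝓘(ℝ, EK) K)} (hΨ : IsHamiltonianAction ωM Ψ)
include hΨ

theorem preservesForm_smul (k : K) (x : M) :
    PreservesForm ωM x (k • x) (tmap E E (fun x : M => k • x) x) :=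
  fun u w => hΨ.symplectic k x u w

/-- The Hamiltonian field is determined by ω and `dh`, and the translation by `k` preserves both. -/
theorem tmap_smul_hamField {h : M → ℝ} (hh : ContMDiff 𝓘(ℝ, E) 𝓘(ℝ, ℝ) ∞ h)
    (hK : ∀ (k : K) (x : M), h (k • x) = h x) (k : K) (x : M) :
    tmap E E (fun x : M => k • x) x (hamField ωM h x) = hamField ωM h (k • x) := by
  symm
  refine hamField_unique ωM fun v => ?_
  have h2 := tmap_comp_apply (E' := E) (g := h) (f := fun x : M => k • x) (x := x)
    (hh.mdifferentiableAt (by simp)) (mdifferentiableAt_smul_right (EG := EK) k x)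
  simp only [hK] at h2
  rw [← tmap_smul_tmap_inv_smul (EK := EK) k x v, preservesForm_smul hΨ, ← h2]
  exact tmap_eq_formAt ωM h x _

theorem FlowsTo.smul {h : M → ℝ} (hh : ContMDiff 𝓘(ℝ, E) 𝓘(ℝ, ℝ) ∞ h)
    (hK : ∀ (k : K) (x : M), h (k • x) = h x) {t : ℝ} {x y : M}
    (H : FlowsTo (hamiltonianField ωM h) t x y) (k : K) :
    FlowsTo (hamiltonianField ωM h) t (k • x) (k • y) := by
  obtain ⟨γ, h1, h2, h3⟩ := H
  refine ⟨fun s => k • γ s, fun s hs => ?_, by simp only [h2], by simp only [h3]⟩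
  have h4 := (mdifferentiableAt_smul_right (E := E) (EG := EK) k
    (γ s)).hasMFDerivAt.comp_hasMFDerivWithinAt s (h1 s hs)
  refine h4.congr_mfderiv ?_
  have h5 : (tmap E E (fun x : M => k • x) (γ s)).comp ((1 : ℝ →L[ℝ] ℝ).smulRight
      (hamField ωM h (γ s))) = (1 : ℝ →L[ℝ] ℝ).smulRight (hamField ωM h (k • γ s)) := by
    ext
    simp [tmap_smul_hamField hΨ hh hK]
  exact h5

theorem poissonBracket_smul {f h : M → ℝ} (hf : ContMDiff 𝓘(ℝ, E) 𝓘(ℝ, ℝ) ∞ f)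
    (hfK : ∀ (k : K) (x : M), f (k • x) = f x) (hh : ContMDiff 𝓘(ℝ, E) 𝓘(ℝ, ℝ) ∞ h)
    (hK : ∀ (k : K) (x : M), h (k • x) = h x) (k : K) (x : M) :
    poissonBracket ωM f h (k • x) = poissonBracket ωM f h x := by
  have h2 := tmap_comp_apply (E' := E) (g := f) (f := fun x : M => k • x) (x := x)
    (hf.mdifferentiableAt (by simp)) (mdifferentiableAt_smul_right (EG := EK) k x)
  simp only [hfK] at h2
  rw [poissonBracket_eq, ← tmap_smul_hamField hΨ hh hK, ← h2]
  rfl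

end HamiltonianInvariance

end InvariantRelations

end

noncomputable section

namespace InvariantRelations

open Set Filter Topology

/-! ### Densities and their transformation under linear maps. -/

section Density

/-- It is applied with `A` the adjoint map, `D` the Jacobian of a change of transversal, and `C` the
sliding along the orbits, which has no influence on the determinant. -/
theorem det_triangular {V W : Type*} [AddCommGroup V] [Module ℝ V] [FiniteDimensional ℝ V]
    [AddCommGroup W] [Module ℝ W] [FiniteDimensional ℝ W] (A : V →ₗ[ℝ] V) (C : W →ₗ[ℝ] V)
    (D : W →ₗ[ℝ] W) :
    LinearMap.det ((A.coprod C).prod (D ∘ₗ LinearMap.snd ℝ V W)) =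
      LinearMap.det A * LinearMap.det D := by
  classical
  let b := Module.finBasis ℝ V
  let b' := Module.finBasis ℝ W
  rw [← LinearMap.det_toMatrix (b.prod b'), ← LinearMap.det_toMatrix b,
    ← LinearMap.det_toMatrix b', ← Matrix.det_fromBlocks_zero₂₁ _ (LinearMap.toMatrix b' b C)]
  congr 1
  ext (i | i) (j | j) <;> simp [LinearMap.toMatrix_apply]

theorem append_update_natAdd {p m : ℕ} {α : Type*} (w : Fin p → α) (v : Fin m → α) (i : Fin m)
    (x : α) : Fin.append w (Function.update v i x) =
      Function.update (Fin.append w v) (Fin.natAdd p i) x := by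
  funext j
  refine Fin.addCases (fun j => ?_) (fun j => ?_) j
  · rw [Fin.append_left, Function.update_of_ne
      (by simp [Fin.ext_iff]; omega), Fin.append_left]
  · rw [Fin.append_right]
    rcases eq_or_ne j i with rfl | hj
    · rw [Function.update_self, Function.update_self]
    · rw [Function.update_of_ne hj, Function.update_of_ne
        (fun h => hj (Fin.natAdd_injective _ _ h)), Fin.append_right]

/-- Fixing the first `p` arguments of an alternating map of `p + m` arguments. -/
def fixLeft {V : Type*} [AddCommGroup V] [Module ℝ V] {p m : ℕ}
    (g : V [⋀^Fin (p + m)]→ₗ[ℝ] ℝ) (w : Fin p → V) : V [⋀^Fin m]→ₗ[ℝ] ℝ where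
  toFun v := g (Fin.append w v)
  map_update_add' := by
    intro inst w i x y
    obtain rfl := Subsingleton.elim inst (instDecidableEqFin _)
    rw [append_update_natAdd, append_update_natAdd, append_update_natAdd, g.map_update_add]
  map_update_smul' := by
    intro inst w i c x
    obtain rfl := Subsingleton.elim inst (instDecidableEqFin _)
    rw [append_update_natAdd, append_update_natAdd, g.map_update_smul]
  map_eq_zero_of_eq' := by
    intro w i j hij hne
    refine g.map_eq_zero_of_eq _ (i := Fin.natAdd p i) (j := Fin.natAdd p j) ?_
      fun h => hne (Fin.natAdd_injective _ _ h)
    rw [Fin.append_right, Fin.append_right, hij]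

theorem alternating_comp_eq_det_mul {V Q : Type*} [AddCommGroup V] [Module ℝ V]
    [AddCommGroup Q] [Module ℝ Q] {m : ℕ} (b : Module.Basis (Fin m) ℝ Q)
    (g : V [⋀^Fin m]→ₗ[ℝ] ℝ) (T : Q →ₗ[ℝ] V) (S : Q →ₗ[ℝ] Q) :
    g (fun i => T (S (b i))) = LinearMap.det S * g fun i => T (b i) := by
  have h1 := (g.compLinearMap T).eq_smul_basis_det b
  have h2 : ∀ v : Fin m → Q, g (fun i => T (v i)) = g (fun i => T (b i)) * b.det v := fun v =>
    congrArg (fun f : Q [⋀^Fin m]→ₗ[ℝ] ℝ => f v) h1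
  have h3 := b.det_comp S b
  rw [b.det_self, mul_one] at h3
  rw [h2 (fun i => S (b i)), mul_comm]
  congr 1

variable {E : Type*} [NormedAddCommGroup E] [NormedSpace ℝ E]
  {M : Type*} [TopologicalSpace M] [ChartedSpace E M]
  (ωM : SymplecticForm E M) {n p m : ℕ} (hdim : 2 * n = p + m) (φ : Fin p → M → ℝ)
  {Q : Type*} [NormedAddCommGroup Q] [NormedSpace ℝ Q] (b : Module.Basis (Fin m) ℝ Q)

/-- The absolute value of the restricted volume on the image of a basis. -/
def volDensity (x : M) (T : Q →L[ℝ] E) : ℝ := |restrictedVolumeAt ωM hdim φ x fun i => T (b i)|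

theorem volDensity_comp (x : M) (T : Q →L[ℝ] E) (S : Q →L[ℝ] Q) :
    volDensity ωM hdim φ b x (T.comp S) =
      |LinearMap.det S.toLinearMap| * volDensity ωM hdim φ b x T := by
  rw [volDensity, volDensity, ← abs_mul, restrictedVolumeAt_eq, restrictedVolumeAt_eq]
  exact congrArg abs (alternating_comp_eq_det_mul b
    (fixLeft (volAt ωM hdim x) (dualFrameAt E φ x)) T.toLinearMap S.toLinearMap)

theorem volDensity_pos [FiniteDimensional ℝ E] (hE : Module.finrank ℝ E = 2 * n) {x : M}
    (hx : IsRegularAt E φ x) {T : Q →L[ℝ] E} (hT : ∀ q α, tmap E ℝ (φ α) x (T q) = 0)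
    (hinj : Function.Injective T) : 0 < volDensity ωM hdim φ b x T := by
  refine abs_pos.2 (restrictedVolumeAt_ne_zero ωM hdim hE hx (fun i α => hT _ α) ?_)
  exact b.linearIndependent.map' T.toLinearMap (LinearMap.ker_eq_bot.2 hinj)

end Density

/-! ### Slice charts: coordinates along the orbits, across them, and across the level set. -/

section SliceChart

variable {E : Type*} [NormedAddCommGroup E] [NormedSpace ℝ E]
  {M : Type*} [TopologicalSpace M] [ChartedSpace E M]
  {EK : Type*} [NormedAddCommGroup EK] [NormedSpace ℝ EK]
  {K : Type*} [TopologicalSpace K] [ChartedSpace EK K] [Group K] [MulAction K M]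
  {Y : Type*} [NormedAddCommGroup Y] [NormedSpace ℝ Y] {p : ℕ}

variable (E) in
/-- A chart `S` at `x` with coordinates `((ζ, z), c)`, such that the functions `φ` are the
coordinates `c` and the orbits of `K` are the sets where `z` and `c` are constant. -/
structure IsSliceChart (φ : Fin p → M → ℝ) (x : M)
    (S : OpenPartialHomeomorph M ((EK × Y) × (Fin p → ℝ))) (κ : EK → K) (D : EK ≃L[ℝ] EK)
    (r : ℝ) : Prop where
  smooth : IsSmoothChart E ((EK × Y) × (Fin p → ℝ)) S
  pos : 0 < r
  ball_subset : Metric.ball 0 r ⊆ S.target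
  symm_zero : S.symm 0 = x
  κ_zero : κ 0 = 1
  κ_diff : MDifferentiableAt 𝓘(ℝ, EK) 𝓘(ℝ, EK) κ 0
  κ_deriv : tmap EK EK κ 0 = D
  snd_eq : ∀ y ∈ S.source, ∀ α, (S y).2 α = φ α y
  symm_eq : ∀ q ∈ Metric.ball 0 r, S.symm q = κ q.1.1 • S.symm ((0, q.1.2), q.2)
  inj : ∀ (k : K) (z z' : Y) (c c' : Fin p → ℝ), ((0, z), c) ∈ Metric.ball (0 : (EK × Y) × _) r →
    ((0, z'), c') ∈ Metric.ball (0 : (EK × Y) × _) r →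
    k • S.symm ((0, z), c) = S.symm ((0, z'), c') → z = z' ∧ c = c'

theorem IsSliceChart.mono {φ : Fin p → M → ℝ} {x : M}
    {S : OpenPartialHomeomorph M ((EK × Y) × (Fin p → ℝ))} {κ : EK → K} {D : EK ≃L[ℝ] EK}
    {r r' : ℝ} (h : IsSliceChart E φ x S κ D r) (hr' : 0 < r') (hrr : r' ≤ r) :
    IsSliceChart E φ x S κ D r' where
  smooth := h.smooth
  pos := hr'
  ball_subset := (Metric.ball_subset_ball hrr).trans h.ball_subset
  symm_zero := h.symm_zero
  κ_zero := h.κ_zero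
  κ_diff := h.κ_diff
  κ_deriv := h.κ_deriv
  snd_eq := h.snd_eq
  symm_eq := fun q hq => h.symm_eq q (Metric.ball_subset_ball hrr hq)
  inj := fun k z z' c c' hz hz' => h.inj k z z' c c' (Metric.ball_subset_ball hrr hz)
    (Metric.ball_subset_ball hrr hz')

variable [FiniteDimensional ℝ E] [FiniteDimensional ℝ EK] [FiniteDimensional ℝ Y]

/-- Linear coordinates on a space adapted to independent functionals and to the image, in their
common kernel, of an injective linear map. -/
theorem exists_adapted_equiv {F : Fin p → E →L[ℝ] ℝ} {w : Fin p → E}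
    (hF : ∀ α β, F α (w β) = if α = β then 1 else 0) {J : EK →L[ℝ] E}
    (hJ : Function.Injective J) (hFJ : ∀ α ζ, F α (J ζ) = 0)
    (hdim : Module.finrank ℝ E = p + (Module.finrank ℝ EK + Module.finrank ℝ Y)) :
    ∃ A : E ≃L[ℝ] (EK × Y) × (Fin p → ℝ), (∀ ζ, A (J ζ) = ((ζ, 0), 0)) ∧
      ∀ v α, (A v).2 α = F α v := by
  let N := (LinearMap.pi fun α => (F α).toLinearMap).ker
  have hN : ∀ v, v ∈ N ↔ ∀ α, F α v = 0 := fun v => by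
    rw [LinearMap.mem_ker]
    exact ⟨fun h α => congrFun h α, fun h => funext h⟩
  have hNdim : Module.finrank ℝ N = Module.finrank ℝ EK + Module.finrank ℝ Y :=
    finrank_iInf_ker (ℓ := fun α => (F α).toLinearMap) hF hdim
  let J' : EK →ₗ[ℝ] N := J.toLinearMap.codRestrict N fun ζ => (hN _).2 fun α => hFJ α ζ
  have hJ' : Function.Injective J' := fun a b hab => hJ (congrArg Subtype.val hab)
  obtain ⟨P, hP⟩ := Submodule.exists_isCompl (LinearMap.range J')
  have hPdim : Module.finrank ℝ Y = Module.finrank ℝ P := by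
    have h1 := Submodule.finrank_add_eq_of_isCompl hP
    rw [LinearMap.finrank_range_of_inj hJ', hNdim] at h1
    omega
  let e : Y ≃ₗ[ℝ] P := LinearEquiv.ofFinrankEq Y P hPdim
  -- The three blocks are the image of `J`, a complement of this image in the common kernel `N`, and
  -- the span of the vectors dual to the functionals. The required equivalence is the inverse of
  -- `L`.
  let L : (EK × Y) × (Fin p → ℝ) →ₗ[ℝ] E :=
    (J.toLinearMap.coprod (N.subtype ∘ₗ P.subtype ∘ₗ e.toLinearMap)).coprod
      (Fintype.linearCombination ℝ w)
  have hL : ∀ q, L q = J q.1.1 + (e q.1.2 : N) + ∑ β, q.2 β • w β := fun q => rfl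
  have hFL : ∀ q α, F α (L q) = q.2 α := by
    intro q α
    have h1 : F α ((e q.1.2 : N) : E) = 0 := (hN _).1 (e q.1.2 : N).2 α
    rw [hL, map_add, map_add, hFJ, h1]
    simp [hF]
  have hLinj : Function.Injective L := by
    rw [← LinearMap.ker_eq_bot, LinearMap.ker_eq_bot']
    intro q hq
    have h2 : q.2 = 0 := by
      funext α
      rw [← hFL, hq, map_zero]
      rfl
    have h3 : J' q.1.1 + (e q.1.2 : N) = 0 := by
      apply Subtype.ext
      have := hL q
      rw [hq, h2] at this
      change J q.1.1 + ((e q.1.2 : N) : E) = 0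
      simpa using this.symm
    have h4 : J' q.1.1 = 0 := by
      have h5 : J' q.1.1 ∈ P := by
        rw [eq_neg_of_add_eq_zero_left h3]
        exact P.neg_mem (e q.1.2).2
      exact (Submodule.mem_bot ℝ).1 (hP.disjoint.le_bot ⟨LinearMap.mem_range_self _ _, h5⟩)
    have h6 : q.1.1 = 0 := hJ' (by rw [h4, map_zero])
    rw [h4, zero_add] at h3
    have h7 : q.1.2 = 0 := e.injective (by rw [map_zero]; exact Subtype.ext h3)
    exact Prod.ext (Prod.ext h6 h7) h2
  let A' := LinearEquiv.ofInjectiveOfFinrankEq L hLinj (by simp [hdim]; ring)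
  have hA' : ∀ q, A' q = L q := fun q => rfl
  refine ⟨A'.symm.toContinuousLinearEquiv, fun ζ => ?_, fun v α => ?_⟩
  · change A'.symm (J ζ) = _
    rw [LinearEquiv.symm_apply_eq, hA', hL]
    simp
  · change (A'.symm v).2 α = _
    rw [← hFL, ← hA', LinearEquiv.apply_symm_apply]

variable [IsManifold 𝓘(ℝ, E) ∞ M] [T2Space M] [LieGroup 𝓘(ℝ, EK) ∞ K] [CompactSpace K]
  [ContMDiffSMul 𝓘(ℝ, EK) 𝓘(ℝ, E) ∞ K M]

/-- Chart coordinates on a Lie group near `1`, centred at `1`. -/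
def groupParam (EK K : Type*) [NormedAddCommGroup EK] [NormedSpace ℝ EK] [TopologicalSpace K]
    [ChartedSpace EK K] [Group K] (ζ : EK) : K :=
  (extChartAt 𝓘(ℝ, EK) (1 : K)).symm (extChartAt 𝓘(ℝ, EK) (1 : K) 1 + ζ)

theorem groupParam_zero : groupParam EK K 0 = 1 := by
  rw [groupParam, add_zero, extChartAt_to_inv]

theorem contMDiffAt_groupParam {ζ : EK}
    (hζ : extChartAt 𝓘(ℝ, EK) (1 : K) 1 + ζ ∈ (extChartAt 𝓘(ℝ, EK) (1 : K)).target) :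
    ContMDiffAt 𝓘(ℝ, EK) 𝓘(ℝ, EK) ∞ (groupParam EK K) ζ := by
  have h1 : ContMDiffAt 𝓘(ℝ, EK) 𝓘(ℝ, EK) ∞ (fun ζ => extChartAt 𝓘(ℝ, EK) (1 : K) 1 + ζ) ζ :=
    (contDiff_const.add contDiff_id).contDiffAt.contMDiffAt
  exact ContMDiffAt.comp ζ (g := (extChartAt 𝓘(ℝ, EK) (1 : K)).symm) (contMDiffAt_chart_symm hζ) h1

theorem exists_groupParam_deriv : ∃ D : EK ≃L[ℝ] EK, tmap EK EK (groupParam EK K) 0 = D := by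
  have ht := mem_extChartAt_target (I := 𝓘(ℝ, EK)) (1 : K)
  have hs := mem_extChartAt_source (I := 𝓘(ℝ, EK)) (1 : K)
  have h1 : ∀ v, tmap EK EK (groupParam EK K) 0 v =
      tmap EK EK (extChartAt 𝓘(ℝ, EK) (1 : K)).symm (extChartAt 𝓘(ℝ, EK) (1 : K) 1) v := by
    intro v
    have hd : HasFDerivAt (fun ζ : EK => extChartAt 𝓘(ℝ, EK) (1 : K) 1 + ζ)
      (ContinuousLinearMap.id ℝ EK) 0 := (hasFDerivAt_id (0 : EK)).const_add _
    have h2 := tmap_comp_apply (E' := EK) (g := (extChartAt 𝓘(ℝ, EK) (1 : K)).symm)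
      (f := fun ζ : EK => extChartAt 𝓘(ℝ, EK) (1 : K) 1 + ζ) (x := 0)
      (by rw [add_zero]; exact mdifferentiableAt_chart_symm ht)
      hd.differentiableAt.mdifferentiableAt v
    rw [tmap_eq_fderiv, hd.fderiv, add_zero] at h2
    exact h2
  have hl : ∀ v, tmap EK EK (extChartAt 𝓘(ℝ, EK) (1 : K)) 1 (tmap EK EK (groupParam EK K) 0 v) =
      v := fun v => by
    have := tmap_chart_tmap_symm ht v
    rwa [extChartAt_to_inv, ← h1] at this
  have hr : ∀ v, tmap EK EK (groupParam EK K) 0 (tmap EK EK (extChartAt 𝓘(ℝ, EK) (1 : K)) 1 v) =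
      v := fun v => by
    rw [h1]
    exact tmap_symm_tmap_chart hs v
  exact ⟨ContinuousLinearEquiv.equivOfInverse _ _ hl hr, by ext; rfl⟩

end SliceChart

end InvariantRelations

end

noncomputable section

namespace InvariantRelations

open Set Filter Topology

/-! ### Existence of slices for a free action of a compact group. -/

section SliceExistence

variable {E : Type*} [NormedAddCommGroup E] [NormedSpace ℝ E] [FiniteDimensional ℝ E]
  {M : Type*} [TopologicalSpace M] [ChartedSpace E M] [IsManifold 𝓘(ℝ, E) ∞ M] [T2Space M]
  {EK : Type*} [NormedAddCommGroup EK] [NormedSpace ℝ EK] [FiniteDimensional ℝ EK]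
  {K : Type*} [TopologicalSpace K] [ChartedSpace EK K] [Group K] [LieGroup 𝓘(ℝ, EK) ∞ K]
  [CompactSpace K] [MulAction K M]
  {p : ℕ}

theorem contMDiff_smul_pair [ContMDiffSMul 𝓘(ℝ, EK) 𝓘(ℝ, E) ∞ K M] :
    ContMDiff (𝓘(ℝ, EK).prod 𝓘(ℝ, E)) 𝓘(ℝ, E) ∞ fun q : K × M => q.1 • q.2 :=
  contMDiff_fst.smul contMDiff_snd

theorem continuous_smul_pair [ContMDiffSMul 𝓘(ℝ, EK) 𝓘(ℝ, E) ∞ K M] : Continuous fun q : K × M => q.1 • q.2 :=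
  (contMDiff_smul_pair (E := E) (EK := EK)).continuous

/-- Points moved away from each other by group elements far from `1`. -/
theorem exists_nhds_smul_ne [ContMDiffSMul 𝓘(ℝ, EK) 𝓘(ℝ, E) ∞ K M]
    (hfree : ∀ (k : K) (x : M), k • x = x → k = 1)
    {N : Set K} (hN : IsOpen N) (h1 : 1 ∈ N) (x : M) :
    ∃ O : Set M, IsOpen O ∧ x ∈ O ∧ ∀ k : K, ∀ y ∈ O, k • y ∈ O → k ∈ N := by
  have hopen : IsOpen {q : K × (M × M) | q.1 • q.2.1 ≠ q.2.2} := by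
    have h2 : Continuous fun q : K × (M × M) => q.1 • q.2.1 :=
      (continuous_smul_pair (E := E) (EK := EK)).comp
        (continuous_fst.prodMk (continuous_fst.comp continuous_snd))
    exact isOpen_ne_fun h2 (continuous_snd.comp continuous_snd)
  -- The group elements outside `N` form a compact set and by freeness none of them fixes `x`, so
  -- they move a whole neighbourhood of `x` off itself.
  obtain ⟨u, v, -, hv, hu, hxv, huv⟩ := generalized_tube_lemma (hN.isClosed_compl.isCompact)
    (isCompact_singleton (x := (x, x))) hopen (by
      rintro ⟨k, q⟩ ⟨hk, hq⟩ he
      rw [mem_singleton_iff] at hq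
      simp only at hq he
      subst hq
      exact hk (hfree k x he ▸ h1))
  obtain ⟨O₁, O₂, hO₁, hO₂, hx₁, hx₂, hsub⟩ := isOpen_prod_iff.1 hv x x (hxv rfl)
  refine ⟨O₁ ∩ O₂, hO₁.inter hO₂, ⟨hx₁, hx₂⟩, fun k y hy hky => ?_⟩
  by_contra hk
  exact huv (⟨hu hk, hsub ⟨hy.1, hky.2⟩⟩ : (k, (y, k • y)) ∈ u ×ˢ v) rfl

variable [ContMDiffSMul 𝓘(ℝ, EK) 𝓘(ℝ, E) ∞ K M]

/-- First straighten the `φ` by `P`, with the orbit directions at `x` going to the factor `EK`; then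
spread out the transversal by the group, `((ζ, z), c) ↦ κ ζ • P.symm ((0, z), c)`. This map `R` is a
local diffeomorphism, and invariance of the `φ` keeps `c` equal to their values. That different
points of the slice lie on different orbits is not local in the group: it needs freeness and
compactness, which leave only group elements near `1`. -/
theorem exists_isSliceChart {Y : Type*} [NormedAddCommGroup Y] [NormedSpace ℝ Y]
    [FiniteDimensional ℝ Y] (hfree : ∀ (k : K) (x : M), k • x = x → k = 1)
    {φ : Fin p → M → ℝ} (hφ : ∀ α, ContMDiff 𝓘(ℝ, E) 𝓘(ℝ, ℝ) ∞ (φ α))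
    (hφK : ∀ α (k : K) (x : M), φ α (k • x) = φ α x)
    {x : M} (hx : ∀ α, φ α x = 0) (hreg : IsRegularAt E φ x)
    (hdim : Module.finrank ℝ E = p + (Module.finrank ℝ EK + Module.finrank ℝ Y)) :
    ∃ (S : OpenPartialHomeomorph M ((EK × Y) × (Fin p → ℝ))) (κ : EK → K) (D : EK ≃L[ℝ] EK)
      (r : ℝ), IsSliceChart E φ x S κ D r := by
  let e := extChartAt 𝓘(ℝ, E) x
  have hxe : x ∈ e.source := mem_extChartAt_source x
  obtain ⟨w, hw⟩ := hreg
  have hJinj : Function.Injective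
      ((tmap E E e x).comp (tmap EK E (fun g : K => g • x) 1)) := by
    rw [injective_iff_map_eq_zero]
    intro ζ hζ
    refine eq_zero_of_genField_eq_zero (E := E) (K := K) hfree (x := x) ?_
    have h1 := tmap_symm_tmap_chart (x₀ := x) hxe (genField E (G := K) ζ x)
    have h2 : tmap E E e x (genField E (G := K) ζ x) = 0 := hζ
    rw [← h1]
    exact (congrArg _ h2).trans (map_zero _)
  have hsymm : ∀ v, tmap E E e.symm (e x) (tmap E E e x v) = v := fun v =>
    tmap_symm_tmap_chart (x₀ := x) hxe v
  obtain ⟨A, hAJ, hA2⟩ := exists_adapted_equiv (Y := Y)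
    (F := fun α => (tmap E ℝ (φ α) x).comp (tmap E E e.symm (e x)))
    (w := fun β => tmap E E e x (w β))
    (fun α β => by
      change tmap E ℝ (φ α) x (tmap E E e.symm (e x) (tmap E E e x (w β))) = _
      rw [hsymm, hw]) hJinj
    (fun α ζ => by
      change tmap E ℝ (φ α) x (tmap E E e.symm (e x) (tmap E E e x (genField E (G := K) ζ x))) = 0
      rw [hsymm]
      exact tmap_genField_eq_zero ((hφ α).mdifferentiableAt (by simp)) (fun k => hφK α k x) ζ) hdim
  obtain ⟨P, hxP, hPx, -, hP, hPφ, hPd⟩ := exists_straightening hφ hx A fun v α => by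
    rw [hA2]
    change tmap E ℝ (φ α) x (tmap E E e.symm (e x) (tmap E E e x v)) = _
    rw [hsymm]
  have h0P : (0 : (EK × Y) × (Fin p → ℝ)) ∈ P.target := hPx ▸ P.map_source hxP
  have hP0 : P.symm 0 = x := by rw [← hPx, P.left_inv hxP]
  let κ := groupParam EK K
  have hκ0 : κ 0 = 1 := groupParam_zero
  let s : (EK × Y) × (Fin p → ℝ) → (EK × Y) × (Fin p → ℝ) := fun q => ((0, q.1.2), q.2)
  have hs : ContDiff ℝ ∞ s :=
    (contDiff_const.prodMk (contDiff_snd.comp contDiff_fst)).prodMk contDiff_snd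
  let R : (EK × Y) × (Fin p → ℝ) → M := fun q => κ q.1.1 • P.symm (s q)
  let Ω₀ : Set ((EK × Y) × (Fin p → ℝ)) := {q | extChartAt 𝓘(ℝ, EK) (1 : K) 1 + q.1.1 ∈
    (extChartAt 𝓘(ℝ, EK) (1 : K)).target} ∩ s ⁻¹' P.target
  have hΩ₀ : IsOpen Ω₀ :=
    ((isOpen_extChartAt_target (I := 𝓘(ℝ, EK)) (1 : K)).preimage
      (by fun_prop : Continuous fun q : (EK × Y) × (Fin p → ℝ) =>
        extChartAt 𝓘(ℝ, EK) (1 : K) 1 + q.1.1)).inter (P.open_target.preimage hs.continuous)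
  have hR : ∀ q ∈ Ω₀, ContMDiffAt 𝓘(ℝ, (EK × Y) × (Fin p → ℝ)) 𝓘(ℝ, E) ∞ R q := by
    intro q hq
    have h1 : ContMDiffAt 𝓘(ℝ, (EK × Y) × (Fin p → ℝ)) 𝓘(ℝ, EK) ∞
        (fun q : (EK × Y) × (Fin p → ℝ) => κ q.1.1) q :=
      ContMDiffAt.comp (I' := 𝓘(ℝ, EK)) q (g := κ)
        (f := fun q : (EK × Y) × (Fin p → ℝ) => q.1.1) (contMDiffAt_groupParam hq.1)
        ((contDiff_fst.comp contDiff_fst).contMDiff.contMDiffAt)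
    have h2 : ContMDiffAt 𝓘(ℝ, (EK × Y) × (Fin p → ℝ)) 𝓘(ℝ, E) ∞ (fun q => P.symm (s q)) q :=
      ContMDiffAt.comp q (g := P.symm) (f := s) (hP.contMDiffAt_symm hq.2) hs.contMDiff.contMDiffAt
    exact h1.smul h2
  have hRc : ContinuousOn R Ω₀ := fun q hq => (hR q hq).continuousAt.continuousWithinAt
  let Ω := Ω₀ ∩ R ⁻¹' P.source
  have hΩ : IsOpen Ω := hRc.isOpen_inter_preimage hΩ₀ P.open_source
  have hs0 : s 0 = 0 := rfl
  have hR0 : R 0 = x := by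
    change κ 0 • P.symm (s 0) = x
    rw [hκ0, one_smul, hs0, hP0]
  have h0Ω₀ : (0 : (EK × Y) × (Fin p → ℝ)) ∈ Ω₀ := by
    refine ⟨?_, h0P⟩
    change extChartAt 𝓘(ℝ, EK) (1 : K) 1 + 0 ∈ (extChartAt 𝓘(ℝ, EK) (1 : K)).target
    rw [add_zero]
    exact mem_extChartAt_target _
  have h0Ω : (0 : (EK × Y) × (Fin p → ℝ)) ∈ Ω := ⟨h0Ω₀, by rw [mem_preimage, hR0]; exact hxP⟩
  let f : (EK × Y) × (Fin p → ℝ) → (EK × Y) × (Fin p → ℝ) := fun q => P (R q)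
  have hf : ContDiffOn ℝ ∞ f Ω := fun q hq =>
    (ContMDiffAt.comp q (g := P) (f := R) (hP.contMDiffAt hq.2)
      (hR q hq.1)).contDiffAt.contDiffWithinAt
  obtain ⟨D, hD⟩ := exists_groupParam_deriv (EK := EK) (K := K)
  have hκd : MDifferentiableAt 𝓘(ℝ, EK) 𝓘(ℝ, EK) κ 0 :=
    (contMDiffAt_groupParam h0Ω₀.1).mdifferentiableAt (by simp)
  -- The derivative of `P ∘ R` at the origin: it is the identity on the transversal directions,
  -- where `κ 0 = 1` acts trivially, and the derivative `D` of `κ` on the orbit directions.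
  let A' : ((EK × Y) × (Fin p → ℝ)) ≃L[ℝ] ((EK × Y) × (Fin p → ℝ)) :=
    (D.prodCongr (ContinuousLinearEquiv.refl ℝ Y)).prodCongr
      (ContinuousLinearEquiv.refl ℝ (Fin p → ℝ))
  have hfd : DifferentiableAt ℝ f 0 :=
    (hf.contDiffAt (hΩ.mem_nhds h0Ω)).differentiableAt (by simp)
  have hder : fderiv ℝ f 0 = (A' : _ →L[ℝ] _) := by
    have h1 : ∀ ζ : EK, fderiv ℝ f 0 ((ζ, 0), 0) = ((D ζ, 0), 0) := by
      intro ζ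
      let ι : EK →L[ℝ] (EK × Y) × (Fin p → ℝ) :=
        (ContinuousLinearMap.inl ℝ (EK × Y) (Fin p → ℝ)).comp (ContinuousLinearMap.inl ℝ EK Y)
      have hι : ∀ ζ, ι ζ = ((ζ, 0), 0) := fun ζ => rfl
      have h2 : HasFDerivAt (fun ζ => f (ι ζ)) ((fderiv ℝ f 0).comp ι) 0 := by
        have h3 : HasFDerivAt f (fderiv ℝ f 0) (ι 0) := by
          rw [map_zero]; exact hfd.hasFDerivAt
        exact h3.comp 0 ι.hasFDerivAt
      have h4 : (fun ζ => f (ι ζ)) = fun ζ => P (κ ζ • x) := by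
        funext ζ
        change P (κ ζ • P.symm 0) = _
        rw [hP0]
      have hd1 : MDifferentiableAt 𝓘(ℝ, EK) 𝓘(ℝ, E) (fun g : K => g • x) (κ 0) :=
        mdifferentiableAt_smul_left (E := E) (κ 0) x
      have hd2 : MDifferentiableAt 𝓘(ℝ, EK) 𝓘(ℝ, E) (fun ζ => κ ζ • x) 0 := hd1.comp 0 hκd
      have hx0 : κ 0 • x = x := by rw [hκ0, one_smul]
      have h5 := tmap_comp_apply (E' := E) (g := P) (f := fun ζ => κ ζ • x) (x := 0)
        (by rw [hx0]; exact hP.mdifferentiableAt hxP) hd2 ζ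
      have h6 := tmap_comp_apply (E' := EK) (g := fun g : K => g • x) (f := κ) (x := 0) hd1 hκd ζ
      rw [h6, hx0, hPd, hκ0, hD] at h5
      have h7 : A (tmap E E e x (tmap EK E (fun g : K => g • x) 1 (D ζ))) = ((D ζ, 0), 0) :=
        hAJ (D ζ)
      have h8 : tmap EK ((EK × Y) × (Fin p → ℝ)) (fun ζ => P (κ ζ • x)) 0 ζ = ((D ζ, 0), 0) :=
        h5.trans h7
      rw [← h4, tmap_eq_fderiv, h2.fderiv] at h8
      exact h8
    have h2 : ∀ u : Y × (Fin p → ℝ), fderiv ℝ f 0 ((0, u.1), u.2) = ((0, u.1), u.2) := by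
      intro u
      let ι : Y × (Fin p → ℝ) →L[ℝ] (EK × Y) × (Fin p → ℝ) :=
        ((ContinuousLinearMap.inr ℝ EK Y).comp (ContinuousLinearMap.fst ℝ Y (Fin p → ℝ))).prod
          (ContinuousLinearMap.snd ℝ Y (Fin p → ℝ))
      have h2 : HasFDerivAt (fun u => f (ι u)) ((fderiv ℝ f 0).comp ι) 0 := by
        have h3 : HasFDerivAt f (fderiv ℝ f 0) (ι 0) := by
          rw [map_zero]; exact hfd.hasFDerivAt
        exact h3.comp 0 ι.hasFDerivAt
      have h4 : (fun u => f (ι u)) =ᶠ[𝓝 0] ι := by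
        have h5 : ∀ᶠ u in 𝓝 0, ι u ∈ P.target :=
          ι.continuous.continuousAt.eventually (by
            rw [map_zero]; exact P.open_target.mem_nhds h0P)
        filter_upwards [h5] with u hu
        change P (κ 0 • P.symm (ι u)) = ι u
        rw [hκ0, one_smul, P.right_inv hu]
      have h6 := h2.unique (ι.hasFDerivAt.congr_of_eventuallyEq h4)
      exact congrArg (fun L : Y × (Fin p → ℝ) →L[ℝ] (EK × Y) × (Fin p → ℝ) => L u) h6
    refine ContinuousLinearMap.ext fun q => ?_
    have hq : q = ((q.1.1, 0), 0) + ((0, q.1.2), q.2) := by ext <;> simp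
    have h3 := h2 (q.1.2, q.2)
    simp only at h3
    rw [hq, map_add, h1, h3]
    simp [A']
    rfl
  obtain ⟨T, hT0, hTΩ, hTf, hTs, -⟩ := exists_smooth_openPartialHomeomorph hΩ hf h0Ω A' hder
  -- The chart is `P` followed by the inverse of `P ∘ R`, so its inverse is `R`.
  have hSsymm : ∀ q ∈ T.source, (P.trans T.symm).symm q = R q := by
    intro q hq
    change P.symm (T q) = R q
    rw [hTf]
    exact P.left_inv (hTΩ hq).2
  have htarget : ∀ q, q ∈ (P.trans T.symm).target ↔ q ∈ T.source := by
    intro q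
    rw [OpenPartialHomeomorph.trans_target]
    refine ⟨fun h => h.1, fun h => ⟨h, ?_⟩⟩
    change T q ∈ P.target
    rw [hTf]
    exact P.map_source (hTΩ h).2
  have hSs : IsSmoothChart E ((EK × Y) × (Fin p → ℝ)) (P.trans T.symm) := by
    constructor
    · intro y hy
      have hy' : y ∈ P.source ∧ P y ∈ T.target := by
        rw [OpenPartialHomeomorph.trans_source] at hy
        exact hy
      exact (ContMDiffAt.comp y (g := T.symm) (f := P)
        ((hTs.contDiffAt (T.open_target.mem_nhds hy'.2)).contMDiffAt)
        (hP.contMDiffAt hy'.1)).contMDiffWithinAt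
    · intro q hq
      rw [htarget] at hq
      refine ((hR q (hTΩ hq).1).congr_of_eventuallyEq ?_).contMDiffWithinAt
      filter_upwards [T.open_source.mem_nhds hq] with q' hq' using hSsymm q' hq'
  obtain ⟨r₀, hr₀, hball₀⟩ := Metric.isOpen_iff.1 T.open_source 0 hT0
  have hsball : ∀ {r : ℝ} {q}, q ∈ Metric.ball (0 : (EK × Y) × (Fin p → ℝ)) r →
      s q ∈ Metric.ball (0 : (EK × Y) × (Fin p → ℝ)) r := by
    intro r q hq
    rw [mem_ball_zero_iff] at hq ⊢
    refine lt_of_le_of_lt ?_ hq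
    simp only [s, Prod.norm_def]
    gcongr
    simp
  have hSs0 : ∀ q ∈ Metric.ball (0 : (EK × Y) × (Fin p → ℝ)) r₀,
      (P.trans T.symm).symm (s q) = P.symm (s q) := by
    intro q hq
    rw [hSsymm _ (hball₀ (hsball hq))]
    change κ 0 • P.symm (s (s q)) = _
    rw [hκ0, one_smul]
  -- group elements near `1` are in the range of the parametrization
  let N : Set K := (extChartAt 𝓘(ℝ, EK) (1 : K)).source ∩ extChartAt 𝓘(ℝ, EK) (1 : K) ⁻¹'
    Metric.ball (extChartAt 𝓘(ℝ, EK) (1 : K) 1) r₀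
  have hN : IsOpen N := (continuousOn_extChartAt (1 : K)).isOpen_inter_preimage
    (isOpen_extChartAt_source (1 : K)) Metric.isOpen_ball
  have hN1 : (1 : K) ∈ N := ⟨mem_extChartAt_source _, Metric.mem_ball_self hr₀⟩
  have hκN : ∀ k ∈ N, ∃ ζ : EK, ‖ζ‖ < r₀ ∧ κ ζ = k := by
    intro k hk
    refine ⟨extChartAt 𝓘(ℝ, EK) (1 : K) k - extChartAt 𝓘(ℝ, EK) (1 : K) 1, ?_, ?_⟩
    · rw [← dist_eq_norm]; exact hk.2
    · change (extChartAt 𝓘(ℝ, EK) (1 : K)).symm (_ + (_ - _)) = k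
      rw [add_sub_cancel, (extChartAt 𝓘(ℝ, EK) (1 : K)).left_inv hk.1]
  obtain ⟨O, hO, hxO, hON⟩ := exists_nhds_smul_ne (E := E) (EK := EK) hfree hN hN1 x
  have hcont : ContinuousAt (P.trans T.symm).symm 0 :=
    (P.trans T.symm).continuousAt_symm ((htarget 0).2 hT0)
  have hsymm0 : (P.trans T.symm).symm 0 = x := (hSsymm 0 hT0).trans hR0
  obtain ⟨r₁, hr₁, hball₁⟩ := Metric.eventually_nhds_iff_ball.1
    (hcont.eventually (by rw [hsymm0]; exact hO.mem_nhds hxO))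
  have hrr₀ : min r₀ r₁ ≤ r₀ := min_le_left _ _
  refine ⟨P.trans T.symm, κ, D, min r₀ r₁, hSs, lt_min hr₀ hr₁, fun q hq => (htarget q).2
    (hball₀ (Metric.ball_subset_ball hrr₀ hq)), hsymm0, hκ0, hκd, hD, ?_, ?_, ?_⟩
  · intro y hy α
    have hq : (P.trans T.symm) y ∈ T.source := (htarget _).1 ((P.trans T.symm).map_source hy)
    have h1 : y = R ((P.trans T.symm) y) := by
      rw [← hSsymm _ hq, (P.trans T.symm).left_inv hy]
    have h2 : φ α y = φ α (P.symm (s ((P.trans T.symm) y))) := by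
      conv_lhs => rw [h1]
      exact hφK α _ _
    rw [h2, ← hPφ _ (P.map_target (hTΩ hq).1.2), P.right_inv (hTΩ hq).1.2]
  · intro q hq
    have hq₀ := Metric.ball_subset_ball hrr₀ hq
    rw [hSsymm q (hball₀ hq₀)]
    exact (congrArg (κ q.1.1 • ·) (hSs0 q hq₀)).symm
  · intro k z z' c c' hz hz' hk
    -- Both points lie in the neighbourhood `O`, so `k` is some `κ ζ`. Then `k • S.symm ((0, z), c)`
    -- has coordinates `((ζ, z), c)`, and injectivity of the chart compares them with `((0, z'),
    -- c')`.
    have hkN : k ∈ N := hON k _ (hball₁ _ (Metric.ball_subset_ball (min_le_right _ _) hz)) (by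
      rw [hk]
      exact hball₁ _ (Metric.ball_subset_ball (min_le_right _ _) hz'))
    obtain ⟨ζ, hζ, rfl⟩ := hκN k hkN
    have hz₀ := Metric.ball_subset_ball hrr₀ hz
    have hz₀' := Metric.ball_subset_ball hrr₀ hz'
    have hζz : ((ζ, z), c) ∈ Metric.ball (0 : (EK × Y) × (Fin p → ℝ)) r₀ := by
      simp only [mem_ball_zero_iff, Prod.norm_def, max_lt_iff] at hz₀ ⊢
      exact ⟨⟨hζ, hz₀.1.2⟩, hz₀.2⟩
    have h1 : (P.trans T.symm).symm ((ζ, z), c) = κ ζ • (P.trans T.symm).symm ((0, z), c) := by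
      rw [hSsymm _ (hball₀ hζz)]
      exact (congrArg (κ ζ • ·) (hSs0 _ hζz)).symm
    rw [← h1] at hk
    have h2 := (P.trans T.symm).symm.injOn ((htarget _).2 (hball₀ hζz))
      ((htarget _).2 (hball₀ hz₀')) hk
    simp only [Prod.mk.injEq] at h2
    exact ⟨h2.1.2, h2.2⟩

end SliceExistence

end InvariantRelations

end

noncomputable section

namespace InvariantRelations

open Set Filter Topology

/-! ### Smoothness of the Liouville volume in arbitrary charts. -/

section FormInChart

variable {E : Type*} [NormedAddCommGroup E] [NormedSpace ℝ E] [FiniteDimensional ℝ E]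
  {M : Type*} [TopologicalSpace M] [ChartedSpace E M] [IsManifold 𝓘(ℝ, E) ∞ M]
  {E' : Type*} [NormedAddCommGroup E'] [NormedSpace ℝ E']
  (ωM : SymplecticForm E M) {Φ : OpenPartialHomeomorph M E'}

/-- The coefficients of the symplectic form in a smooth chart are smooth. -/
theorem contDiffOn_formAt_chart (hΦ : IsSmoothChart E E' Φ) (u w : E') :
    ContDiffOn ℝ ∞ (fun q => formAt ωM (Φ.symm q) ![tmap E' E Φ.symm q u, tmap E' E Φ.symm q w])
      Φ.target := by
  intro q₀ hq₀
  refine ContDiffAt.contDiffWithinAt ?_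
  -- Smoothness of the form is given in preferred charts only, so the computation passes through the
  -- preferred chart at one fixed point.
  let e := extChartAt 𝓘(ℝ, E) (Φ.symm q₀)
  have he : e.source ∈ 𝓝 (Φ.symm q₀) := extChartAt_source_mem_nhds _
  let f : E' → E := fun q => e (Φ.symm q)
  have hf : ContDiffAt ℝ ∞ f q₀ := by
    have h1 : ContMDiffAt 𝓘(ℝ, E') 𝓘(ℝ, E) ∞ f q₀ :=
      ContMDiffAt.comp q₀ (g := e) (f := Φ.symm)
        (contMDiffAt_chart (x₀ := Φ.symm q₀) (mem_of_mem_nhds he)) (hΦ.contMDiffAt_symm hq₀)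
    exact h1.contDiffAt
  have hfd : ∀ v, ContDiffAt ℝ ∞ (fun q => fderiv ℝ f q v) q₀ := fun v =>
    (hf.fderiv_right (m := ∞) (by simp)).clm_apply contDiffAt_const
  have h2 : ContDiffAt ℝ ∞ (fun q => altCLM (chartForm ωM.toForm (Φ.symm q₀) (f q))
      (fderiv ℝ f q u) (fderiv ℝ f q w)) q₀ := by
    refine ContDiffAt.clm_apply (ContDiffAt.clm_apply ?_ (hfd u)) (hfd w)
    exact ContDiffAt.comp q₀ (g := fun y => altCLM (chartForm ωM.toForm (Φ.symm q₀) y))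
      (f := f) ((contDiffOn_altCLM_chartForm ωM (Φ.symm q₀)).contDiffAt
      ((isOpen_extChartAt_target _).mem_nhds (mem_extChartAt_target _))) hf
  refine h2.congr_of_eventuallyEq ?_
  filter_upwards [Φ.open_target.mem_nhds hq₀,
    (Φ.continuousAt_symm hq₀).eventually (eventually_mem_nhds_iff.2 he)] with q hq hqe
  have hqs : Φ.symm q ∈ e.source := mem_of_mem_nhds hqe
  have hD : ∀ v, tmap E E e.symm (f q) (fderiv ℝ f q v) = tmap E' E Φ.symm q v := by
    intro v
    have h3 := tmap_comp_apply (E' := E) (g := e) (f := Φ.symm) (x := q)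
      (mdifferentiableAt_chart (x₀ := Φ.symm q₀) hqs) (hΦ.mdifferentiableAt_symm hq) v
    rw [tmap_eq_fderiv] at h3
    have h4 := tmap_symm_tmap_chart (x₀ := Φ.symm q₀) hqs (tmap E' E Φ.symm q v)
    rw [← h3] at h4
    exact h4
  have hinv : e.symm (f q) = Φ.symm q := e.left_inv hqs
  rw [altCLM_apply, chartForm_apply]
  change _ = formAt ωM (e.symm (f q))
    ![tmap E E e.symm (f q) (fderiv ℝ f q u), tmap E E e.symm (f q) (fderiv ℝ f q w)]
  rw [hD, hD, hinv]

/-- The Liouville volume of coordinate vector fields is smooth. -/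
theorem contDiffOn_volAt_chart (hΦ : IsSmoothChart E E' Φ) {n p m : ℕ} (hdim : 2 * n = p + m)
    (u : Fin (p + m) → E') :
    ContDiffOn ℝ ∞ (fun q => volAt ωM hdim (Φ.symm q) fun i => tmap E' E Φ.symm q (u i))
      Φ.target := by
  simp only [volAt, AlternatingMap.domDomCongr_apply, liouvilleAlt_apply]
  refine contDiffOn_const.mul (ContDiffOn.sum fun τ _ => contDiffOn_const.mul ?_)
  exact contDiffOn_prod fun i _ => contDiffOn_formAt_chart ωM hΦ _ _

end FormInChart

/-! ### The density induced on a transversal. -/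

section OrbitMap

variable {E : Type*} [NormedAddCommGroup E] [NormedSpace ℝ E]
  {M : Type*} [TopologicalSpace M] [ChartedSpace E M]
  {EK : Type*} [NormedAddCommGroup EK] [NormedSpace ℝ EK]
  {K : Type*} [TopologicalSpace K] [ChartedSpace EK K] [Group K] [MulAction K M]
  {Y : Type*} [NormedAddCommGroup Y] [NormedSpace ℝ Y] {p : ℕ}

variable (E EK K) in
/-- The derivative of `(k, z) ↦ k • s(z)` at `k = 1`. -/
def orbitMap (s : Y → M) (z : Y) : EK × Y →L[ℝ] E :=
  (tmap EK E (fun g : K => g • s z) 1).coprod (tmap Y E s z)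

theorem orbitMap_apply (s : Y → M) (z : Y) (v : EK × Y) :
    orbitMap E EK K s z v = genField E (G := K) v.1 (s z) + tmap Y E s z v.2 := rfl

variable (E EK K) in
/-- The density induced on a transversal `s` to the orbits by the restricted Liouville volume. -/
def sliceDensity (ωM : SymplecticForm E M) {n m : ℕ} (hdim : 2 * n = p + m) (φ : Fin p → M → ℝ)
    (b : Module.Basis (Fin m) ℝ (EK × Y)) (s : Y → M) (z : Y) : ℝ :=
  volDensity ωM hdim φ b (s z) (orbitMap E EK K s z)

/-- The transversal to the orbits in a slice chart. -/
def sliceMap (S : OpenPartialHomeomorph M ((EK × Y) × (Fin p → ℝ))) (z : Y) : M :=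
  S.symm ((0, z), 0)

theorem mem_ball_slice {z : Y} {r : ℝ} (hz : z ∈ Metric.ball 0 r) :
    ((0, z), 0) ∈ Metric.ball (0 : (EK × Y) × (Fin p → ℝ)) r := by
  rw [mem_ball_zero_iff] at hz ⊢
  simpa [Prod.norm_def] using hz

namespace IsSliceChart

variable [IsManifold 𝓘(ℝ, E) ∞ M] [ContMDiffSMul 𝓘(ℝ, EK) 𝓘(ℝ, E) ∞ K M]
  {φ : Fin p → M → ℝ} {x : M} {S : OpenPartialHomeomorph M ((EK × Y) × (Fin p → ℝ))} {κ : EK → K}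
  {D : EK ≃L[ℝ] EK} {r : ℝ}

omit [IsManifold 𝓘(ℝ, E) ∞ M] [ContMDiffSMul 𝓘(ℝ, EK) 𝓘(ℝ, E) ∞ K M] in
theorem apply_symm_snd (h : IsSliceChart E φ x S κ D r)
    {q : (EK × Y) × (Fin p → ℝ)} (hq : q ∈ S.target) (α : Fin p) : φ α (S.symm q) = q.2 α := by
  rw [← h.snd_eq _ (S.map_target hq), S.right_inv hq]

omit [IsManifold 𝓘(ℝ, E) ∞ M] [ContMDiffSMul 𝓘(ℝ, EK) 𝓘(ℝ, E) ∞ K M] in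
theorem tmap_symm_snd (h : IsSliceChart E φ x S κ D r)
    (hφ : ∀ α, ContMDiff 𝓘(ℝ, E) 𝓘(ℝ, ℝ) ∞ (φ α)) {q : (EK × Y) × (Fin p → ℝ)}
    (hq : q ∈ S.target) (α : Fin p) (v : (EK × Y) × (Fin p → ℝ)) :
    tmap E ℝ (φ α) (S.symm q) (tmap ((EK × Y) × (Fin p → ℝ)) E S.symm q v) = v.2 α := by
  rw [← tmap_comp_apply (E' := E) ((hφ α).mdifferentiableAt (by simp))
    (h.smooth.mdifferentiableAt_symm hq)]
  let π : (EK × Y) × (Fin p → ℝ) →L[ℝ] ℝ :=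
    (ContinuousLinearMap.proj α).comp (ContinuousLinearMap.snd ℝ (EK × Y) (Fin p → ℝ))
  have h1 : (fun q => φ α (S.symm q)) =ᶠ[𝓝 q] π := by
    filter_upwards [S.open_target.mem_nhds hq] with q' hq' using h.apply_symm_snd hq' α
  rw [tmap_congr h1, tmap_eq_fderiv, π.fderiv]
  rfl

omit [IsManifold 𝓘(ℝ, E) ∞ M] [ContMDiffSMul 𝓘(ℝ, EK) 𝓘(ℝ, E) ∞ K M] in
theorem contMDiffAt_sliceMap (h : IsSliceChart E φ x S κ D r) {z : Y} (hz : z ∈ Metric.ball 0 r) :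
    ContMDiffAt 𝓘(ℝ, Y) 𝓘(ℝ, E) ∞ (sliceMap S) z := by
  have h1 : ContMDiffAt 𝓘(ℝ, Y) 𝓘(ℝ, (EK × Y) × (Fin p → ℝ)) ∞
      (fun z : Y => (((0 : EK), z), (0 : Fin p → ℝ))) z :=
    ((contDiff_const.prodMk contDiff_id).prodMk contDiff_const).contMDiff.contMDiffAt
  exact ContMDiffAt.comp z (g := S.symm) (h.smooth.contMDiffAt_symm
    (h.ball_subset (mem_ball_slice hz))) h1

omit [IsManifold 𝓘(ℝ, E) ∞ M] [ContMDiffSMul 𝓘(ℝ, EK) 𝓘(ℝ, E) ∞ K M] in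
theorem mdifferentiableAt_sliceMap (h : IsSliceChart E φ x S κ D r) {z : Y}
    (hz : z ∈ Metric.ball 0 r) : MDifferentiableAt 𝓘(ℝ, Y) 𝓘(ℝ, E) (sliceMap S) z :=
  (h.contMDiffAt_sliceMap hz).mdifferentiableAt (by simp)

omit [IsManifold 𝓘(ℝ, E) ∞ M] [ContMDiffSMul 𝓘(ℝ, EK) 𝓘(ℝ, E) ∞ K M] in
theorem apply_sliceMap (h : IsSliceChart E φ x S κ D r) {z : Y} (hz : z ∈ Metric.ball 0 r)
    (α : Fin p) : φ α (sliceMap S z) = 0 :=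
  h.apply_symm_snd (h.ball_subset (mem_ball_slice hz)) α

/-- In a slice chart, the derivative of `(k, z) ↦ k • s(z)` is given by the coordinate vectors. -/
theorem orbitMap_eq (h : IsSliceChart E φ x S κ D r) {z : Y} (hz : z ∈ Metric.ball 0 r)
    (ζ : EK) (u : Y) : orbitMap E EK K (sliceMap S) z (D ζ, u) =
      tmap ((EK × Y) × (Fin p → ℝ)) E S.symm ((0, z), 0) ((ζ, u), 0) := by
  have hq := mem_ball_slice (EK := EK) (p := p) hz
  have hd := h.smooth.mdifferentiableAt_symm (h.ball_subset hq)
  have h1 : tmap Y E (sliceMap S) z u =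
      tmap ((EK × Y) × (Fin p → ℝ)) E S.symm ((0, z), 0) ((0, u), 0) := by
    have hι : HasFDerivAt (fun z : Y => (((0 : EK), z), (0 : Fin p → ℝ)))
        ((ContinuousLinearMap.inl ℝ (EK × Y) (Fin p → ℝ)).comp
          (ContinuousLinearMap.inr ℝ EK Y)) z :=
      ((ContinuousLinearMap.inl ℝ (EK × Y) (Fin p → ℝ)).comp
          (ContinuousLinearMap.inr ℝ EK Y)).hasFDerivAt
    have h2 := tmap_comp_apply (E' := (EK × Y) × (Fin p → ℝ)) (g := S.symm)
      (f := fun z : Y => (((0 : EK), z), (0 : Fin p → ℝ))) (x := z) hd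
      hι.differentiableAt.mdifferentiableAt u
    rw [tmap_eq_fderiv, hι.fderiv] at h2
    exact h2
  have h3 : genField E (G := K) (D ζ) (sliceMap S z) =
      tmap ((EK × Y) × (Fin p → ℝ)) E S.symm ((0, z), 0) ((ζ, 0), 0) := by
    have hι : HasFDerivAt (fun ζ : EK => ((ζ, z), (0 : Fin p → ℝ)))
        ((ContinuousLinearMap.inl ℝ (EK × Y) (Fin p → ℝ)).comp
          (ContinuousLinearMap.inl ℝ EK Y)) 0 := by
      have h4 := ((ContinuousLinearMap.inl ℝ (EK × Y) (Fin p → ℝ)).comp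
          (ContinuousLinearMap.inl ℝ EK Y)).hasFDerivAt (x := 0) |>.add_const ((0, z), 0)
      refine h4.congr_of_eventuallyEq (Eventually.of_forall fun ζ => ?_)
      simp
    have h2 := tmap_comp_apply (E' := (EK × Y) × (Fin p → ℝ)) (g := S.symm)
      (f := fun ζ : EK => ((ζ, z), (0 : Fin p → ℝ))) (x := 0) hd
      hι.differentiableAt.mdifferentiableAt ζ
    rw [tmap_eq_fderiv, hι.fderiv] at h2
    have h5 : (fun ζ : EK => S.symm ((ζ, z), (0 : Fin p → ℝ))) =ᶠ[𝓝 0]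
        fun ζ => κ ζ • sliceMap S z := by
      filter_upwards [hι.continuousAt.eventually (Metric.isOpen_ball.mem_nhds hq)] with ζ hζ
      exact h.symm_eq _ hζ
    have h6 := tmap_comp_apply (E' := EK) (g := fun g : K => g • sliceMap S z) (f := κ) (x := 0)
      (mdifferentiableAt_smul_left (E := E) (κ 0) (sliceMap S z)) h.κ_diff ζ
    rw [tmap_congr h5, h6, h.κ_zero, h.κ_deriv] at h2
    exact h2
  rw [orbitMap_apply, h1, h3, ← map_add]
  simp

theorem tmap_orbitMap_eq_zero (h : IsSliceChart E φ x S κ D r)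
    (hφ : ∀ α, ContMDiff 𝓘(ℝ, E) 𝓘(ℝ, ℝ) ∞ (φ α)) {z : Y} (hz : z ∈ Metric.ball 0 r)
    (v : EK × Y) (α : Fin p) :
    tmap E ℝ (φ α) (sliceMap S z) (orbitMap E EK K (sliceMap S) z v) = 0 := by
  have h1 := h.orbitMap_eq hz (D.symm v.1) v.2
  rw [D.apply_symm_apply] at h1
  rw [h1]
  exact h.tmap_symm_snd hφ (h.ball_subset (mem_ball_slice hz)) α _

theorem orbitMap_injective (h : IsSliceChart E φ x S κ D r) {z : Y} (hz : z ∈ Metric.ball 0 r) :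
    Function.Injective (orbitMap E EK K (sliceMap S) z) := by
  rw [injective_iff_map_eq_zero]
  intro v hv
  have h1 := h.orbitMap_eq hz (D.symm v.1) v.2
  rw [D.apply_symm_apply, hv] at h1
  have h2 := h.smooth.tmap_tmap_symm (h.ball_subset (mem_ball_slice hz)) ((D.symm v.1, v.2), 0)
  rw [← h1, map_zero] at h2
  have h3 : D.symm v.1 = 0 := (congrArg (fun q => q.1.1) h2).symm
  have h4 : v.2 = 0 := (congrArg (fun q => q.1.2) h2).symm
  exact Prod.ext ((map_eq_zero_iff _ D.symm.injective).1 h3) h4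

variable [FiniteDimensional ℝ E]
  (ωM : SymplecticForm E M) {n m : ℕ} (hdim : 2 * n = p + m) (b : Module.Basis (Fin m) ℝ (EK × Y))

theorem isRegularAt (h : IsSliceChart E φ x S κ D r)
    (hφ : ∀ α, ContMDiff 𝓘(ℝ, E) 𝓘(ℝ, ℝ) ∞ (φ α)) {q : (EK × Y) × (Fin p → ℝ)}
    (hq : q ∈ S.target) : IsRegularAt E φ (S.symm q) := by
  refine ⟨fun β => tmap ((EK × Y) × (Fin p → ℝ)) E S.symm q (0, Pi.single β 1), fun α β => ?_⟩
  rw [h.tmap_symm_snd hφ hq]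
  exact Pi.single_apply _ _ _

theorem sliceDensity_pos (h : IsSliceChart E φ x S κ D r) (hE : Module.finrank ℝ E = 2 * n)
    (hφ : ∀ α, ContMDiff 𝓘(ℝ, E) 𝓘(ℝ, ℝ) ∞ (φ α)) {z : Y} (hz : z ∈ Metric.ball 0 r) :
    0 < sliceDensity E EK K ωM hdim φ b (sliceMap S) z :=
  volDensity_pos ωM hdim φ b hE (h.isRegularAt hφ (h.ball_subset (mem_ball_slice hz)))
    (fun v α => h.tmap_orbitMap_eq_zero hφ hz v α) (h.orbitMap_injective hz)

/-- The density is the absolute value of the Liouville form on coordinate vectors of the slice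
chart. This is smooth, and the absolute value does no harm because it never vanishes. -/
theorem contDiffOn_sliceDensity (h : IsSliceChart E φ x S κ D r)
    (hE : Module.finrank ℝ E = 2 * n) (hφ : ∀ α, ContMDiff 𝓘(ℝ, E) 𝓘(ℝ, ℝ) ∞ (φ α)) :
    ContDiffOn ℝ ∞ (sliceDensity E EK K ωM hdim φ b (sliceMap S)) (Metric.ball 0 r) := by
  -- The coordinate vectors in the directions `c` are dual to the `dφ_α`, so they may replace the
  -- dual frame in the restricted volume.
  let u : Fin (p + m) → (EK × Y) × (Fin p → ℝ) :=
    Fin.append (fun β => (0, Pi.single β 1)) fun i => ((D.symm (b i).1, (b i).2), 0)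
  let f : Y → ℝ := fun z => volAt ωM hdim (sliceMap S z)
    fun i => tmap ((EK × Y) × (Fin p → ℝ)) E S.symm ((0, z), 0) (u i)
  have hf : ContDiffOn ℝ ∞ f (Metric.ball 0 r) := by
    have h1 : ContDiff ℝ ∞ fun z : Y => (((0 : EK), z), (0 : Fin p → ℝ)) :=
      (contDiff_const.prodMk contDiff_id).prodMk contDiff_const
    exact (contDiffOn_volAt_chart ωM h.smooth hdim u).comp h1.contDiffOn
      fun z hz => h.ball_subset (mem_ball_slice hz)
  have heq : ∀ z ∈ Metric.ball (0 : Y) r,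
      sliceDensity E EK K ωM hdim φ b (sliceMap S) z = |f z| := by
    intro z hz
    have hq := h.ball_subset (mem_ball_slice hz)
    have hw : diffMatrix E φ (sliceMap S z) (fun β =>
        tmap ((EK × Y) × (Fin p → ℝ)) E S.symm ((0, z), 0) (0, Pi.single β 1)) = 1 := by
      ext α β
      rw [Matrix.one_apply]
      exact (h.tmap_symm_snd hφ hq α _).trans (Pi.single_apply _ _ _)
    have h1 := volAt_append ωM hdim hE (h.isRegularAt hφ hq)
      (v := fun i => orbitMap E EK K (sliceMap S) z (b i))
      (fun i α => h.tmap_orbitMap_eq_zero hφ hz (b i) α) (fun β =>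
        tmap ((EK × Y) × (Fin p → ℝ)) E S.symm ((0, z), 0) (0, Pi.single β 1))
    have h2 : (diffMatrix E φ (S.symm ((0, z), 0)) (fun β =>
        tmap ((EK × Y) × (Fin p → ℝ)) E S.symm ((0, z), 0) (0, Pi.single β 1))).det = 1 :=
      (congrArg Matrix.det hw).trans Matrix.det_one
    rw [h2, one_mul] at h1
    refine congrArg abs (h1.symm.trans ?_)
    congr 1
    funext i
    refine Fin.addCases (fun β => ?_) (fun j => ?_) i
    · simp only [u, Fin.append_left]
    · simp only [u, Fin.append_right]
      have h3 := h.orbitMap_eq hz (D.symm (b j).1) (b j).2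
      rw [D.apply_symm_apply] at h3
      exact h3
  intro z hz
  refine ContDiffWithinAt.congr ?_ heq (heq z hz)
  refine ContDiffWithinAt.abs (hf z hz) ?_
  intro h0
  have := h.sliceDensity_pos ωM hdim b hE hφ hz
  rw [heq z hz, h0, abs_zero] at this
  exact lt_irrefl _ this

end IsSliceChart

end OrbitMap

end InvariantRelations

end

noncomputable section

namespace InvariantRelations

open Set Filter Topology

/-! ### Topology of the orbit space. -/

section OrbitSpaceTopology

variable {K M : Type*} [Group K] [MulAction K M]

theorem orbitProj_eq_iff {x y : M} : orbitProj K x = orbitProj K y ↔ ∃ k : K, k • x = y := by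
  rw [eq_comm]
  exact Quotient.eq (r := MulAction.orbitRel K M)

@[simp] theorem orbitProj_smul (k : K) (x : M) : orbitProj K (k • x) = orbitProj K x :=
  (orbitProj_eq_iff.2 ⟨k, rfl⟩).symm

theorem orbitProj_surjective : Function.Surjective (orbitProj K : M → OrbitSpace K M) :=
  Quot.mk_surjective

variable [TopologicalSpace M]

theorem continuous_orbitProj : Continuous (orbitProj K : M → OrbitSpace K M) :=
  continuous_quot_mk

variable [TopologicalSpace K] [ContinuousSMul K M]

theorem isOpenQuotientMap_orbitProj : IsOpenQuotientMap (orbitProj K : M → OrbitSpace K M) :=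
  MulAction.isOpenQuotientMap_quotientMk

theorem isOpenMap_orbitProj : IsOpenMap (orbitProj K : M → OrbitSpace K M) :=
  isOpenQuotientMap_orbitProj.isOpenMap

/-- The orbit relation is the projection of a closed subset of `K × (M × M)` along the compact
factor, hence closed; for an open quotient map this is the Hausdorff property. -/
theorem t2Space_orbitSpace [CompactSpace K] [T2Space M] : T2Space (OrbitSpace K M) := by
  rw [t2Space_iff_of_isOpenQuotientMap (isOpenQuotientMap_orbitProj (K := K) (M := M))]
  have h1 : IsClosed {q : K × (M × M) | q.1 • q.2.1 = q.2.2} :=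
    isClosed_eq (continuous_fst.smul (continuous_fst.comp continuous_snd))
      (continuous_snd.comp continuous_snd)
  have h2 := isClosedMap_snd_of_compactSpace (X := K) _ h1
  convert h2 using 1
  ext q
  constructor
  · intro hq
    obtain ⟨k, hk⟩ := orbitProj_eq_iff.1 hq
    exact ⟨(k, q), hk, rfl⟩
  · rintro ⟨⟨k, q'⟩, hk, rfl⟩
    exact orbitProj_eq_iff.2 ⟨k, hk⟩

end OrbitSpaceTopology

/-! ### Comparison of two transversals. -/

section Transition

variable {E : Type*} [NormedAddCommGroup E] [NormedSpace ℝ E] [FiniteDimensional ℝ E]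
  {M : Type*} [TopologicalSpace M] [ChartedSpace E M]
  {EK : Type*} [NormedAddCommGroup EK] [NormedSpace ℝ EK]
  {K : Type*} [TopologicalSpace K] [ChartedSpace EK K] [Group K] [MulAction K M]
  {p : ℕ} {φ : Fin p → M → ℝ} {ωM : SymplecticForm E M} {n m : ℕ} {hdim : 2 * n = p + m}

/-- Here `L` preserves the differentials `dφ_α` as well as ω, so it takes a dual frame to a dual
frame and the determinant factor is `1`. -/
theorem volDensity_map (hE : Module.finrank ℝ E = 2 * n) {Q : Type*} [NormedAddCommGroup Q]
    [NormedSpace ℝ Q] (b : Module.Basis (Fin m) ℝ Q) {x y : M} (hx : IsRegularAt E φ x)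
    (hy : IsRegularAt E φ y) {L : E →L[ℝ] E} (hL : PreservesForm ωM x y L)
    (hLφ : ∀ α v, tmap E ℝ (φ α) y (L v) = tmap E ℝ (φ α) x v) {T : Q →L[ℝ] E}
    (hT : ∀ q α, tmap E ℝ (φ α) x (T q) = 0) :
    volDensity ωM hdim φ b y (L.comp T) = volDensity ωM hdim φ b x T := by
  have h1 := det_mul_restrictedVolumeAt_map ωM hdim hE hx hy hL (v := fun i => T (b i))
    (fun i α => hT (b i) α) (fun i α => by rw [hLφ, hT]) (dualFrameAt E φ x)
  have h2 : diffMatrix E φ y (L ∘ dualFrameAt E φ x) = diffMatrix E φ x (dualFrameAt E φ x) := by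
    ext α β
    exact hLφ α _
  rw [h2, hx.diffMatrix_dualFrame, Matrix.det_one, one_mul, one_mul] at h1
  exact congrArg abs h1

theorem tmap_smul_eq [ContMDiffSMul 𝓘(ℝ, EK) 𝓘(ℝ, E) ∞ K M]
    (hφ : ∀ α, ContMDiff 𝓘(ℝ, E) 𝓘(ℝ, ℝ) ∞ (φ α))
    (hφK : ∀ α (k : K) (x : M), φ α (k • x) = φ α x) (k : K) (x : M) (α : Fin p) (v : E) :
    tmap E ℝ (φ α) (k • x) (tmap E E (fun x : M => k • x) x v) = tmap E ℝ (φ α) x v := by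
  have h2 := tmap_comp_apply (E' := E) (g := φ α) (f := fun x : M => k • x) (x := x)
    ((hφ α).mdifferentiableAt (by simp)) (mdifferentiableAt_smul_right (EG := EK) k x) v
  simp only [hφK] at h2
  exact h2.symm

theorem isRegularAt_smul [ContMDiffSMul 𝓘(ℝ, EK) 𝓘(ℝ, E) ∞ K M]
    (hφ : ∀ α, ContMDiff 𝓘(ℝ, E) 𝓘(ℝ, ℝ) ∞ (φ α))
    (hφK : ∀ α (k : K) (x : M), φ α (k • x) = φ α x) (k : K) {x : M} (hx : IsRegularAt E φ x) :
    IsRegularAt E φ (k • x) := by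
  obtain ⟨w, hw⟩ := hx
  exact ⟨fun β => tmap E E (fun x : M => k • x) x (w β), fun α β => by
    rw [tmap_smul_eq (EK := EK) hφ hφK, hw]⟩

variable [LieGroup 𝓘(ℝ, EK) ∞ K] [ContMDiffSMul 𝓘(ℝ, EK) 𝓘(ℝ, E) ∞ K M]
  {Ψ : M → Module.Dual ℝ (GroupLieAlgebra 𝓘(ℝ, EK) K)}
  [IsManifold 𝓘(ℝ, E) ∞ M] [FiniteDimensional ℝ EK] [CompactSpace K]
  {Y : Type*} [NormedAddCommGroup Y] [NormedSpace ℝ Y] [FiniteDimensional ℝ Y]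
  (b : Module.Basis (Fin m) ℝ (EK × Y))

/-- A family of points transversal to the orbits, in a slice chart: the change of coordinates, and
the transformation law of the densities. -/
theorem exists_transition (hE : Module.finrank ℝ E = 2 * n) (hΨ : IsHamiltonianAction ωM Ψ)
    (hφ : ∀ α, ContMDiff 𝓘(ℝ, E) 𝓘(ℝ, ℝ) ∞ (φ α))
    (hφK : ∀ α (k : K) (x : M), φ α (k • x) = φ α x)
    {x : M} {S : OpenPartialHomeomorph M ((EK × Y) × (Fin p → ℝ))} {κ : EK → K}
    {D : EK ≃L[ℝ] EK} {r : ℝ} (h : IsSliceChart E φ x S κ D r) {s : Y → M} {w z : Y}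
    (hz : z ∈ Metric.ball 0 r) (hs : MDifferentiableAt 𝓘(ℝ, Y) 𝓘(ℝ, E) s w)
    (hs0 : ∀ᶠ w' in 𝓝 w, ∀ α, φ α (s w') = 0)
    (hσ : orbitProj K (s w) = orbitProj K (sliceMap S z)) :
    ∃ (τ : Y → Y) (τ' : Y →L[ℝ] Y), HasFDerivAt τ τ' w ∧ τ w = z ∧
      (∀ᶠ w' in 𝓝 w, τ w' ∈ Metric.ball 0 r ∧
        orbitProj K (s w') = orbitProj K (sliceMap S (τ w'))) ∧
      sliceDensity E EK K ωM hdim φ b s w =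
        |τ'.det| * sliceDensity E EK K ωM hdim φ b (sliceMap S) z := by
  obtain ⟨k, hk⟩ := orbitProj_eq_iff.1 hσ
  have hq := mem_ball_slice (EK := EK) (p := p) hz
  have hqt := h.ball_subset hq
  have hks : k • s w ∈ S.source := by rw [hk]; exact S.map_target hqt
  have hkd : MDifferentiableAt 𝓘(ℝ, Y) 𝓘(ℝ, E) (fun w' => k • s w') w :=
    (mdifferentiableAt_smul_right (E := E) (EG := EK) k (s w)).comp w hs
  -- After translation by `k` the other transversal passes through the slice chart. Its coordinate
  -- `z` is the change of coordinates `τ`, its group coordinate measures the sliding along the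
  -- orbits, and its last coordinate is zero because it lies in the level set.
  let g : Y → (EK × Y) × (Fin p → ℝ) := fun w' => S (k • s w')
  have hgw : g w = ((0, z), 0) := by
    change S (k • s w) = _
    rw [hk]
    exact S.right_inv hqt
  have hg : MDifferentiableAt 𝓘(ℝ, Y) 𝓘(ℝ, (EK × Y) × (Fin p → ℝ)) g w :=
    MDifferentiableAt.comp w (g := S) (f := fun w' => k • s w') (h.smooth.mdifferentiableAt hks) hkd
  have hgf : HasFDerivAt g (fderiv ℝ g w) w :=
    (mdifferentiableAt_iff_differentiableAt.1 hg).hasFDerivAt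
  let τ' : Y →L[ℝ] Y := (ContinuousLinearMap.snd ℝ EK Y).comp
    ((ContinuousLinearMap.fst ℝ (EK × Y) (Fin p → ℝ)).comp (fderiv ℝ g w))
  let A : Y →L[ℝ] EK := (ContinuousLinearMap.fst ℝ EK Y).comp
    ((ContinuousLinearMap.fst ℝ (EK × Y) (Fin p → ℝ)).comp (fderiv ℝ g w))
  have hev : ∀ᶠ w' in 𝓝 w, k • s w' = S.symm (g w') ∧ g w' ∈ Metric.ball 0 r ∧ (g w').2 = 0 := by
    filter_upwards [hkd.continuousAt.eventually (S.open_source.mem_nhds hks), hs0,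
      hgf.continuousAt.eventually (Metric.isOpen_ball.mem_nhds (hgw ▸ hq))] with w' h1 h2 h3
    refine ⟨(S.left_inv h1).symm, h3, ?_⟩
    funext α
    rw [h.snd_eq _ h1, hφK, h2 α]
    rfl
  have hsnd : ∀ u, (fderiv ℝ g w u).2 = 0 := by
    intro u
    have h1 : HasFDerivAt (fun w' => (g w').2)
        ((ContinuousLinearMap.snd ℝ (EK × Y) (Fin p → ℝ)).comp (fderiv ℝ g w)) w :=
      (ContinuousLinearMap.snd ℝ (EK × Y) (Fin p → ℝ)).hasFDerivAt.comp w hgf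
    have h2 : HasFDerivAt (fun w' => (g w').2) (0 : Y →L[ℝ] (Fin p → ℝ)) w :=
      (hasFDerivAt_const (0 : Fin p → ℝ) w).congr_of_eventuallyEq (hev.mono fun w' h => h.2.2)
    exact congrArg (fun L : Y →L[ℝ] (Fin p → ℝ) => L u) (h1.unique h2)
  have hgu : ∀ u, fderiv ℝ g w u = ((A u, τ' u), 0) := fun u =>
    Prod.ext rfl (hsnd u)
  have hLs : ∀ u, tmap E E (fun x : M => k • x) (s w) (tmap Y E s w u) =
      orbitMap E EK K (sliceMap S) z (D (A u), τ' u) := by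
    intro u
    have h1 := tmap_comp_apply (E' := E) (g := fun x : M => k • x) (f := s) (x := w)
      (mdifferentiableAt_smul_right (EG := EK) k (s w)) hs u
    have h2 := tmap_comp_apply (E' := (EK × Y) × (Fin p → ℝ)) (g := S.symm) (f := g) (x := w)
      (by rw [hgw]; exact h.smooth.mdifferentiableAt_symm hqt) hg u
    rw [tmap_eq_fderiv, hgu, hgw, ← h.orbitMap_eq hz] at h2
    rw [← h1, ← h2, tmap_congr (hev.mono fun w' h => h.1)]
  -- Translation by `k` turns generators by `Ad_k` and sends a transversal vector to its slice
  -- component plus a generator. In these bases it is block triangular with diagonal blocks `Ad_k`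
  -- and `τ'`.
  let L : EK × Y →L[ℝ] EK × Y := ((adMap (EK := EK) k).coprod ((D : EK →L[ℝ] EK).comp A)).prod
    (τ'.comp (ContinuousLinearMap.snd ℝ EK Y))
  have hLT : (tmap E E (fun x : M => k • x) (s w)).comp (orbitMap E EK K s w) =
      (orbitMap E EK K (sliceMap S) z).comp L := by
    refine ContinuousLinearMap.ext fun v => ?_
    change tmap E E (fun x : M => k • x) (s w) (orbitMap E EK K s w v) =
      orbitMap E EK K (sliceMap S) z (adMap (EK := EK) k v.1 + D (A v.2), τ' v.2)
    rw [orbitMap_apply, map_add, tmap_smul_genField, hLs, hk, orbitMap_apply, orbitMap_apply,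
      ← add_assoc]
    congr 1
    exact (map_add (tmap EK E (fun g : K => g • sliceMap S z) 1) _ _).symm
  have hregz : IsRegularAt E φ (k • s w) := hk ▸ h.isRegularAt hφ hqt
  have hregw : IsRegularAt E φ (s w) := by
    have := isRegularAt_smul (EK := EK) hφ hφK k⁻¹ hregz
    rwa [inv_smul_smul] at this
  have hker : ∀ v α, tmap E ℝ (φ α) (s w) (orbitMap E EK K s w v) = 0 := by
    intro v α
    have hd : MDifferentiableAt 𝓘(ℝ, E) 𝓘(ℝ, ℝ) (φ α) (s w) := (hφ α).mdifferentiableAt (by simp)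
    have h1 : (fun w' => φ α (s w')) =ᶠ[𝓝 w] fun _ => 0 := hs0.mono fun w' h => h α
    rw [orbitMap_apply, map_add, tmap_genField_eq_zero hd (fun k => hφK α k _),
      ← tmap_comp_apply hd hs, tmap_congr h1, tmap_const]
    simp
  have h3 := volDensity_map (hdim := hdim) hE b hregw hregz (preservesForm_smul hΨ k (s w))
    (fun α v => tmap_smul_eq (EK := EK) hφ hφK k (s w) α v) hker
  refine ⟨fun w' => (g w').1.2, τ', ?_, congrArg (fun q => q.1.2) hgw, ?_, ?_⟩
  · exact ((ContinuousLinearMap.snd ℝ EK Y).comp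
      (ContinuousLinearMap.fst ℝ (EK × Y) (Fin p → ℝ))).hasFDerivAt.comp w hgf
  · filter_upwards [hev] with w' hw'
    have h0 : (g w').1.2 ∈ Metric.ball (0 : Y) r := by
      have := hw'.2.1
      rw [mem_ball_zero_iff] at this ⊢
      exact ((norm_snd_le _).trans (norm_fst_le _)).trans_lt this
    refine ⟨h0, orbitProj_eq_iff.2 ⟨(κ (g w').1.1)⁻¹ * k, ?_⟩⟩
    rw [mul_smul, hw'.1, h.symm_eq _ hw'.2.1, inv_smul_smul, hw'.2.2]
    rfl
  · rw [sliceDensity, ← h3, hLT, volDensity_comp, hk]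
    congr 1
    have h4 : LinearMap.det L.toLinearMap =
        LinearMap.det (adMap (EK := EK) k).toLinearMap * LinearMap.det τ'.toLinearMap :=
      det_triangular _ _ _
    rw [h4, abs_mul, abs_det_adMap, one_mul]

end Transition

end InvariantRelations

end

noncomputable section

namespace InvariantRelations

open Set Filter Topology

/-! ### Gluing densities into a measure. -/

section MeasureFromDensities

variable {Y : Type*} [NormedAddCommGroup Y] [NormedSpace ℝ Y]
  {X : Type*}

/-- The parametrization `f` of a subset of `X`, with density `ρ`, is related to the parametrization
`f'` with density `ρ'` by differentiable changes of coordinates that transform `ρ'` to `ρ`. -/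
def DensityCompatible (V : Set Y) (f : Y → X) (ρ : Y → ℝ) (V' : Set Y) (f' : Y → X) (ρ' : Y → ℝ) :
    Prop :=
  ∀ w ∈ V, ∀ z ∈ V', f w = f' z → ∃ (τ : Y → Y) (τ' : Y →L[ℝ] Y), HasFDerivAt τ τ' w ∧ τ w = z ∧
    (∀ᶠ w' in 𝓝 w, τ w' ∈ V' ∧ f w' = f' (τ w')) ∧ ρ w = |τ'.det| * ρ' z

variable [FiniteDimensional ℝ Y] [MeasurableSpace Y] [BorelSpace Y] {μ : Measure Y}
  [μ.IsAddHaarMeasure]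

/-- The change of variables formula for the transition map `T`. By injectivity of `f'` this
set-theoretically chosen map agrees near each point of `A` with the differentiable `τ`, and
differentiability within `A` is all the formula needs. -/
theorem DensityCompatible.lintegral_eq {V : Set Y} {f : Y → X} {ρ : Y → ℝ} {V' : Set Y}
    {f' : Y → X} {ρ' : Y → ℝ} (h : DensityCompatible V f ρ V' f' ρ') (hf : InjOn f V)
    (hf' : InjOn f' V') {A : Set Y} (hA : MeasurableSet A) (hAV : A ⊆ V)
    (hAV' : f '' A ⊆ f' '' V') :
    ∫⁻ z in V' ∩ f' ⁻¹' (f '' A), ENNReal.ofReal (ρ' z) ∂μ =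
      ∫⁻ z in A, ENNReal.ofReal (ρ z) ∂μ := by
  choose! T hTV hT using fun w (hw : w ∈ A) => hAV' (mem_image_of_mem f hw)
  have hder : ∀ w ∈ A, ∃ τ' : Y →L[ℝ] Y, HasFDerivWithinAt T τ' A w ∧
      ρ w = |τ'.det| * ρ' (T w) := by
    intro w hw
    obtain ⟨τ, τ', h1, h2, h3, h4⟩ := h w (hAV hw) (T w) (hTV w hw) (hT w hw).symm
    refine ⟨τ', ?_, h4⟩
    refine h1.hasFDerivWithinAt.congr_of_eventuallyEq ?_ h2.symm
    filter_upwards [mem_nhdsWithin_of_mem_nhds h3, self_mem_nhdsWithin] with w' hw' hwA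
    exact hf' (hTV w' hwA) hw'.1 ((hT w' hwA).trans hw'.2)
  choose! T' hT' hρ using hder
  have hTinj : InjOn T A := fun w hw w' hw' he =>
    hf (hAV hw) (hAV hw') (by rw [← hT w hw, ← hT w' hw', he])
  have himage : T '' A = V' ∩ f' ⁻¹' (f '' A) := by
    ext z
    constructor
    · rintro ⟨w, hw, rfl⟩
      exact ⟨hTV w hw, w, hw, (hT w hw).symm⟩
    · rintro ⟨hz, w, hw, he⟩
      exact ⟨w, hw, hf' (hTV w hw) hz ((hT w hw).trans he)⟩
  rw [← himage, lintegral_image_eq_lintegral_abs_det_fderiv_mul μ hA hT' hTinj]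
  refine setLIntegral_congr_fun hA fun w hw => ?_
  rw [hρ w hw, ENNReal.ofReal_mul (abs_nonneg _)]

variable [TopologicalSpace X] [MeasurableSpace X] [BorelSpace X]

omit [NormedSpace ℝ Y] [FiniteDimensional ℝ Y] in
theorem measurableSet_inter_preimage {V : Set Y} (hV : MeasurableSet V) {f : Y → X}
    (hf : ContinuousOn f V) {B : Set X} (hB : MeasurableSet B) : MeasurableSet (V ∩ f ⁻¹' B) := by
  have h1 := (hf.domRestrict.measurable hB)
  have h2 := hV.subtype_image h1
  convert h2 using 1
  ext z
  constructor
  · rintro ⟨hz, hzB⟩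
    exact ⟨⟨z, hz⟩, hzB, rfl⟩
  · rintro ⟨⟨z, hz⟩, hzB, rfl⟩
    exact ⟨hz, hzB⟩

variable (μ) in
/-- The measure given by densities in countably many parametrizations. -/
theorem exists_measure_of_densityCompatible {V : ℕ → Set Y} {f : ℕ → Y → X} {ρ : ℕ → Y → ℝ}
    (hV : ∀ i, IsOpen (V i)) (hf : ∀ i, ContinuousOn (f i) (V i)) (hinj : ∀ i, InjOn (f i) (V i))
    (hP : ∀ i, MeasurableSet (f i '' V i)) :
    ∃ ν : Measure X, ν (⋃ i, f i '' V i)ᶜ = 0 ∧ ∀ (V' : Set Y) (f' : Y → X) (ρ' : Y → ℝ),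
      IsOpen V' → ContinuousOn f' V' → InjOn f' V' → f' '' V' ⊆ ⋃ i, f i '' V i →
      (∀ i, DensityCompatible V' f' ρ' (V i) (f i) (ρ i)) →
      ∀ B, MeasurableSet B → B ⊆ f' '' V' →
        ν B = ∫⁻ z in V' ∩ f' ⁻¹' B, ENNReal.ofReal (ρ' z) ∂μ := by
  let D : ℕ → Set X := disjointed fun i => f i '' V i
  have hD : ∀ i, MeasurableSet (D i) := fun i => MeasurableSet.disjointed hP i
  have hDP : ∀ i, D i ⊆ f i '' V i := fun i => disjointed_subset _ i
  have hDd : Pairwise (Function.onFun Disjoint D) := disjoint_disjointed _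
  have hDU : ⋃ i, D i = ⋃ i, f i '' V i := iUnion_disjointed
  -- Each parametrization contributes only on its share `D i` of a disjoint decomposition.
  -- Compatibility of the densities makes the result independent of how the shares were allotted.
  let ν : Measure X := Measure.sum fun i => (((μ.restrict (V i)).withDensity
    fun z => ENNReal.ofReal (ρ i z)).map (f i)).restrict (D i)
  have hν : ∀ B, MeasurableSet B → ν B =
      ∑' i, ∫⁻ z in V i ∩ f i ⁻¹' (B ∩ D i), ENNReal.ofReal (ρ i z) ∂μ := by
    intro B hB
    rw [Measure.sum_apply _ hB]
    congr 1
    funext i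
    have hae : AEMeasurable (f i) ((μ.restrict (V i)).withDensity
        fun z => ENNReal.ofReal (ρ i z)) :=
      ((hf i).aemeasurable (hV i).measurableSet).mono_ac (withDensity_absolutelyContinuous _ _)
    rw [Measure.restrict_apply hB, Measure.map_apply_of_aemeasurable hae (hB.inter (hD i)),
      withDensity_apply', Measure.restrict_restrict' (hV i).measurableSet, inter_comm]
  refine ⟨ν, ?_, ?_⟩
  · rw [hν _ (MeasurableSet.iUnion hP).compl, ENNReal.tsum_eq_zero]
    intro i
    have : (⋃ i, f i '' V i)ᶜ ∩ D i = ∅ := by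
      rw [← hDU, ← disjoint_iff_inter_eq_empty]
      exact (disjoint_compl_left (a := ⋃ i, D i)).mono_right (subset_iUnion D i)
    rw [this]
    simp
  · intro V' f' ρ' hV' hf' hinj' hsub hc B hB hBV
    rw [hν B hB]
    have hsplit : V' ∩ f' ⁻¹' B = ⋃ i, V' ∩ f' ⁻¹' (B ∩ D i) := by
      rw [← inter_iUnion, ← preimage_iUnion, ← inter_iUnion, hDU]
      congr 1
      rw [inter_eq_left.2 (hBV.trans hsub)]
    rw [hsplit, lintegral_iUnion
      (fun i => measurableSet_inter_preimage hV'.measurableSet hf' (hB.inter (hD i)))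
      (fun i j hij => ?_)]
    · congr 1
      funext i
      have himage : f' '' (V' ∩ f' ⁻¹' (B ∩ D i)) = B ∩ D i := by
        rw [image_inter_preimage, inter_eq_right]
        exact inter_subset_left.trans hBV
      have h1 := (hc i).lintegral_eq (μ := μ) hinj' (hinj i)
        (measurableSet_inter_preimage hV'.measurableSet hf' (hB.inter (hD i))) inter_subset_left
        (by rw [himage]; exact inter_subset_right.trans (hDP i))
      rw [himage] at h1
      exact h1
    · exact ((hDd hij).preimage f').mono (fun z hz => hz.2.2) (fun z hz => hz.2.2)

/-- A map which in suitable parametrizations preserves the densities preserves the measure. -/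
theorem measure_image_eq_of_densities [T2Space X] [PolishSpace Y] {ν : Measure X} {A : Set X}
    (hA : MeasurableSet A) {F : X → X} (hF : InjOn F A) {V : ℕ → Set Y} {f f' : ℕ → Y → X}
    {ρ : ℕ → Y → ℝ} (hV : ∀ i, IsOpen (V i)) (hf : ∀ i, ContinuousOn (f i) (V i))
    (hinj : ∀ i, InjOn (f i) (V i)) (hf' : ∀ i, ContinuousOn (f' i) (V i))
    (hinj' : ∀ i, InjOn (f' i) (V i)) (hAV : A ⊆ ⋃ i, f i '' V i)
    (hFf : ∀ i, ∀ z ∈ V i, f i z ∈ A → F (f i z) = f' i z)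
    (hν : ∀ i B, MeasurableSet B → B ⊆ f i '' V i →
      ν B = ∫⁻ z in V i ∩ f i ⁻¹' B, ENNReal.ofReal (ρ i z) ∂μ)
    (hν' : ∀ i B, MeasurableSet B → B ⊆ f' i '' V i →
      ν B = ∫⁻ z in V i ∩ f' i ⁻¹' B, ENNReal.ofReal (ρ i z) ∂μ) :
    ν (F '' A) = ν A := by
  have hP : ∀ i, MeasurableSet (f i '' V i) := fun i =>
    (hV i).measurableSet.image_of_continuousOn_injOn (hf i) (hinj i)
  let D : ℕ → Set X := disjointed fun i => f i '' V i
  have hD : ∀ i, MeasurableSet (D i) := fun i => MeasurableSet.disjointed hP i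
  have hDP : ∀ i, D i ⊆ f i '' V i := fun i => disjointed_subset _ i
  have hDd : Pairwise (Function.onFun Disjoint D) := disjoint_disjointed _
  have hDU : ⋃ i, D i = ⋃ i, f i '' V i := iUnion_disjointed
  have hsplit : A = ⋃ i, A ∩ D i := by
    rw [← inter_iUnion, hDU, inter_eq_left.2 hAV]
  have hB : ∀ i, MeasurableSet (A ∩ D i) := fun i => hA.inter (hD i)
  have hFB : ∀ i, F '' (A ∩ D i) = f' i '' (V i ∩ f i ⁻¹' (A ∩ D i)) := by
    intro i
    ext y
    constructor
    · rintro ⟨x, hx, rfl⟩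
      obtain ⟨z, hz, rfl⟩ := hDP i hx.2
      exact ⟨z, ⟨hz, hx⟩, (hFf i z hz hx.1).symm⟩
    · rintro ⟨z, ⟨hz, hzx⟩, rfl⟩
      exact ⟨f i z, hzx, hFf i z hz hzx.1⟩
  -- The map `F` need not be known to be measurable: on each piece its image is the injective
  -- continuous image of a Borel set of a Polish space.
  have hFm : ∀ i, MeasurableSet (F '' (A ∩ D i)) := fun i => by
    rw [hFB]
    exact (measurableSet_inter_preimage (hV i).measurableSet (hf i) (hB i)).image_of_continuousOn_injOn
      ((hf' i).mono inter_subset_left) ((hinj' i).mono inter_subset_left)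
  have heq : ∀ i, ν (F '' (A ∩ D i)) = ν (A ∩ D i) := by
    intro i
    rw [hν i _ (hB i) (inter_subset_right.trans (hDP i)), hν' i _ (hFm i)
      (by rw [hFB]; exact image_mono inter_subset_left), hFB]
    congr 2
    ext z
    constructor
    · rintro ⟨hz, w, hw, he⟩
      rw [hinj' i hw.1 hz he] at hw
      exact hw
    · rintro hz
      exact ⟨hz.1, z, hz, rfl⟩
  have h1 : ν A = ∑' i, ν (A ∩ D i) := by
    conv_lhs => rw [hsplit]
    exact measure_iUnion (fun i j hij => (hDd hij).mono inter_subset_right inter_subset_right) hB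
  have h2 : ν (F '' A) = ∑' i, ν (F '' (A ∩ D i)) := by
    conv_lhs => rw [hsplit, image_iUnion]
    refine measure_iUnion (fun i j hij => ?_) hFm
    rw [Function.onFun, disjoint_left]
    rintro y ⟨x, hx, rfl⟩ ⟨x', hx', he⟩
    rw [hF hx'.1 hx.1 he] at hx'
    exact disjoint_left.1 (hDd hij) hx.2 hx'.2
  rw [h1, h2]
  exact tsum_congr heq

end MeasureFromDensities

end InvariantRelations

end

noncomputable section

namespace InvariantRelations

open Set Filter Topology

/-! ### The measure on the quotient of the level set. -/

section QuotientMeasure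

variable {E : Type*} [NormedAddCommGroup E] [NormedSpace ℝ E]
  {M : Type*} [TopologicalSpace M] [ChartedSpace E M]
  {EK : Type*} [NormedAddCommGroup EK] [NormedSpace ℝ EK]
  {K : Type*} [TopologicalSpace K] [ChartedSpace EK K] [Group K] [MulAction K M]
  {p : ℕ} {φ : Fin p → M → ℝ} {ωM : SymplecticForm E M} {n m : ℕ} {hdim : 2 * n = p + m}
  {Ψ : M → Module.Dual ℝ (GroupLieAlgebra 𝓘(ℝ, EK) K)}

/-- A free Hamiltonian action with momentum map `Ψ`, and independent invariant functions `φ`. -/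
structure IsReducible (ωM : SymplecticForm E M)
    (Ψ : M → Module.Dual ℝ (GroupLieAlgebra 𝓘(ℝ, EK) K)) (φ : Fin p → M → ℝ) (n : ℕ) : Prop where
  finrank_eq : Module.finrank ℝ E = 2 * n
  free : ∀ (k : K) (x : M), k • x = x → k = 1
  hamiltonian : IsHamiltonianAction ωM Ψ
  smooth : ∀ α, ContMDiff 𝓘(ℝ, E) 𝓘(ℝ, ℝ) ∞ (φ α)
  invariant : ∀ α (k : K) (x : M), φ α (k • x) = φ α x
  regular : ∀ x, (∀ α, φ α x = 0) → IsRegularAt E φ x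

variable [LieGroup 𝓘(ℝ, EK) ∞ K] [ContMDiffSMul 𝓘(ℝ, EK) 𝓘(ℝ, E) ∞ K M]

section SliceImage

variable {Y : Type*} [NormedAddCommGroup Y] [NormedSpace ℝ Y] {x : M}
  {S : OpenPartialHomeomorph M ((EK × Y) × (Fin p → ℝ))} {κ : EK → K} {D : EK ≃L[ℝ] EK} {r : ℝ}

omit [LieGroup 𝓘(ℝ, EK) ∞ K] [ContMDiffSMul 𝓘(ℝ, EK) 𝓘(ℝ, E) ∞ K M] in
theorem IsSliceChart.isOpen_image_ball (h : IsSliceChart E φ x S κ D r) :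
    IsOpen (S.symm '' Metric.ball 0 r) :=
  S.isOpen_image_symm_of_subset_target Metric.isOpen_ball h.ball_subset

omit [LieGroup 𝓘(ℝ, EK) ∞ K] [ContMDiffSMul 𝓘(ℝ, EK) 𝓘(ℝ, E) ∞ K M] in
theorem IsSliceChart.mem_image_ball (h : IsSliceChart E φ x S κ D r) :
    x ∈ S.symm '' Metric.ball 0 r := ⟨0, Metric.mem_ball_self h.pos, h.symm_zero⟩

omit [LieGroup 𝓘(ℝ, EK) ∞ K] [ContMDiffSMul 𝓘(ℝ, EK) 𝓘(ℝ, E) ∞ K M] in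
/-- A slice meets all the orbits near its base point in the level set. -/
theorem IsSliceChart.image_sliceMap (h : IsSliceChart E φ x S κ D r)
    (hφK : ∀ α (k : K) (x : M), φ α (k • x) = φ α x) :
    (fun z => orbitProj K (sliceMap S z)) '' Metric.ball 0 r =
      orbitProj K '' (S.symm '' Metric.ball 0 r) ∩ orbitProj K '' {x | ∀ α, φ α x = 0} := by
  ext y
  constructor
  · rintro ⟨z, hz, rfl⟩
    exact ⟨⟨_, ⟨_, mem_ball_slice hz, rfl⟩, rfl⟩, _, fun α => h.apply_sliceMap hz α, rfl⟩
  · rintro ⟨⟨_, ⟨q, hq, rfl⟩, rfl⟩, x', hx', he⟩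
    obtain ⟨k, hk⟩ := orbitProj_eq_iff.1 he
    have hq2 : q.2 = 0 := by
      funext α
      rw [← h.apply_symm_snd (h.ball_subset hq), ← hk, hφK, hx']
      rfl
    refine ⟨q.1.2, ?_, ?_⟩
    · rw [mem_ball_zero_iff] at hq ⊢
      exact ((norm_snd_le _).trans (norm_fst_le _)).trans_lt hq
    · change orbitProj K (S.symm ((0, q.1.2), 0)) = orbitProj K (S.symm q)
      rw [h.symm_eq q hq, orbitProj_smul, hq2]

omit [LieGroup 𝓘(ℝ, EK) ∞ K] [ContMDiffSMul 𝓘(ℝ, EK) 𝓘(ℝ, E) ∞ K M] in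
theorem IsSliceChart.injOn_sliceMap (h : IsSliceChart E φ x S κ D r) :
    InjOn (fun z => orbitProj K (sliceMap S z)) (Metric.ball 0 r) := by
  intro z hz z' hz' he
  obtain ⟨k, hk⟩ := orbitProj_eq_iff.1 he
  exact (h.inj k z z' 0 0 (mem_ball_slice hz) (mem_ball_slice hz') hk).1

omit [LieGroup 𝓘(ℝ, EK) ∞ K] [ContMDiffSMul 𝓘(ℝ, EK) 𝓘(ℝ, E) ∞ K M] in
theorem IsSliceChart.continuousOn_sliceMap (h : IsSliceChart E φ x S κ D r) :
    ContinuousOn (fun z => orbitProj K (sliceMap S z)) (Metric.ball 0 r) := fun _ hz =>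
  (continuous_orbitProj.continuousAt.comp
    (h.contMDiffAt_sliceMap hz).continuousAt).continuousWithinAt

variable [IsManifold 𝓘(ℝ, E) ∞ M]

/-- A slice is a parametrization of the quotient of the level set. -/
theorem IsSliceChart.isQuotientParametrization {d : ℕ}
    {S : OpenPartialHomeomorph M ((EK × EuclideanSpace ℝ (Fin d)) × (Fin p → ℝ))}
    (h : IsSliceChart E φ x S κ D r) (hφK : ∀ α (k : K) (x : M), φ α (k • x) = φ α x) :
    IsQuotientParametrization E EK K {x | ∀ α, φ α x = 0} (Metric.ball 0 r) (sliceMap S) where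
  isOpen := Metric.isOpen_ball
  smooth := fun z hz => (h.contMDiffAt_sliceMap hz).contMDiffWithinAt
  mapsTo := fun z hz α => h.apply_sliceMap hz α
  injOn := h.injOn_sliceMap
  isOpen_image := by
    have : ContinuousSMul K M :=
      ContMDiffSMul.continuousSMul (I := 𝓘(ℝ, EK)) (I' := 𝓘(ℝ, E)) ∞
    exact ⟨_, isOpenMap_orbitProj _ h.isOpen_image_ball, h.image_sliceMap hφK⟩
  immersive := by
    intro z hz u (ζ : EK) he
    have h3 : orbitMap E EK K (sliceMap S) z (0, u) = orbitMap E EK K (sliceMap S) z (ζ, 0) := by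
      rw [orbitMap_apply, orbitMap_apply]
      have he' : tmap (EuclideanSpace ℝ (Fin d)) E (sliceMap S) z u =
        genField E (G := K) ζ (sliceMap S z) := he
      have h0 : genField E (G := K) (0 : EK) (sliceMap S z) = 0 := map_zero _
      change genField E (G := K) (0 : EK) (sliceMap S z) +
        tmap (EuclideanSpace ℝ (Fin d)) E (sliceMap S) z u = genField E (G := K) ζ (sliceMap S z) +
          tmap (EuclideanSpace ℝ (Fin d)) E (sliceMap S) z 0
      rw [he', map_zero, h0, zero_add, add_zero]
    exact congrArg Prod.snd (h.orbitMap_injective hz h3)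

end SliceImage

namespace IsReducible

variable [FiniteDimensional ℝ E] [IsManifold 𝓘(ℝ, E) ∞ M] [T2Space M]
  [FiniteDimensional ℝ EK] [CompactSpace K]

include hdim in
-- The generators at a point of the level set embed the Lie algebra of `K` into the tangent space of
-- the level set. This keeps the natural number subtraction in the dimension of the quotient honest.
theorem finrank_le (H : IsReducible ωM Ψ φ n) {x : M} (hx : ∀ α, φ α x = 0) :
    Module.finrank ℝ EK ≤ m := by
  obtain ⟨w, hw⟩ := H.regular x hx
  rw [← finrank_iInf_ker (ℓ := fun α => (tmap E ℝ (φ α) x).toLinearMap) hw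
    (H.finrank_eq.trans hdim)]
  let J : EK →ₗ[ℝ] (LinearMap.pi fun α => (tmap E ℝ (φ α) x).toLinearMap).ker :=
    (tmap EK E (fun g : K => g • x) 1).toLinearMap.codRestrict _ fun ζ => by
      rw [LinearMap.mem_ker]
      funext α
      exact tmap_genField_eq_zero ((H.smooth α).mdifferentiableAt (by simp))
        (fun k => H.invariant α k x) ζ
  refine LinearMap.finrank_le_finrank_of_injective (f := J) ?_
  rw [injective_iff_map_eq_zero]
  intro ζ hζ
  exact eq_zero_of_genField_eq_zero (E := E) (K := K) H.free (x := x) (congrArg Subtype.val hζ)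

variable {d : ℕ} (hd : Module.finrank ℝ EK + d = m)
include hd

include hdim in
theorem exists_isSliceChart (H : IsReducible ωM Ψ φ n) {x : M} (hx : ∀ α, φ α x = 0) :
    ∃ (S : OpenPartialHomeomorph M ((EK × EuclideanSpace ℝ (Fin d)) × (Fin p → ℝ))) (κ : EK → K)
      (D : EK ≃L[ℝ] EK) (r : ℝ), IsSliceChart E φ x S κ D r :=
  InvariantRelations.exists_isSliceChart H.free H.smooth H.invariant hx (H.regular x hx)
    (by rw [H.finrank_eq, hdim, finrank_euclideanSpace, Fintype.card_fin, hd])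

omit hd in
theorem densityCompatible (H : IsReducible ωM Ψ φ n)
    (b : Module.Basis (Fin m) ℝ (EK × EuclideanSpace ℝ (Fin d))) {x : M}
    {S : OpenPartialHomeomorph M ((EK × EuclideanSpace ℝ (Fin d)) × (Fin p → ℝ))} {κ : EK → K}
    {D : EK ≃L[ℝ] EK} {r : ℝ} (h : IsSliceChart E φ x S κ D r)
    {V : Set (EuclideanSpace ℝ (Fin d))} {s : EuclideanSpace ℝ (Fin d) → M} (hV : IsOpen V)
    (hs : ∀ z ∈ V, MDifferentiableAt 𝓘(ℝ, EuclideanSpace ℝ (Fin d)) 𝓘(ℝ, E) s z)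
    (hs0 : ∀ z ∈ V, ∀ α, φ α (s z) = 0) :
    DensityCompatible V (fun z => orbitProj K (s z)) (sliceDensity E EK K ωM hdim φ b s)
      (Metric.ball 0 r) (fun z => orbitProj K (sliceMap S z))
      (sliceDensity E EK K ωM hdim φ b (sliceMap S)) := by
  intro w hw z hz he
  refine exists_transition b H.finrank_eq H.hamiltonian H.smooth H.invariant h hz (hs w hw) ?_ he
  filter_upwards [hV.mem_nhds hw] with w' hw' using hs0 w' hw'

/-- The measure on the quotient of the level set given by the densities of all transversals. -/
theorem exists_measure [SecondCountableTopology M] (H : IsReducible ωM Ψ φ n)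
    (b : Module.Basis (Fin m) ℝ (EK × EuclideanSpace ℝ (Fin d))) {x₀ : M}
    (hx₀ : ∀ α, φ α x₀ = 0) :
    ∃ ν : Measure (OrbitSpace K M), ν (orbitProj K '' {x | ∀ α, φ α x = 0})ᶜ = 0 ∧
      ∀ (V : Set (EuclideanSpace ℝ (Fin d))) (s : EuclideanSpace ℝ (Fin d) → M), IsOpen V →
        (∀ z ∈ V, MDifferentiableAt 𝓘(ℝ, EuclideanSpace ℝ (Fin d)) 𝓘(ℝ, E) s z) →
        (∀ z ∈ V, ∀ α, φ α (s z) = 0) → InjOn (fun z => orbitProj K (s z)) V →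
        ∀ B, MeasurableSet B → B ⊆ (fun z => orbitProj K (s z)) '' V →
          ν B = ∫⁻ z in V ∩ (fun z => orbitProj K (s z)) ⁻¹' B,
            ENNReal.ofReal (sliceDensity E EK K ωM hdim φ b s z) := by
  have : ContinuousSMul K M := ContMDiffSMul.continuousSMul (I := 𝓘(ℝ, EK)) (I' := 𝓘(ℝ, E)) ∞
  have : T2Space (OrbitSpace K M) := t2Space_orbitSpace
  choose S κ D r h using fun x : {x : M | ∀ α, φ α x = 0} =>
    H.exists_isSliceChart (hdim := hdim) hd x.2
  -- By second countability, countably many slices cover the level set up to the action. The point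
  -- `x₀` is needed so that the family is nonempty and can be indexed by the natural numbers.
  obtain ⟨t, htc, htU⟩ := TopologicalSpace.countable_cover_nhds
    (f := fun x => Subtype.val ⁻¹' ((S x).symm '' Metric.ball 0 (r x))) fun x =>
      ((h x).isOpen_image_ball.preimage continuous_subtype_val).mem_nhds (h x).mem_image_ball
  have htne : t.Nonempty := by
    have h1 : (⟨x₀, hx₀⟩ : {x : M | ∀ α, φ α x = 0}) ∈
        ⋃ x ∈ t, Subtype.val ⁻¹' ((S x).symm '' Metric.ball 0 (r x)) := htU ▸ mem_univ _
    obtain ⟨x, hx, -⟩ := mem_iUnion₂.1 h1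
    exact ⟨x, hx⟩
  obtain ⟨c, rfl⟩ := htc.exists_eq_range htne
  have hU : ⋃ i, (fun z => orbitProj K (sliceMap (S (c i)) z)) '' Metric.ball 0 (r (c i)) =
      orbitProj K '' {x | ∀ α, φ α x = 0} := by
    refine Subset.antisymm (iUnion_subset fun i => ?_) ?_
    · rw [(h (c i)).image_sliceMap H.invariant]
      exact inter_subset_right
    · rintro _ ⟨x, hx, rfl⟩
      have h1 : (⟨x, hx⟩ : {x : M | ∀ α, φ α x = 0}) ∈
        ⋃ x ∈ range c, Subtype.val ⁻¹' ((S x).symm '' Metric.ball 0 (r x)) := htU ▸ mem_univ _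
      obtain ⟨_, ⟨i, rfl⟩, hi⟩ := mem_iUnion₂.1 h1
      refine mem_iUnion.2 ⟨i, ?_⟩
      rw [(h (c i)).image_sliceMap H.invariant]
      exact ⟨⟨x, hi, rfl⟩, x, hx, rfl⟩
  obtain ⟨ν, hν0, hν⟩ := exists_measure_of_densityCompatible
    (volume : Measure (EuclideanSpace ℝ (Fin d)))
    (V := fun i => Metric.ball 0 (r (c i)))
    (f := fun i z => orbitProj K (sliceMap (S (c i)) z))
    (ρ := fun i => sliceDensity E EK K ωM hdim φ b (sliceMap (S (c i))))
    (fun i => Metric.isOpen_ball) (fun i => (h (c i)).continuousOn_sliceMap)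
    (fun i => (h (c i)).injOn_sliceMap) (fun i => Metric.isOpen_ball.measurableSet.image_of_continuousOn_injOn
      (h (c i)).continuousOn_sliceMap (h (c i)).injOn_sliceMap)
  refine ⟨ν, by rwa [hU] at hν0, fun V s hV hs hs0 hinj B hB hBV => ?_⟩
  refine hν V (fun z => orbitProj K (s z)) _ hV (fun z hz => ?_) hinj ?_
    (fun i => H.densityCompatible b (h (c i)) hV hs hs0) B hB hBV
  · exact (continuous_orbitProj.continuousAt.comp (hs z hz).continuousAt).continuousWithinAt
  · rw [hU]
    rintro _ ⟨z, hz, rfl⟩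
    exact ⟨s z, hs0 z hz, rfl⟩

end IsReducible

end QuotientMeasure

end InvariantRelations

end

noncomputable section

namespace InvariantRelations

open Set Filter Topology

/-! ### Slice coordinates as smooth functions on the orbit space. -/

section SliceCoordinates

variable {E : Type*} [NormedAddCommGroup E] [NormedSpace ℝ E]
  {M : Type*} [TopologicalSpace M] [ChartedSpace E M]
  {EK : Type*} [NormedAddCommGroup EK] [NormedSpace ℝ EK]
  {K : Type*} [TopologicalSpace K] [ChartedSpace EK K] [Group K] [MulAction K M]
  {Y : Type*} [NormedAddCommGroup Y] [NormedSpace ℝ Y]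
  {p : ℕ} {φ : Fin p → M → ℝ} {x : M} {S : OpenPartialHomeomorph M ((EK × Y) × (Fin p → ℝ))}
  {κ : EK → K} {D : EK ≃L[ℝ] EK} {r : ℝ}

/-- The points with vanishing group coordinate in a slice chart. -/
def transversalMap (S : OpenPartialHomeomorph M ((EK × Y) × (Fin p → ℝ)))
    (w : Y × (Fin p → ℝ)) : M := S.symm ((0, w.1), w.2)

/-- Forgetting the group coordinate. -/
def transversalProj (q : (EK × Y) × (Fin p → ℝ)) : Y × (Fin p → ℝ) := (q.1.2, q.2)

theorem contDiff_transversalProj :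
    ContDiff ℝ ∞ (transversalProj : (EK × Y) × (Fin p → ℝ) → Y × (Fin p → ℝ)) :=
  (contDiff_snd.comp contDiff_fst).prodMk contDiff_snd

theorem mem_ball_transversal {w : Y × (Fin p → ℝ)} {r : ℝ} (hw : w ∈ Metric.ball 0 r) :
    ((0, w.1), w.2) ∈ Metric.ball (0 : (EK × Y) × (Fin p → ℝ)) r := by
  rw [mem_ball_zero_iff] at hw ⊢
  simpa [Prod.norm_def] using hw

theorem transversalProj_mem_ball {q : (EK × Y) × (Fin p → ℝ)} {r : ℝ} (hq : q ∈ Metric.ball 0 r) :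
    transversalProj q ∈ Metric.ball 0 r := by
  rw [mem_ball_zero_iff] at hq ⊢
  simp only [transversalProj, Prod.norm_def, max_lt_iff] at hq ⊢
  exact ⟨hq.1.2, hq.2⟩

namespace IsSliceChart

theorem contMDiffAt_transversalMap (h : IsSliceChart E φ x S κ D r) {w : Y × (Fin p → ℝ)}
    (hw : w ∈ Metric.ball 0 r) :
    ContMDiffAt 𝓘(ℝ, Y × (Fin p → ℝ)) 𝓘(ℝ, E) ∞ (transversalMap S) w := by
  have h1 : ContMDiffAt 𝓘(ℝ, Y × (Fin p → ℝ)) 𝓘(ℝ, (EK × Y) × (Fin p → ℝ)) ∞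
      (fun w : Y × (Fin p → ℝ) => (((0 : EK), w.1), w.2)) w :=
    ((contDiff_const.prodMk contDiff_fst).prodMk contDiff_snd).contMDiff.contMDiffAt
  exact ContMDiffAt.comp w (g := S.symm) (h.smooth.contMDiffAt_symm
    (h.ball_subset (mem_ball_transversal hw))) h1

theorem transversalMap_zero (h : IsSliceChart E φ x S κ D r) : transversalMap S 0 = x :=
  h.symm_zero

theorem orbitProj_symm (h : IsSliceChart E φ x S κ D r) {q : (EK × Y) × (Fin p → ℝ)}
    (hq : q ∈ Metric.ball 0 r) :
    orbitProj K (S.symm q) = orbitProj K (transversalMap S (transversalProj q)) := by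
  rw [h.symm_eq q hq, orbitProj_smul]
  rfl

theorem injOn_transversalMap (h : IsSliceChart E φ x S κ D r) :
    InjOn (fun w => orbitProj K (transversalMap S w)) (Metric.ball 0 r) := by
  intro w hw w' hw' he
  obtain ⟨k, hk⟩ := orbitProj_eq_iff.1 he
  have h1 := h.inj k _ _ _ _ (mem_ball_transversal hw) (mem_ball_transversal hw') hk
  exact Prod.ext h1.1 h1.2

theorem continuousOn_transversalMap (h : IsSliceChart E φ x S κ D r) :
    ContinuousOn (fun w => orbitProj K (transversalMap S w)) (Metric.ball 0 r) := fun _ hw =>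
  (continuous_orbitProj.continuousAt.comp
    (h.contMDiffAt_transversalMap hw).continuousAt).continuousWithinAt

theorem isOpen_image_transversalMap [ContinuousSMul K M] (h : IsSliceChart E φ x S κ D r)
    {O : Set (Y × (Fin p → ℝ))} (hO : IsOpen O) (hOr : O ⊆ Metric.ball 0 r) :
    IsOpen ((fun w => orbitProj K (transversalMap S w)) '' O) := by
  have h1 : (fun w => orbitProj K (transversalMap S w)) '' O =
      orbitProj K '' (S.symm '' (Metric.ball 0 r ∩ transversalProj ⁻¹' O)) := by
    ext y
    constructor
    · rintro ⟨w, hw, rfl⟩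
      exact ⟨_, ⟨_, ⟨mem_ball_transversal (hOr hw), hw⟩, rfl⟩, rfl⟩
    · rintro ⟨_, ⟨q, hq, rfl⟩, rfl⟩
      exact ⟨_, hq.2, (h.orbitProj_symm hq.1).symm⟩
  rw [h1]
  exact isOpenMap_orbitProj _ (S.isOpen_image_symm_of_subset_target
    (Metric.isOpen_ball.inter (hO.preimage contDiff_transversalProj.continuous))
    (inter_subset_left.trans h.ball_subset))

/-- Smooth functions on the orbit space with given values in slice coordinates. -/
theorem exists_smooth_function [IsManifold 𝓘(ℝ, E) ∞ M] [FiniteDimensional ℝ Y]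
    [ContMDiffSMul 𝓘(ℝ, EK) 𝓘(ℝ, E) ∞ K M] [T2Space (OrbitSpace K M)]
    (h : IsSliceChart E φ x S κ D r) {ℓ : Y × (Fin p → ℝ) → ℝ} (hℓ : ContDiff ℝ ∞ ℓ) :
    ∃ F : OrbitSpace K M → ℝ, ContMDiff 𝓘(ℝ, E) 𝓘(ℝ, ℝ) ∞ (F ∘ orbitProj K : M → ℝ) ∧
      ∀ w ∈ Metric.ball 0 (r / 3), F (orbitProj K (transversalMap S w)) = ℓ w := by
  classical
  have hr := h.pos
  let P : Y × (Fin p → ℝ) → OrbitSpace K M := fun w => orbitProj K (transversalMap S w)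
  -- The function is cut off inside the slice and extended by zero. The support is the image of a
  -- compact ball, which is closed because the orbit space is Hausdorff, so the extension is smooth
  -- everywhere.
  let χ : ContDiffBump (0 : Y × (Fin p → ℝ)) := ⟨r / 3, r / 2, by positivity, by linarith⟩
  let F : OrbitSpace K M → ℝ := fun y => if y ∈ P '' Metric.ball 0 r then
    χ (Function.invFunOn P (Metric.ball 0 r) y) * ℓ (Function.invFunOn P (Metric.ball 0 r) y) else 0
  have hF : ∀ w ∈ Metric.ball (0 : Y × (Fin p → ℝ)) r, F (P w) = χ w * ℓ w := by
    intro w hw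
    have h1 : Function.invFunOn P (Metric.ball 0 r) (P w) = w :=
      h.injOn_transversalMap.leftInvOn_invFunOn hw
    simp only [F, h1, if_pos (mem_image_of_mem P hw)]
  refine ⟨F, fun x' => ?_, fun w hw => ?_⟩
  · by_cases hx' : orbitProj K x' ∈ P '' Metric.closedBall 0 (r / 2)
    · obtain ⟨w, hw, he⟩ := hx'
      have hwr : w ∈ Metric.ball (0 : Y × (Fin p → ℝ)) r :=
        Metric.closedBall_subset_ball (by linarith) hw
      obtain ⟨k, hk⟩ := orbitProj_eq_iff.1 he.symm
      have hq := mem_ball_transversal (EK := EK) hwr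
      have hks : k • x' ∈ S.source := by rw [hk]; exact S.map_target (h.ball_subset hq)
      have hSk : S (k • x') = ((0, w.1), w.2) := by
        rw [hk]; exact S.right_inv (h.ball_subset hq)
      have hkc : ContMDiff 𝓘(ℝ, E) 𝓘(ℝ, E) ∞ fun x : M => k • x :=
        (contMDiff_const (I' := 𝓘(ℝ, EK)) (c := k)).smul contMDiff_id
      have h1 : ContMDiffAt 𝓘(ℝ, E) 𝓘(ℝ, (EK × Y) × (Fin p → ℝ)) ∞ (fun x => S (k • x)) x' :=
        ContMDiffAt.comp x' (g := S) (h.smooth.contMDiffAt hks) hkc.contMDiffAt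
      have h2 : ContDiff ℝ ∞ fun q : (EK × Y) × (Fin p → ℝ) =>
          χ (transversalProj q) * ℓ (transversalProj q) :=
        (χ.contDiff.comp contDiff_transversalProj).mul (hℓ.comp contDiff_transversalProj)
      have h3 : ContMDiffAt 𝓘(ℝ, E) 𝓘(ℝ, ℝ) ∞
          (fun x => χ (transversalProj (S (k • x))) * ℓ (transversalProj (S (k • x)))) x' :=
        ContMDiffAt.comp x' (g := fun q => χ (transversalProj q) * ℓ (transversalProj q))
          h2.contMDiff.contMDiffAt h1
      refine h3.congr_of_eventuallyEq ?_
      filter_upwards [hkc.continuous.continuousAt.eventually (S.open_source.mem_nhds hks),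
        h1.continuousAt.eventually (Metric.isOpen_ball.mem_nhds (hSk ▸ hq))] with x'' h4 h5
      have h6 : orbitProj K x'' = P (transversalProj (S (k • x''))) := by
        rw [← orbitProj_smul k x'']
        conv_lhs => rw [← S.left_inv h4]
        exact h.orbitProj_symm h5
      rw [Function.comp_apply, h6]
      exact hF _ (transversalProj_mem_ball h5)
    · have hcl : IsClosed (P '' Metric.closedBall 0 (r / 2)) := by
        refine ((isCompact_closedBall _ _).image_of_continuousOn ?_).isClosed
        exact h.continuousOn_transversalMap.mono (Metric.closedBall_subset_ball (by linarith))
      refine (contMDiffAt_const (c := (0 : ℝ))).congr_of_eventuallyEq ?_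
      filter_upwards [(hcl.isOpen_compl.preimage continuous_orbitProj).mem_nhds hx'] with x'' h1
      change F (orbitProj K x'') = 0
      by_cases h2 : orbitProj K x'' ∈ P '' Metric.ball 0 r
      · obtain ⟨w, hw, he⟩ := h2
        rw [← he, hF w hw]
        have h3 : χ w = 0 := by
          refine χ.zero_of_le_dist ?_
          by_contra h4
          exact h1 ⟨w, Metric.mem_closedBall.2 (not_le.1 h4).le, he⟩
        rw [h3, zero_mul]
      · exact if_neg h2
  · have h1 := hF w (Metric.ball_subset_ball (by linarith) hw)
    have h2 : χ w = 1 := χ.one_of_mem_closedBall (Metric.ball_subset_closedBall hw)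
    rw [h2, one_mul] at h1
    exact h1

end IsSliceChart

end SliceCoordinates

/-! ### Trajectories of the reduced equations. -/

section ReducedTrajectories

variable {E : Type*} [NormedAddCommGroup E] [NormedSpace ℝ E]
  {M : Type*} [TopologicalSpace M] [ChartedSpace E M]
  {K : Type*} [Group K] [MulAction K M] {ωM : SymplecticForm E M}
  {H : OrbitSpace K M → ℝ} {c : ℝ → OrbitSpace K M} {J : Set ℝ}

theorem IsReducedTrajectoryOn.comp_add (hc : IsReducedTrajectoryOn ωM H c J) (a : ℝ) {J' : Set ℝ}
    (hJ : MapsTo (fun s => s + a) J' J) :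
    IsReducedTrajectoryOn ωM H (fun s => c (s + a)) J' := by
  refine ⟨hc.1.comp (by fun_prop) hJ, fun F hF t ht => ?_⟩
  have h1 := (hc.2 F hF (t + a) (hJ ht)).scomp t
    ((hasDerivAt_id t).add_const a).hasDerivWithinAt hJ
  rw [one_smul] at h1
  exact h1

variable [FiniteDimensional ℝ E]
  {EK : Type*} [NormedAddCommGroup EK] [NormedSpace ℝ EK]
  [TopologicalSpace K] [ChartedSpace EK K] [LieGroup 𝓘(ℝ, EK) ∞ K]
  [ContMDiffSMul 𝓘(ℝ, EK) 𝓘(ℝ, E) ∞ K M]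
  {Ψ : M → Module.Dual ℝ (GroupLieAlgebra 𝓘(ℝ, EK) K)} (hΨ : IsHamiltonianAction ωM Ψ)
  (hH : ContMDiff 𝓘(ℝ, E) 𝓘(ℝ, ℝ) ∞ (H ∘ orbitProj K : M → ℝ))
include hΨ hH

/-- The reduced bracket is evaluated at a chosen representative of the orbit; invariance of the
bracket under `K` removes the choice. -/
theorem reducedBracket_orbitProj {F : OrbitSpace K M → ℝ}
    (hF : ContMDiff 𝓘(ℝ, E) 𝓘(ℝ, ℝ) ∞ (F ∘ orbitProj K : M → ℝ)) (x : M) :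
    reducedBracket ωM F H (orbitProj K x) =
      poissonBracket ωM (F ∘ orbitProj K) (H ∘ orbitProj K) x := by
  have h1 : orbitProj K (Quotient.out (orbitProj K x)) = orbitProj K x := Quotient.out_eq _
  obtain ⟨k, hk⟩ := orbitProj_eq_iff.1 h1.symm
  rw [reducedBracket, ← hk]
  exact poissonBracket_smul hΨ hF (fun k x => by simp) hH (fun k x => by simp) k x

/-- The projection of a trajectory is a trajectory of the reduced equations. -/
theorem isReducedTrajectoryOn_orbitProj {γ : ℝ → M}
    (hγ : IsMIntegralCurveOn γ (hamiltonianField ωM (H ∘ orbitProj K)) J) :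
    IsReducedTrajectoryOn ωM H (fun t => orbitProj K (γ t)) J := by
  refine ⟨fun t ht => continuous_orbitProj.continuousAt.comp_continuousWithinAt (hγ t ht).1,
    fun F hF t ht => ?_⟩
  rw [reducedBracket_orbitProj hΨ hH hF]
  have h1 := (hF.mdifferentiableAt (x := γ t) (by simp)).hasMFDerivAt.comp_hasMFDerivWithinAt t
    (hγ t ht)
  have h2 : HasFDerivWithinAt ((F ∘ orbitProj K) ∘ γ)
      ((tmap E ℝ (F ∘ orbitProj K : M → ℝ) (γ t)).comp
        ((1 : ℝ →L[ℝ] ℝ).smulRight (hamField ωM (H ∘ orbitProj K) (γ t)))) J t :=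
    hasMFDerivWithinAt_iff_hasFDerivWithinAt.1 h1
  have h3 : HasDerivWithinAt ((F ∘ orbitProj K) ∘ γ)
      (poissonBracket ωM (F ∘ orbitProj K) (H ∘ orbitProj K) (γ t)) J t := by
    simpa [poissonBracket_eq] using h2.hasDerivWithinAt
  exact h3

variable [IsManifold 𝓘(ℝ, E) ∞ M] [T2Space (OrbitSpace K M)]
  {Y : Type*} [NormedAddCommGroup Y] [NormedSpace ℝ Y] [FiniteDimensional ℝ Y]
  {p : ℕ} {φ : Fin p → M → ℝ}

/-- Two trajectories of the reduced equations through a point at which there is a slice coincide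
near this point. -/
theorem IsReducedTrajectoryOn.eventually_eq {x : M}
    {S : OpenPartialHomeomorph M ((EK × Y) × (Fin p → ℝ))}
    {κ : EK → K} {D : EK ≃L[ℝ] EK} {r : ℝ} (h : IsSliceChart E φ x S κ D r)
    (hc : IsReducedTrajectoryOn ωM H c J) {c' : ℝ → OrbitSpace K M}
    (hc' : IsReducedTrajectoryOn ωM H c' J) (hJ : J.OrdConnected) {s : ℝ} (hs : s ∈ J)
    (hcs : c s = orbitProj K x) (hcs' : c' s = orbitProj K x) :
    ∀ᶠ t in 𝓝[J] s, c t = c' t := by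
  have : ContinuousSMul K M := ContMDiffSMul.continuousSMul (I := 𝓘(ℝ, EK)) (I' := 𝓘(ℝ, E)) ∞
  let N := Module.finrank ℝ (Y × (Fin p → ℝ))
  let e : (Y × (Fin p → ℝ)) ≃L[ℝ] (Fin N → ℝ) :=
    (Module.finBasis ℝ (Y × (Fin p → ℝ))).equivFun.toContinuousLinearEquiv
  -- These functions are coordinates on the orbit space near the orbit of `x`. Tested on them, the
  -- reduced equations become an ordinary differential equation in `ℝ^N` with right-hand side `v`,
  -- to which uniqueness applies.
  choose F hF hFe using fun j : Fin N => h.exists_smooth_function (ℓ := fun w => e w j)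
    (contDiff_apply ℝ ℝ j |>.comp e.contDiff)
  let v : (Fin N → ℝ) → Fin N → ℝ := fun y j =>
    poissonBracket ωM (F j ∘ orbitProj K) (H ∘ orbitProj K) (transversalMap S (e.symm y))
  let O : Set (OrbitSpace K M) :=
    (fun w => orbitProj K (transversalMap S w)) '' Metric.ball 0 (r / 3)
  have hr := h.pos
  have hO : IsOpen O := h.isOpen_image_transversalMap Metric.isOpen_ball
    (Metric.ball_subset_ball (by linarith))
  have h0 : (0 : Y × (Fin p → ℝ)) ∈ Metric.ball 0 (r / 3) := Metric.mem_ball_self (by positivity)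
  have hx0 : orbitProj K x = orbitProj K (transversalMap S (0 : Y × (Fin p → ℝ))) := by
    rw [h.transversalMap_zero]
  have hxO : orbitProj K x ∈ O := ⟨0, h0, hx0.symm⟩
  have hv : ContDiffAt ℝ 1 v 0 := by
    refine contDiffAt_pi.2 fun j => ?_
    have h1 : ContMDiffAt 𝓘(ℝ, Fin N → ℝ) 𝓘(ℝ, Y × (Fin p → ℝ)) ∞ e.symm 0 :=
      e.symm.contDiff.contMDiff.contMDiffAt
    have h2 : ContMDiffAt 𝓘(ℝ, Fin N → ℝ) 𝓘(ℝ, E) ∞ (fun y => transversalMap S (e.symm y)) 0 :=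
      ContMDiffAt.comp 0 (g := transversalMap S) (f := e.symm) (by
        rw [map_zero]
        exact h.contMDiffAt_transversalMap (Metric.mem_ball_self hr)) h1
    have h3 := ContMDiffAt.comp (0 : Fin N → ℝ) (contMDiff_poissonBracket (ωM := ωM) (hF j)
      hH).contMDiffAt h2
    exact h3.contDiffAt.of_le (by simp)
  have hd : ∀ c : ℝ → OrbitSpace K M, IsReducedTrajectoryOn ωM H c J → c s = orbitProj K x →
      ∀ᶠ t in 𝓝[J] s, c t ∈ O ∧
        HasDerivWithinAt (fun t j => F j (c t)) (v fun j => F j (c t)) J t := by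
    intro c hc hcs
    filter_upwards [(hc.1 s hs).eventually (hO.mem_nhds (by rw [hcs]; exact hxO)),
      self_mem_nhdsWithin] with t ht htJ
    refine ⟨ht, hasDerivWithinAt_pi.2 fun j => ?_⟩
    have h1 := hc.2 (F j) (hF j) t htJ
    obtain ⟨w, hw, he⟩ := ht
    have h2 : (fun j => F j (c t)) = e w := by
      funext j
      rw [← he]
      exact hFe j w hw
    have h3 : v (e w) j = reducedBracket ωM (F j) H (c t) := by
      rw [← he]
      simp only [reducedBracket_orbitProj hΨ hH (hF j), v, e.symm_apply_apply]
    rw [h2, h3]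
    exact h1
  have hval : (fun j => F j (c s)) = 0 := by
    funext j
    rw [hcs, hx0]
    refine (hFe j 0 h0).trans ?_
    rw [map_zero]
  have h4 := eventually_eq_of_hasDerivWithinAt (f := fun t j => F j (c t))
    (g := fun t j => F j (c' t)) (v := v) hJ hs (by rw [hval]; exact hv)
    ((hd c hc hcs).mono fun t h => h.2) ((hd c' hc' hcs').mono fun t h => h.2)
    (by simp only [hcs, hcs'])
  filter_upwards [h4, hd c hc hcs, hd c' hc' hcs'] with t h5 h6 h7
  obtain ⟨w, hw, he⟩ := h6.1
  obtain ⟨w', hw', he'⟩ := h7.1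
  have h8 : e w = e w' := by
    funext j
    rw [← hFe j w hw, ← hFe j w' hw']
    have h9 := congrFun h5 j
    rw [← he, ← he'] at h9
    exact h9
  rw [← he, ← he', e.injective h8]

end ReducedTrajectories

end InvariantRelations

end

noncomputable section

namespace InvariantRelations

open Set Filter Topology

theorem mem_uIcc_zero_iff {t s : ℝ} : s ∈ uIcc 0 t ↔ ∃ a ∈ Icc (0 : ℝ) 1, s = a * t := by
  rw [← segment_eq_uIcc, segment_eq_image]
  constructor
  · rintro ⟨a, ha, rfl⟩
    exact ⟨a, ha, by simp⟩
  · rintro ⟨a, ha, rfl⟩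
    exact ⟨a, ha, by simp⟩

theorem FlowsTo.restrict {E : Type*} [NormedAddCommGroup E] [NormedSpace ℝ E]
    {M : Type*} [TopologicalSpace M] [ChartedSpace E M] {X : ∀ x : M, TangentSpace 𝓘(ℝ, E) x}
    {γ : ℝ → M} {t : ℝ} (hγ : IsMIntegralCurveOn γ X (uIcc 0 t)) {s : ℝ} (hs : s ∈ uIcc 0 t) :
    FlowsTo X s (γ 0) (γ s) :=
  ⟨γ, hγ.mono (uIcc_subset_uIcc left_mem_uIcc hs), rfl, rfl⟩

/-! ### The reduced flow as the projection of the flow. -/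

section ReducedFlow

variable {E : Type*} [NormedAddCommGroup E] [NormedSpace ℝ E] [FiniteDimensional ℝ E]
  {M : Type*} [TopologicalSpace M] [ChartedSpace E M] [IsManifold 𝓘(ℝ, E) ∞ M] [T2Space M]
  {EK : Type*} [NormedAddCommGroup EK] [NormedSpace ℝ EK] [FiniteDimensional ℝ EK]
  {K : Type*} [TopologicalSpace K] [ChartedSpace EK K] [Group K] [LieGroup 𝓘(ℝ, EK) ∞ K]
  [CompactSpace K] [MulAction K M] [ContMDiffSMul 𝓘(ℝ, EK) 𝓘(ℝ, E) ∞ K M]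
  {p : ℕ} {φ : Fin p → M → ℝ} {ωM : SymplecticForm E M} {n m : ℕ}
  {Ψ : M → Module.Dual ℝ (GroupLieAlgebra 𝓘(ℝ, EK) K)}

namespace IsReducible

variable {d : ℕ} {H : OrbitSpace K M → ℝ} {c c' : ℝ → OrbitSpace K M} {J : Set ℝ}
  (R : IsReducible ωM Ψ φ n)
  (hH : ContMDiff 𝓘(ℝ, E) 𝓘(ℝ, ℝ) ∞ (H ∘ orbitProj K : M → ℝ))
include R hH

section Uniqueness

variable (hdim : 2 * n = p + m) (hd : Module.finrank ℝ EK + d = m)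
include hd hdim

/-- Slices have been constructed only at points of the level set. It is enough that one of the
curves stays over it, because local uniqueness is invoked only where the curves already agree. -/
theorem eqOn_reducedTrajectory (hc : IsReducedTrajectoryOn ωM H c J)
    (hc' : IsReducedTrajectoryOn ωM H c' J) (hJ : J.OrdConnected)
    (hc0 : ∀ s ∈ J, c' s ∈ orbitProj K '' {x | ∀ α, φ α x = 0}) {t₀ : ℝ} (ht₀ : t₀ ∈ J)
    (h₀ : c t₀ = c' t₀) : EqOn c c' J := by
  have : ContinuousSMul K M := ContMDiffSMul.continuousSMul (I := 𝓘(ℝ, EK)) (I' := 𝓘(ℝ, E)) ∞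
  have : T2Space (OrbitSpace K M) := t2Space_orbitSpace
  refine eqOn_of_locally_eq hJ.isPreconnected hc.1 hc'.1 ht₀ h₀ fun s hs hss => ?_
  obtain ⟨x, hx, he⟩ := hc0 s hs
  obtain ⟨S, κ, D, r, h⟩ := R.exists_isSliceChart (hdim := hdim) hd hx
  exact hc.eventually_eq R.hamiltonian hH h hc' hJ hs (hss.trans he.symm) he.symm

variable (hinv : IsFlowInvariant (hamiltonianField ωM (H ∘ orbitProj K)) {x | ∀ α, φ α x = 0})
include hinv

/-- A trajectory of the reduced equations is, as long as the trajectory of the original equations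
exists, the projection of this trajectory. -/
theorem eq_orbitProj_of_flowsTo {t : ℝ} (hc : IsReducedTrajectoryOn ωM H c (uIcc 0 t)) {x y : M}
    (hx : ∀ α, φ α x = 0) (hc0 : c 0 = orbitProj K x)
    (h : FlowsTo (hamiltonianField ωM (H ∘ orbitProj K)) t x y) : c t = orbitProj K y := by
  obtain ⟨γ, h1, rfl, rfl⟩ := h
  exact R.eqOn_reducedTrajectory hH hdim hd hc (isReducedTrajectoryOn_orbitProj R.hamiltonian hH h1)
    ordConnected_uIcc (fun s hs => ⟨γ s, hinv s _ _ hx (FlowsTo.restrict h1 hs), rfl⟩)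
    left_mem_uIcc hc0 right_mem_uIcc

/-- The reduced flow lifts. -/
theorem exists_flowsTo_of_reducedFlowsTo {t : ℝ} {x : M} (hx : ∀ α, φ α x = 0)
    {y : OrbitSpace K M} (h : ReducedFlowsTo ωM H t (orbitProj K x) y) :
    ∃ x', FlowsTo (hamiltonianField ωM (H ∘ orbitProj K)) t x x' ∧ orbitProj K x' = y := by
  have : ContinuousSMul K M := ContMDiffSMul.continuousSMul (I := 𝓘(ℝ, EK)) (I' := 𝓘(ℝ, E)) ∞
  obtain ⟨c, hc, hc0, hct⟩ := h
  -- The time of existence can be taken uniform over a whole orbit, since translates of trajectories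
  -- are trajectories, and locally uniform in the orbit. Along the compact curve `c` one step length
  -- `δ` is then enough.
  let Q : OrbitSpace K M → ℝ → Prop := fun y ε => ∀ x, orbitProj K x = y → ∀ u, |u| < ε →
    ∃ x', FlowsTo (hamiltonianField ωM (H ∘ orbitProj K)) u x x'
  have hQ : ∀ y, ∃ ε > 0, ∀ᶠ y' in 𝓝 y, Q y' ε := by
    intro y
    obtain ⟨x, rfl⟩ := orbitProj_surjective (K := K) y
    obtain ⟨ε, hε, O, hO, hxO, θ, hθ⟩ := exists_hasLocalFlow (isC2Field_hamField ωM hH) x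
    refine ⟨ε, hε, ?_⟩
    filter_upwards [(isOpenMap_orbitProj (K := K) _ hO).mem_nhds ⟨x, hxO, rfl⟩]
    rintro _ ⟨x₁, hx₁, rfl⟩ x₂ he u hu
    obtain ⟨k, rfl⟩ := orbitProj_eq_iff.1 he.symm
    exact ⟨_, FlowsTo.smul R.hamiltonian hH (fun k x => by simp) (hθ x₁ hx₁ u (abs_lt.1 hu)).1 k⟩
  have hunif : ∃ δ > 0, ∀ s ∈ uIcc 0 t, Q (c s) δ := by
    refine isCompact_uIcc.induction_on (p := fun S => ∃ δ > 0, ∀ s ∈ S, Q (c s) δ)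
      ⟨1, one_pos, by simp⟩ ?_ ?_ ?_
    · rintro S T hST ⟨δ, hδ, H⟩
      exact ⟨δ, hδ, fun s hs => H s (hST hs)⟩
    · rintro S T ⟨δ, hδ, h1⟩ ⟨δ', hδ', h2⟩
      refine ⟨min δ δ', lt_min hδ hδ', fun s hs x hx u hu => ?_⟩
      rcases hs with hs | hs
      · exact h1 s hs x hx u (hu.trans_le (min_le_left _ _))
      · exact h2 s hs x hx u (hu.trans_le (min_le_right _ _))
    · intro s hs
      obtain ⟨ε, hε, h1⟩ := hQ (c s)
      exact ⟨_, hc.1 s hs |>.eventually h1, ε, hε, fun s hs => hs⟩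
  obtain ⟨δ, hδ, hQδ⟩ := hunif
  obtain ⟨N, hN⟩ := exists_nat_gt (|t| / δ)
  have hN0 : (0 : ℝ) < N := (div_nonneg (abs_nonneg t) hδ.le).trans_lt hN
  have htN : |t / N| < δ := by
    rw [abs_div, abs_of_pos hN0, div_lt_iff₀ hN0, mul_comm]
    exact (div_lt_iff₀ hδ).1 hN
  have hmem : ∀ i : ℕ, ∀ a ∈ Icc (0 : ℝ) 1, i + a ≤ N → a * (t / N) + i * (t / N) ∈ uIcc 0 t := by
    intro i a ha hi
    refine mem_uIcc_zero_iff.2 ⟨(i + a) / N, ⟨by have := ha.1; positivity, ?_⟩, by ring⟩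
    rwa [div_le_one hN0]
  have hsteps : ∀ i : ℕ, i ≤ N → ∃ x', FlowsTo (hamiltonianField ωM (H ∘ orbitProj K))
      (i * (t / N)) x x' ∧ c (i * (t / N)) = orbitProj K x' := by
    intro i
    induction i with
    | zero =>
      intro _
      refine ⟨x, ?_, by simp [hc0]⟩
      rw [Nat.cast_zero, zero_mul]
      exact FlowsTo.refl x
    | succ i ih =>
      intro hi
      obtain ⟨x', h1, h2⟩ := ih (by omega)
      have hi' : (i : ℝ) + 1 ≤ N := by exact_mod_cast hi
      have hmi : (i : ℝ) * (t / N) ∈ uIcc 0 t := by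
        have := hmem i 0 ⟨le_rfl, zero_le_one⟩ (by linarith)
        simpa using this
      obtain ⟨x'', h3⟩ := hQδ _ hmi x' h2.symm _ htN
      have hx' := hinv _ _ _ hx h1
      have hshift : IsReducedTrajectoryOn ωM H (fun s => c (s + i * (t / N))) (uIcc 0 (t / N)) := by
        refine hc.comp_add _ fun s hs => ?_
        obtain ⟨a, ha, rfl⟩ := mem_uIcc_zero_iff.1 hs
        exact hmem i a ha (by linarith [ha.2])
      -- The lifted step lies over the level set by invariance, so uniqueness shows that its
      -- endpoint projects to the next point of `c` and the induction continues.
      have h4 := R.eq_orbitProj_of_flowsTo hH hdim hd hinv hshift hx' (by simpa using h2) h3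
      refine ⟨x'', ?_, ?_⟩
      · have h5 := FlowsTo.trans (X := hamField ωM (H ∘ orbitProj K))
          (by rw [mul_assoc]; exact mul_nonneg (Nat.cast_nonneg i) (mul_self_nonneg _)) h1 h3
        have h6 : (i : ℝ) * (t / N) + t / N = ((i + 1 : ℕ) : ℝ) * (t / N) := by push_cast; ring
        rw [h6] at h5
        exact h5
      · rw [← h4]
        congr 1
        push_cast
        ring
  obtain ⟨x', h1, h2⟩ := hsteps N le_rfl
  have h3 : (N : ℝ) * (t / N) = t := by field_simp
  rw [h3] at h1 h2
  exact ⟨x', h1, by rw [← h2, hct]⟩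

/-- The reduced flow is the projection of the flow. -/
theorem reducedFlowsTo_eq {t : ℝ} {x x' : M} (hx : ∀ α, φ α x = 0)
    (h : FlowsTo (hamiltonianField ωM (H ∘ orbitProj K)) t x x') {y : OrbitSpace K M}
    (hy : ReducedFlowsTo ωM H t (orbitProj K x) y) : y = orbitProj K x' := by
  obtain ⟨c, hc, hc0, rfl⟩ := hy
  exact R.eq_orbitProj_of_flowsTo hH hdim hd hinv hc hx hc0 h

end Uniqueness

omit [FiniteDimensional ℝ EK] [CompactSpace K] in
-- Run the flow backward: it commutes with the element of `K` that relates the endpoints.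
theorem orbitProj_eq_of_flowsTo {t : ℝ} {x₁ x₂ y₁ y₂ : M}
    (h₁ : FlowsTo (hamiltonianField ωM (H ∘ orbitProj K)) t x₁ y₁)
    (h₂ : FlowsTo (hamiltonianField ωM (H ∘ orbitProj K)) t x₂ y₂)
    (h : orbitProj K y₁ = orbitProj K y₂) : orbitProj K x₁ = orbitProj K x₂ := by
  obtain ⟨k, rfl⟩ := orbitProj_eq_iff.1 h
  have h3 := FlowsTo.symm (X := hamField ωM (H ∘ orbitProj K))
    (FlowsTo.smul R.hamiltonian hH (fun k x => by simp) h₁ k)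
  have h4 := FlowsTo.unique (isC2Field_hamField ωM hH) h3
    (FlowsTo.symm (X := hamField ωM (H ∘ orbitProj K)) h₂)
  exact orbitProj_eq_iff.2 ⟨k, h4⟩

end IsReducible

end ReducedFlow

end InvariantRelations

end

noncomputable section

namespace InvariantRelations

open Set Filter Topology

/-! ### Invariance of the measure under the reduced flow. -/

section InvariantMeasure

variable {E : Type*} [NormedAddCommGroup E] [NormedSpace ℝ E] [FiniteDimensional ℝ E]
  {M : Type*} [TopologicalSpace M] [ChartedSpace E M] [IsManifold 𝓘(ℝ, E) ∞ M] [T2Space M]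
  {EK : Type*} [NormedAddCommGroup EK] [NormedSpace ℝ EK]
  {K : Type*} [TopologicalSpace K] [ChartedSpace EK K] [Group K] [LieGroup 𝓘(ℝ, EK) ∞ K]
  [MulAction K M] [ContMDiffSMul 𝓘(ℝ, EK) 𝓘(ℝ, E) ∞ K M]
  {p : ℕ} {φ : Fin p → M → ℝ} {ωM : SymplecticForm E M} {n m : ℕ} {hdim : 2 * n = p + m}
  {Ψ : M → Module.Dual ℝ (GroupLieAlgebra 𝓘(ℝ, EK) K)}

namespace IsReducible

variable {H : OrbitSpace K M → ℝ} (R : IsReducible ωM Ψ φ n)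
  (hH : ContMDiff 𝓘(ℝ, E) 𝓘(ℝ, ℝ) ∞ (H ∘ orbitProj K : M → ℝ)) {t : ℝ} {U : Set M} {θ : M → M}
  (hU : IsOpen U)
  (hθ : ∀ x ∈ U, FlowsTo (hamiltonianField ωM (H ∘ orbitProj K)) t x (θ x))
include R hH hU hθ

/-- The flow of an invariant Hamiltonian maps generators to generators. -/
theorem tmap_flow_genField {x : M} (hx : x ∈ U) (hθd : MDifferentiableAt 𝓘(ℝ, E) 𝓘(ℝ, E) θ x)
    (ζ : EK) : tmap E E θ x (genField E (G := K) ζ x) = genField E (G := K) ζ (θ x) := by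
  have : ContinuousSMul K M := ContMDiffSMul.continuousSMul (I := 𝓘(ℝ, EK)) (I' := 𝓘(ℝ, E)) ∞
  -- By uniqueness of trajectories the flow map commutes with the group elements near `1`;
  -- differentiating at `1` gives the claim.
  have h1 : (fun g : K => θ (g • x)) =ᶠ[𝓝 1] fun g => g • θ x := by
    have hc : ContinuousAt (fun g : K => g • x) 1 := by fun_prop
    filter_upwards [hc.eventually (hU.mem_nhds (by simpa using hx))] with g hg
    exact FlowsTo.unique (isC2Field_hamField ωM hH) (hθ _ hg)
      (FlowsTo.smul R.hamiltonian hH (fun k x => by simp) (hθ x hx) g)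
  have h2 := tmap_comp_apply (E' := E) (g := θ) (f := fun g : K => g • x) (x := 1)
    (by rwa [one_smul]) (mdifferentiableAt_smul_left (E := E) 1 x) ζ
  rw [tmap_congr h1, one_smul] at h2
  exact h2.symm

/-- A volume preserving flow preserves the densities of transversals. -/
theorem sliceDensity_flow (hpres : FlowPreservesRestrictedVolume ωM hdim φ (H ∘ orbitProj K))
    {Y : Type*} [NormedAddCommGroup Y] [NormedSpace ℝ Y] (b : Module.Basis (Fin m) ℝ (EK × Y))
    {s : Y → M} {z : Y} (hz : s z ∈ U) (hs : MDifferentiableAt 𝓘(ℝ, Y) 𝓘(ℝ, E) s z)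
    (hs0 : ∀ᶠ z' in 𝓝 z, ∀ α, φ α (s z') = 0)
    (hθd : MDifferentiableAt 𝓘(ℝ, E) 𝓘(ℝ, E) θ (s z)) :
    sliceDensity E EK K ωM hdim φ b (fun z => θ (s z)) z =
      sliceDensity E EK K ωM hdim φ b s z := by
  have h1 : ∀ v, orbitMap E EK K (fun z => θ (s z)) z v =
      tmap E E θ (s z) (orbitMap E EK K s z v) := by
    intro v
    rw [orbitMap_apply, orbitMap_apply, map_add, R.tmap_flow_genField hH hU hθ hz hθd,
      tmap_comp_apply (E' := E) hθd hs]
  have hker : ∀ v α, tmap E ℝ (φ α) (s z) (orbitMap E EK K s z v) = 0 := by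
    intro v α
    have hd : MDifferentiableAt 𝓘(ℝ, E) 𝓘(ℝ, ℝ) (φ α) (s z) :=
      (R.smooth α).mdifferentiableAt (by simp)
    have h1 : (fun w' => φ α (s w')) =ᶠ[𝓝 z] fun _ => 0 := hs0.mono fun w' h => h α
    rw [orbitMap_apply, map_add, tmap_genField_eq_zero hd (fun k => R.invariant α k _),
      ← tmap_comp_apply hd hs, tmap_congr h1, tmap_const]
    simp
  have h2 := hpres t U θ hU hθ (s z) hz hs0.self_of_nhds
    (fun i => orbitMap E EK K s z (b i)) fun i α => hker (b i) α
  rw [sliceDensity, sliceDensity, volDensity, volDensity]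
  simp only [h1]
  exact congrArg abs h2

end IsReducible

variable [FiniteDimensional ℝ EK] [CompactSpace K] [SecondCountableTopology M] {d : ℕ}
  {H : OrbitSpace K M → ℝ}

namespace IsReducible

/-- The slice is shrunk until the flow map of time `t` is defined and differentiable on all of it,
so that the image of the slice is a new transversal. -/
theorem exists_flow_map (R : IsReducible ωM Ψ φ n)
    (hH : ContMDiff 𝓘(ℝ, E) 𝓘(ℝ, ℝ) ∞ (H ∘ orbitProj K : M → ℝ))
    (hd : Module.finrank ℝ EK + d = m) (hdim : 2 * n = p + m) {t : ℝ} {x y : M}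
    (hx : ∀ α, φ α x = 0) (h : FlowsTo (hamiltonianField ωM (H ∘ orbitProj K)) t x y) :
    ∃ (S : OpenPartialHomeomorph M ((EK × EuclideanSpace ℝ (Fin d)) × (Fin p → ℝ))) (κ : EK → K)
      (D : EK ≃L[ℝ] EK) (r : ℝ) (U : Set M) (θ : M → M), IsSliceChart E φ x S κ D r ∧ IsOpen U ∧
      (∀ z ∈ Metric.ball 0 r, sliceMap S z ∈ U) ∧
      ∀ x' ∈ U, FlowsTo (hamiltonianField ωM (H ∘ orbitProj K)) t x' (θ x') ∧
        MDifferentiableAt 𝓘(ℝ, E) 𝓘(ℝ, E) θ x' := by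
  obtain ⟨U, hU, hxU, θ, -, hθ⟩ := InvariantRelations.exists_flow_map
    (R := fun _ _ _ => True) (isC2Field_hamField ωM hH) (fun _ => trivial)
    (fun _ _ _ _ _ _ _ => trivial) (fun x₀ => exists_hasLocalFlow (isC2Field_hamField ωM hH) x₀) h
  obtain ⟨S, κ, D, r, hS⟩ := R.exists_isSliceChart (hdim := hdim) hd hx
  have hc : ContinuousAt (sliceMap S) 0 :=
    (hS.contMDiffAt_sliceMap (Metric.mem_ball_self hS.pos)).continuousAt
  have h0 : sliceMap S 0 = x := hS.symm_zero
  obtain ⟨r', hr', hball⟩ := Metric.eventually_nhds_iff_ball.1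
    (hc.eventually (hU.mem_nhds (by rwa [h0])))
  exact ⟨S, κ, D, min r r', U, θ, hS.mono (lt_min hS.pos hr') (min_le_left _ _), hU,
    fun z hz => hball z (Metric.ball_subset_ball (min_le_right _ _) hz),
    fun x' hx' => ⟨(hθ x' hx').1, (hθ x' hx').2.1⟩⟩

/-- The measure given by the densities of all transversals is invariant under the reduced flow. -/
theorem isReducedInvariantMeasure (R : IsReducible ωM Ψ φ n)
    (hH : ContMDiff 𝓘(ℝ, E) 𝓘(ℝ, ℝ) ∞ (H ∘ orbitProj K : M → ℝ))
    (hd : Module.finrank ℝ EK + d = m)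
    (hinv : IsFlowInvariant (hamiltonianField ωM (H ∘ orbitProj K)) {x | ∀ α, φ α x = 0})
    (hpres : FlowPreservesRestrictedVolume ωM hdim φ (H ∘ orbitProj K))
    (b : Module.Basis (Fin m) ℝ (EK × EuclideanSpace ℝ (Fin d))) {ν : Measure (OrbitSpace K M)}
    (hν : ∀ (V : Set (EuclideanSpace ℝ (Fin d))) (s : EuclideanSpace ℝ (Fin d) → M), IsOpen V →
        (∀ z ∈ V, MDifferentiableAt 𝓘(ℝ, EuclideanSpace ℝ (Fin d)) 𝓘(ℝ, E) s z) →
        (∀ z ∈ V, ∀ α, φ α (s z) = 0) → InjOn (fun z => orbitProj K (s z)) V →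
        ∀ B, MeasurableSet B → B ⊆ (fun z => orbitProj K (s z)) '' V →
          ν B = ∫⁻ z in V ∩ (fun z => orbitProj K (s z)) ⁻¹' B,
            ENNReal.ofReal (sliceDensity E EK K ωM hdim φ b s z)) :
    IsReducedInvariantMeasure ωM H (orbitProj K '' {x | ∀ α, φ α x = 0}) ν := by
  have : ContinuousSMul K M := ContMDiffSMul.continuousSMul (I := 𝓘(ℝ, EK)) (I' := 𝓘(ℝ, E)) ∞
  have : T2Space (OrbitSpace K M) := t2Space_orbitSpace
  intro t A F hA hAS hF
  -- Only the existence of reduced trajectories from points of `A` is assumed; lifting provides the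
  -- actual trajectories in `M` along which flow maps and slices can be constructed.
  have hlift : ∀ x : {x : M | (∀ α, φ α x = 0) ∧ orbitProj K x ∈ A},
      ∃ x', FlowsTo (hamiltonianField ωM (H ∘ orbitProj K)) t x x' ∧
        orbitProj K x' = F (orbitProj K (x : M)) := fun x =>
    R.exists_flowsTo_of_reducedFlowsTo hH hdim hd hinv x.2.1 (hF _ x.2.2)
  choose y hy hyF using hlift
  choose S κ D r U θ hS hU hSU hθ using fun x =>
    R.exists_flow_map hH hd hdim x.2.1 (hy x)
  rcases A.eq_empty_or_nonempty with rfl | ⟨a, ha⟩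
  · rw [image_empty]
  obtain ⟨x₀, hx₀, rfl⟩ := hAS ha
  obtain ⟨T, hTc, hTU⟩ := TopologicalSpace.countable_cover_nhds
    (f := fun x => Subtype.val ⁻¹' ((S x).symm '' Metric.ball 0 (r x))) fun x =>
      ((hS x).isOpen_image_ball.preimage continuous_subtype_val).mem_nhds (hS x).mem_image_ball
  have hcov : ∀ x (hx : x ∈ {x : M | (∀ α, φ α x = 0) ∧ orbitProj K x ∈ A}), ∃ i ∈ T,
      x ∈ (S i).symm '' Metric.ball 0 (r i) := by
    intro x hx
    have h1 : (⟨x, hx⟩ : {x : M | (∀ α, φ α x = 0) ∧ orbitProj K x ∈ A}) ∈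
        ⋃ x ∈ T, Subtype.val ⁻¹' ((S x).symm '' Metric.ball 0 (r x)) := hTU ▸ mem_univ _
    obtain ⟨i, hi, h2⟩ := mem_iUnion₂.1 h1
    exact ⟨i, hi, h2⟩
  obtain ⟨i₀, hi₀, -⟩ := hcov x₀ ⟨hx₀, ha⟩
  obtain ⟨c, rfl⟩ := hTc.exists_eq_range ⟨i₀, hi₀⟩
  have hsd : ∀ i, ∀ z ∈ Metric.ball 0 (r i), MDifferentiableAt 𝓘(ℝ, EuclideanSpace ℝ (Fin d))
      𝓘(ℝ, E) (sliceMap (S i)) z := fun i z hz => (hS i).mdifferentiableAt_sliceMap hz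
  have hθs : ∀ i, ∀ z ∈ Metric.ball 0 (r i),
      MDifferentiableAt 𝓘(ℝ, EuclideanSpace ℝ (Fin d)) 𝓘(ℝ, E)
        (fun z => θ i (sliceMap (S i) z)) z := fun i z hz =>
    ((hθ i _ (hSU i z hz)).2).comp z (hsd i z hz)
  have hs0 : ∀ i, ∀ z ∈ Metric.ball 0 (r i), ∀ α, φ α (sliceMap (S i) z) = 0 := fun i z hz α =>
    (hS i).apply_sliceMap hz α
  have hθ0 : ∀ i, ∀ z ∈ Metric.ball 0 (r i), ∀ α, φ α (θ i (sliceMap (S i) z)) = 0 :=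
    fun i z hz => hinv t _ _ (hs0 i z hz) (hθ i _ (hSU i z hz)).1
  have hinj' : ∀ i, InjOn (fun z => orbitProj K (θ i (sliceMap (S i) z)))
      (Metric.ball 0 (r i)) := fun i z hz z' hz' he =>
    (hS i).injOn_sliceMap hz hz' (R.orbitProj_eq_of_flowsTo hH (hθ i _ (hSU i z hz)).1
      (hθ i _ (hSU i z' hz')).1 he)
  -- On the slice `i`, `f` parametrizes by the transversal and `f'` by its image under the flow.
  -- Both are transversals to which `hν` applies, and as the flow preserves the volume they carry
  -- the same density.
  refine measure_image_eq_of_densities (μ := volume) hA (F := F) ?_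
    (V := fun i => Metric.ball 0 (r (c i)))
    (f := fun i z => orbitProj K (sliceMap (S (c i)) z))
    (f' := fun i z => orbitProj K (θ (c i) (sliceMap (S (c i)) z)))
    (ρ := fun i => sliceDensity E EK K ωM hdim φ b (sliceMap (S (c i))))
    (fun i => Metric.isOpen_ball) (fun i => (hS (c i)).continuousOn_sliceMap)
    (fun i => (hS (c i)).injOn_sliceMap) (fun i z hz =>
      (continuous_orbitProj.continuousAt.comp (hθs (c i) z hz).continuousAt).continuousWithinAt)
    (fun i => hinj' (c i)) ?_ ?_ (fun i => hν _ _ Metric.isOpen_ball (hsd (c i)) (hs0 (c i))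
      (hS (c i)).injOn_sliceMap) ?_
  · intro a₁ h₁ a₂ h₂ he
    obtain ⟨x₁, hx₁, rfl⟩ := hAS h₁
    obtain ⟨x₂, hx₂, rfl⟩ := hAS h₂
    exact R.orbitProj_eq_of_flowsTo hH (hy ⟨x₁, hx₁, h₁⟩) (hy ⟨x₂, hx₂, h₂⟩)
      ((hyF ⟨x₁, hx₁, h₁⟩).trans (he.trans (hyF ⟨x₂, hx₂, h₂⟩).symm))
  · intro a' ha'
    obtain ⟨x, hx, rfl⟩ := hAS ha'
    obtain ⟨_, ⟨i, rfl⟩, hi⟩ := hcov x ⟨hx, ha'⟩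
    refine mem_iUnion.2 ⟨i, ?_⟩
    rw [(hS (c i)).image_sliceMap R.invariant]
    exact ⟨⟨x, hi, rfl⟩, x, hx, rfl⟩
  · intro i z hz hzA
    exact R.reducedFlowsTo_eq hH hdim hd hinv (hs0 (c i) z hz) (hθ (c i) _ (hSU (c i) z hz)).1
      (hF _ hzA)
  · intro i B hB hBV
    rw [hν _ _ Metric.isOpen_ball (hθs (c i)) (hθ0 (c i)) (hinj' (c i)) B hB hBV]
    refine setLIntegral_congr_fun (measurableSet_inter_preimage Metric.isOpen_ball.measurableSet
      (fun z hz => (continuous_orbitProj.continuousAt.comp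
        (hθs (c i) z hz).continuousAt).continuousWithinAt) hB) fun z hz => ?_
    refine congrArg ENNReal.ofReal (R.sliceDensity_flow hH (hU (c i)) (fun x hx =>
      (hθ (c i) x hx).1) hpres b (hSU (c i) z hz.1) (hsd (c i) z hz.1) ?_
      (hθ (c i) _ (hSU (c i) z hz.1)).2)
    filter_upwards [Metric.isOpen_ball.mem_nhds hz.1] with z' hz' using hs0 (c i) z' hz'

/-- The quotient of an invariant level set carries a smooth measure that is invariant under the
reduced flow. -/
theorem exists_invariant_measure (R : IsReducible ωM Ψ φ n) (hdim : 2 * n = p + m)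
    (hH : ContMDiff 𝓘(ℝ, E) 𝓘(ℝ, ℝ) ∞ (H ∘ orbitProj K : M → ℝ))
    (hinv : IsFlowInvariant (hamiltonianField ωM (H ∘ orbitProj K)) {x | ∀ α, φ α x = 0})
    (hpres : FlowPreservesRestrictedVolume ωM hdim φ (H ∘ orbitProj K)) :
    ∃ ν : Measure (OrbitSpace K M),
      IsSmoothQuotientMeasure E EK K {x | ∀ α, φ α x = 0} (m - Module.finrank ℝ EK) ν ∧
      IsReducedInvariantMeasure ωM H (orbitProj K '' {x | ∀ α, φ α x = 0}) ν := by
  -- If the level set is empty, the dimension `m - finrank` may be a truncated difference, but the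
  -- zero measure satisfies all conditions vacuously.
  rcases {x : M | ∀ α, φ α x = 0}.eq_empty_or_nonempty with h0 | ⟨x₀, hx₀⟩
  · refine ⟨0, ⟨by simp, fun x hx => ?_⟩, fun t A F _ _ _ => by simp⟩
    rw [h0] at hx
    exact absurd hx (notMem_empty x)
  have hd : Module.finrank ℝ EK + (m - Module.finrank ℝ EK) = m :=
    Nat.add_sub_cancel' (R.finrank_le (hdim := hdim) hx₀)
  let b : Module.Basis (Fin m) ℝ (EK × EuclideanSpace ℝ (Fin (m - Module.finrank ℝ EK))) :=
    Module.finBasisOfFinrankEq ℝ _ (by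
      rw [Module.finrank_prod, finrank_euclideanSpace, Fintype.card_fin, hd])
  obtain ⟨ν, hν0, hν⟩ := R.exists_measure (hdim := hdim) hd b hx₀
  refine ⟨ν, ⟨hν0, fun x hx => ?_⟩, R.isReducedInvariantMeasure hH hd hinv hpres b hν⟩
  obtain ⟨S, κ, D, r, hS⟩ := R.exists_isSliceChart (hdim := hdim) hd hx
  refine ⟨Metric.ball 0 r, sliceMap S, sliceDensity E EK K ωM hdim φ b (sliceMap S),
    hS.isQuotientParametrization R.invariant, ?_,
    hS.contDiffOn_sliceDensity ωM hdim b R.finrank_eq R.smooth,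
    fun z hz => hS.sliceDensity_pos ωM hdim b R.finrank_eq R.smooth hz,
    hν _ _ Metric.isOpen_ball (fun z hz => hS.mdifferentiableAt_sliceMap hz)
      (fun z hz α => hS.apply_sliceMap hz α) hS.injOn_sliceMap⟩
  exact ⟨0, Metric.mem_ball_self hS.pos, congrArg (orbitProj K) hS.symm_zero⟩

end IsReducible

end InvariantMeasure

end InvariantRelations

end

/-! ### The theorem. -/

open InvariantRelations in
theorem proposition6p1
    {E : Type*} [NormedAddCommGroup E] [NormedSpace ℝ E] [FiniteDimensional ℝ E]
    {M : Type*} [TopologicalSpace M] [ChartedSpace E M] [IsManifold 𝓘(ℝ, E) ∞ M]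
    [T2Space M] [SecondCountableTopology M] [ConnectedSpace M]
    {EG : Type*} [NormedAddCommGroup EG] [NormedSpace ℝ EG] [FiniteDimensional ℝ EG]
    {G : Type*} [TopologicalSpace G] [ChartedSpace EG G] [Group G] [LieGroup 𝓘(ℝ, EG) ∞ G]
    [T2Space G] [ConnectedSpace G]
    [MulAction G M] [ContMDiffSMul 𝓘(ℝ, EG) 𝓘(ℝ, E) ∞ G M] [ProperSMul G M]
    {n p m : ℕ} (hE : Module.finrank ℝ E = 2 * n) (hdim : 2 * n = p + m)
    (ωM : SymplecticForm E M)
    (hfree : ∀ (g : G) (x : M), g • x = x → g = 1)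
    (Φ : M → Module.Dual ℝ (GroupLieAlgebra 𝓘(ℝ, EG) G))
    (hΦ : IsHamiltonianAction ωM Φ)
    (hreg : ZeroIsRegularValue E Φ)
    (b : Module.Basis (Fin p) ℝ (GroupLieAlgebra 𝓘(ℝ, EG) G))
    (φ : Fin p → M → ℝ) (hφ : ∀ α x, φ α x = Φ x (b α))
    (M₀ : Set M) (hM₀ : M₀ = {x | ∀ α, φ α x = 0})
    (h : M → ℝ) (hh : ContMDiff 𝓘(ℝ, E) 𝓘(ℝ, ℝ) ∞ h)
    (hinv : IsFlowInvariant (hamiltonianField ωM h) M₀) :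
    ((∃ U ψ, IsRelationMatrix ωM φ h U ψ) ∧
      (∀ U ψ, IsRelationMatrix ωM φ h U ψ →
        (FlowPreservesRestrictedVolume ωM hdim φ h ↔ ∀ x ∈ M₀, ∑ α, ψ α α x = 0)) ∧
      ((∀ (g : G) (x : M), h (g • x) = h x) → FlowPreservesRestrictedVolume ωM hdim φ h)) ∧
    (∀ {EK : Type*} [NormedAddCommGroup EK] [NormedSpace ℝ EK] [FiniteDimensional ℝ EK]
      {K : Type*} [TopologicalSpace K] [ChartedSpace EK K] [Group K] [LieGroup 𝓘(ℝ, EK) ∞ K]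
      [T2Space K] [ConnectedSpace K] [CompactSpace K]
      [MulAction K M] [ContMDiffSMul 𝓘(ℝ, EK) 𝓘(ℝ, E) ∞ K M]
      (_hfreeK : ∀ (k : K) (x : M), k • x = x → k = 1)
      (Ψ : M → Module.Dual ℝ (GroupLieAlgebra 𝓘(ℝ, EK) K))
      (_hΨ : IsHamiltonianAction ωM Ψ)
      (_hcomm : ∀ (ξ : GroupLieAlgebra 𝓘(ℝ, EG) G) (ζ : GroupLieAlgebra 𝓘(ℝ, EK) K) (x : M),
        poissonBracket ωM (fun y => Φ y ξ) (fun y => Ψ y ζ) x = 0)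
      (H : OrbitSpace K M → ℝ) (_hH : h = H ∘ orbitProj K),
      FlowPreservesRestrictedVolume ωM hdim φ h →
        ∃ ν : Measure (OrbitSpace K M),
          IsSmoothQuotientMeasure E EK K M₀ (m - Module.finrank ℝ EK) ν ∧
          IsReducedInvariantMeasure ωM H (orbitProj K '' M₀) ν) := by
  subst hM₀
  have hφ' : ∀ α, φ α = fun x => Φ x (b α) := fun α => funext (hφ α)
  have hsm : ∀ α, ContMDiff 𝓘(ℝ, E) 𝓘(ℝ, ℝ) ∞ (φ α) := fun α => hφ' α ▸ hΦ.smooth (b α)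
  have hreg' : ∀ x, (∀ α, φ α x = 0) → IsRegularAt E φ x := fun x hx =>
    isRegularAt_of_zeroIsRegularValue hreg b hφ' hx
  refine ⟨⟨exists_isRelationMatrix hsm hh hinv hreg', fun U ψ hψ =>
    ⟨fun hpres x hx => trace_eq_zero_of_flowPreserves hE hsm hreg' hh hinv hψ hpres hx,
      fun htr => flowPreserves_of_trace hE hsm hreg' hh hinv hψ htr⟩,
    fun hG => flowPreserves_of_invariant hE hΦ b hφ' hreg' hh hinv hG⟩, ?_⟩
  intro EK _ _ _ K _ _ _ _ _ _ _ _ _ hfreeK Ψ hΨ hcomm H hH hpres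
  subst hH
  -- The commuting momentum maps enter only here: with `K` connected they make the functions `φ α`
  -- invariant under `K`.
  have hred : IsReducible ωM Ψ φ n := ⟨hE, hfreeK, hΨ, hsm, fun α =>
    smul_eq_of_poissonBracket_eq_zero hΨ (hsm α) fun ζ x => hφ' α ▸ hcomm (b α) ζ x, hreg'⟩
  exact hred.exists_invariant_measure hdim hh hinv hpres
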